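/- **Proposition 4.2.** Write $\langle\xi\rangle=\sqrt{1+\xi^2}$, $\mathbf R^+=(0,\infty)$, $H^l=H^l(\mathbf R^+)$, and for $p\in\{2,\infty\}$ let $W^{k,p}(0,T;H^l)$ be the usual Bochner–Sobolev space, $H^k(0,T;H^l)=W^{k,2}(0,T;H^l)$. Let $\mu>0$ be fixed. Let $a,T_0,M_1>0$, let $\tau\in C([0,T_0])\cap W^{1,\infty}(0,T_0)$ (in the application, $\tau(t)=\tau^{I,0}(t,0)$ is the boundary value of the outer specific volume) satisfy $$M_1^{-1}\le \frac{a^2}{\tau(t)}\le M_1\quad(0\le t\le T_0),\qquad \partial_t\Big(\frac{a^2}{\tau}\Big)\le M_1\quad\text{a.e. on }(0,T_0),$$ and let $f$ be a continuous function on $[0,T_0]\times[0,\infty)$ (the lift of the boundary datum $f(t,0)$) with $$f(0,\xi)=0\ (\xi\ge 0),\qquad f(t,\xi)=0\ (\xi\ge1),\qquad f\in W^{1,\infty}(0,T_0;H^2),$$ whose derivative $\partial_t f$ exists and is continuous on $[0,T_0]\times[0,\infty)$. Put $\tilde g=-\partial_t f$ and assume $\tilde g\in H^1((0,T_0)\times\mathbf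 R^+)$ and the first-order compatibility condition $\tilde g(0,0)=0$ (that is, $\partial_tf(0,0)=0$). Consider the problem $$(4.7)\qquad \partial_t v-a^2\mu\frac1{\tau(t)}\partial_\xi^2(v+f)=\tilde g,\qquad v(t,0)=0,\qquad v(0,\xi)=0,\qquad t,\xi>0,$$ where the equation holds almost everywhere with weak derivatives and $v$ is taken continuous up to $t=0$ and $\xi=0$. There is a $T_1$ with $0<T_1\le T_0$ and a unique solution $v$ of (4.7) on $[0,T_1]\times[0,\infty)$ in the class $$v\in W^{1,\infty}(0,T_1;H^1)\cap H^1(0,T_1;H^2),$$ and for all $n\in\mathbf N$ $$(4.8)\qquad \|\langle\xi\rangle^n v\|_{L^\infty(0,T_1;H^1)}+\|\langle\xi\rangle^n v\|_{L^2(0,T_1;H^2)}\le M\big(\|\langle\xi\rangle^n f\|_{L^2(0,T_1;H^2)}+\|\langle\xi\rangle^n\tilde g\|_{L^2(0,T_1;L^2)}\big)<\infty$$ with a positive constant $M=M(T_1,n,M_1)$ (depending besides only on the fixed $\mu$). Moreover, for every integer $m\ge0$: if $\tau\in W^{m,\infty}(0,T_1)$, if $\tilde g$ is smooth in $\xi$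 and in $H^m$, in the sense that $\partial_\xi^j\tilde g\in H^m((0,T_1)\times\mathbf R^+)$ for all $j\ge0$, and if $$\partial_t^k\tilde g(0,\xi)=0,\qquad k=0,1,\dots,m-1,\quad \xi\ge0,$$ then for all $n\in\mathbf N$ and all integers $k,l\ge0$ with $k+[\tfrac l2]\le m$, $$\langle\xi\rangle^n v\in W^{k,\infty}(0,T_1;H^l)\cap H^k(0,T_1;H^{l+1}).$$ -/

import Mathlib

open MeasureTheory Set
open scoped ENNReal ContDiff

namespace BoundaryLayer

/-- The half-strip `(0,T) × (0,∞)`; a point is `z = (t, ξ)`. -/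
def strip (T : ℝ) : Set (ℝ × ℝ) := Ioo 0 T ×ˢ Ioi 0

/-- The closed half-strip `[0,T] × [0,∞)`. -/
def closedStrip (T : ℝ) : Set (ℝ × ℝ) := Icc 0 T ×ˢ Ici 0

/-- Test functions: smooth with compact support inside the open half-strip. -/
def IsTest (T : ℝ) (φ : ℝ × ℝ → ℝ) : Prop :=
  ContDiff ℝ ∞ φ ∧ HasCompactSupport φ ∧ tsupport φ ⊆ strip T

/-- The classical mixed derivative `∂_t^i ∂_ξ^j φ`. -/
noncomputable def mixedDeriv (i j : ℕ) (φ : ℝ × ℝ → ℝ) (z : ℝ × ℝ) : ℝ :=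
  iteratedDeriv i (fun t => iteratedDeriv j (fun ξ => φ (t, ξ)) z.2) z.1

/-- `w = ∂_t^i ∂_ξ^j u` in the sense of distributions on `(0,T) × (0,∞)`. -/
def IsWeakDeriv (T : ℝ) (i j : ℕ) (u w : ℝ × ℝ → ℝ) : Prop :=
  LocallyIntegrableOn u (strip T) ∧ LocallyIntegrableOn w (strip T) ∧
  ∀ φ : ℝ × ℝ → ℝ, IsTest T φ →
    ∫ z in strip T, u z * mixedDeriv i j φ z = (-1) ^ (i + j) * ∫ z in strip T, w z * φ z

/-- `‖w(t,·)‖_{H^l(0,∞)}`, where `w j` stands for the `j`-th spatial derivative. -/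
noncomputable def sliceNorm (l : ℕ) (w : ℕ → ℝ × ℝ → ℝ) (t : ℝ) : ℝ≥0∞ :=
  (∑ j ∈ Finset.range (l + 1), ∫⁻ ξ in Ioi (0 : ℝ), ‖w j (t, ξ)‖ₑ ^ 2) ^ (1 / 2 : ℝ)

/-- The norm of `u` in the Bochner-Sobolev space `W^{k,p}(0,T; H^l(0,∞))`.
The weak derivatives `w i j = ∂_t^i ∂_ξ^j u` are unique up to null sets, so that the infimum has
only one value to range over when they exist; it is `∞` when they do not. -/
noncomputable def bochnerNorm (T : ℝ) (k : ℕ) (p : ℝ≥0∞) (l : ℕ) (u : ℝ × ℝ → ℝ) : ℝ≥0∞ :=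
  ⨅ (w : ℕ → ℕ → ℝ × ℝ → ℝ) (_ : ∀ i ≤ k, ∀ j ≤ l, IsWeakDeriv T i j u (w i j)),
    ∑ i ∈ Finset.range (k + 1), eLpNorm (sliceNorm l (w i)) p (volume.restrict (Ioo 0 T))

/-- `u ∈ W^{k,p}(0,T; H^l(0,∞))`; for `p = 2` this is `H^k(0,T; H^l(0,∞))`. -/
def MemBochner (T : ℝ) (k : ℕ) (p : ℝ≥0∞) (l : ℕ) (u : ℝ × ℝ → ℝ) : Prop :=
  bochnerNorm T k p l u < ⊤

/-- `u ∈ H^m((0,T) × (0,∞))`. -/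
def MemSobolev (T : ℝ) (m : ℕ) (u : ℝ × ℝ → ℝ) : Prop :=
  ∀ i j : ℕ, i + j ≤ m →
    ∃ w : ℝ × ℝ → ℝ, IsWeakDeriv T i j u w ∧ MemLp w 2 (volume.restrict (strip T))

/-- `c ∈ W^{m,∞}(0,T)`, for a function of time only. -/
def MemTimeWInfty (T : ℝ) (m : ℕ) (c : ℝ → ℝ) : Prop :=
  ∀ k ≤ m, ∃ d : ℝ → ℝ, MemLp d ⊤ (volume.restrict (Ioo 0 T)) ∧
    ∀ φ : ℝ → ℝ, ContDiff ℝ ∞ φ → HasCompactSupport φ → tsupport φ ⊆ Ioo 0 T →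
      ∫ t in Ioo 0 T, c t * iteratedDeriv k φ t = (-1) ^ k * ∫ t in Ioo 0 T, d t * φ t

/-- The weighted function `⟨ξ⟩^n u`, with `⟨ξ⟩ = √(1 + ξ²)`. -/
noncomputable def weighted (n : ℕ) (u : ℝ × ℝ → ℝ) (z : ℝ × ℝ) : ℝ :=
  Real.sqrt (1 + z.2 ^ 2) ^ n * u z

/-- `v` solves, on `(0,T) × (0,∞)`,
`∂_t v - a² μ (1/τ(t)) ∂_ξ² (v + f) = g`, `v(t,0) = 0`, `v(0,ξ) = 0`.
The equation holds almost everywhere, with weak derivatives; `v` is the continuous representative,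
which gives the boundary and initial conditions their pointwise meaning. -/
def IsSolution (a μ : ℝ) (τ : ℝ → ℝ) (f g : ℝ × ℝ → ℝ) (T : ℝ) (v : ℝ × ℝ → ℝ) : Prop :=
  ContinuousOn v (closedStrip T) ∧
  (∃ p q : ℝ × ℝ → ℝ, IsWeakDeriv T 1 0 v p ∧ IsWeakDeriv T 0 2 (fun z => v z + f z) q ∧
    ∀ᵐ z ∂(volume.restrict (strip T)), p z - a ^ 2 * μ * (1 / τ z.1) * q z = g z) ∧
  (∀ t ∈ Icc 0 T, v (t, 0) = 0) ∧
  (∀ ξ ∈ Ici (0 : ℝ), v (0, ξ) = 0)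

/-- The regularity class `W^{1,∞}(0,T; H^1) ∩ H^1(0,T; H^2)`. -/
def InSolutionClass (T : ℝ) (v : ℝ × ℝ → ℝ) : Prop :=
  MemBochner T 1 ⊤ 1 v ∧ MemBochner T 1 2 2 v

end BoundaryLayer

namespace BoundaryLayer
open Filter Topology
open ENNReal (ofReal ofReal_mul ofReal_le_ofReal ofReal_pow mul_lt_top ofReal_lt_top ofReal_add
  ofReal_ne_top sum_lt_top ofReal_le_ofReal_iff coe_toNNReal add_lt_top ofReal_one
  ofReal_coe_nnreal)
open intervalIntegral (integral_of_le integral_mono_on integral_congr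
  integral_eq_sub_of_hasDerivAt integral_hasDerivAt_right
  continuous_parametric_intervalIntegral_of_continuous')
open Real (norm_eq_abs dist_eq volume_Ioo norm_of_nonneg exp)
open MeasureTheory.Measure (volume_eq_prod prod_restrict restrict_mono ae_ae_of_ae_prod)
open Function (uncurry)

notation "vol(" s ")" => volume.restrict s
notation "tr(" f ")" => fun r => f (r, 0)
notation "ℝ²" => ℝ × ℝ
notation "ℝ₊" => Ioi (0 : ℝ)

/-! Put `u = v + f` and `c = a²μ/τ`. Since `g = -∂_t f`, the problem becomes the homogeneous
equation `∂_t u = c(t) ∂_ξ² u` with `u(t,0) = f(t,0)` and `u(0,ξ) = 0`. The coefficient depends on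
time only, so the intrinsic time `∫₀ᵗ c` (`clock`) reduces it to the standard heat equation, and `u`
is the classical double-layer potential of the boundary trace `b = f(·,0)`, that is `-pot c T b 1`.
Hence `v` is explicit (`sol`), exists on all of `[0,T₀]`, and one may take `T₁ = T₀`. The jump
relation `tendsto_pot_one` and `continuousOn_pot_one` give the boundary and initial values.

Regularity rests on two facts. A time derivative of a potential is `c` times two space derivatives
(`hasDerivAt_pot_time`); and two space derivatives can be moved onto the data as one derivative `c⁻¹
∂_t`, provided the data vanish at `t = 0` (`pot_add_two`). So every derivative reduces to a
potential of order 0 or 1 of differentiated data, and these are controlled by Schur's test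
(`exists_lintegral_pot_sq_le`): square integrable data give `L^∞L²` at order 0 and `L²L²` at order
1, bounded data give `L^∞L²` at order 1. This suffices for the higher regularity: the traces of
`∂_t^k g` are square integrable because `∂_ξ ∂_t^k g` is (`trace_weak`), and the compatibility
conditions supply the zeros at `t = 0`.

For the basic class and for the weighted estimate this count falls short, since `∂_t g` is only
square integrable and has no trace. There an energy estimate is used (`energy_rectangle`,
`exists_energy_le`): `∂_t ∫ v_ξ²` is integrated by parts over `δ < ξ < 1`; the boundary term at `ξ =
δ` tends to zero because `v_ξ` stays bounded while `∂_t v` tends to zero by the jump relation, and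
the one at `ξ = 1` is harmless because the kernel is smooth there. It is proved for smooth lifts and
carried to rough ones by mollification and Fatou's lemma (`near_of_profile`). Applied to `f` it
yields `near_lift` and the weighted estimate; applied to `-g/c`, whose potential is the second space
derivative of that of `b`, it yields the solution class (`isSup_pot_trace`).

The weights cost nothing: for `ξ ≥ 1` the lift vanishes and the potential decays faster than any
power, so all norms are split at `ξ = 1`. All constants depend on the coefficient only through its
two bounds `μ/M₁` and `μM₁`.

Uniqueness is a maximum principle: the forward space averages of the difference of two solutions are
classical solutions, and their growth is controlled by the `L^∞L²` bound in the solution class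
(`nonpos_of_isWeakDeriv`). -/

lemma enorm_sq_eq_ofReal (x : ℝ) : ‖x‖ₑ ^ 2 = ofReal (x ^ 2) := by
  rw [Real.enorm_eq_ofReal_abs, ← ofReal_pow (abs_nonneg _), sq_abs]

lemma _root_.ContinuousOn.integrableOn_Ioo {f : ℝ → ℝ} {a b : ℝ} (h : ContinuousOn f (Icc a b)) :
    IntegrableOn f (Ioo a b) := h.integrableOn_Icc.mono_set Ioo_subset_Icc_self

/-! ### The heat kernel and its derivatives -/

/-- The polynomials `P_j` with `∂_x^j e^{-x²/4} = P_j(x) e^{-x²/4}`. -/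
noncomputable def heatPoly : ℕ → Polynomial ℝ
  | 0 => 1
  | j + 1 => (heatPoly j).derivative - Polynomial.C (1 / 2) * Polynomial.X * heatPoly j

/-- The Hermite-type lowering relation; it turns the defining recursion into the three-term
recursion of `gaussDeriv_add_two`. -/
lemma heatPoly_derivative (j : ℕ) :
    (heatPoly (j + 1)).derivative = -Polynomial.C ((j + 1 : ℝ) / 2) * heatPoly j := by
  induction j with
  | zero => simp [heatPoly]
  | succ j ih =>
    have h1 : heatPoly (j + 1 + 1) = (heatPoly (j + 1)).derivative
        - Polynomial.C (1 / 2) * Polynomial.X * heatPoly (j + 1) := rfl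
    have h2 : heatPoly (j + 1) = (heatPoly j).derivative
        - Polynomial.C (1 / 2) * Polynomial.X * heatPoly j := rfl
    have h3 : (Polynomial.C (((j + 1 : ℕ) + 1 : ℝ) / 2) : Polynomial ℝ)
        = Polynomial.C ((j + 1 : ℝ) / 2) + Polynomial.C (1 / 2) := by
      rw [← Polynomial.C_add]; congr 1; push_cast; ring
    rw [h1, Polynomial.derivative_sub, ih, Polynomial.derivative_mul, Polynomial.derivative_mul,
      Polynomial.derivative_mul, ih, h3]
    simp only [Polynomial.derivative_neg, Polynomial.derivative_C, Polynomial.derivative_X]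
    rw [h2]
    ring

/-- `γ_j = ∂_x^j e^{-x²/4}`. -/
noncomputable def gaussDeriv (j : ℕ) (x : ℝ) : ℝ := (heatPoly j).eval x * exp (-(x ^ 2 / 4))

lemma hasDerivAt_gaussDeriv (j : ℕ) (x : ℝ) :
    HasDerivAt (gaussDeriv j) (gaussDeriv (j + 1) x) x := by
  have h1 := (heatPoly j).hasDerivAt x
  have h2 : HasDerivAt (fun x : ℝ => exp (-(x ^ 2 / 4))) (exp (-(x ^ 2 / 4)) * (-(x / 2))) x := by
    have : HasDerivAt (fun x : ℝ => -(x ^ 2 / 4)) (-(x / 2)) x := by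
      have := ((hasDerivAt_pow 2 x).div_const 4).neg
      refine this.congr_deriv ?_
      norm_num
      ring
    exact this.exp
  have := h1.mul h2
  refine this.congr_deriv ?_
  simp only [gaussDeriv, heatPoly, Polynomial.eval_sub, Polynomial.eval_mul, Polynomial.eval_C,
    Polynomial.eval_X]
  ring

/-- This is the heat equation in self-similar form: the right side is exactly what `∂_s` produces
when it falls on `s^{-(j+1)/2} γ_j(ξ/√s)`. -/
lemma gaussDeriv_add_two (j : ℕ) (x : ℝ) :
    gaussDeriv (j + 2) x = -(x / 2) * gaussDeriv (j + 1) x - (j + 1) / 2 * gaussDeriv j x := by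
  have : heatPoly (j + 2) = (heatPoly (j + 1)).derivative
      - Polynomial.C (1 / 2) * Polynomial.X * heatPoly (j + 1) := rfl
  rw [gaussDeriv, this, heatPoly_derivative]
  simp only [gaussDeriv, Polynomial.eval_sub, Polynomial.eval_mul, Polynomial.eval_C,
    Polynomial.eval_X, Polynomial.eval_neg]
  ring

lemma continuous_gaussDeriv (j : ℕ) : Continuous (gaussDeriv j) :=
  continuous_iff_continuousAt.2 fun x => (hasDerivAt_gaussDeriv j x).continuousAt

/-- Half of the Gaussian exponent `x²/4` is spent on absorbing polynomials; the other half remains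
as decay. -/
lemma exists_abs_eval_le_exp (Q : Polynomial ℝ) :
    ∃ K : ℝ, 0 < K ∧ ∀ x : ℝ, |Q.eval x| ≤ K * exp (x ^ 2 / 8) := by
  induction Q using Polynomial.induction_on' with
  | add p q hp hq =>
    obtain ⟨K, hK, h⟩ := hp
    obtain ⟨L, hL, h'⟩ := hq
    refine ⟨K + L, by positivity, fun x => ?_⟩
    rw [Polynomial.eval_add, add_mul]
    exact (abs_add_le _ _).trans (add_le_add (h x) (h' x))
  | monomial n a =>
    refine ⟨|a| * (1 + 8 ^ n * n.factorial) + 1, by positivity, fun x => ?_⟩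
    rw [Polynomial.eval_monomial, abs_mul, abs_pow]
    have h1 : |x| ^ n ≤ 1 + (x ^ 2) ^ n := by
      rcases le_total |x| 1 with h | h
      · have := pow_le_one₀ (abs_nonneg x) h (n := n)
        have : 0 ≤ (x ^ 2) ^ n := by positivity
        linarith
      · have : |x| ^ n ≤ (x ^ 2) ^ n := by
          apply pow_le_pow_left₀ (abs_nonneg _)
          rw [← sq_abs]; nlinarith
        linarith
    -- The inequality `yⁿ/n! ≤ e^y` at `y = x²/8`; this is where `8ⁿ n!` comes from.
    have h2 : (x ^ 2) ^ n ≤ 8 ^ n * n.factorial * exp (x ^ 2 / 8) := by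
      have := Real.pow_div_factorial_le_exp (x ^ 2 / 8) (by positivity) n
      rw [div_pow, div_div, div_le_iff₀ (by positivity)] at this
      linarith
    have h3 : 1 ≤ exp (x ^ 2 / 8) := Real.one_le_exp (by positivity)
    have h4 : |x| ^ n ≤ (1 + 8 ^ n * n.factorial) * exp (x ^ 2 / 8) := by nlinarith
    have h5 : |a| * |x| ^ n ≤ |a| * ((1 + 8 ^ n * n.factorial) * exp (x ^ 2 / 8)) :=
      mul_le_mul_of_nonneg_left h4 (abs_nonneg _)
    nlinarith

lemma exists_abs_gaussDeriv_le (j k : ℕ) :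
    ∃ K : ℝ, 0 < K ∧ ∀ x : ℝ, |x| ^ k * |gaussDeriv j x| ≤ K * exp (-(x ^ 2 / 8)) := by
  obtain ⟨K, hK, h⟩ := exists_abs_eval_le_exp (Polynomial.X ^ k * heatPoly j)
  refine ⟨K, hK, fun x => ?_⟩
  have := h x
  rw [Polynomial.eval_mul, Polynomial.eval_pow, Polynomial.eval_X, abs_mul, abs_pow] at this
  rw [gaussDeriv, abs_mul, Real.abs_exp, ← mul_assoc]
  calc _ ≤ K * exp (x ^ 2 / 8) * exp (-(x ^ 2 / 4)) := by gcongr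
    _ = _ := by rw [mul_assoc, ← Real.exp_add]; ring_nf

/-- The `j`-th spatial derivative of the heat kernel `(π s)^{-1/2} e^{-ξ²/4s}`, extended by zero to
`s ≤ 0`. -/
noncomputable def ker (j : ℕ) (s ξ : ℝ) : ℝ :=
  if 0 < s then (√Real.pi)⁻¹ * ((√s)⁻¹ ^ (j + 1) * gaussDeriv j (ξ / √s))
  else 0

lemma ker_of_nonpos {j : ℕ} {s : ℝ} (hs : s ≤ 0) (ξ : ℝ) : ker j s ξ = 0 := by
  simp [ker, not_lt.2 hs]

lemma ker_of_pos {j : ℕ} {s : ℝ} (hs : 0 < s) (ξ : ℝ) : ker j s ξ =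
    (√Real.pi)⁻¹ * ((√s)⁻¹ ^ (j + 1) * gaussDeriv j (ξ / √s)) := by
  simp [ker, hs]

lemma hasDerivAt_ker_space (j : ℕ) (s ξ : ℝ) :
    HasDerivAt (fun ξ => ker j s ξ) (ker (j + 1) s ξ) ξ := by
  rcases le_or_gt s 0 with hs | hs
  · simp only [ker_of_nonpos hs]; exact hasDerivAt_const _ _
  · simp only [ker_of_pos hs]
    have h1 : HasDerivAt (fun ξ : ℝ => ξ / √s) (1 / √s) ξ := (hasDerivAt_id ξ).div_const _
    have := (((hasDerivAt_gaussDeriv j (ξ / √s)).comp ξ h1).const_mul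
      ((√s)⁻¹ ^ (j + 1))).const_mul (√Real.pi)⁻¹
    refine this.congr_deriv ?_
    rw [pow_succ _ (j + 1)]; ring

lemma hasDerivAt_ker_time_of_pos (j : ℕ) {s : ℝ} (hs : 0 < s) (ξ : ℝ) :
    HasDerivAt (fun s => ker j s ξ) (ker (j + 2) s ξ) s := by
  have hσ : 0 < √s := Real.sqrt_pos.2 hs
  have h0 : HasDerivAt (fun s : ℝ => (√s)⁻¹)
      (-(1 / (2 * √s)) / √s ^ 2) s := (Real.hasDerivAt_sqrt hs.ne').inv hσ.ne'
  have h1 : HasDerivAt (fun s : ℝ => ξ / √s) (ξ * (-(1 / (2 * √s)) / √s ^ 2)) s := by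
    simpa only [div_eq_mul_inv] using h0.const_mul ξ
  have h2 := ((h0.pow (j + 1)).mul ((hasDerivAt_gaussDeriv j (ξ / √s)).comp s h1)).const_mul (√Real.pi)⁻¹
  have h3 : (fun s => ker j s ξ) =ᶠ[𝓝 s] fun s =>
      (√Real.pi)⁻¹ * ((√s)⁻¹ ^ (j + 1) * gaussDeriv j (ξ / √s)) := by
    filter_upwards [lt_mem_nhds hs] with s hs
    exact ker_of_pos hs ξ
  refine HasDerivAt.congr_of_eventuallyEq ?_ h3
  refine h2.congr_deriv ?_
  rw [ker_of_pos hs, gaussDeriv_add_two]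
  simp only [Function.comp, Pi.pow_apply, Nat.add_sub_cancel]
  have h4 : -(1 / (2 * √s)) / √s ^ 2 = -((√s)⁻¹ ^ 3 / 2) := by
    field_simp
  rw [h4, div_eq_mul_inv ξ]
  push_cast
  ring

/-- With `x = ξ/√s` the quantity `s^{-(j+1)/2} |γ_j(x)|` equals `s^{k/2} ξ^{-(j+1+k)}` times
`x^{j+1+k} |γ_j(x)|`, and the last factor is bounded. The free parameter `k` buys both smallness as
`s → 0` and decay as `ξ → ∞`. -/
lemma exists_abs_ker_le (j k : ℕ) : ∃ K : ℝ, 0 < K ∧ ∀ s ξ : ℝ, 0 ≤ s → 0 < ξ →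
    |ker j s ξ| ≤ K * √s ^ k / ξ ^ (j + 1 + k) := by
  obtain ⟨K, hK, h⟩ := exists_abs_gaussDeriv_le j (j + 1 + k)
  refine ⟨K, hK, fun s ξ hs0 hξ => ?_⟩
  rcases hs0.eq_or_lt with rfl | hs
  · rw [ker_of_nonpos le_rfl, abs_zero]; positivity
  have hσ : 0 < √s := Real.sqrt_pos.2 hs
  have h1 : (√Real.pi)⁻¹ ≤ 1 := by
    apply inv_le_one_of_one_le₀
    rw [Real.one_le_sqrt]; linarith [Real.pi_gt_three]
  have h2 := h (ξ / √s)
  rw [abs_of_pos (div_pos hξ hσ)] at h2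
  have h3 : exp (-((ξ / √s) ^ 2 / 8)) ≤ 1 := Real.exp_le_one_iff.2 (by
    have : 0 ≤ (ξ / √s) ^ 2 / 8 := by positivity
    linarith)
  have h4 : (ξ / √s) ^ (j + 1 + k) * |gaussDeriv j (ξ / √s)| ≤ K := by nlinarith
  rw [ker_of_pos hs, abs_mul, abs_mul, abs_of_nonneg (by positivity : 0 ≤ (√Real.pi)⁻¹),
    abs_of_nonneg (by positivity : 0 ≤ (√s)⁻¹ ^ (j + 1)), le_div_iff₀ (by positivity)]
  have h5 : (√s)⁻¹ ^ (j + 1) * |gaussDeriv j (ξ / √s)| * ξ ^ (j + 1 + k)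
      = √s ^ k * ((ξ / √s) ^ (j + 1 + k) * |gaussDeriv j (ξ / √s)|) := by
    rw [div_pow, pow_add (√s) (j + 1) k, inv_pow]
    field_simp
  calc (√Real.pi)⁻¹ * ((√s)⁻¹ ^ (j + 1) * |gaussDeriv j (ξ / √s)|)
        * ξ ^ (j + 1 + k) = (√Real.pi)⁻¹ * ((√s)⁻¹ ^ (j + 1) * |gaussDeriv j (ξ / √s)|
        * ξ ^ (j + 1 + k)) := by ring
    _ ≤ 1 * (√s ^ k * K) := by
        rw [h5]; gcongr
    _ = _ := by ring

lemma exists_abs_ker_le_div (j : ℕ) : ∃ K : ℝ, 0 < K ∧ ∀ s ξ : ℝ, 0 < ξ →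
    |ker j s ξ| ≤ K / ξ ^ (j + 1) := by
  obtain ⟨K, hK, h⟩ := exists_abs_ker_le j 0
  refine ⟨K, hK, fun s ξ hξ => ?_⟩
  rcases le_or_gt s 0 with hs | hs
  · rw [ker_of_nonpos hs, abs_zero]; positivity
  · simpa using h s ξ hs.le hξ

/-- The case `k = 4`: quadratic vanishing in `s` is what makes the extension by zero differentiable
at `s = 0`. -/
lemma exists_abs_ker_le_sq (j : ℕ) : ∃ K : ℝ, 0 < K ∧ ∀ s ξ : ℝ, 0 < ξ →
    |ker j s ξ| ≤ K * s ^ 2 / ξ ^ (j + 5) := by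
  obtain ⟨K, hK, h⟩ := exists_abs_ker_le j 4
  refine ⟨K, hK, fun s ξ hξ => ?_⟩
  rcases le_or_gt s 0 with hs | hs
  · rw [ker_of_nonpos hs, abs_zero]; positivity
  · have := h s ξ hs.le hξ
    rwa [show √s ^ 4 = s ^ 2 by
      rw [show (4 : ℕ) = 2 * 2 by norm_num, pow_mul, Real.sq_sqrt hs.le], show j + 1 + 4 = j + 5 by ring]
      at this

/-- For fixed `ξ > 0` the heat equation persists across `s = 0`, where both sides vanish. This is
why no endpoint term `r = t` appears when potentials are differentiated. -/
lemma hasDerivAt_ker_time (j : ℕ) (s : ℝ) {ξ : ℝ} (hξ : 0 < ξ) :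
    HasDerivAt (fun s => ker j s ξ) (ker (j + 2) s ξ) s := by
  rcases lt_trichotomy s 0 with hs | rfl | hs
  · rw [ker_of_nonpos hs.le]
    refine (hasDerivAt_const s (0 : ℝ)).congr_of_eventuallyEq ?_
    filter_upwards [gt_mem_nhds hs] with s hs
    exact ker_of_nonpos (le_of_lt hs) ξ
  · obtain ⟨K, hK, h⟩ := exists_abs_ker_le_sq j
    rw [ker_of_nonpos le_rfl, hasDerivAt_iff_isLittleO]
    simp only [ker_of_nonpos le_rfl, sub_zero, smul_zero]
    have h1 : (fun s => ker j s ξ) =O[𝓝 0] fun s : ℝ => s ^ 2 := by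
      refine Asymptotics.IsBigO.of_bound (K / ξ ^ (j + 5)) (.of_forall fun s => ?_)
      rw [norm_eq_abs, norm_eq_abs, abs_of_nonneg (sq_nonneg s)]
      refine (h s ξ hξ).trans_eq (by ring)
    exact h1.trans_isLittleO (by simpa using Asymptotics.isLittleO_pow_id one_lt_two)
  · exact hasDerivAt_ker_time_of_pos j hs ξ

lemma continuousOn_ker (j : ℕ) :
    ContinuousOn (fun z => ker j z.1 z.2) (univ ×ˢ Ioi 0) := by
  rintro ⟨s, ξ⟩ ⟨-, hξ⟩
  have hξ : 0 < ξ := hξ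
  apply ContinuousAt.continuousWithinAt
  rcases le_or_gt s 0 with hs | hs
  · obtain ⟨K, hK, h⟩ := exists_abs_ker_le_sq j
    have h0 : ker j s ξ = 0 := ker_of_nonpos hs ξ
    rw [ContinuousAt]
    simp only [h0]
    have h1 : ∀ᶠ z : ℝ² in 𝓝 (s, ξ), |ker j z.1 z.2| ≤ K * (max z.1 0) ^ 2 / z.2 ^ (j + 5) := by
      have : ∀ᶠ z : ℝ² in 𝓝 (s, ξ), 0 < z.2 := by
        have : Tendsto (fun z => z.2) (𝓝 (s, ξ)) (𝓝 ξ) := continuous_snd.continuousAt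
        exact this (lt_mem_nhds hξ)
      filter_upwards [this] with z hz
      rcases le_or_gt z.1 0 with h' | h'
      · rw [ker_of_nonpos h', abs_zero]; positivity
      · rw [max_eq_left h'.le]; exact h _ _ hz
    refine squeeze_zero_norm' h1 ?_
    have : ContinuousAt (fun z => K * (max z.1 0) ^ 2 / z.2 ^ (j + 5)) (s, ξ) := by
      apply ContinuousAt.div
      · fun_prop
      · fun_prop
      · positivity
    have h2 := this.tendsto
    simpa [max_eq_right hs] using h2
  · have h3 : (fun z => ker j z.1 z.2) =ᶠ[𝓝 (s, ξ)] fun z => (√Real.pi)⁻¹ *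
        ((√z.1)⁻¹ ^ (j + 1) * gaussDeriv j (z.2 / √z.1)) := by
      have : Tendsto (fun z => z.1) (𝓝 (s, ξ)) (𝓝 s) := continuous_fst.continuousAt
      filter_upwards [this (lt_mem_nhds hs)] with z hz
      exact ker_of_pos hz _
    refine ContinuousAt.congr ?_ h3.symm
    have hσ : √s ≠ 0 := (Real.sqrt_pos.2 hs).ne'
    have h4 : ContinuousAt (fun z => √z.1) (s, ξ) := by fun_prop
    refine continuousAt_const.mul ((h4.inv₀ hσ).pow _ |>.mul ?_)
    exact (continuous_gaussDeriv j).continuousAt.comp (continuousAt_snd.div h4 hσ)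

lemma measurable_gaussDeriv (j : ℕ) : Measurable (gaussDeriv j) := (continuous_gaussDeriv j).measurable

lemma measurable_ker (j : ℕ) : Measurable (fun z : ℝ² => ker j z.1 z.2) := by
  unfold ker
  refine Measurable.ite (measurableSet_lt measurable_const measurable_fst) ?_ measurable_const
  have h := measurable_gaussDeriv j
  fun_prop

/-- The square of the kernel integrates in space to `O(s^{-(j+1/2)})`. -/
lemma exists_lintegral_ker_sq_le (j : ℕ) : ∃ K : ℝ, 0 < K ∧ ∀ s : ℝ, 0 < s →
    ∫⁻ ξ in ℝ₊, ‖ker j s ξ‖ₑ ^ 2 ≤ ofReal (K * (√s)⁻¹ ^ (2 * j + 1)) := by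
  obtain ⟨K, hK, h⟩ := exists_abs_gaussDeriv_le j 0
  -- `K²` is the squared pointwise constant, and `∫ exp(-ξ²/4s) dξ = √(4πs)` gives the rest; its
  -- `√s` lowers the power of `s^{-1/2}` from `2j + 2` to `2j + 1`.
  refine ⟨K ^ 2 * √(4 * Real.pi), by positivity, fun s hs => ?_⟩
  have hσ : 0 < √s := Real.sqrt_pos.2 hs
  have h1 : (√Real.pi)⁻¹ ≤ 1 := by
    apply inv_le_one_of_one_le₀
    rw [Real.one_le_sqrt]; linarith [Real.pi_gt_three]
  have hpt : ∀ ξ : ℝ, ker j s ξ ^ 2 ≤ K ^ 2 * (√s)⁻¹ ^ (2 * j + 2) * exp (-(1 / (4 * s)) * ξ ^ 2) := by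
    intro ξ
    have h2 := h (ξ / √s)
    rw [pow_zero, one_mul] at h2
    have h3 : |ker j s ξ| ≤ (√s)⁻¹ ^ (j + 1) * (K * exp (-((ξ / √s) ^ 2 / 8))) := by
      rw [ker_of_pos hs, abs_mul, abs_mul, abs_of_nonneg (by positivity : 0 ≤ (√Real.pi)⁻¹),
        abs_of_nonneg (by positivity : 0 ≤ (√s)⁻¹ ^ (j + 1))]
      calc _ ≤ 1 * ((√s)⁻¹ ^ (j + 1) * (K * exp (-((ξ / √s) ^ 2 / 8)))) := by gcongr
        _ = _ := one_mul _
    rw [← sq_abs]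
    calc |ker j s ξ| ^ 2
        ≤ ((√s)⁻¹ ^ (j + 1) * (K * exp (-((ξ / √s) ^ 2 / 8)))) ^ 2 := by gcongr
      _ = K ^ 2 * (√s)⁻¹ ^ (2 * j + 2) * (exp (-((ξ / √s) ^ 2 / 8))) ^ 2 := by ring
      _ = _ := by
          rw [← Real.exp_nat_mul, div_pow, Real.sq_sqrt hs.le]; congr 2; push_cast; field_simp; ring
  have hint : Integrable (fun ξ : ℝ => K ^ 2 * (√s)⁻¹ ^ (2 * j + 2) *
      exp (-(1 / (4 * s)) * ξ ^ 2)) := (integrable_exp_neg_mul_sq (by positivity)).const_mul _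
  calc ∫⁻ ξ in ℝ₊, ‖ker j s ξ‖ₑ ^ 2
      ≤ ∫⁻ ξ, ‖ker j s ξ‖ₑ ^ 2 := setLIntegral_le_lintegral _ _
    _ ≤ ∫⁻ ξ, ofReal (K ^ 2 * (√s)⁻¹ ^ (2 * j + 2) * exp (-(1 / (4 * s)) * ξ ^ 2)) := by
        refine lintegral_mono fun ξ => ?_
        rw [Real.enorm_eq_ofReal_abs, ← ofReal_pow (abs_nonneg _), sq_abs]
        exact ofReal_le_ofReal (hpt ξ)
    _ = ofReal (∫ ξ, K ^ 2 * (√s)⁻¹ ^ (2 * j + 2) * exp (-(1 / (4 * s)) * ξ ^ 2)) :=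
        (ofReal_integral_eq_lintegral_ofReal hint (.of_forall fun ξ => by positivity)).symm
    _ = _ := by
        rw [integral_const_mul, integral_gaussian]
        congr 1
        have : √(Real.pi / (1 / (4 * s))) = √(4 * Real.pi) * √s := by
          rw [← Real.sqrt_mul (by positivity)]; congr 1; field_simp
        rw [this, show 2 * j + 2 = (2 * j + 1) + 1 by ring, pow_succ (√s)⁻¹ (2 * j + 1)]
        field_simp

/-! ### Boundary potentials in intrinsic time -/

/-- A continuous coefficient bounded between two positive constants. -/
structure IsCoeff (c : ℝ → ℝ) (c₀ c₁ : ℝ) : Prop where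
  cont : Continuous c
  pos : 0 < c₀
  lower : ∀ t, c₀ ≤ c t
  upper : ∀ t, c t ≤ c₁

/-- The intrinsic time `∫₀ᵗ c`. -/
noncomputable def clock (c : ℝ → ℝ) (t : ℝ) : ℝ := ∫ r in 0..t, c r

/-- The boundary potential `∫₀ᵗ ∂_ξ^j N(C(t) - C(r), ξ) c(r) b(r) dr` of boundary data `b` on
`(0,T)`, where `N` is the (Neumann) heat kernel and `C` the intrinsic time. -/
noncomputable def pot (c : ℝ → ℝ) (T : ℝ) (b : ℝ → ℝ) (j : ℕ) (t ξ : ℝ) : ℝ :=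
  ∫ r in Ioo 0 T, ker j (clock c t - clock c r) ξ * (c r * b r)

namespace IsCoeff
variable {c : ℝ → ℝ} {c₀ c₁ : ℝ} (hc : IsCoeff c c₀ c₁)
include hc

lemma c_pos (t : ℝ) : 0 < c t := hc.pos.trans_le (hc.lower t)

lemma c₁_pos : 0 < c₁ := (hc.c_pos 0).trans_le (hc.upper 0)

lemma hasDerivAt_clock (t : ℝ) : HasDerivAt (clock c) (c t) t :=
  integral_hasDerivAt_right (hc.cont.intervalIntegrable _ _)
    (hc.cont.stronglyMeasurableAtFilter _ _) hc.cont.continuousAt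

lemma continuous_clock : Continuous (clock c) :=
  continuous_iff_continuousAt.2 fun t => (hc.hasDerivAt_clock t).continuousAt

lemma clock_sub (t r : ℝ) : clock c t - clock c r = ∫ x in r..t, c x :=
  intervalIntegral.integral_interval_sub_left (hc.cont.intervalIntegrable _ _) (hc.cont.intervalIntegrable _ _)

lemma clock_sub_ge {t r : ℝ} (h : r ≤ t) : c₀ * (t - r) ≤ clock c t - clock c r := by
  rw [hc.clock_sub]
  have := integral_mono_on h (intervalIntegrable_const (c := c₀) (μ := volume))
    (hc.cont.intervalIntegrable r t) (fun x _ => hc.lower x)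
  rw [intervalIntegral.integral_const, smul_eq_mul] at this
  linarith

lemma clock_sub_le {t r : ℝ} (h : r ≤ t) : clock c t - clock c r ≤ c₁ * (t - r) := by
  rw [hc.clock_sub]
  have := integral_mono_on h (hc.cont.intervalIntegrable r t)
    (intervalIntegrable_const (c := c₁) (μ := volume)) (fun x _ => hc.upper x)
  rw [intervalIntegral.integral_const, smul_eq_mul] at this
  linarith

lemma strictMono_clock : StrictMono (clock c) := by
  intro r t h
  have := hc.clock_sub_ge h.le
  have : 0 < c₀ * (t - r) := mul_pos hc.pos (sub_pos.2 h)
  linarith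

omit hc in
lemma clock_zero : clock c 0 = 0 := by simp [clock]

lemma integrableOn_mul {T : ℝ} {b : ℝ → ℝ} (hb : IntegrableOn b (Ioo 0 T)) :
    IntegrableOn (fun r => c r * b r) (Ioo 0 T) := by
  refine Integrable.bdd_mul (c := c₁) hb hc.cont.aestronglyMeasurable (.of_forall fun r => ?_)
  rw [norm_eq_abs, abs_of_pos (hc.c_pos r)]
  exact hc.upper r

lemma aestronglyMeasurable_ker_mul {T : ℝ} {b : ℝ → ℝ}
    (hb : AEStronglyMeasurable b vol(Ioo 0 T)) (j : ℕ) (t ξ : ℝ) :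
    AEStronglyMeasurable (fun r => ker j (clock c t - clock c r) ξ * (c r * b r)) vol(Ioo 0 T) := by
  refine AEStronglyMeasurable.mul (Measurable.aestronglyMeasurable ?_) (hc.cont.aestronglyMeasurable.mul hb)
  have h1 : Measurable fun r => ((clock c t - clock c r, ξ) : ℝ²) :=
    (measurable_const.sub hc.continuous_clock.measurable).prodMk measurable_const
  exact (measurable_ker j).comp h1

lemma integrableOn_ker_mul {T : ℝ} {b : ℝ → ℝ} (hb : IntegrableOn b (Ioo 0 T)) (j : ℕ) (t : ℝ)
    {ξ : ℝ} (hξ : 0 < ξ) :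
    IntegrableOn (fun r => ker j (clock c t - clock c r) ξ * (c r * b r)) (Ioo 0 T) := by
  obtain ⟨K, hK, h⟩ := exists_abs_ker_le_div j
  refine Integrable.mono' ((hc.integrableOn_mul hb).norm.const_mul (K / ξ ^ (j + 1)))
    (hc.aestronglyMeasurable_ker_mul hb.aestronglyMeasurable j t ξ) (.of_forall fun r => ?_)
  rw [norm_mul]
  exact mul_le_mul_of_nonneg_right (h _ _ hξ) (norm_nonneg _)

lemma hasDerivAt_pot_space {T : ℝ} {b : ℝ → ℝ} (hb : IntegrableOn b (Ioo 0 T)) (j : ℕ) (t : ℝ)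
    {ξ : ℝ} (hξ : 0 < ξ) :
    HasDerivAt (fun ξ => pot c T b j t ξ) (pot c T b (j + 1) t ξ) ξ := by
  obtain ⟨K, hK, h⟩ := exists_abs_ker_le_div (j + 1)
  -- On `ξ > ξ₀/2` the kernel and its derivatives are bounded uniformly in time, so integrable data
  -- suffice for domination.
  refine (hasDerivAt_integral_of_dominated_loc_of_deriv_le (s := Ioi (ξ / 2))
    (bound := fun r => K / (ξ / 2) ^ (j + 1 + 1) * ‖c r * b r‖)
    (F' := fun ξ r => ker (j + 1) (clock c t - clock c r) ξ * (c r * b r))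
    (Ioi_mem_nhds (by linarith)) ?_ ?_ ?_ ?_ ?_ ?_).2
  · exact .of_forall fun ξ => hc.aestronglyMeasurable_ker_mul hb.aestronglyMeasurable j t ξ
  · exact hc.integrableOn_ker_mul hb j t hξ
  · exact hc.aestronglyMeasurable_ker_mul hb.aestronglyMeasurable _ t ξ
  · refine .of_forall fun r x hx => ?_
    have hx : ξ / 2 < x := hx
    have hx0 : 0 < x := by linarith
    rw [norm_mul]
    refine mul_le_mul_of_nonneg_right ((h _ _ hx0).trans ?_) (norm_nonneg _)
    gcongr
  · exact (hc.integrableOn_mul hb).norm.const_mul _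
  · exact .of_forall fun r x _ => (hasDerivAt_ker_space j _ x).mul_const _

/-- The interval of integration is the fixed `(0,T)` and causality is built into the kernel, so one
differentiates under the integral without a Leibniz endpoint term. -/
lemma hasDerivAt_pot_time {T : ℝ} {b : ℝ → ℝ} (hb : IntegrableOn b (Ioo 0 T)) (j : ℕ) (t : ℝ)
    {ξ : ℝ} (hξ : 0 < ξ) :
    HasDerivAt (fun t => pot c T b j t ξ) (c t * pot c T b (j + 2) t ξ) t := by
  obtain ⟨K, hK, h⟩ := exists_abs_ker_le_div (j + 2)
  have key := (hasDerivAt_integral_of_dominated_loc_of_deriv_le (s := univ) (x₀ := t)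
    (F := fun t r => ker j (clock c t - clock c r) ξ * (c r * b r)) (μ := vol(Ioo 0 T))
    (bound := fun r => K / ξ ^ (j + 2 + 1) * c₁ * ‖c r * b r‖)
    (F' := fun t r => ker (j + 2) (clock c t - clock c r) ξ * c t * (c r * b r))
    univ_mem ?_ ?_ ?_ ?_ ?_ ?_).2
  · refine key.congr_deriv ?_
    rw [pot, ← integral_const_mul]
    congr 1; ext r; ring
  · exact .of_forall fun t => hc.aestronglyMeasurable_ker_mul hb.aestronglyMeasurable j t ξ
  · exact hc.integrableOn_ker_mul hb j t hξ
  · have := (hc.aestronglyMeasurable_ker_mul hb.aestronglyMeasurable (j + 2) t ξ).const_mul (c t)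
    refine this.congr (.of_forall fun r => ?_)
    simp only; ring
  · refine .of_forall fun r x hx => ?_
    rw [norm_mul, norm_mul]
    refine mul_le_mul_of_nonneg_right (mul_le_mul (h _ _ hξ) ?_ (norm_nonneg _) (by positivity)) (norm_nonneg _)
    rw [norm_eq_abs, abs_of_pos (hc.c_pos x)]; exact hc.upper x
  · exact (hc.integrableOn_mul hb).norm.const_mul _
  · refine .of_forall fun r x _ => HasDerivAt.mul_const ?_ _
    exact (hasDerivAt_ker_time j _ hξ).comp x ((hc.hasDerivAt_clock x).sub_const _)

lemma continuousOn_pot {T : ℝ} {b : ℝ → ℝ} (hb : IntegrableOn b (Ioo 0 T)) (j : ℕ) :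
    ContinuousOn (fun z : ℝ² => pot c T b j z.1 z.2) (univ ×ˢ Ioi 0) := by
  rintro ⟨t, ξ⟩ ⟨-, hξ⟩
  have hξ : 0 < ξ := hξ
  obtain ⟨K, hK, h⟩ := exists_abs_ker_le_div j
  apply ContinuousAt.continuousWithinAt
  have hev : ∀ᶠ z : ℝ² in 𝓝 (t, ξ), ξ / 2 < z.2 := by
    have : Tendsto (fun z : ℝ² => z.2) (𝓝 (t, ξ)) (𝓝 ξ) := continuous_snd.continuousAt
    exact this (lt_mem_nhds (by linarith))
  refine continuousAt_of_dominated (bound := fun r => K / (ξ / 2) ^ (j + 1) * ‖c r * b r‖) ?_ ?_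
    ((hc.integrableOn_mul hb).norm.const_mul _) ?_
  · exact .of_forall fun z => hc.aestronglyMeasurable_ker_mul hb.aestronglyMeasurable j _ _
  · filter_upwards [hev] with z hz
    refine .of_forall fun r => ?_
    have hx0 : 0 < z.2 := by linarith
    rw [norm_mul]
    refine mul_le_mul_of_nonneg_right ((h _ _ hx0).trans ?_) (norm_nonneg _)
    gcongr
  · refine .of_forall fun r => ContinuousAt.mul ?_ continuousAt_const
    have h1 : ContinuousAt (fun z : ℝ² => ker j z.1 z.2) (clock c t - clock c r, ξ) :=
      (continuousOn_ker j).continuousAt (prod_mem_nhds univ_mem (Ioi_mem_nhds hξ))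
    have h2 : ContinuousAt (fun z : ℝ² => ((clock c z.1 - clock c r, z.2) : ℝ²)) (t, ξ) := by
      have := hc.continuous_clock
      fun_prop
    exact ContinuousAt.comp (f := fun z : ℝ² => ((clock c z.1 - clock c r, z.2) : ℝ²)) h1 h2

lemma ker_clock_eq_zero (j : ℕ) {t r : ℝ} (h : t ≤ r) (ξ : ℝ) :
    ker j (clock c t - clock c r) ξ = 0 :=
  ker_of_nonpos (sub_nonpos.2 (hc.strictMono_clock.monotone h)) ξ

lemma pot_eq_Ioo {T t : ℝ} (b : ℝ → ℝ) (ht : t ≤ T) (j : ℕ) (ξ : ℝ) :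
    pot c T b j t ξ = ∫ r in Ioo 0 t, ker j (clock c t - clock c r) ξ * (c r * b r) := by
  rw [pot]
  refine (setIntegral_eq_of_subset_of_forall_sdiff_eq_zero measurableSet_Ioo
    (Ioo_subset_Ioo_right ht) fun r hr => ?_)
  have : t ≤ r := by
    by_contra h
    exact hr.2 ⟨hr.1.1, not_le.1 h⟩
  rw [hc.ker_clock_eq_zero j this, zero_mul]

lemma pot_zero_time {T : ℝ} (hT : 0 ≤ T) (b : ℝ → ℝ) (j : ℕ) (ξ : ℝ) : pot c T b j 0 ξ = 0 := by
  rw [hc.pot_eq_Ioo b hT]; simp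

/-- Integration by parts in time: two space derivatives of the potential fall on the data. -/
lemma pot_add_two {T : ℝ} {b b₁ : ℝ → ℝ} (hb₁ : IntegrableOn b₁ (Ioo 0 T))
    (hb : ∀ t ∈ Icc 0 T, b t = ∫ r in 0..t, c r * b₁ r) (j : ℕ) {t : ℝ} (ht : t ∈ Icc 0 T)
    {ξ : ℝ} (hξ : 0 < ξ) : pot c T b (j + 2) t ξ = pot c T b₁ j t ξ := by
  have hT : 0 ≤ T := ht.1.trans ht.2
  set B : ℝ → ℝ := fun t => ∫ r in 0..t, c r * b₁ r with hB
  set k : ℝ → ℝ := fun r => ker j (clock c t - clock c r) ξ with hk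
  have hi : IntervalIntegrable (fun r => c r * b₁ r) volume 0 T := by
    rw [intervalIntegrable_iff_integrableOn_Ioo_of_le hT]; exact hc.integrableOn_mul hb₁
  have hkd : ∀ r, HasDerivAt k (-(ker (j + 2) (clock c t - clock c r) ξ * c r)) r := fun r => by
    have := (hasDerivAt_ker_time j (clock c t - clock c r) hξ).comp r
      ((hc.hasDerivAt_clock r).const_sub (clock c t))
    exact this.congr_deriv (by ring)
  have hkc : Continuous (fun r => -(ker (j + 2) (clock c t - clock c r) ξ * c r)) := by
    have h1 : Continuous fun r => ((clock c t - clock c r, ξ) : ℝ²) := by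
      have := hc.continuous_clock
      fun_prop
    exact (((continuousOn_ker (j + 2)).comp_continuous h1 fun r => ⟨mem_univ _, hξ⟩).mul hc.cont).neg
  -- The data derivative is merely integrable, so the integration by parts has to be the one for
  -- absolutely continuous functions.
  have hBac : AbsolutelyContinuousOnInterval B 0 T :=
    hi.absolutelyContinuousOnInterval_intervalIntegral (by simp)
  have hkac : AbsolutelyContinuousOnInterval k 0 T := by
    have h2 : ∀ r, k r = k 0 + ∫ x in 0..r, -(ker (j + 2) (clock c t - clock c x) ξ * c x) := by
      intro r
      rw [integral_eq_sub_of_hasDerivAt (fun x _ => hkd x) (hkc.intervalIntegrable _ _)]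
      ring
    have h3 := (hkc.intervalIntegrable (μ := volume) 0 T).absolutelyContinuousOnInterval_intervalIntegral
      (c := 0) (by simp)
    have h4 : AbsolutelyContinuousOnInterval (fun _ : ℝ => k 0) 0 T :=
      (LipschitzWith.const (k 0)).lipschitzOnWith.absolutelyContinuousOnInterval
    have h5 : k = (fun _ : ℝ => k 0) + fun r => ∫ x in 0..r,
        -(ker (j + 2) (clock c t - clock c x) ξ * c x) := funext h2
    rw [h5]
    exact h4.add h3
  have hparts := hkac.integral_mul_deriv_eq_deriv_mul hBac
  -- Both endpoint terms vanish: at `r = T ≥ t` the kernel has nonpositive time argument, and at `r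
  -- = 0` the data are zero.
  have hk0 : k T = 0 := hc.ker_clock_eq_zero j ht.2 ξ
  have hB0 : B 0 = 0 := by simp [hB]
  rw [hk0, hB0, zero_mul, mul_zero, sub_zero, zero_sub] at hparts
  have hBd : ∀ᵐ r, r ∈ uIcc 0 T → HasDerivAt B (c r * b₁ r) r := by
    filter_upwards [hi.ae_hasDerivAt_integral] with r hr hmem
    exact hr hmem 0 (by simp)
  have e1 : pot c T b₁ j t ξ = ∫ r in 0..T, k r * deriv B r := by
    rw [pot, ← integral_Ioc_eq_integral_Ioo, ← integral_of_le hT]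
    refine intervalIntegral.integral_congr_ae ?_
    filter_upwards [hBd] with r hr hmem
    rw [(hr (uIoc_subset_uIcc hmem)).deriv]
  have e2 : pot c T b (j + 2) t ξ = -∫ r in 0..T, deriv k r * B r := by
    rw [pot, ← integral_Ioc_eq_integral_Ioo, ← integral_of_le hT, ← intervalIntegral.integral_neg]
    refine integral_congr fun r hr => ?_
    rw [uIcc_of_le hT] at hr
    rw [(hkd r).deriv, hb r hr]
    ring
  rw [e1, e2, hparts]

omit hc in
/-- Away from the boundary the potential decays faster than any power. -/
lemma exists_abs_pot_le (c₀ c₁ T : ℝ) (hT : 0 < T) (hc₁ : 0 < c₁) (j k : ℕ) :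
    ∃ K : ℝ, 0 < K ∧ ∀ c : ℝ → ℝ, IsCoeff c c₀ c₁ → ∀ b : ℝ → ℝ, IntegrableOn b (Ioo 0 T) →
      ∀ t ∈ Icc 0 T, ∀ ξ : ℝ, 1 ≤ ξ →
        |pot c T b j t ξ| ≤ K / ξ ^ k * ∫ r in Ioo 0 t, |b r| := by
  obtain ⟨K, hK, h⟩ := exists_abs_ker_le j k
  -- The intrinsic time that elapses is at most `c₁ T`, and the factor `c r` is at most `c₁`. The
  -- constant is fixed before `c`, which keeps the final estimate uniform over coefficients.
  refine ⟨K * √(c₁ * T) ^ k * c₁, by positivity, fun c hc b hb t ht ξ hξ => ?_⟩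
  have hξ0 : 0 < ξ := by linarith
  have hb' : IntegrableOn b (Ioo 0 t) := hb.mono_set (Ioo_subset_Ioo_right ht.2)
  rw [hc.pot_eq_Ioo b ht.2, ← integral_const_mul]
  refine (norm_integral_le_integral_norm (μ := vol(Ioo 0 t))
    (fun r => ker j (clock c t - clock c r) ξ * (c r * b r))).trans ?_
  refine integral_mono_of_nonneg (.of_forall fun r => norm_nonneg _) (hb'.norm.const_mul _) ?_
  rw [EventuallyLE, ae_restrict_iff' measurableSet_Ioo]
  refine .of_forall fun r hr => ?_
  have h0 : 0 ≤ clock c t - clock c r := (mul_nonneg hc.pos.le (by linarith [hr.2])).trans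
    (hc.clock_sub_ge hr.2.le)
  have h1 : clock c t - clock c r ≤ c₁ * T := (hc.clock_sub_le hr.2.le).trans
    (by gcongr; linarith [hr.1, ht.2])
  simp only [norm_mul, norm_eq_abs, abs_of_pos (hc.c_pos r)]
  calc |ker j (clock c t - clock c r) ξ| * (c r * |b r|)
      ≤ (K * √(c₁ * T) ^ k / ξ ^ k) * (c₁ * |b r|) := by
        gcongr
        · exact mul_nonneg (hc.c_pos r).le (abs_nonneg _)
        · refine (h _ _ h0 hξ0).trans ?_
          gcongr
          omega
        · exact hc.upper r
    _ = _ := by ring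

lemma surjective_clock : Function.Surjective (clock c) := by
  refine hc.continuous_clock.surjective ?_ ?_
  · refine tendsto_atTop_mono' _ ?_ (tendsto_id.const_mul_atTop hc.pos)
    filter_upwards [eventually_ge_atTop 0] with t ht
    have := hc.clock_sub_ge ht
    simpa [clock_zero] using this
  · refine tendsto_atBot_mono' _ ?_ (tendsto_id.const_mul_atBot hc.pos)
    filter_upwards [eventually_le_atBot 0] with t ht
    have := hc.clock_sub_ge ht
    rw [clock_zero] at this
    simp only [id]; linarith

/-- The intrinsic time as an order isomorphism of the line. -/
noncomputable def clockIso : ℝ ≃o ℝ :=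
  hc.strictMono_clock.orderIsoOfSurjective _ hc.surjective_clock

lemma clockIso_symm_clock (t : ℝ) : hc.clockIso.symm (clock c t) = t :=
  hc.clockIso.symm_apply_apply t

lemma clock_clockIso_symm (t : ℝ) : clock c (hc.clockIso.symm t) = t :=
  hc.clockIso.apply_symm_apply t

lemma continuous_clockIso_symm : Continuous hc.clockIso.symm :=
  hc.clockIso.symm.continuous

lemma clock_image_Ioo (T : ℝ) : clock c '' Ioo 0 T = Ioo 0 (clock c T) := by
  have := hc.clockIso.image_Ioo 0 T
  rw [show (hc.clockIso 0 : ℝ) = clock c 0 from rfl, clock_zero] at this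
  exact this

/-- The data in intrinsic time, extended by zero. -/
noncomputable def data (T : ℝ) (b : ℝ → ℝ) : ℝ → ℝ :=
  (Ioo 0 (clock c T)).indicator fun s => b (hc.clockIso.symm s)

/-- After passing to intrinsic time, the substitution `s = ξ²/(4y²)` turns the order-one kernel into
the weight `e^{-y²}`, free of `ξ`; the dependence on `ξ` moves into the argument of the data. The
sup bound, the jump relation and continuity up to the boundary are all read off from this formula.
-/
lemma pot_one_eq (T : ℝ) (b : ℝ → ℝ) (t : ℝ) {ξ : ℝ} (hξ : 0 < ξ) :
    pot c T b 1 t ξ = -(2 / √Real.pi *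
      ∫ y in ℝ₊, exp (-y ^ 2) * hc.data T b (clock c t - ξ ^ 2 / (4 * y ^ 2))) := by
  have e1 : pot c T b 1 t ξ = ∫ s, ker 1 (clock c t - s) ξ * hc.data T b s := by
    have := integral_image_eq_integral_abs_deriv_smul (s := Ioo 0 T) (f := clock c) (f' := c)
      measurableSet_Ioo (fun r _ => (hc.hasDerivAt_clock r).hasDerivWithinAt)
      hc.strictMono_clock.injective.injOn (fun s => ker 1 (clock c t - s) ξ * b (hc.clockIso.symm s))
    rw [hc.clock_image_Ioo, ← integral_indicator measurableSet_Ioo] at this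
    rw [pot]
    calc _ = ∫ r in Ioo 0 T, |c r| • (ker 1 (clock c t - clock c r) ξ *
          b (hc.clockIso.symm (clock c r))) := by
          congr 1; ext r
          rw [hc.clockIso_symm_clock, abs_of_pos (hc.c_pos r), smul_eq_mul]; ring
      _ = _ := by
          rw [← this]
          congr 1; ext s
          by_cases hs : s ∈ Ioo 0 (clock c T)
          · simp [data, hs]
          · simp [data, hs]
  have e2 : pot c T b 1 t ξ = ∫ s in ℝ₊, ker 1 s ξ * hc.data T b (clock c t - s) := by
    have h1 := integral_sub_left_eq_self (μ := volume)
      (fun s => ker 1 s ξ * hc.data T b (clock c t - s)) (clock c t)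
    simp only [sub_sub_cancel] at h1
    rw [e1, h1]
    refine (setIntegral_eq_integral_of_forall_compl_eq_zero fun s hs => ?_).symm
    rw [ker_of_nonpos (not_lt.1 hs), zero_mul]
  have himg : (fun y : ℝ => ξ ^ 2 / (4 * y ^ 2)) '' Ioi 0 = Ioi 0 := by
    ext s
    constructor
    · rintro ⟨y, hy, rfl⟩
      have : 0 < y := hy
      show 0 < ξ ^ 2 / (4 * y ^ 2)
      positivity
    · intro hs
      have hs : 0 < s := hs
      refine ⟨ξ / (2 * √s), mem_Ioi.2 (by positivity), ?_⟩
      simp only [div_pow, mul_pow, Real.sq_sqrt hs.le]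
      field_simp
      norm_num
  have hinj : InjOn (fun y : ℝ => ξ ^ 2 / (4 * y ^ 2)) (Ioi 0) := by
    intro x hx y hy h
    have hx : 0 < x := hx
    have hy : 0 < y := hy
    have h' : ξ ^ 2 / (4 * x ^ 2) = ξ ^ 2 / (4 * y ^ 2) := h
    rw [div_eq_div_iff (by positivity) (by positivity)] at h'
    have h2 : ξ ^ 2 ≠ 0 := by positivity
    have h3 : x ^ 2 = y ^ 2 := by
      have := mul_left_cancel₀ h2 h'
      linarith
    exact (pow_left_inj₀ hx.le hy.le two_ne_zero).1 h3
  have hder : ∀ y ∈ ℝ₊, HasDerivWithinAt (fun y : ℝ => ξ ^ 2 / (4 * y ^ 2))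
      (-(ξ ^ 2 / (2 * y ^ 3))) (Ioi 0) y := by
    intro y hy
    have hy : 0 < y := hy
    have h1 := (((hasDerivAt_pow 2 y).const_mul 4).inv (by positivity)).const_mul (ξ ^ 2)
    refine (h1.congr_deriv ?_).hasDerivWithinAt
    field_simp
    norm_num
    ring
  rw [e2]
  nth_rewrite 1 [← himg]
  rw [integral_image_eq_integral_abs_deriv_smul measurableSet_Ioi hder hinj,
    ← integral_const_mul, ← integral_neg]
  refine setIntegral_congr_fun measurableSet_Ioi fun y hy => ?_
  have hy : 0 < y := hy
  have hs : 0 < ξ ^ 2 / (4 * y ^ 2) := by positivity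
  have hsq : √(ξ ^ 2 / (4 * y ^ 2)) = ξ / (2 * y) := by
    rw [show ξ ^ 2 / (4 * y ^ 2) = (ξ / (2 * y)) ^ 2 by ring, Real.sqrt_sq (by positivity)]
  have hg : gaussDeriv 1 (ξ / (ξ / (2 * y))) = -y * exp (-y ^ 2) := by
    rw [show ξ / (ξ / (2 * y)) = 2 * y by field_simp]
    simp only [gaussDeriv, heatPoly, Polynomial.derivative_one, zero_sub, Polynomial.eval_neg,
      Polynomial.eval_mul, Polynomial.eval_C, Polynomial.eval_X, Polynomial.eval_one]
    rw [show -((2 * y) ^ 2 / 4) = -y ^ 2 by ring]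
    ring
  simp only [smul_eq_mul]
  rw [ker_of_pos hs, hsq, hg, abs_neg, abs_of_pos (by positivity)]
  have hpi : √Real.pi ≠ 0 := by positivity
  field_simp
  norm_num
  left
  field_simp
  norm_num

omit hc in
lemma integral_exp_neg_sq : 2 / √Real.pi * ∫ y in ℝ₊, exp (-y ^ 2) = 1 := by
  have := integral_gaussian_Ioi 1
  simp only [neg_mul, one_mul, div_one] at this
  rw [this]
  have hpi : √Real.pi ≠ 0 := by positivity
  field_simp

omit hc in
lemma integrable_exp_neg_sq : Integrable (fun y : ℝ => exp (-y ^ 2)) := by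
  simpa using integrable_exp_neg_mul_sq (b := 1) one_pos

/-- The weight `(2/√π) e^{-y²}` is a probability density on `y > 0`. -/
lemma abs_pot_one_le {T B : ℝ} {b : ℝ → ℝ} (hB : 0 ≤ B) (hb : ∀ r ∈ Ioo 0 T, |b r| ≤ B) (t : ℝ)
    {ξ : ℝ} (hξ : 0 < ξ) : |pot c T b 1 t ξ| ≤ B := by
  have hd : ∀ s, |hc.data T b s| ≤ B := by
    intro s
    by_cases hs : s ∈ Ioo 0 (clock c T)
    · rw [data, indicator_of_mem hs]
      refine hb _ ?_
      rw [← hc.clock_image_Ioo] at hs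
      obtain ⟨r, hr, rfl⟩ := hs
      rwa [hc.clockIso_symm_clock]
    · rw [data, indicator_of_notMem hs, abs_zero]; exact hB
  have h1 : |∫ y in ℝ₊, exp (-y ^ 2) * hc.data T b (clock c t - ξ ^ 2 / (4 * y ^ 2))| ≤
      ∫ y in ℝ₊, exp (-y ^ 2) * B := by
    refine norm_integral_le_of_norm_le (μ := vol(Ioi 0)) (f := fun y : ℝ =>
      exp (-y ^ 2) * hc.data T b (clock c t - ξ ^ 2 / (4 * y ^ 2)))
      (integrable_exp_neg_sq.integrableOn.mul_const B) (.of_forall fun y => ?_)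
    rw [norm_mul, norm_eq_abs, Real.abs_exp]
    exact mul_le_mul_of_nonneg_left (hd _) (Real.exp_pos _).le
  rw [hc.pot_one_eq T b t hξ, abs_neg, abs_mul, abs_of_pos (by positivity)]
  calc _ ≤ 2 / √Real.pi * ∫ y in ℝ₊, exp (-y ^ 2) * B := by gcongr
    _ = (2 / √Real.pi * ∫ y in ℝ₊, exp (-y ^ 2)) * B := by
        rw [integral_mul_const]; ring
    _ = B := by rw [integral_exp_neg_sq, one_mul]

lemma measurable_data (T : ℝ) {b : ℝ → ℝ} (hb : Continuous b) : Measurable (hc.data T b) :=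
  (hb.comp hc.continuous_clockIso_symm).measurable.indicator measurableSet_Ioo

/-- The jump relation: the potential attains its data at the boundary. -/
lemma tendsto_pot_one {T : ℝ} {b : ℝ → ℝ} (hb : Continuous b) {t : ℝ} (ht : t ∈ Ioo 0 T) :
    Tendsto (fun ξ => pot c T b 1 t ξ) (𝓝[>] 0) (𝓝 (-b t)) := by
  obtain ⟨B, hB⟩ := isCompact_Icc.exists_bound_of_continuousOn (s := Icc 0 T) hb.continuousOn
  have hB0 : 0 ≤ B := (norm_nonneg _).trans (hB t (Ioo_subset_Icc_self ht))
  have hd : ∀ s, ‖hc.data T b s‖ ≤ B := by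
    intro s
    by_cases hs : s ∈ Ioo 0 (clock c T)
    · rw [data, indicator_of_mem hs]
      refine hB _ ?_
      rw [← hc.clock_image_Ioo] at hs
      obtain ⟨r, hr, rfl⟩ := hs
      rw [hc.clockIso_symm_clock]; exact Ioo_subset_Icc_self hr
    · rw [data, indicator_of_notMem hs, norm_zero]; exact hB0
  have hmem : clock c t ∈ Ioo 0 (clock c T) := by
    rw [← hc.clock_image_Ioo]; exact ⟨t, ht, rfl⟩
  have hcont : ContinuousAt (hc.data T b) (clock c t) := by
    have : ContinuousAt (fun s => b (hc.clockIso.symm s)) (clock c t) :=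
      (hb.comp hc.continuous_clockIso_symm).continuousAt
    refine this.congr ?_
    filter_upwards [Ioo_mem_nhds hmem.1 hmem.2] with s hs
    rw [data, indicator_of_mem hs]
  have hval : hc.data T b (clock c t) = b t := by
    rw [data, indicator_of_mem hmem, hc.clockIso_symm_clock]
  have key : Tendsto (fun ξ : ℝ => ∫ y in ℝ₊, exp (-y ^ 2) *
      hc.data T b (clock c t - ξ ^ 2 / (4 * y ^ 2))) (𝓝[>] 0) (𝓝 (∫ y in ℝ₊, exp (-y ^ 2) * b t)) := by
    refine tendsto_integral_filter_of_dominated_convergence (fun y => exp (-y ^ 2) * B) ?_ ?_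
      (integrable_exp_neg_sq.integrableOn.mul_const B) ?_
    · refine .of_forall fun ξ => Measurable.aestronglyMeasurable ?_
      have := hc.measurable_data T hb
      fun_prop
    · refine .of_forall fun ξ => .of_forall fun y => ?_
      rw [norm_mul, norm_eq_abs, Real.abs_exp]
      exact mul_le_mul_of_nonneg_left (hd _) (Real.exp_pos _).le
    · refine .of_forall fun y => Tendsto.const_mul _ ?_
      rw [← hval]
      refine hcont.tendsto.comp (tendsto_nhdsWithin_of_tendsto_nhds ?_)
      have : Continuous fun ξ : ℝ => clock c t - ξ ^ 2 / (4 * y ^ 2) := by fun_prop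
      have h := this.tendsto 0
      simpa using h
  have h2 := (key.const_mul (2 / √Real.pi)).neg
  have h3 : -(2 / √Real.pi * ∫ y in ℝ₊, exp (-y ^ 2) * b t) = -b t := by
    rw [integral_mul_const, ← mul_assoc, integral_exp_neg_sq, one_mul]
  rw [h3] at h2
  refine h2.congr' ?_
  filter_upwards [self_mem_nhdsWithin] with ξ hξ
  exact (hc.pot_one_eq T b t hξ).symm

/-- The solution `-pot 1` of the heat equation, with its boundary values filled in, is continuous
up to the boundary when the data are continuous and vanish at the initial time. -/
lemma continuousOn_pot_one {T : ℝ} (hT : 0 < T) {b : ℝ → ℝ} (hb : ContinuousOn b (Icc 0 T))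
    (hb0 : b 0 = 0) :
    ContinuousOn (fun z : ℝ² => if 0 < z.2 then -pot c T b 1 z.1 z.2 else b z.1) (closedStrip T) := by
  -- Because the data vanish at time zero, their constant continuation agrees with the continuation
  -- by zero for negative times. The sharp cutoff is thereby replaced by a continuous function, and
  -- dominated convergence gives joint continuity down to `ξ = 0` and `t = 0`.
  set b' : ℝ → ℝ := IccExtend hT.le ((Icc 0 T).domRestrict b) with hb'
  have hb'c : Continuous b' := hb.domRestrict.Icc_extend'
  have hb'v : ∀ t ∈ Icc 0 T, b' t = b t := fun t ht => by
    rw [hb', IccExtend_of_mem _ _ ht]; rfl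
  have hb'neg : ∀ t ≤ 0, b' t = 0 := fun t ht => by
    rw [hb', IccExtend_of_le_left _ _ ht]; exact hb0
  obtain ⟨B, hB⟩ := isCompact_Icc.exists_bound_of_continuousOn hb
  have hBall : ∀ t, ‖b' t‖ ≤ B := fun t => by
    rw [hb', IccExtend_apply]; exact hB _ (Subtype.coe_prop _)
  set h : ℝ → ℝ := fun s => b' (hc.clockIso.symm s) with hh
  have hhc : Continuous h := hb'c.comp hc.continuous_clockIso_symm
  have hU : Continuous (fun z : ℝ² => 2 / √Real.pi * ∫ y in ℝ₊,
      exp (-y ^ 2) * h (clock c z.1 - z.2 ^ 2 / (4 * y ^ 2))) := by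
    refine continuous_const.mul (continuous_of_dominated (bound := fun y => exp (-y ^ 2) * B)
      ?_ ?_ (integrable_exp_neg_sq.integrableOn.mul_const B) ?_)
    · intro z
      refine Measurable.aestronglyMeasurable ?_
      have := hhc.measurable
      fun_prop
    · refine fun z => .of_forall fun y => ?_
      rw [norm_mul, norm_eq_abs, Real.abs_exp]
      exact mul_le_mul_of_nonneg_left (hBall _) (Real.exp_pos _).le
    · refine .of_forall fun y => ?_
      have := hc.continuous_clock
      fun_prop
  refine hU.continuousOn.congr fun z hz => ?_
  obtain ⟨t, ξ⟩ := z
  obtain ⟨ht, hξ⟩ := hz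
  simp only at ht hξ ⊢
  split_ifs with hpos
  · rw [hc.pot_one_eq T b t hpos, neg_neg]
    congr 1
    refine setIntegral_congr_fun measurableSet_Ioi fun y hy => ?_
    have hy : 0 < y := hy
    congr 1
    set s := clock c t - ξ ^ 2 / (4 * y ^ 2) with hs
    have hs1 : s < clock c T := by
      have h1 : clock c t ≤ clock c T := hc.strictMono_clock.monotone ht.2
      have h2 : 0 < ξ ^ 2 / (4 * y ^ 2) := by positivity
      linarith
    by_cases hs0 : 0 < s
    · have hmem : s ∈ Ioo 0 (clock c T) := ⟨hs0, hs1⟩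
      rw [data, indicator_of_mem hmem, hh]
      rw [← hc.clock_image_Ioo] at hmem
      obtain ⟨r, hr, hrs⟩ := hmem
      simp only
      rw [← hrs, hc.clockIso_symm_clock, hb'v r (Ioo_subset_Icc_self hr)]
    · rw [data, indicator_of_notMem (fun h => hs0 h.1), hh]
      refine (hb'neg _ ?_).symm
      by_contra hcon
      have := hc.strictMono_clock (not_le.1 hcon)
      rw [clock_zero, hc.clock_clockIso_symm] at this
      exact hs0 this
  · have hξ0 : ξ = 0 := le_antisymm (not_lt.1 hpos) hξ
    subst hξ0
    simp only [ne_eq, OfNat.ofNat_ne_zero, not_false_eq_true, zero_pow, zero_div, sub_zero]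
    rw [integral_mul_const, ← mul_assoc, integral_exp_neg_sq, one_mul]
    show b t = b' (hc.clockIso.symm (clock c t))
    rw [hc.clockIso_symm_clock, hb'v t ht]

end IsCoeff

/-! ### Weighted square-integrable functions on the half-strip -/

lemma volume_restrict_strip (T : ℝ) : vol(strip T) =
    vol(Ioo 0 T).prod vol(ℝ₊) := by
  rw [prod_restrict, strip, volume_eq_prod]

lemma strip_subset_closedStrip (T : ℝ) : strip T ⊆ closedStrip T :=
  Set.prod_mono Ioo_subset_Icc_self Ioi_subset_Ici_self

lemma measurableSet_strip (T : ℝ) : MeasurableSet (strip T) := measurableSet_Ioo.prod measurableSet_Ioi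

lemma isOpen_strip (T : ℝ) : IsOpen (strip T) := isOpen_Ioo.prod isOpen_Ioi

/-- `L^∞` in time with values in weighted `L²` in space, for all powers of the weight. -/
def IsSup (T : ℝ) (w : ℝ² → ℝ) : Prop :=
  AEStronglyMeasurable w vol(strip T) ∧ ∀ N : ℕ, ∃ B : NNReal, ∀ᵐ t ∂vol(Ioo 0 T),
    ∫⁻ ξ in ℝ₊, ‖weighted N w (t, ξ)‖ₑ ^ 2 ≤ B

/-- `L²` in time with values in weighted `L²` in space, for all powers of the weight. -/
def IsSq (T : ℝ) (w : ℝ² → ℝ) : Prop :=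
  AEStronglyMeasurable w vol(strip T) ∧ ∀ N : ℕ, ∫⁻ z in strip T, ‖weighted N w z‖ₑ ^ 2 < ⊤

lemma aemeasurable_enorm_sq {α : Type*} [MeasurableSpace α] {μ : Measure α} {w : α → ℝ}
    (hw : AEStronglyMeasurable w μ) : AEMeasurable (fun z => ‖w z‖ₑ ^ 2) μ := hw.enorm.pow_const 2

lemma enorm_add_sq_le (a b : ℝ) : ‖a + b‖ₑ ^ 2 ≤ 2 * ‖a‖ₑ ^ 2 + 2 * ‖b‖ₑ ^ 2 := by
  simp only [enorm_sq_eq_ofReal]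
  rw [show (2 : ℝ≥0∞) = ofReal 2 by simp, ← ofReal_mul (by norm_num),
    ← ofReal_mul (by norm_num), ← ofReal_add (by positivity) (by positivity)]
  exact ofReal_le_ofReal (by nlinarith [sq_nonneg (a - b)])

lemma lintegral_enorm_add_sq_le {α : Type*} [MeasurableSpace α] {μ : Measure α} {u w : α → ℝ}
    (hu : AEStronglyMeasurable u μ) :
    ∫⁻ z, ‖u z + w z‖ₑ ^ 2 ∂μ ≤ 2 * ∫⁻ z, ‖u z‖ₑ ^ 2 ∂μ + 2 * ∫⁻ z, ‖w z‖ₑ ^ 2 ∂μ := by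
  calc _ ≤ ∫⁻ z, (2 * ‖u z‖ₑ ^ 2 + 2 * ‖w z‖ₑ ^ 2) ∂μ := lintegral_mono fun z => enorm_add_sq_le _ _
    _ = _ := by
      rw [lintegral_add_left' ((aemeasurable_enorm_sq hu).const_mul 2),
        lintegral_const_mul'' _ (aemeasurable_enorm_sq hu), lintegral_const_mul' _ _ (by norm_num)]

lemma lintegral_strip (T : ℝ) {w : ℝ² → ℝ} (hw : AEStronglyMeasurable w vol(strip T)) :
    ∫⁻ z in strip T, ‖w z‖ₑ ^ 2 = ∫⁻ t in Ioo 0 T, ∫⁻ ξ in ℝ₊, ‖w (t, ξ)‖ₑ ^ 2 := by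
  have h := aemeasurable_enorm_sq hw
  rw [volume_restrict_strip] at h ⊢
  exact lintegral_prod _ h

lemma aestronglyMeasurable_weighted {T : ℝ} {w : ℝ² → ℝ}
    (hw : AEStronglyMeasurable w vol(strip T)) (N : ℕ) :
    AEStronglyMeasurable (weighted N w) vol(strip T) := by
  refine AEStronglyMeasurable.mul ?_ hw
  have : Continuous fun z : ℝ² => √(1 + z.2 ^ 2) ^ N := by fun_prop
  exact this.aestronglyMeasurable

lemma ae_slice_aestronglyMeasurable {T : ℝ} {w : ℝ² → ℝ}
    (hw : AEStronglyMeasurable w vol(strip T)) :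
    ∀ᵐ t ∂vol(Ioo 0 T), AEStronglyMeasurable (fun ξ => w (t, ξ)) vol(Ioi 0) := by
  rw [volume_restrict_strip] at hw
  exact hw.prodMk_left

lemma one_le_sqrt_weight (ξ : ℝ) : 1 ≤ √(1 + ξ ^ 2) := by
  rw [Real.one_le_sqrt]; nlinarith [sq_nonneg ξ]

lemma IsSup.isSq {T : ℝ} {w : ℝ² → ℝ} (h : IsSup T w) : IsSq T w := by
  refine ⟨h.1, fun N => ?_⟩
  obtain ⟨B, hB⟩ := h.2 N
  rw [lintegral_strip T (aestronglyMeasurable_weighted h.1 N)]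
  calc _ ≤ ∫⁻ _ in Ioo 0 T, (B : ℝ≥0∞) := lintegral_mono_ae hB
    _ < ⊤ := by
      rw [setLIntegral_const, volume_Ioo]
      exact mul_lt_top ENNReal.coe_lt_top ofReal_lt_top

lemma weighted_add (N : ℕ) (u w : ℝ² → ℝ) (z : ℝ²) :
    weighted N (fun z => u z + w z) z = weighted N u z + weighted N w z := by
  simp only [weighted]; ring

lemma IsSup.add {T : ℝ} {u w : ℝ² → ℝ} (hu : IsSup T u) (hw : IsSup T w) :
    IsSup T (fun z => u z + w z) := by
  refine ⟨hu.1.add hw.1, fun N => ?_⟩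
  obtain ⟨A, hA⟩ := hu.2 N
  obtain ⟨B, hB⟩ := hw.2 N
  refine ⟨2 * A + 2 * B, ?_⟩
  filter_upwards [hA, hB, ae_slice_aestronglyMeasurable (aestronglyMeasurable_weighted hu.1 N)] with t hA hB hm
  simp only [weighted_add]
  refine (lintegral_enorm_add_sq_le hm).trans ?_
  push_cast
  gcongr

lemma IsSq.add {T : ℝ} {u w : ℝ² → ℝ} (hu : IsSq T u) (hw : IsSq T w) :
    IsSq T (fun z => u z + w z) := by
  refine ⟨hu.1.add hw.1, fun N => ?_⟩
  simp only [weighted_add]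
  refine (lintegral_enorm_add_sq_le (aestronglyMeasurable_weighted hu.1 N)).trans_lt ?_
  exact ENNReal.add_lt_top.2 ⟨mul_lt_top (by norm_num) (hu.2 N), mul_lt_top (by norm_num) (hw.2 N)⟩

/-- A multiplier of polynomial growth costs finitely many powers of the weight; since `IsSup` and
`IsSq` ask for all powers, they are stable under such multipliers. -/
lemma enorm_weighted_mul_le {m w : ℝ² → ℝ} {K : ℝ} {r : ℕ} {z : ℝ²}
    (h : |m z| ≤ K * √(1 + z.2 ^ 2) ^ r) (N : ℕ) :
    ‖weighted N (fun z => m z * w z) z‖ₑ ^ 2 ≤ ofReal (K ^ 2) * ‖weighted (N + r) w z‖ₑ ^ 2 := by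
  simp only [enorm_sq_eq_ofReal]
  rw [← ofReal_mul (by positivity)]
  refine ofReal_le_ofReal ?_
  have h1 : m z ^ 2 ≤ (K * √(1 + z.2 ^ 2) ^ r) ^ 2 := by
    rw [← sq_abs]; gcongr
  simp only [weighted]
  calc (√(1 + z.2 ^ 2) ^ N * (m z * w z)) ^ 2
      = (√(1 + z.2 ^ 2) ^ N * w z) ^ 2 * m z ^ 2 := by ring
    _ ≤ (√(1 + z.2 ^ 2) ^ N * w z) ^ 2 * (K * √(1 + z.2 ^ 2) ^ r) ^ 2 := by gcongr
    _ = _ := by ring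

lemma IsSup.mul {T : ℝ} {w m : ℝ² → ℝ} (hw : IsSup T w)
    (hm : AEStronglyMeasurable m vol(strip T)) {K : ℝ} {r : ℕ}
    (h : ∀ z ∈ strip T, |m z| ≤ K * √(1 + z.2 ^ 2) ^ r) : IsSup T (fun z => m z * w z) := by
  refine ⟨hm.mul hw.1, fun N => ?_⟩
  obtain ⟨B, hB⟩ := hw.2 (N + r)
  refine ⟨Real.toNNReal (K ^ 2) * B, ?_⟩
  filter_upwards [hB, ae_restrict_mem measurableSet_Ioo] with t hB ht
  calc _ ≤ ∫⁻ ξ in ℝ₊, ofReal (K ^ 2) * ‖weighted (N + r) w (t, ξ)‖ₑ ^ 2 :=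
        setLIntegral_mono' measurableSet_Ioi fun ξ hξ => enorm_weighted_mul_le (h _ ⟨ht, hξ⟩) N
    _ ≤ _ := by
      rw [lintegral_const_mul' _ _ ofReal_ne_top, ENNReal.coe_mul]
      gcongr
      exact le_rfl

lemma IsSq.mul {T : ℝ} {w m : ℝ² → ℝ} (hw : IsSq T w)
    (hm : AEStronglyMeasurable m vol(strip T)) {K : ℝ} {r : ℕ}
    (h : ∀ z ∈ strip T, |m z| ≤ K * √(1 + z.2 ^ 2) ^ r) : IsSq T (fun z => m z * w z) := by
  refine ⟨hm.mul hw.1, fun N => ?_⟩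
  calc _ ≤ ∫⁻ z in strip T, ofReal (K ^ 2) * ‖weighted (N + r) w z‖ₑ ^ 2 :=
        setLIntegral_mono' (measurableSet_strip T) fun z hz => enorm_weighted_mul_le (h _ hz) N
    _ < _ := by
      rw [lintegral_const_mul' _ _ ofReal_ne_top]
      exact mul_lt_top ofReal_lt_top (hw.2 _)

lemma IsSup.neg {T : ℝ} {w : ℝ² → ℝ} (hw : IsSup T w) : IsSup T (fun z => -w z) := by
  have := hw.mul (m := fun _ => -1) aestronglyMeasurable_const (K := 1) (r := 0) (by simp)
  simpa using this

lemma IsSq.neg {T : ℝ} {w : ℝ² → ℝ} (hw : IsSq T w) : IsSq T (fun z => -w z) := by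
  have := hw.mul (m := fun _ => -1) aestronglyMeasurable_const (K := 1) (r := 0) (by simp)
  simpa using this

/-! ### Slice norms -/

lemma sliceNorm_rpow_two (l : ℕ) (w : ℕ → ℝ² → ℝ) (t : ℝ) : ‖sliceNorm l w t‖ₑ ^ (2 : ℝ) =
    ∑ j ∈ Finset.range (l + 1), ∫⁻ ξ in ℝ₊, ‖w j (t, ξ)‖ₑ ^ 2 := by
  rw [enorm_eq_self, sliceNorm, ← ENNReal.rpow_mul]
  norm_num

lemma eLpNorm_sliceNorm_two (T : ℝ) (l : ℕ) (w : ℕ → ℝ² → ℝ)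
    (hw : ∀ j ≤ l, AEStronglyMeasurable (w j) vol(strip T)) :
    eLpNorm (sliceNorm l w) 2 vol(Ioo 0 T) =
      (∑ j ∈ Finset.range (l + 1), ∫⁻ z in strip T, ‖w j z‖ₑ ^ 2) ^ (1 / 2 : ℝ) := by
  rw [eLpNorm_eq_lintegral_rpow_enorm_toReal (by norm_num) (by norm_num)]
  simp only [ENNReal.toReal_ofNat, sliceNorm_rpow_two]
  congr 1
  rw [lintegral_finsetSum']
  · refine Finset.sum_congr rfl fun j hj => (lintegral_strip T (hw j ?_)).symm
    exact Nat.lt_succ_iff.1 (Finset.mem_range.1 hj)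
  · intro j hj
    have := aemeasurable_enorm_sq (hw j (Nat.lt_succ_iff.1 (Finset.mem_range.1 hj)))
    rw [volume_restrict_strip] at this
    exact this.lintegral_prod_right'

lemma eLpNorm_sliceNorm_top_le (T : ℝ) (l : ℕ) (w : ℕ → ℝ² → ℝ) (B : ℕ → ℝ≥0∞)
    (hw : ∀ j ≤ l, ∀ᵐ t ∂vol(Ioo 0 T), ∫⁻ ξ in ℝ₊, ‖w j (t, ξ)‖ₑ ^ 2 ≤ B j) :
    eLpNorm (sliceNorm l w) ⊤ vol(Ioo 0 T) ≤ (∑ j ∈ Finset.range (l + 1), B j) ^ (1 / 2 : ℝ) := by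
  rw [eLpNorm_exponent_top]
  refine eLpNormEssSup_le_of_ae_enorm_bound ?_
  have : ∀ᵐ t ∂vol(Ioo 0 T), ∀ j ∈ Finset.range (l + 1), ∫⁻ ξ in ℝ₊, ‖w j (t, ξ)‖ₑ ^ 2 ≤ B j := by
    rw [Filter.eventually_all_finset]
    exact fun j hj => hw j (Nat.lt_succ_iff.1 (Finset.mem_range.1 hj))
  filter_upwards [this] with t ht
  rw [enorm_eq_self, sliceNorm]
  exact ENNReal.rpow_le_rpow (Finset.sum_le_sum ht) (by norm_num)

lemma weighted_zero (w : ℝ² → ℝ) : weighted 0 w = w := by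
  ext z; simp [weighted]

lemma memBochner_top {T : ℝ} {k l : ℕ} {u : ℝ² → ℝ} (w : ℕ → ℕ → ℝ² → ℝ)
    (hw : ∀ i ≤ k, ∀ j ≤ l, IsWeakDeriv T i j u (w i j)) (h : ∀ i ≤ k, ∀ j ≤ l, IsSup T (w i j)) :
    MemBochner T k ⊤ l u := by
  refine (iInf₂_le w hw).trans_lt (ENNReal.sum_lt_top.2 fun i hi => ?_)
  have hi : i ≤ k := Nat.lt_succ_iff.1 (Finset.mem_range.1 hi)
  have h' : ∀ j, ∃ B : NNReal, j ≤ l → ∀ᵐ t ∂vol(Ioo 0 T), ∫⁻ ξ in ℝ₊, ‖w i j (t, ξ)‖ₑ ^ 2 ≤ B := by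
    intro j
    by_cases hj : j ≤ l
    · obtain ⟨B, hB⟩ := (h i hi j hj).2 0
      rw [weighted_zero] at hB
      exact ⟨B, fun _ => hB⟩
    · exact ⟨0, fun h => absurd h hj⟩
  choose B hB using h'
  refine (eLpNorm_sliceNorm_top_le T l (w i) (fun j => B j) fun j hj => hB j hj).trans_lt ?_
  exact ENNReal.rpow_lt_top_of_nonneg (by norm_num) (ENNReal.sum_lt_top.2 fun j _ => ENNReal.coe_lt_top).ne

lemma memBochner_two {T : ℝ} {k l : ℕ} {u : ℝ² → ℝ} (w : ℕ → ℕ → ℝ² → ℝ)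
    (hw : ∀ i ≤ k, ∀ j ≤ l, IsWeakDeriv T i j u (w i j)) (h : ∀ i ≤ k, ∀ j ≤ l, IsSq T (w i j)) :
    MemBochner T k 2 l u := by
  refine (iInf₂_le w hw).trans_lt (ENNReal.sum_lt_top.2 fun i hi => ?_)
  have hi : i ≤ k := Nat.lt_succ_iff.1 (Finset.mem_range.1 hi)
  rw [eLpNorm_sliceNorm_two T l (w i) fun j hj => (h i hi j hj).1]
  refine ENNReal.rpow_lt_top_of_nonneg (by norm_num) (ENNReal.sum_lt_top.2 fun j hj => ?_).ne
  have := (h i hi j (Nat.lt_succ_iff.1 (Finset.mem_range.1 hj))).2 0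
  rwa [weighted_zero] at this

/-! ### Splitting the half-line at `ξ = 1` -/

/-- For `ξ < 1` the squared weight is at most `2^N`. For `ξ ≥ 1` one has `1 + ξ² ≤ 2ξ²`, so the
decay of order `N + 1` leaves `2^N K² ξ^{-2}`, and `ξ^{-2}` has integral one over `[1,∞)`. -/
lemma lintegral_weighted_sq_le (N : ℕ) (w : ℝ → ℝ) {K : ℝ}
    (h : ∀ ξ, 1 ≤ ξ → |w ξ| ≤ K / ξ ^ (N + 1)) :
    ∫⁻ ξ in ℝ₊, ‖√(1 + ξ ^ 2) ^ N * w ξ‖ₑ ^ 2 ≤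
      2 ^ N * (∫⁻ ξ in Ioo 0 1, ‖w ξ‖ₑ ^ 2) + 2 ^ N * ofReal (K ^ 2) := by
  have hsplit : ℝ₊ ⊆ Ioo 0 1 ∪ Ici 1 := fun x hx => by
    rcases lt_or_ge x 1 with h | h
    · exact Or.inl ⟨hx, h⟩
    · exact Or.inr h
  have two : (2 : ℝ≥0∞) ^ N = ofReal (2 ^ N) := by
    rw [ofReal_pow (by norm_num)]; norm_num
  have hw2 : ∀ ξ : ℝ, (√(1 + ξ ^ 2) ^ N) ^ 2 = (1 + ξ ^ 2) ^ N := fun ξ => by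
    rw [← pow_mul, mul_comm N 2, pow_mul, Real.sq_sqrt (by positivity)]
  refine (lintegral_mono_set hsplit).trans ((lintegral_union_le _ _ _).trans (add_le_add ?_ ?_))
  · rw [← lintegral_const_mul' _ _ (by simp)]
    refine setLIntegral_mono' measurableSet_Ioo fun ξ hξ => ?_
    simp only [enorm_sq_eq_ofReal]
    rw [two, ← ofReal_mul (by positivity)]
    refine ofReal_le_ofReal ?_
    rw [mul_pow, hw2]
    gcongr
    nlinarith [hξ.1, hξ.2]
  · have hint : ∫⁻ ξ in Ici (1 : ℝ), ofReal (ξ ^ (-2 : ℝ)) = 1 := by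
      rw [setLIntegral_congr Ioi_ae_eq_Ici.symm, ← ofReal_integral_eq_lintegral_ofReal
        (integrableOn_Ioi_rpow_of_lt (by norm_num) one_pos)
        (ae_restrict_of_forall_mem measurableSet_Ioi (fun ξ hξ =>
          Real.rpow_nonneg (by linarith [mem_Ioi.1 hξ]) _)), integral_Ioi_rpow_of_lt (by norm_num) one_pos]
      norm_num
    calc _ ≤ ∫⁻ ξ in Ici (1 : ℝ), ofReal (2 ^ N * K ^ 2) * ofReal (ξ ^ (-2 : ℝ)) := by
          refine setLIntegral_mono' measurableSet_Ici fun ξ hξ => ?_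
          have hξ : 1 ≤ ξ := hξ
          simp only [enorm_sq_eq_ofReal]
          rw [← ofReal_mul (by positivity)]
          refine ofReal_le_ofReal ?_
          rw [mul_pow, hw2]
          have h1 : w ξ ^ 2 ≤ (K / ξ ^ (N + 1)) ^ 2 := by
            rw [← sq_abs]; gcongr; exact h ξ hξ
          have h2 : (1 + ξ ^ 2) ^ N ≤ (2 * ξ ^ 2) ^ N := by
            gcongr; nlinarith
          calc _ ≤ (2 * ξ ^ 2) ^ N * (K / ξ ^ (N + 1)) ^ 2 := by gcongr
            _ = _ := by
              rw [Real.rpow_neg (by linarith), Real.rpow_two, mul_pow]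
              have : ξ ≠ 0 := by linarith
              field_simp
              ring
      _ = _ := by
          rw [lintegral_const_mul' _ _ ofReal_ne_top, hint, mul_one, two, ← ofReal_mul (by positivity)]

lemma isSup_of_near_far {T : ℝ} {w : ℝ² → ℝ}
    (hm : AEStronglyMeasurable w vol(strip T)) {B : NNReal}
    (hnear : ∀ᵐ t ∂vol(Ioo 0 T), ∫⁻ ξ in Ioo 0 1, ‖w (t, ξ)‖ₑ ^ 2 ≤ B)
    (hfar : ∀ N : ℕ, ∃ K : ℝ, ∀ t ∈ Ioo 0 T, ∀ ξ, 1 ≤ ξ → |w (t, ξ)| ≤ K / ξ ^ N) : IsSup T w := by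
  refine ⟨hm, fun N => ?_⟩
  obtain ⟨K, hK⟩ := hfar (N + 1)
  refine ⟨2 ^ N * B + 2 ^ N * Real.toNNReal (K ^ 2), ?_⟩
  filter_upwards [hnear, ae_restrict_mem measurableSet_Ioo] with t ht htm
  refine (lintegral_weighted_sq_le N (fun ξ => w (t, ξ)) (hK t htm)).trans ?_
  push_cast
  gcongr
  exact le_rfl

lemma isSq_of_near_far {T : ℝ} {w : ℝ² → ℝ}
    (hm : AEStronglyMeasurable w vol(strip T))
    (hnear : ∫⁻ t in Ioo 0 T, ∫⁻ ξ in Ioo 0 1, ‖w (t, ξ)‖ₑ ^ 2 < ⊤)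
    (hfar : ∀ N : ℕ, ∃ K : ℝ, ∀ t ∈ Ioo 0 T, ∀ ξ, 1 ≤ ξ → |w (t, ξ)| ≤ K / ξ ^ N) : IsSq T w := by
  refine ⟨hm, fun N => ?_⟩
  obtain ⟨K, hK⟩ := hfar (N + 1)
  rw [lintegral_strip T (aestronglyMeasurable_weighted hm N)]
  calc _ ≤ ∫⁻ t in Ioo 0 T, (2 ^ N * (∫⁻ ξ in Ioo 0 1, ‖w (t, ξ)‖ₑ ^ 2)
          + 2 ^ N * ofReal (K ^ 2)) :=
        setLIntegral_mono' measurableSet_Ioo fun t ht =>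
          lintegral_weighted_sq_le N (fun ξ => w (t, ξ)) (hK t ht)
    _ < ⊤ := by
      rw [lintegral_add_right _ measurable_const, lintegral_const_mul' _ _ (by simp),
        setLIntegral_const, volume_Ioo]
      refine ENNReal.add_lt_top.2 ⟨mul_lt_top (by simp) hnear, mul_lt_top
        (mul_lt_top (by simp) ofReal_lt_top) ofReal_lt_top⟩

/-! ### Schur's test for potentials of order zero and one -/

lemma lintegral_mul_sq_le {α : Type*} [MeasurableSpace α] {μ : Measure α} {f g : α → ℝ≥0∞}
    (hf : AEMeasurable f μ) (hg : AEMeasurable g μ) :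
    (∫⁻ a, f a * g a ∂μ) ^ 2 ≤ (∫⁻ a, f a ^ 2 ∂μ) * ∫⁻ a, g a ^ 2 ∂μ := by
  have h := ENNReal.lintegral_mul_le_Lp_mul_Lq μ Real.HolderConjugate.two_two hf hg
  simp only [Pi.mul_apply, ENNReal.rpow_two] at h
  calc _ ≤ ((∫⁻ a, f a ^ 2 ∂μ) ^ (1 / 2 : ℝ) * (∫⁻ a, g a ^ 2 ∂μ) ^ (1 / 2 : ℝ)) ^ 2 := by gcongr
    _ = _ := by
      rw [mul_pow, ← ENNReal.rpow_natCast, ← ENNReal.rpow_natCast, ← ENNReal.rpow_mul, ← ENNReal.rpow_mul]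
      norm_num

lemma lintegral_rpow_sub_le {a : ℝ} (ha : -1 < a) {T t : ℝ} (ht : t ∈ Ioo 0 T) :
    ∫⁻ r in Ioo 0 t, ofReal ((t - r) ^ a) ≤ ofReal (T ^ (a + 1) / (a + 1)) := by
  have ht0 : 0 < t := ht.1
  have hi : IntervalIntegrable (fun r : ℝ => r ^ a) volume 0 t :=
    intervalIntegral.intervalIntegrable_rpow' ha
  have hi2 : IntegrableOn (fun r : ℝ => (t - r) ^ a) (Ioo 0 t) := by
    have := hi.comp_sub_left t
    rw [sub_zero, sub_self] at this
    exact (intervalIntegrable_iff_integrableOn_Ioo_of_le ht0.le).1 this.symm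
  rw [← ofReal_integral_eq_lintegral_ofReal hi2 (ae_restrict_of_forall_mem measurableSet_Ioo (fun r hr => Real.rpow_nonneg (by linarith [hr.2]) _))]
  refine ofReal_le_ofReal ?_
  rw [← integral_Ioc_eq_integral_Ioo, ← integral_of_le ht0.le,
    intervalIntegral.integral_comp_sub_left (fun r : ℝ => r ^ a), sub_zero, sub_self,
    integral_rpow (Or.inl ha), Real.zero_rpow (by linarith), sub_zero]
  gcongr
  exacts [by linarith, by linarith, ht.2.le]

namespace IsCoeff
variable {c : ℝ → ℝ} {c₀ c₁ : ℝ} (hc : IsCoeff c c₀ c₁)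
include hc

lemma measurable_ker_clock (j : ℕ) (t : ℝ) :
    Measurable fun z : ℝ² => ker j (clock c t - clock c z.2) z.1 := by
  have h1 : Measurable fun z : ℝ² => ((clock c t - clock c z.2, z.1) : ℝ²) := by
    have := hc.continuous_clock.measurable
    fun_prop
  exact (measurable_ker j).comp h1

/-- Schur's test for the potentials with a square integrable data. -/
lemma exists_lintegral_pot_sq_le (j : ℕ) (T : ℝ) :
    ∃ K : ℝ, 0 ≤ K ∧ ∀ b : ℝ → ℝ, AEStronglyMeasurable b vol(Ioo 0 T) →
    ∀ t ∈ Ioo 0 T, ∫⁻ ξ in ℝ₊, ‖pot c T b j t ξ‖ₑ ^ 2 ≤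
      ofReal K * ∫⁻ r in Ioo 0 t, ofReal ((t - r) ^ (1 / 4 - j : ℝ)) * ‖b r‖ₑ ^ 2 := by
  obtain ⟨K, hK, h⟩ := exists_lintegral_ker_sq_le j
  -- The maximum with zero only secures nonnegativity when `T ≤ 0`, where the time interval is
  -- empty.
  set K₁ : ℝ := max 0 (T ^ ((-3 / 4 : ℝ) + 1) / (-3 / 4 + 1)) with hK₁
  set K₂ : ℝ := K * (√c₀)⁻¹ ^ (2 * j + 1) * c₁ ^ 2 with hK₂
  have hc₀ := hc.pos
  have hc₁ := hc.c₁_pos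
  refine ⟨K₁ * K₂, by positivity, fun b hb t ht => ?_⟩
  have hb' : AEStronglyMeasurable b vol(Ioo 0 t) :=
    hb.mono_measure (restrict_mono (Ioo_subset_Ioo_right ht.2.le) le_rfl)
  -- The integrand is split by the weight `(t-r)^{∓3/8}`. The square `(t-r)^{-3/4}` of the first
  -- factor is integrable; that of the second meets the space integral of the squared kernel, of
  -- size `(t-r)^{-(j+1/2)}`, and leaves `(t-r)^{1/4-j}`, which is bounded for `j = 0` and
  -- integrable for `j = 1`.
  set α : ℝ → ℝ≥0∞ := fun r => ofReal ((t - r) ^ (-3 / 8 : ℝ)) with hα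
  set β : ℝ → ℝ → ℝ≥0∞ := fun ξ r => ofReal ((t - r) ^ (3 / 8 : ℝ)) *
    (‖ker j (clock c t - clock c r) ξ‖ₑ * ‖c r * b r‖ₑ) with hβ
  have hmeasα : Measurable α := by
    apply Measurable.ennreal_ofReal; fun_prop
  have hmcb : AEMeasurable (fun r => ‖c r * b r‖ₑ) vol(Ioo 0 t) :=
    (hc.cont.aestronglyMeasurable.mul hb').enorm
  have hmeasβ : ∀ ξ, AEMeasurable (β ξ) vol(Ioo 0 t) := by
    intro ξ
    have h2 : Measurable fun r => ker j (clock c t - clock c r) ξ :=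
      (hc.measurable_ker_clock j t).comp (measurable_const.prodMk measurable_id)
    refine AEMeasurable.mul ?_ (h2.enorm.aemeasurable.mul hmcb)
    exact (Measurable.ennreal_ofReal (by fun_prop)).aemeasurable
  have hmeasβ2 : AEMeasurable (fun z : ℝ² => β z.1 z.2 ^ 2) (vol(Ioi 0).prod vol(Ioo 0 t)) := by
    have hm1 : Measurable fun z : ℝ² => ofReal ((t - z.2) ^ (3 / 8 : ℝ)) :=
      Measurable.ennreal_ofReal (by fun_prop)
    refine AEMeasurable.pow_const (hm1.aemeasurable.mul (AEMeasurable.mul ?_ ?_)) 2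
    · exact (hc.measurable_ker_clock j t).enorm.aemeasurable
    · exact AEMeasurable.comp_snd (f := fun r => ‖c r * b r‖ₑ) hmcb
  have hα2 : ∫⁻ r in Ioo 0 t, α r ^ 2 ≤ ofReal K₁ := by
    calc _ = ∫⁻ r in Ioo 0 t, ofReal ((t - r) ^ (-3 / 4 : ℝ)) := by
          refine setLIntegral_congr_fun measurableSet_Ioo fun r hr => ?_
          have : 0 < t - r := by linarith [hr.2]
          simp only [hα]
          rw [← ofReal_pow (by positivity), ← Real.rpow_natCast, ← Real.rpow_mul this.le]
          norm_num
      _ ≤ _ := (lintegral_rpow_sub_le (by norm_num) ht).trans (ofReal_le_ofReal (le_max_right _ _))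
  have hpt : ∀ ξ, ‖pot c T b j t ξ‖ₑ ^ 2 ≤ ofReal K₁ * ∫⁻ r in Ioo 0 t, β ξ r ^ 2 := by
    intro ξ
    calc ‖pot c T b j t ξ‖ₑ ^ 2 ≤ (∫⁻ r in Ioo 0 t, α r * β ξ r) ^ 2 := by
          gcongr
          rw [hc.pot_eq_Ioo b ht.2.le]
          refine (enorm_integral_le_lintegral_enorm _).trans_eq ?_
          refine setLIntegral_congr_fun measurableSet_Ioo fun r hr => ?_
          have h0 : 0 < t - r := by linarith [hr.2]
          simp only [hα, hβ]
          rw [← mul_assoc (ofReal _) (ofReal _), ← ofReal_mul (by positivity),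
            ← Real.rpow_add h0, enorm_mul (ker j _ _)]
          norm_num
      _ ≤ (∫⁻ r in Ioo 0 t, α r ^ 2) * ∫⁻ r in Ioo 0 t, β ξ r ^ 2 :=
          lintegral_mul_sq_le hmeasα.aemeasurable (hmeasβ ξ)
      _ ≤ _ := by gcongr
  calc _ ≤ ∫⁻ ξ in ℝ₊, ofReal K₁ * ∫⁻ r in Ioo 0 t, β ξ r ^ 2 :=
        lintegral_mono fun ξ => hpt ξ
    _ = ofReal K₁ * ∫⁻ r in Ioo 0 t, ∫⁻ ξ in ℝ₊, β ξ r ^ 2 := by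
        rw [lintegral_const_mul' _ _ ofReal_ne_top, lintegral_lintegral_swap hmeasβ2]
    _ ≤ ofReal K₁ * ∫⁻ r in Ioo 0 t, ofReal K₂ * (ofReal ((t - r) ^ (1 / 4 - j : ℝ)) * ‖b r‖ₑ ^ 2) := by
        gcongr _ * ?_
        refine setLIntegral_mono' measurableSet_Ioo fun r hr => ?_
        have h0 : 0 < t - r := by linarith [hr.2]
        have h1 : 0 < clock c t - clock c r := (mul_pos hc₀ h0).trans_le (hc.clock_sub_ge hr.2.le)
        simp only [hβ, mul_pow]
        have hcb : ‖c r * b r‖ₑ ^ 2 ≤ ofReal (c₁ ^ 2) * ‖b r‖ₑ ^ 2 := by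
          rw [enorm_mul, mul_pow]
          gcongr
          rw [Real.enorm_eq_ofReal_abs, abs_of_pos (hc.c_pos r), ← ofReal_pow (hc.c_pos r).le]
          have := (hc.c_pos r).le
          exact ofReal_le_ofReal (by gcongr; exact hc.upper r)
        have hs : (√(clock c t - clock c r))⁻¹ ≤ (√c₀)⁻¹ * (t - r) ^ (-1 / 2 : ℝ) := by
          rw [show (-1 / 2 : ℝ) = -(1 / 2) by norm_num, Real.rpow_neg h0.le, ← Real.sqrt_eq_rpow,
            ← mul_inv, ← Real.sqrt_mul hc₀.le]
          gcongr
          exact hc.clock_sub_ge hr.2.le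
        have hk := h _ h1
        have hpow : ((t - r) ^ (3 / 8 : ℝ)) ^ 2 * ((t - r) ^ (-1 / 2 : ℝ)) ^ (2 * j + 1) =
            (t - r) ^ (1 / 4 - j : ℝ) := by
          rw [← Real.rpow_natCast, ← Real.rpow_natCast, ← Real.rpow_mul h0.le, ← Real.rpow_mul h0.le,
            ← Real.rpow_add h0]
          congr 1; push_cast; ring
        calc _ = ofReal ((t - r) ^ (3 / 8 : ℝ)) ^ 2 * ‖c r * b r‖ₑ ^ 2 *
              ∫⁻ ξ in ℝ₊, ‖ker j (clock c t - clock c r) ξ‖ₑ ^ 2 := by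
              rw [← lintegral_const_mul' _ _ (ENNReal.mul_ne_top (by simp) (ENNReal.pow_ne_top enorm_ne_top))]
              refine lintegral_congr fun ξ => ?_
              ring
          _ ≤ ofReal (((t - r) ^ (3 / 8 : ℝ)) ^ 2) * (ofReal (c₁ ^ 2) * ‖b r‖ₑ ^ 2) *
              ofReal (K * ((√c₀)⁻¹ * (t - r) ^ (-1 / 2 : ℝ)) ^ (2 * j + 1)) := by
              rw [ofReal_pow (by positivity)]
              gcongr
              refine hk.trans (ofReal_le_ofReal ?_)
              gcongr
          _ = _ := by
              rw [show ∀ a b c d : ℝ≥0∞, a * (b * c) * d = a * b * d * c by intros; ring,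
                ← ofReal_mul (by positivity), ← ofReal_mul (by positivity),
                ← mul_assoc (ofReal K₂), ← ofReal_mul (by positivity), ← hpow, hK₂]
              congr 2
              ring
    _ = _ := by
        rw [lintegral_const_mul' _ _ ofReal_ne_top, ← mul_assoc, ← ofReal_mul (by positivity)]

lemma aestronglyMeasurable_pot {T : ℝ} {b : ℝ → ℝ} (hb : IntegrableOn b (Ioo 0 T)) (j : ℕ) :
    AEStronglyMeasurable (fun z => pot c T b j z.1 z.2) vol(strip T) :=
  ((hc.continuousOn_pot hb j).mono (prod_mono (subset_univ _) subset_rfl)).aestronglyMeasurable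
    (measurableSet_strip T)

lemma exists_abs_pot_le_div {T : ℝ} {b : ℝ → ℝ} (hb : IntegrableOn b (Ioo 0 T)) (j N : ℕ) :
    ∃ K : ℝ, ∀ t ∈ Ioo 0 T, ∀ ξ : ℝ, 1 ≤ ξ → |pot c T b j t ξ| ≤ K / ξ ^ N := by
  rcases le_or_gt T 0 with hT | hT
  · exact ⟨0, fun t ht => absurd (ht.1.trans ht.2) (not_lt.2 hT)⟩
  obtain ⟨K, hK, h⟩ := exists_abs_pot_le c₀ c₁ T hT hc.c₁_pos j N
  refine ⟨K * ∫ r in Ioo 0 T, |b r|, fun t ht ξ hξ => ?_⟩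
  have hξ0 : 0 < ξ := by linarith
  refine (h c hc b hb t (Ioo_subset_Icc_self ht) ξ hξ).trans ?_
  rw [div_mul_eq_mul_div]
  refine div_le_div_of_nonneg_right (mul_le_mul_of_nonneg_left ?_ hK.le) (by positivity)
  exact setIntegral_mono_set hb.abs (.of_forall fun r => abs_nonneg _)
    (Ioo_subset_Ioo_right ht.2.le).eventuallyLE

lemma isSup_pot_of_near {T : ℝ} {b : ℝ → ℝ} (hb : IntegrableOn b (Ioo 0 T)) {j : ℕ} {B : NNReal}
    (h : ∀ t ∈ Ioo 0 T, ∫⁻ ξ in Ioo 0 1, ‖pot c T b j t ξ‖ₑ ^ 2 ≤ B) :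
    IsSup T (fun z => pot c T b j z.1 z.2) :=
  isSup_of_near_far (hc.aestronglyMeasurable_pot hb j) (ae_restrict_of_forall_mem measurableSet_Ioo (h))
    fun N => hc.exists_abs_pot_le_div hb j N

lemma isSq_pot_of_near {T : ℝ} {b : ℝ → ℝ} (hb : IntegrableOn b (Ioo 0 T)) {j : ℕ}
    (h : ∫⁻ t in Ioo 0 T, ∫⁻ ξ in Ioo 0 1, ‖pot c T b j t ξ‖ₑ ^ 2 < ⊤) :
    IsSq T (fun z => pot c T b j z.1 z.2) :=
  isSq_of_near_far (hc.aestronglyMeasurable_pot hb j) h fun N => hc.exists_abs_pot_le_div hb j N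

omit hc in
lemma integrableOn_of_memLp_two {T : ℝ} {b : ℝ → ℝ} (hb : MemLp b 2 vol(Ioo 0 T)) :
    IntegrableOn b (Ioo 0 T) := hb.integrable (by norm_num)

omit hc in
lemma lintegral_sq_lt_top {T : ℝ} {b : ℝ → ℝ} (hb : MemLp b 2 vol(Ioo 0 T)) :
    ∫⁻ r in Ioo 0 T, ‖b r‖ₑ ^ 2 < ⊤ := by
  have := lintegral_rpow_enorm_lt_top_of_eLpNorm_lt_top (by norm_num) (by norm_num) hb.2
  simpa using this

/-- At order zero the Schur kernel `(t-r)^{1/4}` is bounded by `T^{1/4}`, so square integrable data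
suffice uniformly in time. -/
lemma isSup_pot_zero {T : ℝ} {b : ℝ → ℝ} (hb : MemLp b 2 vol(Ioo 0 T)) :
    IsSup T (fun z => pot c T b 0 z.1 z.2) := by
  obtain ⟨K, hK, h⟩ := hc.exists_lintegral_pot_sq_le 0 T
  have hfin := lintegral_sq_lt_top hb
  set B : ℝ≥0∞ := ofReal K * (ofReal (T ^ (1 / 4 : ℝ)) * ∫⁻ r in Ioo 0 T, ‖b r‖ₑ ^ 2)
    with hB
  have hBfin : B ≠ ⊤ := (mul_lt_top ofReal_lt_top (mul_lt_top ofReal_lt_top hfin)).ne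
  refine hc.isSup_pot_of_near (B := B.toNNReal) (integrableOn_of_memLp_two hb) fun t ht => ?_
  rw [coe_toNNReal hBfin]
  refine (lintegral_mono_set Ioo_subset_Ioi_self).trans ((h b hb.1 t ht).trans ?_)
  rw [hB]
  gcongr
  rw [← lintegral_const_mul' _ _ ofReal_ne_top]
  refine (setLIntegral_mono' measurableSet_Ioo fun r hr => ?_).trans
    (lintegral_mono_set (Ioo_subset_Ioo_right ht.2.le))
  have h0 : 0 < t - r := by linarith [hr.2]
  gcongr
  · simp only [CharP.cast_eq_zero, sub_zero]
    gcongr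
    linarith [hr.1, ht.2]

/-- At order one the Schur kernel `(t-r)^{-3/4}` is integrable but unbounded; uniformity in time
therefore asks for bounded data. -/
lemma isSup_pot_one {T B : ℝ} {b : ℝ → ℝ} (hb : AEStronglyMeasurable b vol(Ioo 0 T))
    (hB : ∀ r ∈ Ioo 0 T, |b r| ≤ B) :
    IsSup T (fun z => pot c T b 1 z.1 z.2) := by
  obtain ⟨K, hK, h⟩ := hc.exists_lintegral_pot_sq_le 1 T
  have hbi : IntegrableOn b (Ioo 0 T) := by
    refine Integrable.mono' (g := fun _ => B) (by simp) hb ?_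
    exact ae_restrict_of_forall_mem measurableSet_Ioo (hB)
  set A : ℝ≥0∞ := ofReal K * (ofReal (T ^ ((-3 / 4 : ℝ) + 1) / (-3 / 4 + 1)) * ofReal (B ^ 2)) with hA
  have hAfin : A ≠ ⊤ := (mul_lt_top ofReal_lt_top (mul_lt_top ofReal_lt_top ofReal_lt_top)).ne
  refine hc.isSup_pot_of_near (B := A.toNNReal) hbi fun t ht => ?_
  rw [coe_toNNReal hAfin]
  refine (lintegral_mono_set Ioo_subset_Ioi_self).trans ((h b hb t ht).trans ?_)
  rw [hA]
  gcongr
  calc _ ≤ ∫⁻ r in Ioo 0 t, ofReal ((t - r) ^ (-3 / 4 : ℝ)) * ofReal (B ^ 2) := by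
        refine setLIntegral_mono' measurableSet_Ioo fun r hr => ?_
        have h1 := hB r ⟨hr.1, hr.2.trans ht.2⟩
        rw [show (1 / 4 - ((1 : ℕ) : ℝ)) = -3 / 4 by norm_num, Real.enorm_eq_ofReal_abs,
          ← ofReal_pow (abs_nonneg _)]
        gcongr
    _ ≤ _ := by
        rw [lintegral_mul_const' _ _ ofReal_ne_top]
        gcongr
        exact lintegral_rpow_sub_le (by norm_num) ht

/-- With merely square integrable data the integration in `t` is done before the one in `r`, and
`(t-r)^{-3/4}` is integrable in `t` as well. -/
lemma isSq_pot_one {T : ℝ} {b : ℝ → ℝ} (hb : MemLp b 2 vol(Ioo 0 T)) :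
    IsSq T (fun z => pot c T b 1 z.1 z.2) := by
  obtain ⟨K, hK, h⟩ := hc.exists_lintegral_pot_sq_le 1 T
  have hfin := lintegral_sq_lt_top hb
  refine hc.isSq_pot_of_near (integrableOn_of_memLp_two hb) ?_
  -- The indicator turns the triangle `r < t` into a function on a product, as Tonelli's theorem
  -- wants it.
  set k : ℝ → ℝ → ℝ≥0∞ := fun t r => (Ioo 0 t).indicator
    (fun r => ofReal ((t - r) ^ (1 / 4 - (1 : ℕ) : ℝ)) * ‖b r‖ₑ ^ 2) r with hk
  have hkm : AEMeasurable (uncurry k) (vol(Ioo 0 T).prod vol(Ioo 0 T)) := by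
    have : uncurry k = ({z : ℝ² | 0 < z.2 ∧ z.2 < z.1}).indicator
        (fun z => ofReal ((z.1 - z.2) ^ (1 / 4 - (1 : ℕ) : ℝ)) * ‖b z.2‖ₑ ^ 2) := by
      ext ⟨t, r⟩
      rfl
    rw [this]
    have hm1 : Measurable fun z : ℝ² => ofReal ((z.1 - z.2) ^ (1 / 4 - (1 : ℕ) : ℝ)) :=
      Measurable.ennreal_ofReal (by fun_prop)
    refine AEMeasurable.indicator (hm1.aemeasurable.mul ?_) ?_
    · exact AEMeasurable.comp_snd (f := fun r => ‖b r‖ₑ ^ 2) (hb.1.enorm.pow_const 2)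
    · exact (measurableSet_lt measurable_const measurable_snd).inter
        (measurableSet_lt measurable_snd measurable_fst)
  calc _ ≤ ∫⁻ t in Ioo 0 T, ofReal K * ∫⁻ r in Ioo 0 T, k t r := by
        refine setLIntegral_mono' measurableSet_Ioo fun t ht => ?_
        refine (lintegral_mono_set Ioo_subset_Ioi_self).trans ((h b hb.1 t ht).trans ?_)
        rw [lintegral_indicator measurableSet_Ioo, Measure.restrict_restrict measurableSet_Ioo,
          inter_eq_left.2 (Ioo_subset_Ioo_right ht.2.le)]
    _ = ofReal K * ∫⁻ r in Ioo 0 T, ∫⁻ t in Ioo 0 T, k t r := by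
        rw [lintegral_const_mul' _ _ ofReal_ne_top, lintegral_lintegral_swap hkm]
    _ ≤ ofReal K * ∫⁻ r in Ioo 0 T, ofReal (T ^ ((-3 / 4 : ℝ) + 1) / (-3 / 4 + 1)) * ‖b r‖ₑ ^ 2 := by
        gcongr _ * ?_
        refine setLIntegral_mono' measurableSet_Ioo fun r hr => ?_
        calc _ ≤ ∫⁻ t in Ioo r T, ofReal ((t - r) ^ (-3 / 4 : ℝ)) * ‖b r‖ₑ ^ 2 := by
              rw [← lintegral_indicator measurableSet_Ioo, ← lintegral_indicator measurableSet_Ioo]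
              refine lintegral_mono fun t => ?_
              by_cases h1 : t ∈ Ioo 0 T
              · by_cases h2 : r < t
                · rw [indicator_of_mem h1, indicator_of_mem (show t ∈ Ioo r T from ⟨h2, h1.2⟩)]
                  simp only [hk]
                  rw [indicator_of_mem (show r ∈ Ioo 0 t from ⟨hr.1, h2⟩)]
                  norm_num
                · rw [indicator_of_mem h1]
                  simp only [hk]
                  rw [indicator_of_notMem (fun h => h2 h.2)]
                  exact bot_le
              · rw [indicator_of_notMem h1]; exact bot_le
          _ ≤ _ := by
              rw [lintegral_mul_const' _ _ (by simp)]
              gcongr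
              have hrT : 0 < T - r := by linarith [hr.2]
              have hi : IntervalIntegrable (fun t : ℝ => t ^ (-3 / 4 : ℝ)) volume 0 (T - r) :=
                intervalIntegral.intervalIntegrable_rpow' (by norm_num)
              have hi2 : IntegrableOn (fun t : ℝ => (t - r) ^ (-3 / 4 : ℝ)) (Ioo r T) := by
                have := hi.comp_sub_right r
                rw [zero_add, sub_add_cancel] at this
                exact (intervalIntegrable_iff_integrableOn_Ioo_of_le hr.2.le).1 this
              rw [← ofReal_integral_eq_lintegral_ofReal hi2 (ae_restrict_of_forall_mem measurableSet_Ioo (fun r hr => Real.rpow_nonneg (by linarith [hr.1]) _))]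
              refine ofReal_le_ofReal ?_
              rw [← integral_Ioc_eq_integral_Ioo, ← integral_of_le hr.2.le,
                intervalIntegral.integral_comp_sub_right (fun r : ℝ => r ^ (-3 / 4 : ℝ)), sub_self,
                integral_rpow (Or.inl (by norm_num)), Real.zero_rpow (by norm_num), sub_zero]
              have := hr.1.le
              gcongr
              linarith
    _ < ⊤ := by
        rw [lintegral_const_mul' _ _ ofReal_ne_top]
        exact mul_lt_top ofReal_lt_top (mul_lt_top ofReal_lt_top hfin)

end IsCoeff

/-! ### The energy estimate near the boundary -/

/-- The energy inequality for `v_t = c v_ξξ + F` on the rectangle `[0,t] × [δ,1]`. -/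
lemma energy_rectangle {v₁ v₂ vt v₁t F : ℝ → ℝ → ℝ} {c : ℝ → ℝ} {c₀ δ t : ℝ} (hδ : δ ≤ 1)
    (ht : 0 ≤ t) (hc₀ : 0 < c₀) (hc : ∀ s, c₀ ≤ c s)
    (hv₁ : Continuous (uncurry v₁)) (hv₂ : Continuous (uncurry v₂))
    (hvt : Continuous (uncurry vt)) (hv₁t : Continuous (uncurry v₁t)) (hF : Continuous (uncurry F))
    (h₁₂ : ∀ s, ∀ ξ ∈ Ioo δ 1, HasDerivAt (v₁ s) (v₂ s ξ) ξ)
    (htx : ∀ s, ∀ ξ ∈ Ioo δ 1, HasDerivAt (vt s) (v₁t s ξ) ξ)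
    (h₁t : ∀ s ξ, HasDerivAt (fun s => v₁ s ξ) (v₁t s ξ) s) (heq : ∀ s ξ, vt s ξ = c s * v₂ s ξ + F s ξ) :
    (∫ ξ in δ..1, v₁ t ξ ^ 2) + c₀ * ∫ s in 0..t, ∫ ξ in δ..1, v₂ s ξ ^ 2 ≤
      (∫ ξ in δ..1, v₁ 0 ξ ^ 2) + c₀⁻¹ * (∫ s in 0..t, ∫ ξ in δ..1, F s ξ ^ 2)
        + 2 * (∫ s in 0..t, v₁ s 1 * vt s 1) - 2 * ∫ s in 0..t, v₁ s δ * vt s δ := by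
  have c1 : ∀ s, Continuous (v₁ s) := fun s => hv₁.comp (by fun_prop : Continuous fun ξ => (s, ξ))
  have c2 : ∀ s, Continuous (v₂ s) := fun s => hv₂.comp (by fun_prop : Continuous fun ξ => (s, ξ))
  have c3 : ∀ s, Continuous (vt s) := fun s => hvt.comp (by fun_prop : Continuous fun ξ => (s, ξ))
  have c4 : ∀ s, Continuous (v₁t s) := fun s => hv₁t.comp (by fun_prop : Continuous fun ξ => (s, ξ))
  have c5 : ∀ s, Continuous (F s) := fun s => hF.comp (by fun_prop : Continuous fun ξ => (s, ξ))
  have d1 : ∀ ξ, Continuous fun s => v₁ s ξ := fun ξ =>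
    hv₁.comp (by fun_prop : Continuous fun s => (s, ξ))
  have d3 : ∀ ξ, Continuous fun s => vt s ξ := fun ξ =>
    hvt.comp (by fun_prop : Continuous fun s => (s, ξ))
  have d4 : ∀ ξ, Continuous fun s => v₁t s ξ := fun ξ =>
    hv₁t.comp (by fun_prop : Continuous fun s => (s, ξ))
  have hparam : ∀ G : ℝ → ℝ → ℝ, Continuous (uncurry G) →
      Continuous fun s => ∫ ξ in δ..1, G s ξ := fun G hG =>
    continuous_parametric_intervalIntegral_of_continuous' hG δ 1
  have hv2sq : Continuous (uncurry fun s ξ => v₂ s ξ ^ 2) := hv₂.pow 2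
  have hFsq : Continuous (uncurry fun s ξ => F s ξ ^ 2) := hF.pow 2
  have hG : Continuous (uncurry fun ξ s => 2 * (v₁ s ξ * v₁t s ξ)) :=
    continuous_const.mul ((hv₁.comp continuous_swap).mul (hv₁t.comp continuous_swap))
  have hG2 : Continuous (uncurry fun s ξ => v₂ s ξ * vt s ξ) := hv₂.mul hvt
  have hG3 : Continuous (uncurry fun s ξ => 2 * (v₂ s ξ * vt s ξ)) :=
    continuous_const.mul hG2
  have e1 : ∀ ξ, v₁ t ξ ^ 2 - v₁ 0 ξ ^ 2 = ∫ s in 0..t, 2 * (v₁ s ξ * v₁t s ξ) := by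
    intro ξ
    rw [integral_eq_sub_of_hasDerivAt (f := fun s => v₁ s ξ ^ 2)]
    · intro s _
      exact ((h₁t s ξ).pow 2).congr_deriv (by push_cast; ring)
    · exact (continuous_const.mul ((d1 ξ).mul (d4 ξ))).intervalIntegrable _ _
  have e2 : (∫ ξ in δ..1, v₁ t ξ ^ 2) - ∫ ξ in δ..1, v₁ 0 ξ ^ 2 =
      ∫ s in 0..t, ∫ ξ in δ..1, 2 * (v₁ s ξ * v₁t s ξ) := by
    rw [← intervalIntegral.integral_sub (f := fun ξ => v₁ t ξ ^ 2) (g := fun ξ => v₁ 0 ξ ^ 2)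
      (((c1 t).pow 2).intervalIntegrable _ _) (((c1 0).pow 2).intervalIntegrable _ _)]
    simp only [e1]
    refine intervalIntegral_intervalIntegral_swap ?_
    refine (hG.continuousOn.integrableOn_compact (K := uIcc δ 1 ×ˢ uIcc 0 t) ?_).mono_set ?_
    · exact isCompact_uIcc.prod isCompact_uIcc
    · exact prod_mono uIoc_subset_uIcc uIoc_subset_uIcc
  -- Moving the space derivative off `∂_ξ ∂_t v` leaves boundary terms `v_ξ ∂_t v`, which are small
  -- where `∂_t v` is.
  have e3 : ∀ s, ∫ ξ in δ..1, v₁ s ξ * v₁t s ξ =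
      v₁ s 1 * vt s 1 - v₁ s δ * vt s δ - ∫ ξ in δ..1, v₂ s ξ * vt s ξ := by
    intro s
    refine intervalIntegral.integral_mul_deriv_eq_deriv_mul_of_hasDeriv_right (c1 s).continuousOn
      (c3 s).continuousOn ?_ ?_ ((c2 s).intervalIntegrable _ _) ((c4 s).intervalIntegrable _ _)
    · intro ξ hξ
      rw [min_eq_left hδ, max_eq_right hδ] at hξ
      exact (h₁₂ s ξ hξ).hasDerivWithinAt
    · intro ξ hξ
      rw [min_eq_left hδ, max_eq_right hδ] at hξ
      exact (htx s ξ hξ).hasDerivWithinAt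
  have e4 : (∫ s in 0..t, ∫ ξ in δ..1, 2 * (v₁ s ξ * v₁t s ξ)) =
      2 * (∫ s in 0..t, v₁ s 1 * vt s 1) - 2 * (∫ s in 0..t, v₁ s δ * vt s δ)
        - ∫ s in 0..t, ∫ ξ in δ..1, 2 * (v₂ s ξ * vt s ξ) := by
    simp only [intervalIntegral.integral_const_mul, e3]
    rw [intervalIntegral.integral_sub, intervalIntegral.integral_sub]
    · ring
    · exact ((d1 1).mul (d3 1)).intervalIntegrable _ _
    · exact ((d1 δ).mul (d3 δ)).intervalIntegrable _ _
    · exact (((d1 1).mul (d3 1)).sub ((d1 δ).mul (d3 δ))).intervalIntegrable _ _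
    · exact (hparam _ hG2).intervalIntegrable _ _
  -- Young's inequality: completing the square with `c₀ v₂ + F` absorbs the mixed term into one of
  -- the two copies of `c₀ v₂²`.
  have hpt : ∀ s ξ, c₀ * v₂ s ξ ^ 2 - c₀⁻¹ * F s ξ ^ 2 ≤ 2 * (v₂ s ξ * vt s ξ) := by
    intro s ξ
    have h1 : c₀ * v₂ s ξ ^ 2 ≤ c s * v₂ s ξ ^ 2 := mul_le_mul_of_nonneg_right (hc s) (sq_nonneg _)
    have h2 : 0 ≤ c₀⁻¹ * (c₀ * v₂ s ξ + F s ξ) ^ 2 := by positivity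
    have h3 : c₀⁻¹ * (c₀ * v₂ s ξ + F s ξ) ^ 2 =
        c₀ * v₂ s ξ ^ 2 + 2 * (v₂ s ξ * F s ξ) + c₀⁻¹ * F s ξ ^ 2 := by
      field_simp; ring
    rw [heq]
    nlinarith
  have e5 : c₀ * (∫ s in 0..t, ∫ ξ in δ..1, v₂ s ξ ^ 2)
      - c₀⁻¹ * (∫ s in 0..t, ∫ ξ in δ..1, F s ξ ^ 2) ≤
      ∫ s in 0..t, ∫ ξ in δ..1, 2 * (v₂ s ξ * vt s ξ) := by
    rw [← intervalIntegral.integral_const_mul, ← intervalIntegral.integral_const_mul,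
      ← intervalIntegral.integral_sub]
    · refine integral_mono_on ht ?_ ?_ fun s _ => ?_
      · exact ((continuous_const.mul (hparam _ hv2sq)).sub
          (continuous_const.mul (hparam _ hFsq))).intervalIntegrable _ _
      · exact (hparam _ hG3).intervalIntegrable _ _
      · rw [← intervalIntegral.integral_const_mul, ← intervalIntegral.integral_const_mul,
          ← intervalIntegral.integral_sub]
        · refine integral_mono_on hδ ?_ ?_ fun ξ _ => hpt s ξ
          · exact ((continuous_const.mul ((c2 s).pow 2)).sub
              (continuous_const.mul ((c5 s).pow 2))).intervalIntegrable _ _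
          · exact (continuous_const.mul ((c2 s).mul (c3 s))).intervalIntegrable _ _
        · exact (continuous_const.mul ((c2 s).pow 2)).intervalIntegrable _ _
        · exact (continuous_const.mul ((c5 s).pow 2)).intervalIntegrable _ _
    · exact (continuous_const.mul (hparam _ hv2sq)).intervalIntegrable _ _
    · exact (continuous_const.mul (hparam _ hFsq)).intervalIntegrable _ _
  linarith

/-- A regular lift of boundary data, together with its derivatives, vanishing for `ξ ≥ 1`. -/
structure IsLift (φ φx φxx φt φtx : ℝ → ℝ → ℝ) : Prop where
  dx : ∀ t ξ, HasDerivAt (φ t) (φx t ξ) ξ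
  dxx : ∀ t ξ, HasDerivAt (φx t) (φxx t ξ) ξ
  dt : ∀ t ξ, HasDerivAt (fun t => φ t ξ) (φt t ξ) t
  dtx : ∀ t ξ, HasDerivAt (φt t) (φtx t ξ) ξ
  dxt : ∀ t ξ, HasDerivAt (fun t => φx t ξ) (φtx t ξ) t
  cx : Continuous (uncurry φx)
  cxx : Continuous (uncurry φxx)
  ct : Continuous (uncurry φt)
  ctx : Continuous (uncurry φtx)
  supp : ∀ t ξ, 1 ≤ ξ → φ t ξ = 0

/-- The energy estimate for the difference of the solution with the boundary data `φ(t,0) - φ(0,0)`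
and the lift `φ`. -/
def EnergyBound (c : ℝ → ℝ) (c₀ T K : ℝ) : Prop :=
  ∀ φ φx φxx φt φtx : ℝ → ℝ → ℝ, IsLift φ φx φxx φt φtx → ∀ δ ∈ Ioo 0 1, ∀ t ∈ Icc 0 T,
    (∫ ξ in δ..1, (-pot c T (fun t => φ t 0 - φ 0 0) 2 t ξ - φx t ξ) ^ 2)
      + c₀ * ∫ s in 0..t, ∫ ξ in δ..1, (-pot c T (fun t => φ t 0 - φ 0 0) 3 s ξ - φxx s ξ) ^ 2 ≤
    (∫ ξ in 0..1, φx 0 ξ ^ 2)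
      + c₀⁻¹ * (∫ s in 0..t, ∫ ξ in 0..1, (c s * φxx s ξ - φt s ξ) ^ 2)
      + K * (∫ r in Ioo 0 t, |φ r 0 - φ 0 0|) ^ 2

namespace IsLift
variable {φ φx φxx φt φtx : ℝ → ℝ → ℝ} (h : IsLift φ φx φxx φt φtx)
include h

/-- The lift is differentiable and zero to the right of `ξ = 1`. Together with `dt_one` this leaves
only the potential in the boundary term at `ξ = 1`. -/
lemma dx_one (t : ℝ) : φx t 1 = 0 := by
  have h1 : HasDerivWithinAt (φ t) (φx t 1) (Ici 1) 1 := (h.dx t 1).hasDerivWithinAt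
  have h2 : HasDerivWithinAt (φ t) 0 (Ici 1) 1 :=
    (hasDerivWithinAt_const (1 : ℝ) (Ici 1) (0 : ℝ)).congr (fun ξ hξ => h.supp t ξ hξ) (h.supp t 1 le_rfl)
  exact (uniqueDiffWithinAt_Ici (1 : ℝ)).eq_deriv _ h1 h2

lemma dt_one (t : ℝ) : φt t 1 = 0 := by
  have h1 := h.dt t 1
  have h2 : (fun t => φ t 1) = fun _ => 0 := funext fun t => h.supp t 1 le_rfl
  rw [h2] at h1
  exact h1.unique (hasDerivAt_const t 0)

lemma continuous_dt_zero : Continuous fun t => φt t 0 :=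
  h.ct.comp (by fun_prop : Continuous fun s : ℝ => (s, (0 : ℝ)))

lemma sub_eq_integral (t : ℝ) : φ t 0 - φ 0 0 = ∫ r in 0..t, φt r 0 :=
  (integral_eq_sub_of_hasDerivAt (fun r _ => h.dt r 0) (h.continuous_dt_zero.intervalIntegrable _ _)).symm

lemma continuous_data : Continuous fun t => φ t 0 - φ 0 0 := by
  refine Continuous.sub ?_ continuous_const
  exact continuous_iff_continuousAt.2 fun t => (h.dt t 0).continuousAt

end IsLift

namespace IsCoeff
variable {c : ℝ → ℝ} {c₀ c₁ : ℝ} (hc : IsCoeff c c₀ c₁)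
include hc

/-- The order-zero kernel is `O(s^{-1/2})` uniformly in `ξ`, hence integrable in time. It keeps
`v_ξ` bounded up to the boundary, which is all the energy estimate needs from that factor. -/
lemma exists_abs_pot_zero_le {T B : ℝ} {b : ℝ → ℝ} (hb : ∀ r ∈ Ioo 0 T, |b r| ≤ B) :
    ∃ K : ℝ, ∀ t ∈ Ioo 0 T, ∀ ξ, |pot c T b 0 t ξ| ≤ K := by
  set K : ℝ := (√c₀)⁻¹ * (c₁ * B) with hK
  refine ⟨K * (T ^ ((-1 / 2 : ℝ) + 1) / (-1 / 2 + 1)), fun t ht ξ => ?_⟩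
  have hc₀ := hc.pos
  have hc₁ := hc.c₁_pos
  have hB : 0 ≤ B := (abs_nonneg _).trans (hb t ht)
  have hT : 0 < T := ht.1.trans ht.2
  have h1 : ‖pot c T b 0 t ξ‖ₑ ≤ ofReal K * ofReal (T ^ ((-1 / 2 : ℝ) + 1) / (-1 / 2 + 1)) := by
    rw [hc.pot_eq_Ioo b ht.2.le]
    calc _ ≤ ∫⁻ r in Ioo 0 t, ‖ker 0 (clock c t - clock c r) ξ * (c r * b r)‖ₑ :=
          enorm_integral_le_lintegral_enorm _
      _ ≤ ∫⁻ r in Ioo 0 t, ofReal K * ofReal ((t - r) ^ (-1 / 2 : ℝ)) := by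
          refine setLIntegral_mono' measurableSet_Ioo fun r hr => ?_
          have h0 : 0 < t - r := by linarith [hr.2]
          have h1 : 0 < clock c t - clock c r := (mul_pos hc₀ h0).trans_le (hc.clock_sub_ge hr.2.le)
          have hs : (√(clock c t - clock c r))⁻¹ ≤ (√c₀)⁻¹ * (t - r) ^ (-1 / 2 : ℝ) := by
            rw [show (-1 / 2 : ℝ) = -(1 / 2) by norm_num, Real.rpow_neg h0.le, ← Real.sqrt_eq_rpow,
              ← mul_inv, ← Real.sqrt_mul hc₀.le]
            gcongr
            exact hc.clock_sub_ge hr.2.le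
          have hg : ∀ x, |gaussDeriv 0 x| ≤ 1 := fun x => by
            simp only [gaussDeriv, heatPoly, Polynomial.eval_one, one_mul, Real.abs_exp]
            exact Real.exp_le_one_iff.2 (by nlinarith [sq_nonneg x])
          have hpi : (√Real.pi)⁻¹ ≤ 1 := by
            apply inv_le_one_of_one_le₀
            rw [Real.one_le_sqrt]; linarith [Real.pi_gt_three]
          rw [Real.enorm_eq_ofReal_abs, ← ofReal_mul (by positivity)]
          refine ofReal_le_ofReal ?_
          rw [ker_of_pos h1, abs_mul, abs_mul, abs_mul, abs_mul, abs_of_pos (hc.c_pos r),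
            abs_of_pos (by positivity : 0 < (√Real.pi)⁻¹), zero_add, pow_one,
            abs_of_pos (by positivity : 0 < (√(clock c t - clock c r))⁻¹)]
          have hcb : c r * |b r| ≤ c₁ * B := mul_le_mul (hc.upper r) (hb r ⟨hr.1, hr.2.trans ht.2⟩)
            (abs_nonneg _) hc₁.le
          calc _ ≤ 1 * (((√c₀)⁻¹ * (t - r) ^ (-1 / 2 : ℝ)) * 1) * (c₁ * B) := by
                have := (hc.c_pos r).le
                gcongr
                exact hg _
            _ = _ := by rw [hK]; ring
      _ ≤ _ := by
          rw [lintegral_const_mul' _ _ ofReal_ne_top]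
          gcongr
          exact lintegral_rpow_sub_le (by norm_num) ht
  rw [← ofReal_mul (by positivity), Real.enorm_eq_ofReal_abs] at h1
  exact (ofReal_le_ofReal_iff (by positivity)).1 h1

/-- Extending from `ξ ≥ δ` by a constant makes the potentials globally continuous. -/
lemma continuous_pot_max {T δ : ℝ} {b : ℝ → ℝ} (hb : IntegrableOn b (Ioo 0 T)) (hδ : 0 < δ) (j : ℕ) :
    Continuous (uncurry fun t ξ => pot c T b j t (max ξ δ)) := by
  refine (hc.continuousOn_pot hb j).comp_continuous
    (by fun_prop : Continuous fun z : ℝ² => (z.1, max z.2 δ)) fun z => ⟨mem_univ _, ?_⟩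
  exact hδ.trans_le (le_max_right _ _)

/-- `energy_rectangle` applied to `v = -pot 1 - φ`, frozen for `ξ < δ` so that all functions are
continuous on the plane. The potential vanishes at time zero, so the initial energy is that of `φ`,
and the forcing is `c φ_ξξ - φ_t`. The constant `φ(0,0)` is subtracted from the boundary data so
that they start from zero. -/
lemma energy_aux {φ φx φxx φt φtx : ℝ → ℝ → ℝ} (h : IsLift φ φx φxx φt φtx) {T δ t : ℝ}
    (hδ : δ ∈ Ioo 0 1) (ht : t ∈ Icc 0 T) :
    (∫ ξ in δ..1, (-pot c T (fun t => φ t 0 - φ 0 0) 2 t ξ - φx t ξ) ^ 2)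
        + c₀ * ∫ s in 0..t, ∫ ξ in δ..1, (-pot c T (fun t => φ t 0 - φ 0 0) 3 s ξ - φxx s ξ) ^ 2 ≤
      (∫ ξ in δ..1, φx 0 ξ ^ 2) + c₀⁻¹ * (∫ s in 0..t, ∫ ξ in δ..1, (c s * φxx s ξ - φt s ξ) ^ 2)
        + 2 * (∫ s in 0..t, pot c T (fun t => φ t 0 - φ 0 0) 2 s 1
            * (c s * pot c T (fun t => φ t 0 - φ 0 0) 3 s 1))
        - 2 * ∫ s in 0..t, (-pot c T (fun t => φ t 0 - φ 0 0) 2 s δ - φx s δ)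
            * (-(c s * pot c T (fun t => φ t 0 - φ 0 0) 3 s δ) - φt s δ) := by
  set b : ℝ → ℝ := fun t => φ t 0 - φ 0 0 with hb
  have hbi : IntegrableOn b (Ioo 0 T) := by
    exact (h.continuous_data.integrableOn_Icc).mono_set Ioo_subset_Icc_self
  have hm : Continuous fun z : ℝ² => (z.1, max z.2 δ) := by fun_prop
  have hcc : Continuous fun z : ℝ² => c z.1 := hc.cont.comp continuous_fst
  have hnear : ∀ ξ ∈ Ioo δ 1, (fun ξ : ℝ => max ξ δ) =ᶠ[𝓝 ξ] fun ξ => ξ := fun ξ hξ => by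
    filter_upwards [lt_mem_nhds hξ.1] with x hx
    exact max_eq_left (le_of_lt hx)
  have hpos : ∀ ξ : ℝ, 0 < max ξ δ := fun ξ => hδ.1.trans_le (le_max_right _ _)
  have key := energy_rectangle (δ := δ) (t := t) (c := c) (c₀ := c₀)
    (v₁ := fun t ξ => -pot c T b 2 t (max ξ δ) - φx t (max ξ δ))
    (v₂ := fun t ξ => -pot c T b 3 t (max ξ δ) - φxx t (max ξ δ))
    (vt := fun t ξ => -(c t * pot c T b 3 t (max ξ δ)) - φt t (max ξ δ))
    (v₁t := fun t ξ => -(c t * pot c T b 4 t (max ξ δ)) - φtx t (max ξ δ))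
    (F := fun t ξ => c t * φxx t (max ξ δ) - φt t (max ξ δ))
    hδ.2.le ht.1 hc.pos hc.lower ((hc.continuous_pot_max hbi hδ.1 2).neg.sub (h.cx.comp hm))
    ((hc.continuous_pot_max hbi hδ.1 3).neg.sub (h.cxx.comp hm))
    ((hcc.mul (hc.continuous_pot_max hbi hδ.1 3)).neg.sub (h.ct.comp hm))
    ((hcc.mul (hc.continuous_pot_max hbi hδ.1 4)).neg.sub (h.ctx.comp hm))
    ((hcc.mul (h.cxx.comp hm)).sub (h.ct.comp hm)) (fun s ξ hξ => by
      have hξ0 : 0 < ξ := hδ.1.trans hξ.1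
      have h1 := (hc.hasDerivAt_pot_space hbi 2 s hξ0).neg.sub (h.dxx s ξ)
      simp only [max_eq_left hξ.1.le]
      refine h1.congr_of_eventuallyEq ?_
      filter_upwards [hnear ξ hξ] with x hx
      simp only [hx, Pi.sub_apply, Pi.neg_apply]) (fun s ξ hξ => by
      have hξ0 : 0 < ξ := hδ.1.trans hξ.1
      have h1 := ((hc.hasDerivAt_pot_space hbi 3 s hξ0).const_mul (c s)).neg.sub (h.dtx s ξ)
      simp only [max_eq_left hξ.1.le]
      refine h1.congr_of_eventuallyEq ?_
      filter_upwards [hnear ξ hξ] with x hx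
      simp only [hx, Pi.sub_apply, Pi.neg_apply])
    (fun s ξ => (hc.hasDerivAt_pot_time hbi 2 s (hpos ξ)).neg.sub (h.dxt s (max ξ δ))) (fun s ξ => by ring)
  have r1 : ∀ G : ℝ → ℝ, ∫ ξ in δ..1, G (max ξ δ) = ∫ ξ in δ..1, G ξ := fun G => by
    refine integral_congr fun ξ hξ => ?_
    rw [uIcc_of_le hδ.2.le] at hξ
    simp only [max_eq_left hξ.1]
  have q1 := r1 fun ξ => (-pot c T b 2 t ξ - φx t ξ) ^ 2
  have q2 := fun s => r1 fun ξ => (-pot c T b 3 s ξ - φxx s ξ) ^ 2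
  have q3 := r1 fun ξ => φx 0 ξ ^ 2
  have q4 := fun s => r1 fun ξ => (c s * φxx s ξ - φt s ξ) ^ 2
  have q5 : ∀ ξ, pot c T b 2 0 ξ = 0 := fun ξ => hc.pot_zero_time (ht.1.trans ht.2) b 2 ξ
  beta_reduce at q1 q2 q3 q4
  simp only [q1, q2, q3, q4, q5, neg_zero, zero_sub, neg_sq, max_self, max_eq_left hδ.2.le, h.dx_one,
    h.dt_one, sub_zero, neg_mul_neg] at key
  exact key

omit hc in
-- The two boundary terms of `energy_aux` are disposed of. At `ξ = 1` the kernel is bounded, so the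
-- term is quadratic in `∫|b|`. As the left end tends to zero, `v_ξ` is bounded by
-- `exists_abs_pot_zero_le` and `∂_t v` tends to zero by the jump relation, so dominated convergence
-- removes the other.
lemma _root_.BoundaryLayer.exists_energy_le (c₀ c₁ T : ℝ) (hT : 0 < T) (hc₁ : 0 < c₁) :
    ∃ K : ℝ, 0 < K ∧ ∀ c : ℝ → ℝ, IsCoeff c c₀ c₁ → EnergyBound c c₀ T K := by
  obtain ⟨K₂, hK₂, H₂⟩ := exists_abs_pot_le c₀ c₁ T hT hc₁ 2 0
  obtain ⟨K₃, hK₃, H₃⟩ := exists_abs_pot_le c₀ c₁ T hT hc₁ 3 0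
  -- The term `2 ∫ pot 2 · c · pot 3` at `ξ = 1`: the two far-field constants, the bound on `c`, and
  -- the length of the time interval.
  refine ⟨2 * (T * (K₂ * (c₁ * K₃))), by positivity, fun c hc φ φx φxx φt φtx h δ hδ t ht => ?_⟩
  set b : ℝ → ℝ := fun t => φ t 0 - φ 0 0 with hb
  have hbi : IntegrableOn b (Ioo 0 T) := (h.continuous_data.integrableOn_Icc).mono_set Ioo_subset_Icc_self
  have hc₀ := hc.pos
  have hfar : 2 * (∫ s in 0..t, pot c T b 2 s 1 * (c s * pot c T b 3 s 1)) ≤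
      2 * (T * (K₂ * (c₁ * K₃))) * (∫ r in Ioo 0 t, |b r|) ^ 2 := by
    set A := ∫ r in Ioo 0 t, |b r| with hA
    have hA0 : 0 ≤ A := integral_nonneg fun r => abs_nonneg _
    have hpt : ∀ s ∈ uIoc 0 t, ‖pot c T b 2 s 1 * (c s * pot c T b 3 s 1)‖ ≤ K₂ * (c₁ * K₃) * A ^ 2 := by
      intro s hs
      rw [uIoc_of_le ht.1] at hs
      have hsT : s ∈ Icc 0 T := ⟨hs.1.le, hs.2.trans ht.2⟩
      have hmono : ∫ r in Ioo 0 s, |b r| ≤ A := setIntegral_mono_set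
        ((hbi.mono_set (Ioo_subset_Ioo_right ht.2)).abs) (.of_forall fun r => abs_nonneg _)
        (Ioo_subset_Ioo_right hs.2).eventuallyLE
      have a2 := H₂ c hc b hbi s hsT 1 le_rfl
      have a3 := H₃ c hc b hbi s hsT 1 le_rfl
      rw [pow_zero, div_one] at a2 a3
      rw [norm_mul, norm_mul, norm_eq_abs, norm_eq_abs, norm_eq_abs, abs_of_pos (hc.c_pos s)]
      calc _ ≤ (K₂ * A) * (c₁ * (K₃ * A)) := by
            have := (hc.c_pos s).le
            gcongr
            · exact a2.trans (by gcongr)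
            · exact hc.upper s
            · exact a3.trans (by gcongr)
        _ = _ := by ring
    have := intervalIntegral.norm_integral_le_of_norm_le_const hpt
    have h2 := (le_abs_self _).trans this
    rw [sub_zero, abs_of_nonneg ht.1] at h2
    have h3 : K₂ * (c₁ * K₃) * A ^ 2 * t ≤ K₂ * (c₁ * K₃) * A ^ 2 * T := by
      gcongr; exact ht.2
    linarith
  -- With these data, `pot_add_two` turns the potentials of order 2 and 3 of `b` into those of order
  -- 0 and 1 of `b₁`, for which bounds and a boundary limit are known.
  set b₁ : ℝ → ℝ := fun t => φt t 0 / c t with hb₁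
  have hb₁c : Continuous b₁ := h.continuous_dt_zero.div hc.cont fun t => (hc.c_pos t).ne'
  have hb₁i : IntegrableOn b₁ (Ioo 0 T) := (hb₁c.integrableOn_Icc).mono_set Ioo_subset_Icc_self
  have hbb₁ : ∀ t ∈ Icc 0 T, b t = ∫ r in 0..t, c r * b₁ r := fun t _ => by
    show φ t 0 - φ 0 0 = _
    rw [h.sub_eq_integral]
    congr 1; ext r
    rw [hb₁, mul_div_cancel₀ _ (hc.c_pos r).ne']
  obtain ⟨B, hB⟩ := isCompact_Icc.exists_bound_of_continuousOn (s := Icc 0 T) hb₁c.continuousOn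
  have hB0 : 0 ≤ B := (norm_nonneg _).trans (hB t ht)
  have hB' : ∀ r ∈ Ioo 0 T, |b₁ r| ≤ B := fun r hr => hB r (Ioo_subset_Icc_self hr)
  obtain ⟨L, hL⟩ := hc.exists_abs_pot_zero_le hB'
  have hK : IsCompact (Icc 0 T ×ˢ Icc (0 : ℝ) 1) := isCompact_Icc.prod isCompact_Icc
  obtain ⟨X, hX⟩ := hK.exists_bound_of_continuousOn h.cx.continuousOn
  obtain ⟨Y, hY⟩ := hK.exists_bound_of_continuousOn h.ct.continuousOn
  have hnear : Tendsto (fun ε : ℝ => ∫ s in 0..t, (-pot c T b 2 s ε - φx s ε)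
      * (-(c s * pot c T b 3 s ε) - φt s ε)) (𝓝[>] 0) (𝓝 0) := by
    rw [show 𝓝 (0 : ℝ) = 𝓝 (∫ s in 0..t, (0 : ℝ)) by simp]
    simp only [integral_of_le ht.1, integral_Ioc_eq_integral_Ioo]
    have hmem : ∀ᶠ ε : ℝ in 𝓝[>] 0, ε ∈ Ioo (0 : ℝ) 1 := Ioo_mem_nhdsGT one_pos
    have hbd : ∀ ε ∈ Ioo (0 : ℝ) 1, ∀ s ∈ Ioo 0 t, |-pot c T b 2 s ε - φx s ε| ≤ L + X := by
      intro ε hε s hs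
      have hsT : s ∈ Ioo 0 T := ⟨hs.1, hs.2.trans_le ht.2⟩
      rw [hc.pot_add_two hb₁i hbb₁ 0 (Ioo_subset_Icc_self hsT) hε.1]
      have a1 := hL s hsT ε
      have a2 := hX (s, ε) ⟨Ioo_subset_Icc_self hsT, Ioo_subset_Icc_self hε⟩
      calc _ ≤ |-pot c T b₁ 0 s ε| + |φx s ε| := abs_sub _ _
        _ ≤ _ := by rw [abs_neg]; exact add_le_add a1 a2
    refine tendsto_integral_filter_of_dominated_convergence (fun _ => (L + X) * (c₁ * B + Y)) ?_ ?_ ?_ ?_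
    · filter_upwards [hmem] with ε hε
      refine Continuous.aestronglyMeasurable ?_
      have hsε : Continuous fun s : ℝ => (s, ε) := by fun_prop
      have e : ∀ j, Continuous fun s => pot c T b j s ε := fun j => by
        have := (hc.continuous_pot_max hbi hε.1 j).comp hsε
        simpa [Function.comp_def, uncurry] using this
      exact ((e 2).neg.sub (h.cx.comp hsε)).mul ((hc.cont.mul (e 3)).neg.sub (h.ct.comp hsε))
    · filter_upwards [hmem] with ε hε
      refine ae_restrict_of_forall_mem measurableSet_Ioo fun s hs => ?_
      have hsT : s ∈ Ioo 0 T := ⟨hs.1, hs.2.trans_le ht.2⟩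
      have a1 := hbd ε hε s hs
      have a2 : |-(c s * pot c T b 3 s ε) - φt s ε| ≤ c₁ * B + Y := by
        rw [hc.pot_add_two hb₁i hbb₁ 1 (Ioo_subset_Icc_self hsT) hε.1]
        calc _ ≤ |-(c s * pot c T b₁ 1 s ε)| + |φt s ε| := abs_sub _ _
          _ ≤ _ := by
            rw [abs_neg, abs_mul, abs_of_pos (hc.c_pos s)]
            exact add_le_add (mul_le_mul (hc.upper s) (hc.abs_pot_one_le hB0 hB' s hε.1)
              (abs_nonneg _) hc₁.le) (hY (s, ε) ⟨Ioo_subset_Icc_self hsT, Ioo_subset_Icc_self hε⟩)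
      rw [norm_mul]
      exact mul_le_mul a1 a2 (abs_nonneg _) ((abs_nonneg _).trans a1)
    · exact integrable_const _
    · refine ae_restrict_of_forall_mem measurableSet_Ioo fun s hs => ?_
      have hsT : s ∈ Ioo 0 T := ⟨hs.1, hs.2.trans_le ht.2⟩
      have h1 : Tendsto (fun ε => -(c s * pot c T b 3 s ε) - φt s ε) (𝓝[>] 0) (𝓝 0) := by
        have t1 := ((hc.tendsto_pot_one hb₁c hsT).const_mul (c s)).neg
        have t2 : Tendsto (fun ε => φt s ε) (𝓝[>] 0) (𝓝 (φt s 0)) := by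
          have : Continuous fun ε => φt s ε := h.ct.comp (by fun_prop : Continuous fun ε : ℝ => (s, ε))
          exact (this.tendsto 0).mono_left nhdsWithin_le_nhds
        have t3 := t1.sub t2
        have e : -(c s * -b₁ s) - φt s 0 = 0 := by
          rw [hb₁]; have := (hc.c_pos s).ne'; field_simp; ring
        rw [e] at t3
        refine t3.congr' ?_
        filter_upwards [hmem] with ε hε
        rw [hc.pot_add_two hb₁i hbb₁ 1 (Ioo_subset_Icc_self hsT) hε.1]
      have hbu : IsBoundedUnder (· ≤ ·) (𝓝[>] (0 : ℝ)) (norm ∘ fun ε => -pot c T b 2 s ε - φx s ε) := by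
        refine isBoundedUnder_of_eventually_le (a := L + X) ?_
        filter_upwards [hmem] with ε hε
        exact hbd ε hε s hs
      exact isBoundedUnder_le_mul_tendsto_zero hbu h1
  have hlim := ((hnear.const_mul 2).const_sub ((∫ ξ in 0..1, φx 0 ξ ^ 2)
        + c₀⁻¹ * (∫ s in 0..t, ∫ ξ in 0..1, (c s * φxx s ξ - φt s ξ) ^ 2)
        + 2 * (T * (K₂ * (c₁ * K₃))) * (∫ r in Ioo 0 t, |b r|) ^ 2))
  rw [mul_zero, sub_zero] at hlim
  refine ge_of_tendsto hlim ?_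
  -- For `ε < δ` the integrals over `(δ,1)` are at most those over `(ε,1)`, while the ones on the
  -- right are at most those over `(0,1)`; so the inequality at level `ε` implies the one claimed up
  -- to the vanishing boundary term.
  filter_upwards [Ioo_mem_nhdsGT hδ.1] with ε hε
  have hε1 : ε ∈ Ioo (0 : ℝ) 1 := ⟨hε.1, hε.2.trans hδ.2⟩
  have key := hc.energy_aux h hε1 ht
  have cpot : ∀ j, Continuous (uncurry fun t ξ => pot c T b j t (max ξ ε)) :=
    fun j => hc.continuous_pot_max hbi hε.1 j
  have hm : Continuous fun z : ℝ² => (z.1, max z.2 ε) := by fun_prop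
  have mono : ∀ (a d : ℝ) (G : ℝ → ℝ), a ≤ d → d ≤ 1 → Continuous G →
      (∫ ξ in d..1, G ξ ^ 2) ≤ ∫ ξ in a..1, G ξ ^ 2 := fun a d G ha hd hG =>
    intervalIntegral.integral_mono_interval ha hd le_rfl (.of_forall fun ξ => sq_nonneg _)
      ((hG.pow 2).intervalIntegrable _ _)
  have rmax : ∀ (d : ℝ) (G : ℝ → ℝ), ε ≤ d → d ≤ 1 →
      ∫ ξ in d..1, G (max ξ ε) = ∫ ξ in d..1, G ξ := fun d G h1 h2 => by
    refine integral_congr fun ξ hξ => ?_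
    rw [uIcc_of_le h2] at hξ
    simp only [max_eq_left (h1.trans hξ.1)]
  have g1 : Continuous (uncurry fun s ξ => -pot c T b 2 s (max ξ ε) - φx s (max ξ ε)) :=
    (cpot 2).neg.sub (h.cx.comp hm)
  have g2 : Continuous (uncurry fun s ξ => -pot c T b 3 s (max ξ ε) - φxx s (max ξ ε)) :=
    (cpot 3).neg.sub (h.cxx.comp hm)
  have g3 : Continuous (uncurry fun s ξ => c s * φxx s ξ - φt s ξ) :=
    ((hc.cont.comp continuous_fst).mul h.cxx).sub h.ct
  have slice : ∀ {G : ℝ → ℝ → ℝ}, Continuous (uncurry G) → ∀ s, Continuous (G s) :=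
    fun hG s => hG.comp (by fun_prop : Continuous fun ξ => (s, ξ))
  have ii : ∀ {G : ℝ → ℝ → ℝ}, Continuous (uncurry G) → ∀ d : ℝ,
      IntervalIntegrable (fun s => ∫ ξ in d..1, G s ξ ^ 2) volume 0 t := fun hG d =>
    (continuous_parametric_intervalIntegral_of_continuous' (hG.pow 2) d 1).intervalIntegrable _ _
  have m1 : (∫ ξ in δ..1, (-pot c T b 2 t ξ - φx t ξ) ^ 2) ≤
      ∫ ξ in ε..1, (-pot c T b 2 t ξ - φx t ξ) ^ 2 := by
    rw [← rmax δ (fun ξ => (-pot c T b 2 t ξ - φx t ξ) ^ 2) hε.2.le hδ.2.le,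
      ← rmax ε (fun ξ => (-pot c T b 2 t ξ - φx t ξ) ^ 2) le_rfl hε1.2.le]
    exact mono ε δ _ hε.2.le hδ.2.le (slice g1 t)
  have m2 : (∫ s in 0..t, ∫ ξ in δ..1, (-pot c T b 3 s ξ - φxx s ξ) ^ 2) ≤
      ∫ s in 0..t, ∫ ξ in ε..1, (-pot c T b 3 s ξ - φxx s ξ) ^ 2 := by
    simp only [← fun s => rmax δ (fun ξ => (-pot c T b 3 s ξ - φxx s ξ) ^ 2) hε.2.le hδ.2.le,
      ← fun s => rmax ε (fun ξ => (-pot c T b 3 s ξ - φxx s ξ) ^ 2) le_rfl hε1.2.le]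
    exact integral_mono_on ht.1 (ii g2 δ) (ii g2 ε) fun s _ => mono ε δ _ hε.2.le hδ.2.le (slice g2 s)
  have m3 : (∫ ξ in ε..1, φx 0 ξ ^ 2) ≤ ∫ ξ in 0..1, φx 0 ξ ^ 2 :=
    mono 0 ε _ hε.1.le hε1.2.le (slice h.cx 0)
  have m4 : (∫ s in 0..t, ∫ ξ in ε..1, (c s * φxx s ξ - φt s ξ) ^ 2) ≤
      ∫ s in 0..t, ∫ ξ in 0..1, (c s * φxx s ξ - φt s ξ) ^ 2 :=
    integral_mono_on ht.1 (ii g3 ε) (ii g3 0) fun s _ => mono 0 ε _ hε.1.le hε1.2.le (slice g3 s)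
  have m2' := mul_le_mul_of_nonneg_left m2 hc₀.le
  have m4' := mul_le_mul_of_nonneg_left m4 (inv_nonneg.2 hc₀.le)
  linarith

end IsCoeff

/-! ### Calculus of weak derivatives on the half-strip -/

/-- The partial derivative in time. -/
noncomputable def dT (φ : ℝ² → ℝ) (z : ℝ²) : ℝ := fderiv ℝ φ z (1, 0)

/-- The partial derivative in space. -/
noncomputable def dX (φ : ℝ² → ℝ) (z : ℝ²) : ℝ := fderiv ℝ φ z (0, 1)

lemma hasDerivAt_dT {φ : ℝ² → ℝ} (h : ContDiff ℝ ∞ φ) (t ξ : ℝ) :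
    HasDerivAt (fun t => φ (t, ξ)) (dT φ (t, ξ)) t :=
  ((h.differentiable (by simp)) (t, ξ)).hasFDerivAt.comp_hasDerivAt t
    ((hasDerivAt_id t).prodMk (hasDerivAt_const t ξ))

lemma hasDerivAt_dX {φ : ℝ² → ℝ} (h : ContDiff ℝ ∞ φ) (t ξ : ℝ) :
    HasDerivAt (fun ξ => φ (t, ξ)) (dX φ (t, ξ)) ξ :=
  ((h.differentiable (by simp)) (t, ξ)).hasFDerivAt.comp_hasDerivAt ξ
    ((hasDerivAt_const ξ t).prodMk (hasDerivAt_id ξ))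

lemma contDiff_fderiv_apply {φ : ℝ² → ℝ} (h : ContDiff ℝ ∞ φ) (e : ℝ²) :
    ContDiff ℝ ∞ fun z => fderiv ℝ φ z e := (h.fderiv_right (m := ∞) (by simp)).clm_apply contDiff_const

lemma contDiff_dT {φ : ℝ² → ℝ} (h : ContDiff ℝ ∞ φ) : ContDiff ℝ ∞ (dT φ) :=
  contDiff_fderiv_apply h _

lemma contDiff_dX {φ : ℝ² → ℝ} (h : ContDiff ℝ ∞ φ) : ContDiff ℝ ∞ (dX φ) :=
  contDiff_fderiv_apply h _

lemma dT_dX {φ : ℝ² → ℝ} (h : ContDiff ℝ ∞ φ) : dT (dX φ) = dX (dT φ) := by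
  ext z
  have h1 : DifferentiableAt ℝ (fderiv ℝ φ) z :=
    ((h.fderiv_right (m := ∞) (by simp)).differentiable (by simp)) z
  have h2 : IsSymmSndFDerivAt ℝ φ z := h.contDiffAt.isSymmSndFDerivAt
    (by simpa using WithTop.coe_le_coe.2 (le_top : (2 : ℕ∞) ≤ ⊤))
  have e : ∀ v w : ℝ², fderiv ℝ (fun y => fderiv ℝ φ y v) z w = fderiv ℝ (fderiv ℝ φ) z w v := by
    intro v w
    rw [fderiv_clm_apply h1 (differentiableAt_const v)]
    simp
  unfold dT dX
  rw [e, e]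
  exact h2.eq _ _

lemma IsTest.fderiv_apply {T : ℝ} {φ : ℝ² → ℝ} (h : IsTest T φ) (e : ℝ²) :
    IsTest T fun z => fderiv ℝ φ z e := ⟨contDiff_fderiv_apply h.1 e, h.2.1.fderiv_apply (𝕜 := ℝ) e,
    (tsupport_fderiv_apply_subset ℝ e).trans h.2.2⟩

lemma IsTest.dT {T : ℝ} {φ : ℝ² → ℝ} (h : IsTest T φ) : IsTest T (dT φ) := h.fderiv_apply _

lemma IsTest.dX {T : ℝ} {φ : ℝ² → ℝ} (h : IsTest T φ) : IsTest T (dX φ) := h.fderiv_apply _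

lemma IsTest.mul {T : ℝ} {φ m : ℝ² → ℝ} (h : IsTest T φ) (hm : ContDiff ℝ ∞ m) :
    IsTest T fun z => m z * φ z := ⟨hm.mul h.1, h.2.1.mul_left, (tsupport_mul_subset_right).trans h.2.2⟩

lemma mixedDeriv_zero (φ : ℝ² → ℝ) : mixedDeriv 0 0 φ = φ := by
  ext z; simp [mixedDeriv]

lemma mixedDeriv_succ_right {φ : ℝ² → ℝ} (h : ContDiff ℝ ∞ φ) (i j : ℕ) :
    mixedDeriv i (j + 1) φ = mixedDeriv i j (dX φ) := by
  ext z
  unfold mixedDeriv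
  congr 1
  ext t
  rw [iteratedDeriv_succ']
  congr 1
  ext ξ
  exact (hasDerivAt_dX h t ξ).deriv

lemma mixedDeriv_succ_left {φ : ℝ² → ℝ} (h : ContDiff ℝ ∞ φ) (i j : ℕ) :
    mixedDeriv (i + 1) j φ = mixedDeriv i j (dT φ) := by
  induction j generalizing φ with
  | zero =>
    ext z
    unfold mixedDeriv
    rw [iteratedDeriv_succ']
    congr 1
    ext t
    simp only [iteratedDeriv_zero]
    exact (hasDerivAt_dT h t z.2).deriv
  | succ j ih =>
    rw [mixedDeriv_succ_right h, ih (contDiff_dX h), dT_dX h, mixedDeriv_succ_right (contDiff_dT h)]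

lemma mixedDeriv_one_zero {φ : ℝ² → ℝ} (h : ContDiff ℝ ∞ φ) : mixedDeriv 1 0 φ = dT φ := by
  rw [mixedDeriv_succ_left h, mixedDeriv_zero]

lemma mixedDeriv_zero_one {φ : ℝ² → ℝ} (h : ContDiff ℝ ∞ φ) : mixedDeriv 0 1 φ = dX φ := by
  rw [mixedDeriv_succ_right h, mixedDeriv_zero]

lemma contDiff_mixedDeriv {φ : ℝ² → ℝ} (h : ContDiff ℝ ∞ φ) (i j : ℕ) :
    ContDiff ℝ ∞ (mixedDeriv i j φ) := by
  induction i generalizing φ with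
  | zero =>
    induction j generalizing φ with
    | zero => rwa [mixedDeriv_zero]
    | succ j ih => rw [mixedDeriv_succ_right h]; exact ih (contDiff_dX h)
  | succ i ih => rw [mixedDeriv_succ_left h]; exact ih (contDiff_dT h)

lemma IsTest.mixedDeriv {T : ℝ} {φ : ℝ² → ℝ} (h : IsTest T φ) (i j : ℕ) :
    IsTest T (mixedDeriv i j φ) := by
  induction i generalizing φ with
  | zero =>
    induction j generalizing φ with
    | zero => rwa [mixedDeriv_zero]
    | succ j ih => rw [mixedDeriv_succ_right h.1]; exact ih h.dX
  | succ i ih => rw [mixedDeriv_succ_left h.1]; exact ih h.dT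

lemma dT_mixedDeriv {φ : ℝ² → ℝ} (h : ContDiff ℝ ∞ φ) (i j : ℕ) :
    dT (mixedDeriv i j φ) = mixedDeriv (i + 1) j φ := by
  induction i generalizing φ with
  | zero =>
    induction j generalizing φ with
    | zero => rw [mixedDeriv_zero, mixedDeriv_one_zero h]
    | succ j ih => rw [mixedDeriv_succ_right h, ih (contDiff_dX h), ← mixedDeriv_succ_right h]
  | succ i ih => rw [mixedDeriv_succ_left h, ih (contDiff_dT h), ← mixedDeriv_succ_left h]

lemma dX_mixedDeriv {φ : ℝ² → ℝ} (h : ContDiff ℝ ∞ φ) (i j : ℕ) :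
    dX (mixedDeriv i j φ) = mixedDeriv i (j + 1) φ := by
  induction j generalizing φ with
  | zero =>
    induction i generalizing φ with
    | zero => rw [mixedDeriv_zero, mixedDeriv_zero_one h]
    | succ i ih => rw [mixedDeriv_succ_left h, ih (contDiff_dT h), ← mixedDeriv_succ_left h]
  | succ j ih => rw [mixedDeriv_succ_right h, ih (contDiff_dX h), ← mixedDeriv_succ_right h]

lemma mixedDeriv_mixedDeriv {φ : ℝ² → ℝ} (h : ContDiff ℝ ∞ φ) (i j k l : ℕ) :
    mixedDeriv i j (mixedDeriv k l φ) = mixedDeriv (i + k) (j + l) φ := by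
  induction i generalizing k with
  | zero =>
    induction j generalizing l with
    | zero => rw [mixedDeriv_zero, zero_add, zero_add]
    | succ j ih =>
      rw [mixedDeriv_succ_right (contDiff_mixedDeriv h k l), dX_mixedDeriv h, ih, add_right_comm, add_assoc j]
  | succ i ih =>
    rw [mixedDeriv_succ_left (contDiff_mixedDeriv h k l), dT_mixedDeriv h, ih]
    congr 1; omega

lemma IsTest.integrable {T : ℝ} {φ w : ℝ² → ℝ} (h : IsTest T φ)
    (hw : LocallyIntegrableOn w (strip T)) : Integrable (fun z => w z * φ z) vol(strip T) := by
  have hK : IntegrableOn w (tsupport φ) := hw.integrableOn_compact_subset h.2.2 h.2.1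
  have h1 : IntegrableOn (fun z => w z * φ z) (tsupport φ) :=
    hK.mul_continuousOn h.1.continuous.continuousOn h.2.1
  refine ((integrableOn_iff_integrable_of_support_subset ?_).1 h1).integrableOn
  exact (Function.support_mul_subset_right _ _).trans (subset_tsupport _)

section Algebra
variable {T : ℝ} {i j : ℕ} {u u' w w' : ℝ² → ℝ}

lemma IsWeakDeriv.refl (hu : LocallyIntegrableOn u (strip T)) : IsWeakDeriv T 0 0 u u :=
  ⟨hu, hu, fun φ _ => by simp [mixedDeriv_zero]⟩

/-- Derivatives of test functions are again test functions, so orders add. The converse direction is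
as useful: when two derivatives of the same function are known, one is recognised as a derivative of
the other. -/
lemma IsWeakDeriv.comp_iff (h : IsWeakDeriv T i j u w) {k l : ℕ} :
    IsWeakDeriv T k l w w' ↔ IsWeakDeriv T (k + i) (l + j) u w' := by
  constructor
  · intro h'
    refine ⟨h.1, h'.2.1, fun φ hφ => ?_⟩
    have := h.2.2 _ (hφ.mixedDeriv k l)
    rw [mixedDeriv_mixedDeriv hφ.1] at this
    rw [add_comm k, add_comm l, this, h'.2.2 φ hφ, ← mul_assoc, ← pow_add]
    congr 2; omega
  · intro h'
    refine ⟨h.2.1, h'.2.1, fun φ hφ => ?_⟩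
    have h1 := h.2.2 _ (hφ.mixedDeriv k l)
    have h2 := h'.2.2 φ hφ
    rw [mixedDeriv_mixedDeriv hφ.1, add_comm i, add_comm j, h2] at h1
    have e : ((-1 : ℝ) ^ (i + j)) * (-1) ^ (i + j) = 1 := by
      rw [← mul_pow]; norm_num
    calc _ = ((-1 : ℝ) ^ (i + j)) * ((-1) ^ (i + j) * ∫ z in strip T, w z * BoundaryLayer.mixedDeriv k l φ z) := by
            rw [← mul_assoc, e, one_mul]
      _ = _ := by
        rw [← h1, ← mul_assoc, ← pow_add, show i + j + (k + i + (l + j)) = (i + j) + (i + j) + (k + l) by ring,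
          pow_add, pow_add, e, one_mul]

lemma IsWeakDeriv.comp (h : IsWeakDeriv T i j u w) {k l : ℕ} (h' : IsWeakDeriv T k l w w') :
    IsWeakDeriv T (k + i) (l + j) u w' := h.comp_iff.1 h'

lemma IsWeakDeriv.add (h : IsWeakDeriv T i j u w) (h' : IsWeakDeriv T i j u' w') :
    IsWeakDeriv T i j (fun z => u z + u' z) (fun z => w z + w' z) := by
  refine ⟨h.1.add h'.1, h.2.1.add h'.2.1, fun φ hφ => ?_⟩
  simp only [add_mul]
  rw [integral_add ((hφ.mixedDeriv i j).integrable h.1) ((hφ.mixedDeriv i j).integrable h'.1),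
    integral_add (hφ.integrable h.2.1) (hφ.integrable h'.2.1), h.2.2 φ hφ, h'.2.2 φ hφ, mul_add]

lemma IsWeakDeriv.neg (h : IsWeakDeriv T i j u w) :
    IsWeakDeriv T i j (fun z => -u z) (fun z => -w z) := by
  refine ⟨h.1.neg, h.2.1.neg, fun φ hφ => ?_⟩
  simp only [neg_mul]
  rw [integral_neg, integral_neg, h.2.2 φ hφ, mul_neg]

lemma IsWeakDeriv.sub (h : IsWeakDeriv T i j u w) (h' : IsWeakDeriv T i j u' w') :
    IsWeakDeriv T i j (fun z => u z - u' z) (fun z => w z - w' z) := by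
  simpa only [sub_eq_add_neg] using h.add h'.neg

lemma locallyIntegrableOn_congr (h : u =ᵐ[vol(strip T)] w)
    (hu : LocallyIntegrableOn u (strip T)) : LocallyIntegrableOn w (strip T) := by
  rw [locallyIntegrableOn_iff (isOpen_strip T).isLocallyClosed] at hu ⊢
  intro k hk hk'
  exact (hu k hk hk').congr (ae_restrict_of_ae_restrict_of_subset hk h)

lemma IsWeakDeriv.congr (h : IsWeakDeriv T i j u w) (hu : u =ᵐ[vol(strip T)] u')
    (hw : w =ᵐ[vol(strip T)] w') : IsWeakDeriv T i j u' w' := by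
  refine ⟨locallyIntegrableOn_congr hu h.1, locallyIntegrableOn_congr hw h.2.1, fun φ hφ => ?_⟩
  have e1 : ∫ z in strip T, u' z * BoundaryLayer.mixedDeriv i j φ z =
      ∫ z in strip T, u z * BoundaryLayer.mixedDeriv i j φ z :=
    integral_congr_ae (hu.mono fun z hz => by simp only [hz])
  have e2 : ∫ z in strip T, w' z * φ z = ∫ z in strip T, w z * φ z :=
    integral_congr_ae (hw.mono fun z hz => by simp only [hz])
  rw [e1, e2]
  exact h.2.2 φ hφ

lemma IsWeakDeriv.ae_eq (h : IsWeakDeriv T i j u w) (h' : IsWeakDeriv T i j u w') :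
    w =ᵐ[vol(strip T)] w' := by
  have hz : ∀ᵐ z, z ∈ strip T → w z - w' z = 0 := by
    refine (isOpen_strip T).ae_eq_zero_of_integral_contDiff_smul_eq_zero (h.2.1.sub h'.2.1) ?_
    intro φ h1 h2 h3
    have hφ : IsTest T φ := ⟨h1, h2, h3⟩
    have e : ((-1 : ℝ) ^ (i + j)) ≠ 0 := pow_ne_zero _ (by norm_num)
    have e1 := mul_left_cancel₀ e ((h.2.2 φ hφ).symm.trans (h'.2.2 φ hφ))
    have e2 : ∫ z, φ z • (w z - w' z) = ∫ z in strip T, φ z • (w z - w' z) := by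
      refine (setIntegral_eq_integral_of_forall_compl_eq_zero fun z hz => ?_).symm
      rw [image_eq_zero_of_notMem_tsupport fun hz' => hz (h3 hz'), zero_smul]
    show ∫ z, φ z • (w z - w' z) = 0
    rw [e2]
    simp only [smul_eq_mul, mul_comm (φ _), sub_mul]
    rw [integral_sub (hφ.integrable h.2.1) (hφ.integrable h'.2.1), e1, sub_self]
  rw [EventuallyEq, ae_restrict_iff' (measurableSet_strip T)]
  filter_upwards [hz] with z hz hm
  linarith [hz hm]

/-- Weak derivatives are local: testing with functions supported in `ξ > 1` suffices. Thus all
derivatives of the lift and of the source vanish there and are insensitive to weights. -/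
lemma IsWeakDeriv.ae_eq_zero_of_one_lt (h : IsWeakDeriv T i j u w)
    (hu : ∀ z ∈ strip T, 1 < z.2 → u z = 0) :
    ∀ᵐ z ∂vol(strip T), 1 < z.2 → w z = 0 := by
  have ho : IsOpen (Ioo 0 T ×ˢ Ioi (1 : ℝ)) := isOpen_Ioo.prod isOpen_Ioi
  have hsub : Ioo 0 T ×ˢ Ioi (1 : ℝ) ⊆ strip T :=
    prod_mono_right (Ioi_subset_Ioi zero_le_one)
  have hz : ∀ᵐ z, z ∈ Ioo 0 T ×ˢ Ioi (1 : ℝ) → w z = 0 := by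
    refine ho.ae_eq_zero_of_integral_contDiff_smul_eq_zero (h.2.1.mono_set hsub) ?_
    intro φ h1 h2 h3
    have hφ : IsTest T φ := ⟨h1, h2, h3.trans hsub⟩
    have hz : ∀ z ∈ strip T, z ∉ Ioo 0 T ×ˢ Ioi (1 : ℝ) → BoundaryLayer.mixedDeriv i j φ z = 0 := by
      have hφ' : tsupport (BoundaryLayer.mixedDeriv i j φ) ⊆ tsupport φ := by
        clear hφ h3 hu h
        have aux : ∀ (ψ : ℝ² → ℝ), ContDiff ℝ ∞ ψ → ∀ j,
            tsupport (BoundaryLayer.mixedDeriv 0 j ψ) ⊆ tsupport ψ := by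
          intro ψ hψ j
          induction j generalizing ψ with
          | zero => rw [mixedDeriv_zero]
          | succ j ih =>
            rw [mixedDeriv_succ_right hψ]
            exact (ih _ (contDiff_dX hψ)).trans (tsupport_fderiv_apply_subset ℝ _)
        clear h2
        induction i generalizing φ with
        | zero => exact aux φ h1 j
        | succ i ih =>
          rw [mixedDeriv_succ_left h1]
          exact (ih _ (contDiff_dT h1)).trans (tsupport_fderiv_apply_subset ℝ _)
      intro z _ hz'
      exact image_eq_zero_of_notMem_tsupport fun hz'' => hz' (h3 (hφ' hz''))
    have e0 : ∫ z in strip T, u z * BoundaryLayer.mixedDeriv i j φ z = 0 := by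
      refine setIntegral_eq_zero_of_forall_eq_zero fun z hzm => ?_
      by_cases hzc : z ∈ Ioo 0 T ×ˢ Ioi (1 : ℝ)
      · rw [hu z hzm hzc.2, zero_mul]
      · rw [hz z hzm hzc, mul_zero]
    have e1 := h.2.2 φ hφ
    rw [e0] at e1
    have e2 : ∫ z, φ z • w z = ∫ z in strip T, φ z • w z := by
      refine (setIntegral_eq_integral_of_forall_compl_eq_zero fun z hz => ?_).symm
      rw [image_eq_zero_of_notMem_tsupport fun hz' => hz (hsub (h3 hz')), zero_smul]
    rw [e2]
    simp only [smul_eq_mul, mul_comm (φ _)]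
    exact (mul_eq_zero.1 e1.symm).resolve_left (pow_ne_zero _ (by norm_num))
  rw [ae_restrict_iff' (measurableSet_strip T)]
  filter_upwards [hz] with z hz hm h1
  exact hz ⟨hm.1, h1⟩

/-- Multiplication by a smooth function of space: the first weak derivatives. -/
lemma IsWeakDeriv.mul_space {m m' : ℝ → ℝ} (hm : ContDiff ℝ ∞ m) (hm' : ∀ x, HasDerivAt m (m' x) x)
    (h : IsWeakDeriv T 0 1 u w) :
    IsWeakDeriv T 0 1 (fun z => m z.2 * u z) (fun z => m' z.2 * u z + m z.2 * w z) := by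
  have hd : m' = deriv m := funext fun x => (hm' x).deriv.symm
  have hmc' : ContDiff ℝ ∞ m' := hd ▸ (contDiff_infty_iff_deriv.1 hm).2
  have c1 : ContDiff ℝ ∞ fun z : ℝ² => m z.2 := hm.comp contDiff_snd
  have c2 : ContDiff ℝ ∞ fun z : ℝ² => m' z.2 := hmc'.comp contDiff_snd
  have l1 : LocallyIntegrableOn (fun z : ℝ² => m' z.2 * u z) (strip T) :=
    h.1.continuousOn_mul c2.continuous.continuousOn (isOpen_strip T).isLocallyClosed
  have l2 : LocallyIntegrableOn (fun z : ℝ² => m z.2 * w z) (strip T) :=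
    h.2.1.continuousOn_mul c1.continuous.continuousOn (isOpen_strip T).isLocallyClosed
  have l3 : LocallyIntegrableOn (fun z : ℝ² => m z.2 * u z) (strip T) :=
    h.1.continuousOn_mul c1.continuous.continuousOn (isOpen_strip T).isLocallyClosed
  refine ⟨l3, l1.add l2, fun φ hφ => ?_⟩
  have h1 := h.2.2 _ (hφ.mul c1)
  rw [mixedDeriv_zero_one (hφ.mul c1).1] at h1
  have e : ∀ z, dX (fun z => m z.2 * φ z) z = m' z.2 * φ z + m z.2 * dX φ z := fun z => by
    have a1 := hasDerivAt_dX (hφ.mul c1).1 z.1 z.2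
    exact a1.unique ((hm' z.2).mul (hasDerivAt_dX hφ.1 z.1 z.2))
  rw [mixedDeriv_zero_one hφ.1]
  simp only [e, mul_add, add_mul] at h1 ⊢
  have i1 := hφ.integrable l1
  have i2 := hφ.integrable l2
  have i3 := hφ.dX.integrable l3
  have i1' : Integrable (fun z => u z * (m' z.2 * φ z)) vol(strip T) :=
    i1.congr (.of_forall fun z => by ring)
  have i3' : Integrable (fun z => u z * (m z.2 * BoundaryLayer.dX φ z)) vol(strip T) :=
    i3.congr (.of_forall fun z => by ring)
  rw [integral_add i1' i3'] at h1
  rw [integral_add i1 i2]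
  have q1 : ∫ z in strip T, m' z.2 * u z * φ z = ∫ z in strip T, u z * (m' z.2 * φ z) := by
    congr 1; ext z; ring
  have q2 : ∫ z in strip T, m z.2 * w z * φ z = ∫ z in strip T, w z * (m z.2 * φ z) := by
    congr 1; ext z; ring
  have q3 : ∫ z in strip T, m z.2 * u z * BoundaryLayer.dX φ z =
      ∫ z in strip T, u z * (m z.2 * BoundaryLayer.dX φ z) := by
    congr 1; ext z; ring
  rw [q1, q2, q3]
  simp only [zero_add, pow_one] at h1 ⊢
  linarith

lemma IsWeakDeriv.mul_time {m : ℝ → ℝ} (hm : ContDiff ℝ ∞ m) (h : IsWeakDeriv T i 0 u w) :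
    IsWeakDeriv T i 0 (fun z => m z.2 * u z) (fun z => m z.2 * w z) := by
  have c1 : ContDiff ℝ ∞ fun z : ℝ² => m z.2 := hm.comp contDiff_snd
  refine ⟨h.1.continuousOn_mul c1.continuous.continuousOn (isOpen_strip T).isLocallyClosed,
    h.2.1.continuousOn_mul c1.continuous.continuousOn (isOpen_strip T).isLocallyClosed, fun φ hφ => ?_⟩
  have h1 := h.2.2 _ (hφ.mul c1)
  have e : ∀ (ψ : ℝ² → ℝ), ContDiff ℝ ∞ ψ → ∀ i, BoundaryLayer.mixedDeriv i 0 (fun z => m z.2 * ψ z) =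
      fun z => m z.2 * BoundaryLayer.mixedDeriv i 0 ψ z := by
    intro ψ hψ i
    induction i generalizing ψ with
    | zero => simp only [mixedDeriv_zero]
    | succ i ih =>
      rw [mixedDeriv_succ_left (c1.mul hψ), mixedDeriv_succ_left hψ, ← ih _ (contDiff_dT hψ)]
      congr 1
      ext z
      have a1 := hasDerivAt_dT (c1.mul hψ) z.1 z.2
      exact a1.unique ((hasDerivAt_dT hψ z.1 z.2).const_mul (m z.2))
  rw [e φ hφ.1] at h1
  have q1 : ∫ z in strip T, m z.2 * u z * BoundaryLayer.mixedDeriv i 0 φ z =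
      ∫ z in strip T, u z * (m z.2 * BoundaryLayer.mixedDeriv i 0 φ z) := by
    congr 1; ext z; ring
  have q2 : ∫ z in strip T, m z.2 * w z * φ z = ∫ z in strip T, w z * (m z.2 * φ z) := by
    congr 1; ext z; ring
  rw [q1, q2, h1]

/-- The `j`-th term of the Leibniz rule, for the derivatives `M` of the first and `W` of the second
factor. -/
def leib : ℕ → (ℕ → ℝ → ℝ) → (ℕ → ℝ² → ℝ) → ℝ² → ℝ
  | 0, M, W => fun z => M 0 z.2 * W 0 z
  | j + 1, M, W => fun z => leib j (fun q => M (q + 1)) W z + leib j M (fun p => W (p + 1)) z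

/-- Each differentiation raises the index of one of the two sequences, so the Leibniz rule appears
as a binary tree without binomial coefficients, and the induction runs along its two branches. -/
lemma IsWeakDeriv.leib_step {M : ℕ → ℝ → ℝ} (hM : ∀ q, ContDiff ℝ ∞ (M q))
    (hM' : ∀ q x, HasDerivAt (M q) (M (q + 1) x) x) (j : ℕ) {W : ℕ → ℝ² → ℝ}
    (hW : ∀ p ≤ j, IsWeakDeriv T 0 1 (W p) (W (p + 1))) :
    IsWeakDeriv T 0 1 (leib j M W) (leib (j + 1) M W) := by
  induction j generalizing M W with
  | zero => exact (hW 0 le_rfl).mul_space (hM 0) (hM' 0)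
  | succ j ih =>
    exact (ih (fun q => hM (q + 1)) (fun q => hM' (q + 1)) fun p hp => hW p (by omega)).add
      (ih hM hM' fun p hp => hW (p + 1) (by omega))

lemma IsWeakDeriv.leib {M : ℕ → ℝ → ℝ} (hM : ∀ q, ContDiff ℝ ∞ (M q))
    (hM' : ∀ q x, HasDerivAt (M q) (M (q + 1) x) x) (j : ℕ) {W : ℕ → ℝ² → ℝ}
    (h0 : IsWeakDeriv T i 0 u (W 0)) (hW : ∀ p < j, IsWeakDeriv T 0 1 (W p) (W (p + 1))) :
    IsWeakDeriv T i j (fun z => M 0 z.2 * u z) (leib j M W) := by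
  induction j with
  | zero => exact h0.mul_time (hM 0)
  | succ j ih =>
    have := (ih fun p hp => hW p (by omega)).comp (IsWeakDeriv.leib_step hM hM' j fun p hp => hW p (by omega))
    rwa [zero_add, add_comm 1] at this

end Algebra

/-! ### Absolutely continuous functions of time -/

/-- Test functions of time. -/
def IsTimeTest (T : ℝ) (θ : ℝ → ℝ) : Prop :=
  ContDiff ℝ ∞ θ ∧ HasCompactSupport θ ∧ tsupport θ ⊆ Ioo 0 T

/-- `γ` is absolutely continuous on `[0,T]` with derivative `γ'`. -/
structure IsPrimitive (T : ℝ) (γ γ' : ℝ → ℝ) : Prop where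
  ac : AbsolutelyContinuousOnInterval γ 0 T
  ae : ∀ᵐ t ∂vol(Ioo 0 T), HasDerivAt γ (γ' t) t

lemma _root_.AbsolutelyContinuousOnInterval.congr_eqOn {f g : ℝ → ℝ} {a b : ℝ}
    (h : AbsolutelyContinuousOnInterval f a b) (hfg : EqOn f g (uIcc a b)) :
    AbsolutelyContinuousOnInterval g a b := by
  rw [absolutelyContinuousOnInterval_iff] at h ⊢
  intro ε hε
  obtain ⟨δ, hδ, H⟩ := h ε hε
  refine ⟨δ, hδ, fun E hE hEδ => ?_⟩
  have := H E hE hEδ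
  refine lt_of_eq_of_lt (Finset.sum_congr rfl fun i hi => ?_) this
  rw [hfg (hE.1 i hi).1, hfg (hE.1 i hi).2]

namespace IsPrimitive
variable {T : ℝ} {γ γ' δ δ' : ℝ → ℝ}

lemma ae_deriv (h : IsPrimitive T γ γ') : γ' =ᵐ[vol(Ioo 0 T)] deriv γ :=
  h.ae.mono fun _ ht => ht.deriv.symm

lemma integrableOn (h : IsPrimitive T γ γ') (hT : 0 ≤ T) : IntegrableOn γ' (Ioo 0 T) := by
  have h1 := h.ac.intervalIntegrable_deriv
  rw [intervalIntegrable_iff_integrableOn_Ioo_of_le hT] at h1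
  exact h1.congr h.ae_deriv.symm

lemma sub_eq_integral (h : IsPrimitive T γ γ') {s t : ℝ} (hs : s ∈ Icc 0 T) (ht : t ∈ Icc 0 T) :
    γ t - γ s = ∫ r in s..t, γ' r := by
  have hT : 0 ≤ T := hs.1.trans hs.2
  rw [← (h.ac.mono (c := s) (d := t) (by rw [uIcc_of_le hT]; exact uIcc_subset_Icc hs ht)).integral_deriv_eq_sub]
  refine intervalIntegral.integral_congr_ae ?_
  have h1 : ∀ᵐ r, r ∈ Ioo 0 T → γ' r = deriv γ r := (ae_restrict_iff' measurableSet_Ioo).1 h.ae_deriv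
  have h2 : ∀ᵐ r : ℝ, r ≠ T := by simp [ae_iff, measure_singleton]
  filter_upwards [h1, h2] with r h1 h2 hr
  have hr' := uIoc_subset_uIcc hr
  have hr1 : r ∈ Icc 0 T := uIcc_subset_Icc hs ht hr'
  have hr0 : 0 < r := by
    rcases le_total s t with h | h
    · rw [uIoc_of_le h] at hr; exact hs.1.trans_lt hr.1
    · rw [uIoc_of_ge h] at hr; exact ht.1.trans_lt hr.1
  exact (h1 ⟨hr0, lt_of_le_of_ne hr1.2 h2⟩).symm

lemma of_integral (hT : 0 ≤ T) (hi : IntegrableOn γ' (Ioo 0 T))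
    (h : ∀ t ∈ Icc 0 T, γ t = γ 0 + ∫ r in 0..t, γ' r) : IsPrimitive T γ γ' := by
  have hii : IntervalIntegrable γ' volume 0 T := (intervalIntegrable_iff_integrableOn_Ioo_of_le hT).2 hi
  have hconst : AbsolutelyContinuousOnInterval (fun _ : ℝ => γ 0) 0 T :=
    (LipschitzOnWith.of_dist_le_mul (K := 0) (by simp)).absolutelyContinuousOnInterval
  refine ⟨(hconst.add
    (hii.absolutelyContinuousOnInterval_intervalIntegral (c := 0) (by simp))).congr_eqOn ?_, ?_⟩
  · rw [uIcc_of_le hT]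
    exact fun t ht => (h t ht).symm
  · rw [ae_restrict_iff' measurableSet_Ioo]
    filter_upwards [hii.ae_hasDerivAt_integral] with t h1 ht
    rw [uIcc_of_le hT] at h1
    have h2 := (h1 (Ioo_subset_Icc_self ht) 0 (left_mem_Icc.2 hT)).const_add (γ 0)
    refine h2.congr_of_eventuallyEq ?_
    filter_upwards [Ioo_mem_nhds ht.1 ht.2] with s hs
    exact h s (Ioo_subset_Icc_self hs)

lemma of_hasDerivAt (hT : 0 ≤ T) (h : ∀ t ∈ Icc 0 T, HasDerivAt γ (γ' t) t)
    (hc : ContinuousOn γ' (Icc 0 T)) : IsPrimitive T γ γ' := by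
  refine of_integral hT (hc.integrableOn_Ioo) fun t ht => ?_
  have hsub : uIcc 0 t ⊆ Icc 0 T := by
    rw [uIcc_of_le ht.1]; exact Icc_subset_Icc_right ht.2
  rw [integral_eq_sub_of_hasDerivAt (fun s hs => h s (hsub hs)) (hc.mono hsub).intervalIntegrable]
  ring

lemma add (h : IsPrimitive T γ γ') (h' : IsPrimitive T δ δ') :
    IsPrimitive T (fun t => γ t + δ t) (fun t => γ' t + δ' t) :=
  ⟨h.ac.add h'.ac, by filter_upwards [h.ae, h'.ae] with t h1 h2 using h1.add h2⟩

lemma mul (h : IsPrimitive T γ γ') (h' : IsPrimitive T δ δ') :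
    IsPrimitive T (fun t => γ t * δ t) (fun t => γ' t * δ t + γ t * δ' t) :=
  ⟨h.ac.mul h'.ac, by filter_upwards [h.ae, h'.ae] with t h1 h2 using h1.mul h2⟩

lemma const (T a : ℝ) : IsPrimitive T (fun _ => a) (fun _ => 0) :=
  ⟨(LipschitzOnWith.of_dist_le_mul (K := 0) (by simp)).absolutelyContinuousOnInterval,
    .of_forall fun t => hasDerivAt_const t a⟩

lemma congr_right (h : IsPrimitive T γ γ') (he : γ' =ᵐ[vol(Ioo 0 T)] δ') :
    IsPrimitive T γ δ' := ⟨h.ac, by filter_upwards [h.ae, he] with t h1 h2; rwa [← h2]⟩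

lemma congr_left (h : IsPrimitive T γ γ') (hT : 0 ≤ T) (he : EqOn γ δ (Icc 0 T)) :
    IsPrimitive T δ γ' := by
  refine of_integral hT (h.integrableOn hT) fun t ht => ?_
  have h0 : (0 : ℝ) ∈ Icc 0 T := left_mem_Icc.2 hT
  rw [← he ht, ← he h0, ← h.sub_eq_integral h0 ht]
  ring

lemma continuousOn (h : IsPrimitive T γ γ') (hT : 0 ≤ T) : ContinuousOn γ (Icc 0 T) := by
  rw [← uIcc_of_le hT]; exact h.ac.continuousOn

/-- Integration by parts against a function that vanishes at the ends. -/
lemma integral_mul_eq (h : IsPrimitive T γ γ') (h' : IsPrimitive T δ δ') (hT : 0 ≤ T) (h0 : δ 0 = 0)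
    (h1 : δ T = 0) : ∫ t in Ioo 0 T, γ t * δ' t = -∫ t in Ioo 0 T, γ' t * δ t := by
  have := (h.mul h').sub_eq_integral (left_mem_Icc.2 hT) (right_mem_Icc.2 hT)
  simp only [h0, h1, mul_zero, sub_zero] at this
  rw [integral_of_le hT, integral_Ioc_eq_integral_Ioo, integral_add] at this
  · linarith
  · exact (((h.integrableOn hT).congr_set_ae Ioo_ae_eq_Icc.symm).mul_continuousOn (h'.continuousOn hT)
      isCompact_Icc).mono_set Ioo_subset_Icc_self
  · exact (((h'.integrableOn hT).congr_set_ae Ioo_ae_eq_Icc.symm).continuousOn_mul (h.continuousOn hT)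
      isCompact_Icc).mono_set Ioo_subset_Icc_self

lemma memLp_top (h : IsPrimitive T γ γ') (hT : 0 ≤ T) : MemLp γ ⊤ vol(Ioo 0 T) := by
  obtain ⟨C, hC⟩ := isCompact_Icc.exists_bound_of_continuousOn (h.continuousOn hT)
  refine memLp_top_of_bound
    (((h.continuousOn hT).mono Ioo_subset_Icc_self).aestronglyMeasurable measurableSet_Ioo) C ?_
  exact ae_restrict_of_forall_mem measurableSet_Ioo (fun t ht => hC t (Ioo_subset_Icc_self ht))

lemma lipschitz (h : IsPrimitive T γ γ') (h' : MemLp γ' ⊤ vol(Ioo 0 T)) :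
    ∃ K : NNReal, LipschitzOnWith K γ (Icc 0 T) := by
  obtain ⟨K, hK⟩ : ∃ K : NNReal, ∀ᵐ t ∂vol(Ioo 0 T), ‖γ' t‖ ≤ K := by
    have hlt : eLpNormEssSup γ' vol(Ioo 0 T) < ⊤ := by
      have := h'.2; rwa [eLpNorm_exponent_top] at this
    refine ⟨(eLpNormEssSup γ' vol(Ioo 0 T)).toNNReal, ?_⟩
    filter_upwards [ae_le_eLpNormEssSup (f := γ') (μ := vol(Ioo 0 T))] with t ht
    have := ENNReal.toNNReal_mono hlt.ne ht
    exact_mod_cast this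
  refine ⟨K, LipschitzOnWith.of_dist_le_mul fun x hx y hy => ?_⟩
  rw [dist_eq, dist_eq, h.sub_eq_integral hy hx, ← norm_eq_abs (∫ r in y..x, γ' r)]
  refine intervalIntegral.norm_integral_le_of_norm_le_const_ae ?_
  have h2 : ∀ᵐ r : ℝ, r ≠ T := by simp [ae_iff, measure_singleton]
  filter_upwards [(ae_restrict_iff' measurableSet_Ioo).1 hK, h2] with r h1 h2 hr
  have hr1 : r ∈ Icc 0 T := uIcc_subset_Icc hy hx (uIoc_subset_uIcc hr)
  have hr0 : 0 < r := by
    rcases le_total y x with h | h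
    · rw [uIoc_of_le h] at hr; exact hy.1.trans_lt hr.1
    · rw [uIoc_of_ge h] at hr; exact hx.1.trans_lt hr.1
  exact h1 ⟨hr0, lt_of_le_of_ne hr1.2 h2⟩

/-- Reciprocals of Lipschitz functions. -/
lemma inv {a : ℝ} (ha : 0 < a) (hT : 0 ≤ T) (hγ : ∀ t ∈ Icc 0 T, a ≤ γ t) (h : IsPrimitive T γ γ')
    (h' : MemLp γ' ⊤ vol(Ioo 0 T)) :
    IsPrimitive T (fun t => (γ t)⁻¹) (fun t => -(γ' t * ((γ t)⁻¹ * (γ t)⁻¹))) := by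
  obtain ⟨K, hK⟩ := h.lipschitz h'
  have hpos : ∀ t ∈ Icc 0 T, 0 < γ t := fun t ht => ha.trans_le (hγ t ht)
  constructor
  · refine LipschitzOnWith.absolutelyContinuousOnInterval (K := K * (a⁻¹ * a⁻¹).toNNReal) ?_
    rw [uIcc_of_le hT]
    refine LipschitzOnWith.of_dist_le_mul fun x hx y hy => ?_
    have e : (γ x)⁻¹ - (γ y)⁻¹ = (γ y - γ x) * ((γ x)⁻¹ * (γ y)⁻¹) := by
      have := (hpos x hx).ne'; have := (hpos y hy).ne'; field_simp
    have h1 := hK.dist_le_mul y hy x hx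
    rw [dist_eq, dist_eq] at h1
    rw [dist_eq, e, abs_mul, dist_eq, abs_sub_comm x y]
    have h2 : |(γ x)⁻¹ * (γ y)⁻¹| ≤ a⁻¹ * a⁻¹ := by
      rw [abs_of_pos (mul_pos (inv_pos.2 (hpos x hx)) (inv_pos.2 (hpos y hy)))]
      gcongr
      · exact inv_nonneg.2 (hpos y hy).le
      · exact hγ x hx
      · exact hγ y hy
    push_cast
    rw [Real.coe_toNNReal _ (by positivity)]
    calc _ ≤ (K * |y - x|) * (a⁻¹ * a⁻¹) := by gcongr
      _ = _ := by ring
  · filter_upwards [h.ae, ae_restrict_mem measurableSet_Ioo] with t h1 ht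
    have := (hpos t (Ioo_subset_Icc_self ht)).ne'
    refine (h1.inv this).congr_deriv ?_
    field_simp

end IsPrimitive

lemma IsTimeTest.vanish {T : ℝ} {θ : ℝ → ℝ} (h : IsTimeTest T θ) {t : ℝ} (ht : t ∉ Ioo 0 T) : θ t = 0 :=
  image_eq_zero_of_notMem_tsupport fun h' => ht (h.2.2 h')

lemma IsTimeTest.hasDerivAt {T : ℝ} {θ : ℝ → ℝ} (h : IsTimeTest T θ) (t : ℝ) :
    HasDerivAt θ (deriv θ t) t := ((h.1.differentiable (by simp)) t).hasDerivAt

lemma IsTimeTest.continuous_deriv {T : ℝ} {θ : ℝ → ℝ} (h : IsTimeTest T θ) : Continuous (deriv θ) :=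
  (contDiff_infty_iff_deriv.1 h.1).2.continuous

lemma IsTimeTest.isPrimitive {T : ℝ} {θ : ℝ → ℝ} (h : IsTimeTest T θ) (hT : 0 ≤ T) :
    IsPrimitive T θ (deriv θ) :=
  .of_hasDerivAt hT (fun t _ => h.hasDerivAt t) h.continuous_deriv.continuousOn

/-- The primitive is zero before the support and, by the vanishing mean, zero again after it. -/
lemma exists_isTimeTest_primitive {T : ℝ} (hT : 0 < T) {η : ℝ → ℝ} (h : IsTimeTest T η)
    (h0 : ∫ t in Ioo 0 T, η t = 0) : ∃ θ, IsTimeTest T θ ∧ deriv θ = η := by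
  have hcont := h.1.continuous
  have hd : ∀ t, HasDerivAt (fun t => ∫ r in 0..t, η r) (η t) t := fun t =>
    integral_hasDerivAt_right (hcont.intervalIntegrable _ _)
      (hcont.stronglyMeasurableAtFilter _ _) hcont.continuousAt
  have hde : deriv (fun t => ∫ r in 0..t, η r) = η := funext fun t => (hd t).deriv
  obtain ⟨a, b, ha, hb, hab⟩ : ∃ a b : ℝ, 0 < a ∧ b < T ∧ tsupport η ⊆ Icc a b := by
    rcases (tsupport η).eq_empty_or_nonempty with he | hne
    -- For empty support any empty interval will do; `[T,0]` satisfies both strict inequalities.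
    · exact ⟨T, 0, hT, hT, by rw [he]; exact empty_subset _⟩
    · have hK : IsCompact (tsupport η) := h.2.1
      exact ⟨sInf (tsupport η), sSup (tsupport η), (h.2.2 (hK.sInf_mem hne)).1,
        (h.2.2 (hK.sSup_mem hne)).2, fun x hx => ⟨csInf_le hK.bddBelow hx, le_csSup hK.bddAbove hx⟩⟩
  have hz : ∀ x, x ∉ Icc a b → η x = 0 := fun x hx =>
    image_eq_zero_of_notMem_tsupport fun h' => hx (hab h')
  have htot : ∫ r in 0..T, η r = 0 := by
    rw [integral_of_le hT.le, integral_Ioc_eq_integral_Ioo, h0]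
  have hsupp : ∀ t, t ∉ Icc a b → ∫ r in 0..t, η r = 0 := by
    intro t ht
    by_cases hta : t < a
    · refine intervalIntegral.integral_zero_ae (.of_forall fun r hr => hz r fun hr' => ?_)
      rcases (mem_uIoc.1 hr) with hr | hr
      · exact absurd hr'.1 (not_le.2 (hr.2.trans_lt hta))
      · exact absurd hr'.1 (not_le.2 (hr.2.trans_lt ha))
    · have htb : b < t := by
        by_contra hcon; exact ht ⟨not_lt.1 hta, not_lt.1 hcon⟩
      have h1 : ∫ r in t..T, η r = 0 := by
        refine intervalIntegral.integral_zero_ae (.of_forall fun r hr => hz r fun hr' => ?_)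
        rcases (mem_uIoc.1 hr) with hr | hr
        · exact absurd hr'.2 (not_le.2 (htb.trans hr.1))
        · exact absurd hr'.2 (not_le.2 (hb.trans hr.1))
      have h2 := intervalIntegral.integral_add_adjacent_intervals (hcont.intervalIntegrable (μ := volume) 0 t)
        (hcont.intervalIntegrable t T)
      rw [h1, htot, add_zero] at h2
      exact h2
  have hts : tsupport (fun t => ∫ r in 0..t, η r) ⊆ Icc a b :=
    closure_minimal (fun t ht => by
      by_contra hcon
      exact ht (hsupp t hcon)) isClosed_Icc
  refine ⟨fun t => ∫ r in 0..t, η r, ⟨?_, isCompact_Icc.of_isClosed_subset (isClosed_tsupport _) hts,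
    hts.trans fun x hx => ⟨ha.trans_le hx.1, hx.2.trans_lt hb⟩⟩, hde⟩
  rw [contDiff_infty_iff_deriv, hde]
  exact ⟨fun t => (hd t).differentiableAt, h.1⟩

lemma IsTimeTest.integrable_mul {T : ℝ} {θ γ : ℝ → ℝ} (h : IsTimeTest T θ) (hγ : IntegrableOn γ (Ioo 0 T)) :
    Integrable (fun t => γ t * θ t) vol(Ioo 0 T) :=
  ((hγ.congr_set_ae Ioo_ae_eq_Icc.symm).mul_continuousOn h.1.continuous.continuousOn
      isCompact_Icc).mono_set Ioo_subset_Icc_self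

lemma exists_isTimeTest_integral_one {T : ℝ} (hT : 0 < T) : ∃ θ, IsTimeTest T θ ∧ ∫ t in Ioo 0 T, θ t = 1 := by
  let f : ContDiffBump (T / 2) := ⟨T / 8, T / 4, by positivity, by linarith⟩
  refine ⟨f.normed volume, ⟨f.contDiff_normed, f.hasCompactSupport_normed, ?_⟩, ?_⟩
  · rw [f.tsupport_normed_eq, Real.closedBall_eq_Icc]
    intro x hx
    have e : f.rOut = T / 4 := rfl
    rw [e] at hx
    exact ⟨by linarith [hx.1], by linarith [hx.2]⟩
  · rw [← f.integral_normed (μ := volume)]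
    refine setIntegral_eq_integral_of_forall_compl_eq_zero fun x hx => ?_
    refine image_eq_zero_of_notMem_tsupport fun hx' => hx ?_
    rw [f.tsupport_normed_eq, Real.closedBall_eq_Icc] at hx'
    have e : f.rOut = T / 4 := rfl
    rw [e] at hx'
    exact ⟨by linarith [hx'.1], by linarith [hx'.2]⟩

/-- The lemma of du Bois-Reymond. -/
lemma ae_eq_const_of_integral_deriv_eq_zero {T : ℝ} (hT : 0 < T) {h : ℝ → ℝ}
    (hi : IntegrableOn h (Ioo 0 T)) (h0 : ∀ θ, IsTimeTest T θ → ∫ t in Ioo 0 T, h t * deriv θ t = 0) :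
    ∃ C, ∀ᵐ t ∂vol(Ioo 0 T), h t = C := by
  obtain ⟨θ₀, hθ₀, h1⟩ := exists_isTimeTest_integral_one hT
  set C := ∫ t in Ioo 0 T, h t * θ₀ t with hC
  refine ⟨C, ?_⟩
  have key : ∀ᵐ t, t ∈ Ioo 0 T → h t - C = 0 := by
    refine isOpen_Ioo.ae_eq_zero_of_integral_contDiff_smul_eq_zero
      ((hi.sub (integrable_const C)).locallyIntegrableOn) fun ψ p1 p2 p3 => ?_
    have hψ : IsTimeTest T ψ := ⟨p1, p2, p3⟩
    set I := ∫ t in Ioo 0 T, ψ t with hI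
    have iψ : Integrable ψ vol(Ioo 0 T) := (p1.continuous.integrableOn_Icc).mono_set Ioo_subset_Icc_self
    have iθ : Integrable θ₀ vol(Ioo 0 T) := (hθ₀.1.continuous.integrableOn_Icc).mono_set Ioo_subset_Icc_self
    -- Subtracting the right multiple of a fixed test function of mean one makes the mean zero,
    -- hence the difference a derivative of a test function.
    have hη : IsTimeTest T fun t => ψ t - I * θ₀ t := by
      refine ⟨p1.sub (contDiff_const.mul hθ₀.1), p2.sub hθ₀.2.1.mul_left, ?_⟩
      exact (tsupport_sub _ _).trans (union_subset p3 (tsupport_mul_subset_right.trans hθ₀.2.2))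
    obtain ⟨θ, hθ, hd⟩ := exists_isTimeTest_primitive hT hη (by
      rw [integral_sub iψ (iθ.const_mul I), integral_const_mul, h1, mul_one, sub_self])
    have h2 := h0 θ hθ
    rw [hd] at h2
    have e1 : ∫ t, ψ t • (h t - C) = ∫ t in Ioo 0 T, ψ t • (h t - C) :=
      (setIntegral_eq_integral_of_forall_compl_eq_zero fun z hz => by rw [hψ.vanish hz, zero_smul]).symm
    rw [e1]
    simp only [smul_eq_mul, mul_sub] at h2 ⊢
    have i1 := hψ.integrable_mul hi
    have i2 := hθ₀.integrable_mul hi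
    rw [integral_sub (i1.congr (.of_forall fun t => mul_comm _ _)) (iψ.mul_const C), integral_mul_const]
    rw [integral_sub i1 ((i2.const_mul I).congr (.of_forall fun t => by ring))] at h2
    have e2 : ∫ t in Ioo 0 T, h t * (I * θ₀ t) = I * C := by
      rw [hC, ← integral_const_mul]; congr 1; ext t; ring
    rw [e2] at h2
    have e3 : ∫ t in Ioo 0 T, ψ t * h t = ∫ t in Ioo 0 T, h t * ψ t := by
      congr 1; ext t; ring
    rw [e3]; exact h2
  rw [ae_restrict_iff' measurableSet_Ioo]
  filter_upwards [key] with t ht hm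
  linarith [ht hm]

/-- The difference of `γ` and a primitive of `γ'` has weak derivative zero, so it is constant by the
lemma of du Bois-Reymond. -/
lemma exists_isPrimitive_ae {T : ℝ} (hT : 0 < T) {γ γ' : ℝ → ℝ} (hi : IntegrableOn γ (Ioo 0 T))
    (hi' : IntegrableOn γ' (Ioo 0 T))
    (h : ∀ θ, IsTimeTest T θ → ∫ t in Ioo 0 T, γ t * deriv θ t = -∫ t in Ioo 0 T, γ' t * θ t) :
    ∃ δ, IsPrimitive T δ γ' ∧ γ =ᵐ[vol(Ioo 0 T)] δ := by
  have hp : IsPrimitive T (fun t => ∫ r in 0..t, γ' r) γ' :=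
    .of_integral hT.le hi' fun t _ => by simp
  have hpi : IntegrableOn (fun t => ∫ r in 0..t, γ' r) (Ioo 0 T) :=
    ((hp.continuousOn hT.le).integrableOn_Icc).mono_set Ioo_subset_Icc_self
  obtain ⟨C, hC⟩ := ae_eq_const_of_integral_deriv_eq_zero hT (hi.sub hpi) fun θ hθ => by
    have hd : IsTimeTest T (deriv θ) :=
      ⟨(contDiff_infty_iff_deriv.1 hθ.1).2, hθ.2.1.deriv, (tsupport_deriv_subset (𝕜 := ℝ)).trans hθ.2.2⟩
    simp only [Pi.sub_apply, sub_mul]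
    rw [integral_sub (hd.integrable_mul hi) (hd.integrable_mul hpi), h θ hθ,
      hp.integral_mul_eq (hθ.isPrimitive hT.le) hT.le (hθ.vanish (by simp)) (hθ.vanish (by simp)), sub_self]
  refine ⟨fun t => C + ∫ r in 0..t, γ' r, ?_, ?_⟩
  · exact ((IsPrimitive.const T C).add hp).congr_right (.of_forall fun t => zero_add _)
  · filter_upwards [hC] with t ht
    simp only [Pi.sub_apply] at ht
    linarith

lemma isPrimitive_of_weak {T : ℝ} (hT : 0 < T) {γ γ' : ℝ → ℝ} (hc : ContinuousOn γ (Icc 0 T))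
    (hi' : IntegrableOn γ' (Ioo 0 T))
    (h : ∀ θ, IsTimeTest T θ → ∫ t in Ioo 0 T, γ t * deriv θ t = -∫ t in Ioo 0 T, γ' t * θ t) :
    IsPrimitive T γ γ' := by
  obtain ⟨δ, hδ, he⟩ := exists_isPrimitive_ae hT (hc.integrableOn_Ioo) hi' h
  refine hδ.congr_left hT.le fun t ht => ?_
  have h1 : EqOn γ δ (Ioo 0 T) := Measure.eqOn_open_of_ae_eq he isOpen_Ioo
    (hc.mono Ioo_subset_Icc_self) ((hδ.continuousOn hT.le).mono Ioo_subset_Icc_self)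
  have h2 : EqOn γ δ (Icc 0 T) :=
    h1.of_subset_closure hc (hδ.continuousOn hT.le) Ioo_subset_Icc_self (by rw [closure_Ioo hT.ne])
  exact (h2 ht).symm

/-! ### One-dimensional Sobolev classes -/

/-- `γ ∈ W^{m,p}(0,T)`, in terms of the absolutely continuous representatives of the derivatives of
order less than `m`; if `z` holds, these vanish at `t = 0`. -/
def Chain (z : Prop) (p : ℝ≥0∞) (T : ℝ) : ℕ → (ℝ → ℝ) → Prop
  | 0, γ => MemLp γ p vol(Ioo 0 T)
  | m + 1, γ => (z → γ 0 = 0) ∧ ∃ γ', Chain z p T m γ' ∧ IsPrimitive T γ γ'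

namespace Chain
variable {z : Prop} {p : ℝ≥0∞} {T : ℝ} {m : ℕ} {γ δ κ : ℝ → ℝ}

lemma memLp (hT : 0 ≤ T) (h : Chain z p T m γ) : MemLp γ p vol(Ioo 0 T) := by
  cases m with
  | zero => exact h
  | succ m =>
    obtain ⟨-, γ', -, h'⟩ := h
    exact (h'.memLp_top hT).mono_exponent le_top

lemma mono (hT : 0 ≤ T) {k : ℕ} (hk : k ≤ m) (h : Chain z p T m γ) : Chain z p T k γ := by
  induction m generalizing γ k with
  | zero => obtain rfl : k = 0 := by omega
            exact h
  | succ m ih =>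
    cases k with
    | zero => exact h.memLp hT
    | succ k =>
      obtain ⟨h0, γ', h1, h'⟩ := h
      exact ⟨h0, γ', ih (by omega) h1, h'⟩

lemma add (h : Chain z p T m γ) (h' : Chain z p T m δ) : Chain z p T m fun t => γ t + δ t := by
  induction m generalizing γ δ with
  | zero => exact MemLp.add h h'
  | succ m ih =>
    obtain ⟨h0, γ', h1, h2⟩ := h
    obtain ⟨h0', δ', h1', h2'⟩ := h'
    exact ⟨fun hz => by beta_reduce; rw [h0 hz, h0' hz, add_zero], _, ih h1 h1', h2.add h2'⟩

lemma mul (hT : 0 ≤ T) (h : Chain False ⊤ T m κ) (h' : Chain z p T m γ) :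
    Chain z p T m fun t => κ t * γ t := by
  induction m generalizing κ γ with
  | zero => exact MemLp.mul (p := ⊤) (q := p) h' h
  | succ m ih =>
    obtain ⟨-, κ', h1, h2⟩ := id h
    obtain ⟨h0', γ', h1', h2'⟩ := id h'
    exact ⟨fun hz => by beta_reduce; rw [h0' hz, mul_zero], _,
      (ih h1 (h'.mono hT m.le_succ)).add (ih (h.mono hT m.le_succ) h1'), h2.mul h2'⟩

lemma const (T a : ℝ) (m : ℕ) : Chain False ⊤ T m fun _ => a := by
  induction m generalizing a with
  | zero => exact memLp_const a
  | succ m ih => exact ⟨False.elim, _, ih 0, .const T a⟩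

lemma neg (hT : 0 ≤ T) (h : Chain z p T m γ) : Chain z p T m fun t => -γ t := by
  simpa using (const T (-1) m).mul hT h

/-- In `(κ⁻¹)' = -κ' κ⁻²` the right side involves `κ⁻¹` with one derivative less, which the
induction supplies. -/
lemma inv (hT : 0 ≤ T) {a : ℝ} (ha : 0 < a) (hκ : ∀ t ∈ Icc 0 T, a ≤ κ t) (hc : ContinuousOn κ (Icc 0 T))
    (h : Chain False ⊤ T m κ) : Chain False ⊤ T m fun t => (κ t)⁻¹ := by
  induction m with
  | zero =>
    refine memLp_top_of_bound (((hc.inv₀ fun t ht => (ha.trans_le (hκ t ht)).ne').mono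
      Ioo_subset_Icc_self).aestronglyMeasurable measurableSet_Ioo) a⁻¹ ?_
    refine ae_restrict_of_forall_mem measurableSet_Ioo (fun t ht => ?_)
    have := hκ t (Ioo_subset_Icc_self ht)
    rw [norm_inv, norm_of_nonneg (ha.le.trans this)]
    gcongr
  | succ m ih =>
    have hi := ih (h.mono hT m.le_succ)
    obtain ⟨-, κ', h1, h2⟩ := h
    exact ⟨False.elim, _, (h1.mul hT (hi.mul hT hi)).neg hT, h2.inv ha hT hκ (h1.memLp hT)⟩

lemma of_seq {D : ℕ → ℝ → ℝ} (h : ∀ k ≤ m, MemLp (D k) p vol(Ioo 0 T))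
    (h' : ∀ k < m, IsPrimitive T (D k) (D (k + 1))) (h0 : z → ∀ k < m, D k 0 = 0) :
    Chain z p T m (D 0) := by
  induction m generalizing D with
  | zero => exact h 0 le_rfl
  | succ m ih =>
    exact ⟨fun hz => h0 hz 0 (by omega), D 1, ih (D := fun k => D (k + 1)) (fun k hk => h _ (by omega))
      (fun k hk => h' _ (by omega)) fun hz k hk => h0 hz _ (by omega), h' 0 (by omega)⟩

end Chain

/-- The continuous derivative is continued past the ends of the interval, where the fundamental
theorem then applies; the value at `t = 0` is what the compatibility conditions speak about. -/
lemma IsPrimitive.derivWithin_eq {T : ℝ} (hT : 0 < T) {γ γ' : ℝ → ℝ} (h : IsPrimitive T γ γ')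
    (hc : ContinuousOn γ' (Icc 0 T)) {t : ℝ} (ht : t ∈ Icc 0 T) :
    derivWithin γ (Icc 0 T) t = γ' t := by
  have h0 : (0 : ℝ) ∈ Icc 0 T := left_mem_Icc.2 hT.le
  have hext : Continuous (IccExtend hT.le (domRestrict (Icc 0 T) γ')) :=
    hc.domRestrict.Icc_extend'
  have h1 : HasDerivAt (fun t => γ 0 + ∫ r in 0..t, IccExtend hT.le (domRestrict (Icc 0 T) γ') r)
      (IccExtend hT.le (domRestrict (Icc 0 T) γ') t) t :=
    (integral_hasDerivAt_right (hext.intervalIntegrable _ _)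
      (hext.stronglyMeasurableAtFilter _ _) hext.continuousAt).const_add _
  have e : ∀ r ∈ Icc 0 T, IccExtend hT.le (domRestrict (Icc 0 T) γ') r = γ' r := fun r hr => by
    rw [IccExtend_of_mem _ _ hr]; rfl
  rw [e t ht] at h1
  have h2 : HasDerivWithinAt γ (γ' t) (Icc 0 T) t := by
    have hs : ∀ s ∈ Icc 0 T, γ s = γ 0 + ∫ r in 0..s, IccExtend hT.le (domRestrict (Icc 0 T) γ') r := by
      intro s hs
      have := h.sub_eq_integral h0 hs
      rw [integral_congr (g := γ')]
      · linarith
      · intro r hr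
        rw [uIcc_of_le hs.1] at hr
        exact e r ⟨hr.1, hr.2.trans hs.2⟩
    exact h1.hasDerivWithinAt.congr hs (hs t ht)
  exact h2.derivWithin (uniqueDiffOn_Icc hT t ht)

lemma IsTimeTest.iteratedDeriv {T : ℝ} {θ : ℝ → ℝ} (h : IsTimeTest T θ) (k : ℕ) :
    IsTimeTest T (iteratedDeriv k θ) := by
  induction k with
  | zero => simpa using h
  | succ k ih =>
    rw [iteratedDeriv_succ]
    exact ⟨(contDiff_infty_iff_deriv.1 ih.1).2, ih.2.1.deriv, (tsupport_deriv_subset (𝕜 := ℝ)).trans ih.2.2⟩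

lemma IsTimeTest.deriv {T : ℝ} {θ : ℝ → ℝ} (h : IsTimeTest T θ) : IsTimeTest T (deriv θ) := by
  simpa using h.iteratedDeriv 1

/-- Each weak derivative of order below `m` has an absolutely continuous representative. Being
continuous, these are the iterated one-sided derivatives of `γ`, so zeros at `t = 0` stated for
`iteratedDerivWithin` pass to them. -/
lemma chain_of_weak {z : Prop} {p : ℝ≥0∞} (hp : 1 ≤ p) {T : ℝ} (hT : 0 < T) {m : ℕ} {γ : ℝ → ℝ}
    (hc : ContinuousOn γ (Icc 0 T)) (G : ℕ → ℝ → ℝ) (hG : ∀ k ≤ m, MemLp (G k) p vol(Ioo 0 T))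
    (h : ∀ k ≤ m, ∀ θ, IsTimeTest T θ →
      ∫ t in Ioo 0 T, γ t * iteratedDeriv k θ t = (-1) ^ k * ∫ t in Ioo 0 T, G k t * θ t)
    (h0 : z → ∀ k < m, iteratedDerivWithin k γ (Icc 0 T) 0 = 0) : Chain z p T m γ := by
  have hi : ∀ k ≤ m, IntegrableOn (G k) (Ioo 0 T) := fun k hk => (hG k hk).integrable hp
  have hD : ∀ k, ∃ δ, (k < m → IsPrimitive T δ (G (k + 1))) ∧ (k ≤ m → G k =ᵐ[vol(Ioo 0 T)] δ) := by
    intro k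
    by_cases hk : k < m
    · obtain ⟨δ, h1, h2⟩ := exists_isPrimitive_ae hT (hi k hk.le) (hi (k + 1) hk) fun θ hθ => by
        have e1 := h k hk.le _ hθ.deriv
        have e2 := h (k + 1) hk θ hθ
        rw [iteratedDeriv_succ'] at e2
        have hu : ((-1 : ℝ) ^ k) * (-1) ^ k = 1 := by rw [← mul_pow]; norm_num
        rw [e2] at e1
        have := congrArg (fun x => (-1 : ℝ) ^ k * x) e1
        simp only [← mul_assoc, pow_succ, hu, one_mul] at this
        linarith
      exact ⟨δ, fun _ => h1, fun _ => h2⟩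
    · exact ⟨G k, fun h => absurd h hk, fun _ => EventuallyEq.rfl⟩
  choose D hD1 hD2 using hD
  -- At order zero the representative must be `γ` itself, not merely a function equal to it almost
  -- everywhere.
  set E : ℕ → ℝ → ℝ := fun k => if k = 0 then γ else D k with hE
  have hE0 : E 0 = γ := rfl
  have hγG : γ =ᵐ[vol(Ioo 0 T)] G 0 := by
    have key : ∀ᵐ t, t ∈ Ioo 0 T → γ t - G 0 t = 0 := by
      refine isOpen_Ioo.ae_eq_zero_of_integral_contDiff_smul_eq_zero
        (((hc.integrableOn_Ioo).sub (hi 0 (Nat.zero_le _))).locallyIntegrableOn)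
        fun ψ p1 p2 p3 => ?_
      have hψ : IsTimeTest T ψ := ⟨p1, p2, p3⟩
      have e1 : ∫ t, ψ t • (γ t - G 0 t) = ∫ t in Ioo 0 T, ψ t • (γ t - G 0 t) :=
        (setIntegral_eq_integral_of_forall_compl_eq_zero fun z hz => by rw [hψ.vanish hz, zero_smul]).symm
      have e2 := h 0 (Nat.zero_le _) ψ hψ
      rw [e1]
      simp only [smul_eq_mul, mul_comm (ψ _), sub_mul]
      simp only [iteratedDeriv_zero, pow_zero, one_mul] at e2
      rw [integral_sub (hψ.integrable_mul (hc.integrableOn_Ioo))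
        (hψ.integrable_mul (hi 0 (Nat.zero_le _))), e2, sub_self]
    rw [EventuallyEq, ae_restrict_iff' measurableSet_Ioo]
    filter_upwards [key] with t ht hm
    linarith [ht hm]
  have hEG : ∀ k ≤ m, G k =ᵐ[vol(Ioo 0 T)] E k := by
    intro k hk
    cases k with
    | zero => exact hγG.symm
    | succ k => exact hD2 _ hk
  have hEP : ∀ k < m, IsPrimitive T (E k) (E (k + 1)) := by
    intro k hk
    refine IsPrimitive.congr_right ?_ (hEG (k + 1) hk)
    cases k with
    | zero =>
      have hδ := hD1 0 hk
      refine hδ.congr_left hT.le fun t ht => ?_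
      have h1 : EqOn γ (D 0) (Ioo 0 T) := Measure.eqOn_open_of_ae_eq (hγG.trans (hD2 0 hk.le))
        isOpen_Ioo (hc.mono Ioo_subset_Icc_self) ((hδ.continuousOn hT.le).mono Ioo_subset_Icc_self)
      exact (h1.of_subset_closure hc (hδ.continuousOn hT.le) Ioo_subset_Icc_self
        (by rw [closure_Ioo hT.ne]) ht).symm
    | succ k => exact hD1 _ hk
  have hEc : ∀ k < m, ContinuousOn (E k) (Icc 0 T) := fun k hk => (hEP k hk).continuousOn hT.le
  have hEd : ∀ k < m, ∀ t ∈ Icc 0 T, iteratedDerivWithin k γ (Icc 0 T) t = E k t := by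
    intro k
    induction k with
    | zero => intro _ t _; rw [iteratedDerivWithin_zero, hE0]
    | succ k ih =>
      intro hk t ht
      rw [iteratedDerivWithin_succ, derivWithin_congr (ih (by omega)) (ih (by omega) t ht)]
      exact (hEP k (by omega)).derivWithin_eq hT (hEc _ hk) ht
  rw [← hE0]
  refine Chain.of_seq (fun k hk => (hG k hk).ae_eq (hEG k hk)) hEP fun hz k hk => ?_
  rw [← hEd k hk 0 (left_mem_Icc.2 hT.le)]
  exact h0 hz k hk

/-! ### Regularity of potentials -/

/-- `(c⁻¹ ∂_t)^k b` vanishes at `t = 0` for `k < q` and is in `L²` for `k = q`. -/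
def DataChain (c : ℝ → ℝ) (T : ℝ) : ℕ → (ℝ → ℝ) → Prop
  | 0, b => MemLp b 2 vol(Ioo 0 T)
  | q + 1, b => ∃ b₁, DataChain c T q b₁ ∧ ∀ t ∈ Icc 0 T, b t = ∫ r in 0..t, c r * b₁ r

/-- Each link is `b ↦ c⁻¹ b'`. The first one differentiates `b` before `c⁻¹` enters, so `c⁻¹` needs
one derivative less than `b`. -/
lemma DataChain.of_chain {c : ℝ → ℝ} (hc : ∀ t, c t ≠ 0) {T : ℝ} (hT : 0 ≤ T) {q : ℕ} {b : ℝ → ℝ}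
    (hκ : Chain False ⊤ T (q - 1) fun t => (c t)⁻¹) (h : Chain True 2 T q b) : DataChain c T q b := by
  induction q generalizing b with
  | zero => exact h
  | succ q ih =>
    obtain ⟨h0, b', h1, h2⟩ := h
    refine ⟨fun t => (c t)⁻¹ * b' t, ih (hκ.mono hT (by simp)) (hκ.mul hT h1), fun t ht => ?_⟩
    have := h2.sub_eq_integral (left_mem_Icc.2 hT) ht
    rw [h0 trivial, sub_zero] at this
    rw [this]
    congr 1; ext r
    rw [mul_inv_cancel_left₀ (hc r)]

lemma IsSup.congr {T : ℝ} {u w : ℝ² → ℝ} (h : IsSup T u) (he : EqOn u w (strip T)) : IsSup T w := by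
  refine ⟨h.1.congr (ae_restrict_of_forall_mem (measurableSet_strip T) (he)), fun N => ?_⟩
  obtain ⟨B, hB⟩ := h.2 N
  refine ⟨B, ?_⟩
  filter_upwards [hB, ae_restrict_mem measurableSet_Ioo] with t ht htm
  refine le_of_eq_of_le (setLIntegral_congr_fun measurableSet_Ioi fun ξ hξ => ?_) ht
  simp only [weighted, he (show (t, ξ) ∈ strip T from ⟨htm, hξ⟩)]

lemma IsSq.congr {T : ℝ} {u w : ℝ² → ℝ} (h : IsSq T u) (he : u =ᵐ[vol(strip T)] w) :
    IsSq T w := by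
  refine ⟨h.1.congr he, fun N => ?_⟩
  refine lt_of_eq_of_lt (lintegral_congr_ae ?_) (h.2 N)
  filter_upwards [he] with z hz
  simp only [weighted, hz]

lemma IsSup.mul_time {T : ℝ} {w : ℝ² → ℝ} {P : ℝ → ℝ} (hw : IsSup T w)
    (hP : MemLp P ⊤ vol(Ioo 0 T)) : IsSup T fun z => P z.1 * w z := by
  refine ⟨AEStronglyMeasurable.mul ?_ hw.1, fun N => ?_⟩
  · rw [volume_restrict_strip]
    exact hP.1.comp_fst
  · obtain ⟨B, hB⟩ := hw.2 N
    have hlt : eLpNormEssSup P vol(Ioo 0 T) < ⊤ := by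
      have := hP.2; rwa [eLpNorm_exponent_top] at this
    set K := (eLpNormEssSup P vol(Ioo 0 T)).toNNReal with hK
    refine ⟨K ^ 2 * B, ?_⟩
    filter_upwards [hB, ae_le_eLpNormEssSup (f := P) (μ := vol(Ioo 0 T))] with t ht hPt
    rw [← coe_toNNReal hlt.ne] at hPt
    have e : ∀ ξ, ‖weighted N (fun z => P z.1 * w z) (t, ξ)‖ₑ ^ 2 =
        ‖P t‖ₑ ^ 2 * ‖weighted N w (t, ξ)‖ₑ ^ 2 := fun ξ => by
      rw [← mul_pow, ← enorm_mul]
      congr 2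
      simp only [weighted]; ring
    simp only [e]
    rw [lintegral_const_mul' _ _ (by simp)]
    push_cast
    gcongr

lemma IsSq.mul_time {T : ℝ} {w : ℝ² → ℝ} {P : ℝ → ℝ} (hw : IsSq T w)
    (hP : MemLp P ⊤ vol(Ioo 0 T)) : IsSq T fun z => P z.1 * w z := by
  refine ⟨AEStronglyMeasurable.mul ?_ hw.1, fun N => ?_⟩
  · rw [volume_restrict_strip]
    exact hP.1.comp_fst
  · have hlt : eLpNormEssSup P vol(Ioo 0 T) < ⊤ := by
      have := hP.2; rwa [eLpNorm_exponent_top] at this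
    have h1 : ∀ᵐ z ∂vol(strip T), ‖P z.1‖ₑ ≤ eLpNormEssSup P vol(Ioo 0 T) := by
      rw [volume_restrict_strip]
      exact Measure.quasiMeasurePreserving_fst.ae (ae_le_eLpNormEssSup (f := P))
    calc _ ≤ ∫⁻ z in strip T, eLpNormEssSup P vol(Ioo 0 T) ^ 2 * ‖weighted N w z‖ₑ ^ 2 := by
          refine lintegral_mono_ae ?_
          filter_upwards [h1] with z hz
          have e : weighted N (fun z => P z.1 * w z) z = P z.1 * weighted N w z := by
            simp only [weighted]; ring
          rw [e, enorm_mul, mul_pow]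
          gcongr
      _ < ⊤ := by
          rw [lintegral_const_mul' _ _ (ENNReal.pow_ne_top hlt.ne)]
          exact mul_lt_top (ENNReal.pow_lt_top hlt) (hw.2 N)

namespace IsCoeff
variable {c : ℝ → ℝ} {c₀ c₁ : ℝ} (hc : IsCoeff c c₀ c₁)
include hc

lemma isPrimitive_data {T : ℝ} (hT : 0 ≤ T) {b b₁ : ℝ → ℝ} (hb₁ : IntegrableOn b₁ (Ioo 0 T))
    (hb : ∀ t ∈ Icc 0 T, b t = ∫ r in 0..t, c r * b₁ r) :
    IsPrimitive T b (fun r => c r * b₁ r) := by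
  refine .of_integral hT (hc.integrableOn_mul hb₁) fun t ht => ?_
  rw [hb t ht, hb 0 (left_mem_Icc.2 hT), intervalIntegral.integral_same, zero_add]

lemma memLp_of_dataChain {T : ℝ} (hT : 0 ≤ T) {q : ℕ} {b : ℝ → ℝ} (h : DataChain c T q b) :
    MemLp b 2 vol(Ioo 0 T) := by
  induction q generalizing b with
  | zero => exact h
  | succ q ih =>
    obtain ⟨b₁, h1, h2⟩ := h
    exact ((hc.isPrimitive_data hT (integrableOn_of_memLp_two (ih h1)) h2).memLp_top hT).mono_exponent le_top

/-- Every link of the chain removes two space derivatives. What is left is order 0, or order 1 for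
data that still have a link and are therefore continuous and bounded. -/
lemma isSup_pot_of_dataChain {T : ℝ} (hT : 0 ≤ T) {q : ℕ} {b : ℝ → ℝ} (h : DataChain c T q b) {j : ℕ}
    (hj : j ≤ 2 * q) : IsSup T fun z => pot c T b j z.1 z.2 := by
  induction q generalizing b j with
  | zero => obtain rfl : j = 0 := by omega
            exact hc.isSup_pot_zero h
  | succ q ih =>
    have hb := hc.memLp_of_dataChain hT h
    obtain ⟨b₁, h1, h2⟩ := h
    have hb₁ := integrableOn_of_memLp_two (hc.memLp_of_dataChain hT h1)
    match j, hj with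
    | 0, _ => exact hc.isSup_pot_zero hb
    | 1, _ =>
      have hp := hc.isPrimitive_data hT hb₁ h2
      obtain ⟨C, hC⟩ := isCompact_Icc.exists_bound_of_continuousOn (hp.continuousOn hT)
      exact hc.isSup_pot_one hb.1 fun r hr => hC r (Ioo_subset_Icc_self hr)
    | j + 2, hj =>
      exact (ih h1 (j := j) (by omega)).congr fun z hz =>
        (hc.pot_add_two hb₁ h2 j (Ioo_subset_Icc_self hz.1) hz.2).symm

/-- Only the top order `2q + 1` is new: it reduces to order one with data that are no better than
square integrable. -/
lemma isSq_pot_of_dataChain {T : ℝ} (hT : 0 ≤ T) {q : ℕ} {b : ℝ → ℝ} (h : DataChain c T q b) {j : ℕ}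
    (hj : j ≤ 2 * q + 1) : IsSq T fun z => pot c T b j z.1 z.2 := by
  rcases Nat.lt_or_ge j (2 * q + 1) with hlt | hge
  · exact (hc.isSup_pot_of_dataChain hT h (by omega)).isSq
  obtain rfl : j = 2 * q + 1 := by omega
  induction q generalizing b with
  | zero => exact hc.isSq_pot_one h
  | succ q ih =>
    obtain ⟨b₁, h1, h2⟩ := h
    have hb₁ := integrableOn_of_memLp_two (hc.memLp_of_dataChain hT h1)
    refine (ih h1 le_rfl le_rfl).congr (ae_restrict_of_forall_mem (measurableSet_strip T) (fun z hz => ?_))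
    exact (hc.pot_add_two hb₁ h2 (2 * q + 1) (Ioo_subset_Icc_self hz.1) hz.2).symm

end IsCoeff

/-! ### Weak derivatives from classical ones -/

lemma IsTest.integrableOn_mul {T : ℝ} {φ w : ℝ² → ℝ} (h : IsTest T φ)
    (hw : LocallyIntegrableOn w (strip T)) :
    Integrable (fun z => w z * φ z) (vol(Ioo 0 T).prod vol(ℝ₊)) := by
  rw [← volume_restrict_strip]
  exact h.integrable hw

lemma IsTest.time_slice {T : ℝ} {φ : ℝ² → ℝ} (h : IsTest T φ) (ξ : ℝ) :
    IsTimeTest T fun t => φ (t, ξ) := by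
  have hsub : tsupport (fun t => φ (t, ξ)) ⊆ Prod.fst '' tsupport φ :=
    closure_minimal (fun t ht => ⟨(t, ξ), subset_tsupport _ ht, rfl⟩) (h.2.1.image continuous_fst).isClosed
  refine ⟨h.1.comp (contDiff_id.prodMk contDiff_const),
    (h.2.1.image continuous_fst).of_isClosed_subset (isClosed_tsupport _) hsub, hsub.trans ?_⟩
  rintro _ ⟨z, hz, rfl⟩
  exact (h.2.2 hz).1

lemma isWeakDeriv_time_of_slices {T : ℝ} {w w' : ℝ² → ℝ} (hw : LocallyIntegrableOn w (strip T))
    (hw' : LocallyIntegrableOn w' (strip T)) (h : ∀ᵐ ξ ∂vol(ℝ₊), ∀ θ, IsTimeTest T θ →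
      ∫ t in Ioo 0 T, w (t, ξ) * deriv θ t = -∫ t in Ioo 0 T, w' (t, ξ) * θ t) :
    IsWeakDeriv T 1 0 w w' := by
  refine ⟨hw, hw', fun φ hφ => ?_⟩
  rw [mixedDeriv_one_zero hφ.1, volume_restrict_strip, integral_prod_symm _ (hφ.dT.integrableOn_mul hw),
    integral_prod_symm _ (hφ.integrableOn_mul hw'), ← integral_const_mul]
  refine integral_congr_ae ?_
  filter_upwards [h] with ξ hξ
  have := hξ _ (hφ.time_slice ξ)
  have e : ∀ t, deriv (fun t => φ (t, ξ)) t = dT φ (t, ξ) := fun t => (hasDerivAt_dT hφ.1 t ξ).deriv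
  simp only [e] at this
  rw [this]; norm_num

/-- The product, extended by zero, is differentiable on the whole line with integrable derivative,
and the integral of that derivative is zero. -/
lemma integral_mul_deriv_eq_neg {U : Set ℝ} {f f' θ θ' : ℝ → ℝ}
    (hf : ∀ x ∈ U, HasDerivAt f (f' x) x) (hf' : ContinuousOn f' U) (hθ : ∀ x, HasDerivAt θ (θ' x) x)
    (hθ' : Continuous θ') (hc : HasCompactSupport θ) (hs : tsupport θ ⊆ U) :
    ∫ x in U, f x * θ' x = -∫ x in U, f' x * θ x := by
  have hde : θ' = deriv θ := funext fun x => (hθ x).deriv.symm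
  have hts : tsupport θ' ⊆ tsupport θ := hde ▸ tsupport_deriv_subset
  have hfc : ContinuousOn f U := fun x hx => (hf x hx).continuousAt.continuousWithinAt
  have i1 : Integrable fun x => f x * θ' x := by
    refine (integrableOn_iff_integrable_of_support_subset (s := tsupport θ) ?_).1 ?_
    · exact (Function.support_mul_subset_right _ _).trans ((subset_tsupport _).trans hts)
    · exact ((hfc.mono hs).mul hθ'.continuousOn).integrableOn_compact hc
  have hθc : Continuous θ := continuous_iff_continuousAt.2 fun x => (hθ x).continuousAt
  have i2 : Integrable fun x => f' x * θ x := by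
    refine (integrableOn_iff_integrable_of_support_subset (s := tsupport θ) ?_).1 ?_
    · exact (Function.support_mul_subset_right _ _).trans (subset_tsupport _)
    · exact ((hf'.mono hs).mul hθc.continuousOn).integrableOn_compact hc
  have i3 : Integrable fun x => f x * θ x := by
    refine (integrableOn_iff_integrable_of_support_subset (s := tsupport θ) ?_).1 ?_
    · exact (Function.support_mul_subset_right _ _).trans (subset_tsupport _)
    · exact ((hfc.mono hs).mul hθc.continuousOn).integrableOn_compact hc
  have hz : ∀ x, x ∉ tsupport θ → θ x = 0 := fun x hx => image_eq_zero_of_notMem_tsupport hx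
  have hz' : ∀ x, x ∉ tsupport θ → θ' x = 0 := fun x hx =>
    image_eq_zero_of_notMem_tsupport fun h => hx (hts h)
  have hder : ∀ x, HasDerivAt (fun x => f x * θ x) (f' x * θ x + f x * θ' x) x := by
    intro x
    by_cases hx : x ∈ tsupport θ
    · exact (hf x (hs hx)).mul (hθ x)
    · rw [hz x hx, hz' x hx, mul_zero, mul_zero, add_zero]
      refine (hasDerivAt_const x (0 : ℝ)).congr_of_eventuallyEq ?_
      filter_upwards [(isClosed_tsupport θ).isOpen_compl.mem_nhds hx] with y hy
      rw [hz y hy, mul_zero]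
  have h0 := integral_eq_zero_of_hasDerivAt_of_integrable hder (i2.add i1) i3
  rw [integral_add i2 i1] at h0
  rw [setIntegral_eq_integral_of_forall_compl_eq_zero fun x hx => by rw [hz' x fun h => hx (hs h), mul_zero],
    setIntegral_eq_integral_of_forall_compl_eq_zero fun x hx => by rw [hz x fun h => hx (hs h), mul_zero]]
  linarith

lemma isWeakDeriv_space_of_hasDerivAt {T : ℝ} {w w' : ℝ² → ℝ}
    (l1 : LocallyIntegrableOn w (strip T)) (l2 : LocallyIntegrableOn w' (strip T))
    (hw' : ∀ t ∈ Ioo 0 T, ContinuousOn (fun ξ => w' (t, ξ)) (Ioi 0))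
    (h : ∀ t ∈ Ioo 0 T, ∀ ξ, 0 < ξ → HasDerivAt (fun ξ => w (t, ξ)) (w' (t, ξ)) ξ) :
    IsWeakDeriv T 0 1 w w' := by
  refine ⟨l1, l2, fun φ hφ => ?_⟩
  rw [mixedDeriv_zero_one hφ.1, volume_restrict_strip, integral_prod _ (hφ.dX.integrableOn_mul l1),
    integral_prod _ (hφ.integrableOn_mul l2), ← integral_const_mul]
  refine setIntegral_congr_fun measurableSet_Ioo fun t ht => ?_
  have hsub : tsupport (fun ξ => φ (t, ξ)) ⊆ Prod.snd '' tsupport φ :=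
    closure_minimal (fun ξ hξ => ⟨(t, ξ), subset_tsupport _ hξ, rfl⟩) (hφ.2.1.image continuous_snd).isClosed
  have hm : Continuous fun ξ : ℝ => (t, ξ) := by fun_prop
  have := integral_mul_deriv_eq_neg (fun ξ hξ => h t ht ξ hξ) (hw' t ht) (fun ξ => hasDerivAt_dX hφ.1 t ξ)
    ((contDiff_dX hφ.1).continuous.comp hm)
    ((hφ.2.1.image continuous_snd).of_isClosed_subset (isClosed_tsupport _) hsub)
    (hsub.trans (by rintro _ ⟨z, hz, rfl⟩; exact (hφ.2.2 hz).2))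
  simp only [zero_add, pow_one, neg_one_mul]
  exact this

lemma locallyIntegrableOn_fst {T : ℝ} {P : ℝ → ℝ} (hP : IntegrableOn P (Ioo 0 T)) :
    LocallyIntegrableOn (fun z => P z.1) (strip T) := by
  rw [locallyIntegrableOn_iff (isOpen_strip T).isLocallyClosed]
  intro k hk hk'
  obtain ⟨R, hR⟩ := (hk'.image continuous_snd).bddAbove
  have hsub : k ⊆ Ioo 0 T ×ˢ Icc 0 R := fun z hz =>
    ⟨(hk hz).1, (hk hz).2.le, hR ⟨z, hz, rfl⟩⟩
  refine IntegrableOn.mono_set ?_ hsub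
  rw [IntegrableOn, volume_eq_prod, ← prod_restrict]
  exact Integrable.comp_fst hP _

/-- The time derivative of the product of a function of time and a classically differentiable one. -/
lemma isWeakDeriv_time_mul {T : ℝ} (hT : 0 ≤ T) {P P' : ℝ → ℝ} {U U' : ℝ² → ℝ}
    (hP : IsPrimitive T P P') (hU : ContinuousOn U (Icc 0 T ×ˢ Ioi 0))
    (hU' : ContinuousOn U' (Icc 0 T ×ˢ Ioi 0))
    (h : ∀ t ∈ Icc 0 T, ∀ ξ, 0 < ξ → HasDerivAt (fun t => U (t, ξ)) (U' (t, ξ)) t) :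
    IsWeakDeriv T 1 0 (fun z => P z.1 * U z) (fun z => P' z.1 * U z + P z.1 * U' z) := by
  have hsub : strip T ⊆ Icc 0 T ×ˢ Ioi 0 := prod_mono_left Ioo_subset_Icc_self
  have hPl := locallyIntegrableOn_fst ((hP.continuousOn hT).integrableOn_Ioo)
  have hPl' := locallyIntegrableOn_fst (hP.integrableOn hT)
  have l1 := hPl.mul_continuousOn (hU.mono hsub) (isOpen_strip T).isLocallyClosed
  have l2 := hPl.mul_continuousOn (hU'.mono hsub) (isOpen_strip T).isLocallyClosed
  have l3 := hPl'.mul_continuousOn (hU.mono hsub) (isOpen_strip T).isLocallyClosed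
  refine isWeakDeriv_time_of_slices l1 (l3.add l2) ?_
  refine ae_restrict_of_forall_mem measurableSet_Ioi (fun ξ hξ θ hθ => ?_)
  have hm : Continuous fun t : ℝ => (t, ξ) := by fun_prop
  have hUp : IsPrimitive T (fun t => U (t, ξ)) (fun t => U' (t, ξ)) :=
    .of_hasDerivAt hT (fun t ht => h t ht ξ hξ) (hU'.comp hm.continuousOn fun t ht => ⟨ht, hξ⟩)
  exact (hP.mul hUp).integral_mul_eq (hθ.isPrimitive hT) hT (hθ.vanish (by simp)) (hθ.vanish (by simp))

/-! ### Weak derivatives of the potential -/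

namespace IsCoeff
variable {c : ℝ → ℝ} {c₀ c₁ : ℝ} (hc : IsCoeff c c₀ c₁)
include hc

lemma isWeakDeriv_mul_pot_space {T : ℝ} {b P : ℝ → ℝ} (hb : IntegrableOn b (Ioo 0 T))
    (hP : IntegrableOn P (Ioo 0 T)) (j l : ℕ) :
    IsWeakDeriv T 0 l (fun z => P z.1 * pot c T b j z.1 z.2) (fun z => P z.1 * pot c T b (j + l) z.1 z.2) := by
  have hloc : ∀ j, LocallyIntegrableOn (fun z => P z.1 * pot c T b j z.1 z.2) (strip T) :=
    fun j => (locallyIntegrableOn_fst hP).mul_continuousOn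
      ((hc.continuousOn_pot hb j).mono (prod_mono_left (subset_univ _))) (isOpen_strip T).isLocallyClosed
  induction l with
  | zero => exact .refl (hloc j)
  | succ l ih =>
    have := ih.comp (isWeakDeriv_space_of_hasDerivAt (hloc _) (hloc (j + l + 1))
      (fun t _ ξ hξ => ((hc.hasDerivAt_pot_space hb (j + l + 1) t hξ).const_mul
        (P t)).continuousAt.continuousWithinAt)
      fun t _ ξ hξ => (hc.hasDerivAt_pot_space hb (j + l) t hξ).const_mul (P t))
    rwa [zero_add, add_comm 1] at this

lemma isWeakDeriv_pot_time {T : ℝ} (hT : 0 ≤ T) {b : ℝ → ℝ} (hb : IntegrableOn b (Ioo 0 T)) {P P' : ℝ → ℝ}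
    (hP : IsPrimitive T P P') (j : ℕ) :
    IsWeakDeriv T 1 0 (fun z => P z.1 * pot c T b j z.1 z.2)
      (fun z => P' z.1 * pot c T b j z.1 z.2 + P z.1 * c z.1 * pot c T b (j + 2) z.1 z.2) := by
  have hcont : ∀ j, ContinuousOn (fun z => pot c T b j z.1 z.2) (Icc 0 T ×ˢ Ioi 0) := fun j =>
    (hc.continuousOn_pot hb j).mono (prod_mono_left (subset_univ _))
  have := isWeakDeriv_time_mul hT hP (hcont j)
    ((hc.cont.comp continuous_fst).continuousOn.mul (hcont (j + 2)))
    fun t _ ξ hξ => hc.hasDerivAt_pot_time hb j t hξ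
  simpa only [mul_assoc, Pi.mul_apply, Function.comp_apply] using this

/-- A time derivative either falls on the coefficient `P` or raises the order of the potential by
two and produces a factor `c`. Hence `i` of them lead to orders at most `j + l + 2i`, and the
induction has to let `P` and `j` vary. -/
lemma exists_isWeakDeriv_pot {T : ℝ} (hT : 0 ≤ T) {b : ℝ → ℝ} (hb : IntegrableOn b (Ioo 0 T)) (i : ℕ)
    (hci : Chain False ⊤ T i c) {P : ℝ → ℝ} (hP : Chain False ⊤ T i P) (j : ℕ) :
    ∃ w : ℕ → ℝ² → ℝ, ∀ l, IsWeakDeriv T i l (fun z => P z.1 * pot c T b j z.1 z.2) (w l) ∧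
      ((∀ q ≤ j + l + 2 * i, IsSup T fun z => pot c T b q z.1 z.2) → IsSup T (w l)) ∧
      ((∀ q ≤ j + l + 2 * i, IsSq T fun z => pot c T b q z.1 z.2) → IsSq T (w l)) := by
  induction i generalizing P j with
  | zero =>
    have hP' : MemLp P ⊤ vol(Ioo 0 T) := hP
    exact ⟨_, fun l => ⟨hc.isWeakDeriv_mul_pot_space hb (hP'.integrable le_top) j l,
      fun h => (h _ le_rfl).mul_time hP', fun h => (h _ le_rfl).mul_time hP'⟩⟩
  | succ i ih =>
    obtain ⟨-, P', h1, h2⟩ := id hP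
    obtain ⟨w₁, H₁⟩ := ih (hci.mono hT i.le_succ) h1 j
    obtain ⟨w₂, H₂⟩ := ih (hci.mono hT i.le_succ)
      ((hP.mono hT i.le_succ).mul hT (hci.mono hT i.le_succ)) (j + 2)
    refine ⟨fun l z => w₁ l z + w₂ l z, fun l => ⟨?_, fun h => ?_, fun h => ?_⟩⟩
    · exact (hc.isWeakDeriv_pot_time hT hb h2 j).comp ((H₁ l).1.add (H₂ l).1)
    · exact ((H₁ l).2.1 fun q hq => h q (by omega)).add ((H₂ l).2.1 fun q hq => h q (by omega))
    · exact ((H₁ l).2.2 fun q hq => h q (by omega)).add ((H₂ l).2.2 fun q hq => h q (by omega))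

end IsCoeff

/-! ### A one-sided mollifier -/

/-- A smooth bump of integral one supported in `[1/4, 3/4]`. -/
noncomputable def bumpOne : ℝ → ℝ :=
  (⟨1 / 8, 1 / 4, by norm_num, by norm_num⟩ : ContDiffBump (1 / 2 : ℝ)).normed volume

/-- The rescaled bump, supported in `[ε/4, 3ε/4]`. -/
noncomputable def bump (ε x : ℝ) : ℝ := ε⁻¹ * bumpOne (ε⁻¹ * x)

lemma contDiff_bumpOne : ContDiff ℝ ∞ bumpOne := ContDiffBump.contDiff_normed _

lemma contDiff_bump (ε : ℝ) : ContDiff ℝ ∞ (bump ε) :=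
  contDiff_const.mul (contDiff_bumpOne.comp (contDiff_const.mul contDiff_id))

lemma continuous_bump (ε : ℝ) : Continuous (bump ε) := (contDiff_bump ε).continuous

lemma bumpOne_nonneg (x : ℝ) : 0 ≤ bumpOne x := ContDiffBump.nonneg_normed _ x

lemma bump_nonneg {ε : ℝ} (hε : 0 < ε) (x : ℝ) : 0 ≤ bump ε x :=
  mul_nonneg (inv_nonneg.2 hε.le) (bumpOne_nonneg _)

lemma bumpOne_eq_zero {x : ℝ} (hx : x ∉ Icc (1 / 4 : ℝ) (3 / 4)) : bumpOne x = 0 := by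
  refine image_eq_zero_of_notMem_tsupport fun h => hx ?_
  rw [bumpOne, ContDiffBump.tsupport_normed_eq, Real.closedBall_eq_Icc] at h
  norm_num at h ⊢
  exact h

lemma bump_eq_zero {ε x : ℝ} (hε : 0 < ε) (hx : x ∉ Icc (ε / 4) (3 * ε / 4)) : bump ε x = 0 := by
  rw [bump, bumpOne_eq_zero, mul_zero]
  rintro ⟨h1, h2⟩
  refine hx ⟨?_, ?_⟩
  · rw [le_inv_mul_iff₀ hε] at h1; linarith
  · rw [inv_mul_le_iff₀ hε] at h2; linarith

lemma bump_eq_zero_of_le {ε x : ℝ} (hε : 0 < ε) (hx : x ≤ 0) : bump ε x = 0 :=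
  bump_eq_zero hε fun h => by linarith [h.1]

lemma bump_eq_zero_of_ge {ε x : ℝ} (hε : 0 < ε) (hx : ε ≤ x) : bump ε x = 0 :=
  bump_eq_zero hε fun h => by linarith [h.2]

lemma integral_bump {ε : ℝ} (hε : 0 < ε) : ∫ x, bump ε x = 1 := by
  have h1 : ∫ x, bumpOne x = 1 := ContDiffBump.integral_normed _
  have := Measure.integral_comp_mul_left bumpOne ε⁻¹
  simp only [bump, integral_const_mul]
  rw [this, h1, inv_inv, abs_of_pos hε, smul_eq_mul, mul_one, inv_mul_cancel₀ hε.ne']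

lemma exists_bump_le : ∃ K : ℝ, 0 < K ∧ ∀ ε x : ℝ, 0 < ε → bump ε x ≤ K / ε := by
  have hc : HasCompactSupport bumpOne := ContDiffBump.hasCompactSupport_normed _
  obtain ⟨C, hC⟩ := hc.exists_bound_of_continuous contDiff_bumpOne.continuous
  have hC0 : 0 ≤ C := (norm_nonneg _).trans (hC 0)
  refine ⟨C + 1, by positivity, fun ε x hε => ?_⟩
  rw [bump, inv_mul_eq_div]
  gcongr
  linarith [(le_abs_self _).trans (hC (ε⁻¹ * x))]

lemma tsupport_bump_subset {ε : ℝ} (hε : 0 < ε) : tsupport (bump ε) ⊆ Icc (ε / 4) (3 * ε / 4) :=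
  closure_minimal (fun x hx => by
    by_contra h
    exact hx (bump_eq_zero hε h)) isClosed_Icc

lemma integrable_bump (ε : ℝ) (hε : 0 < ε) : Integrable (bump ε) :=
  (continuous_bump ε).integrable_of_hasCompactSupport
    (isCompact_Icc.of_isClosed_subset (isClosed_tsupport _) (tsupport_bump_subset hε))

lemma setIntegral_bump {ε : ℝ} (hε : 0 < ε) {s : Set ℝ} (hs : Ioo 0 ε ⊆ s) :
    ∫ x in s, bump ε x = 1 := by
  rw [← integral_bump hε]
  refine setIntegral_eq_integral_of_forall_compl_eq_zero fun x hx => ?_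
  rcases le_or_gt x 0 with h | h
  · exact bump_eq_zero_of_le hε h
  · exact bump_eq_zero_of_ge hε (by by_contra hcon; exact hx (hs ⟨h, not_le.1 hcon⟩))

/-- The bump lives in `(0,ε)`, so it concentrates at the endpoint from inside and picks out the
boundary value. -/
lemma tendsto_integral_bump {f : ℝ → ℝ} (hf : ContinuousOn f (Icc 0 1)) :
    Tendsto (fun ε => ∫ x in Ioo 0 1, f x * bump ε x) (𝓝[>] 0) (𝓝 (f 0)) := by
  have hi : IntegrableOn f (Ioo 0 1) := hf.integrableOn_Ioo
  rw [Metric.tendsto_nhds]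
  intro η hη
  have h0 := Metric.continuousWithinAt_iff.1 (hf 0 (left_mem_Icc.2 zero_le_one)) (η / 2) (by positivity)
  obtain ⟨δ, hδ, H⟩ := h0
  filter_upwards [Ioo_mem_nhdsGT (lt_min hδ one_pos)] with ε hε
  have hε1 : ε < 1 := hε.2.trans_le (min_le_right _ _)
  have hεδ : ε < δ := hε.2.trans_le (min_le_left _ _)
  have e1 := setIntegral_bump hε.1 (s := Ioo 0 1) (Ioo_subset_Ioo_right hε1.le)
  have ib : IntegrableOn (bump ε) (Ioo 0 1) := (integrable_bump ε hε.1).integrableOn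
  have ifb : IntegrableOn (fun x => f x * bump ε x) (Ioo 0 1) :=
    ((hf.mul (continuous_bump ε).continuousOn).integrableOn_Icc).mono_set Ioo_subset_Icc_self
  have e2 : (∫ x in Ioo 0 1, f x * bump ε x) - f 0 = ∫ x in Ioo 0 1, (f x - f 0) * bump ε x := by
    simp only [sub_mul]
    rw [integral_sub ifb (ib.const_mul _), integral_const_mul, e1, mul_one]
  rw [dist_eq, e2]
  calc _ ≤ ∫ x in Ioo 0 1, η / 2 * bump ε x := by
        rw [← norm_eq_abs]
        refine norm_integral_le_of_norm_le (ib.const_mul _) ?_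
        refine ae_restrict_of_forall_mem measurableSet_Ioo (fun x hx => ?_)
        rw [norm_mul, norm_of_nonneg (bump_nonneg hε.1 x)]
        rcases lt_or_ge x ε with h | h
        · have := H (Ioo_subset_Icc_self hx) (by
            rw [dist_eq, sub_zero, abs_of_pos hx.1]; exact h.trans hεδ)
          exact mul_le_mul_of_nonneg_right (le_of_lt this) (bump_nonneg hε.1 x)
        · rw [bump_eq_zero_of_ge hε.1 h, mul_zero, mul_zero]
    _ = η / 2 := by rw [integral_const_mul, e1, mul_one]
    _ < η := by linarith

/-! ### Traces -/

lemma memLp_two_iff_lintegral {α : Type*} [MeasurableSpace α] {μ : Measure α} {w : α → ℝ}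
    (hw : AEStronglyMeasurable w μ) : MemLp w 2 μ ↔ ∫⁻ z, ‖w z‖ₑ ^ 2 ∂μ < ⊤ := by
  have := eLpNorm_lt_top_iff_lintegral_rpow_enorm_lt_top (f := w) (μ := μ) (p := 2) (by norm_num) (by norm_num)
  simp only [ENNReal.toReal_ofNat, ENNReal.rpow_ofNat] at this
  rw [← this]
  exact ⟨fun h => h.2, fun h => ⟨hw, h⟩⟩

/-- The cutoff rises with slope `bump δ` and is brought back to zero by a second bump beyond `ξ =
1`. The two have equal mass, so the primitive has compact support, and the descent is invisible to
functions vanishing for `ξ ≥ 1`. -/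
lemma exists_cutoff {δ : ℝ} (hδ : δ ∈ Ioo 0 1) : ∃ ζ : ℝ → ℝ, IsTimeTest 2 ζ ∧
    (∀ ξ ≤ 1, deriv ζ ξ = bump δ ξ) ∧ (∀ ξ ∈ Icc 0 1, |ζ ξ| ≤ 1) ∧ ∀ ξ ∈ Icc δ 1, ζ ξ = 1 := by
  have hη : IsTimeTest 2 fun ξ => bump δ ξ - bump 1 (ξ - 1) := by
    have h1 : tsupport (bump δ) ⊆ Ioo 0 2 := (tsupport_bump_subset hδ.1).trans fun x hx =>
      ⟨by linarith [hx.1, hδ.1], by linarith [hx.2, hδ.2, hδ.1]⟩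
    have h2 : tsupport (fun ξ => bump 1 (ξ - 1)) ⊆ Icc (5 / 4) (7 / 4) := closure_minimal (fun x hx => by
      by_contra h
      refine hx (bump_eq_zero one_pos fun h' => h ⟨by linarith [h'.1], by linarith [h'.2]⟩)) isClosed_Icc
    have k1 : HasCompactSupport (bump δ) :=
      isCompact_Icc.of_isClosed_subset (isClosed_tsupport _) (tsupport_bump_subset hδ.1)
    have k2 : HasCompactSupport fun ξ => bump 1 (ξ - 1) :=
      isCompact_Icc.of_isClosed_subset (isClosed_tsupport _) h2
    refine ⟨(contDiff_bump δ).sub ((contDiff_bump 1).comp (contDiff_id.sub contDiff_const)),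
      k1.sub k2, (tsupport_sub _ _).trans (union_subset h1 (h2.trans fun x hx => ?_))⟩
    exact ⟨by linarith [hx.1], by linarith [hx.2]⟩
  have i2 : Integrable fun ξ => bump 1 (ξ - 1) := (integrable_bump 1 one_pos).comp_sub_right 1
  obtain ⟨ζ, hζ, hd⟩ := exists_isTimeTest_primitive two_pos hη (by
    rw [integral_sub (integrable_bump δ hδ.1).integrableOn i2.integrableOn,
      setIntegral_bump hδ.1 (Ioo_subset_Ioo_right (by linarith [hδ.2])), sub_eq_zero,
      setIntegral_eq_integral_of_forall_compl_eq_zero, integral_sub_right_eq_self (bump 1), integral_bump one_pos]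
    intro x hx
    refine bump_eq_zero one_pos fun h' => hx ⟨by linarith [h'.1], by linarith [h'.2]⟩)
  have hd1 : ∀ ξ ≤ 1, deriv ζ ξ = bump δ ξ := fun ξ hξ => by
    rw [hd]; beta_reduce; rw [bump_eq_zero_of_le one_pos (by linarith : ξ - 1 ≤ 0), sub_zero]
  have hval : ∀ ξ ∈ Icc 0 1, ζ ξ = ∫ x in Ioc 0 ξ, bump δ x := by
    intro ξ hξ
    have h1 := (hζ.isPrimitive (T := 2) (by norm_num)).sub_eq_integral (s := 0) (t := ξ) (by simp)
      ⟨hξ.1, hξ.2.trans (by norm_num)⟩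
    rw [hζ.vanish (t := 0) (by simp), sub_zero] at h1
    rw [h1, integral_of_le hξ.1]
    exact setIntegral_congr_fun measurableSet_Ioc fun x hx => hd1 x (hx.2.trans hξ.2)
  refine ⟨ζ, hζ, hd1, fun ξ hξ => ?_, fun ξ hξ => ?_⟩
  · rw [hval ξ hξ, abs_of_nonneg (integral_nonneg fun x => bump_nonneg hδ.1 x), ← integral_bump hδ.1]
    exact setIntegral_le_integral (integrable_bump δ hδ.1) (.of_forall fun x => bump_nonneg hδ.1 x)
  · rw [hval ξ ⟨hδ.1.le.trans hξ.1, hξ.2⟩]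
    exact setIntegral_bump hδ.1 fun x hx => ⟨hx.1, hx.2.le.trans hξ.1⟩

lemma isTest_mul {T R : ℝ} {θ ζ : ℝ → ℝ} (hθ : IsTimeTest T θ) (hζ : IsTimeTest R ζ) :
    IsTest T fun z => θ z.1 * ζ z.2 := by
  have hsub : tsupport (fun z => θ z.1 * ζ z.2) ⊆ tsupport θ ×ˢ tsupport ζ :=
    closure_minimal (fun z hz => ⟨subset_tsupport _ (left_ne_zero_of_mul hz),
      subset_tsupport _ (right_ne_zero_of_mul hz)⟩) ((isClosed_tsupport _).prod (isClosed_tsupport _))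
  have hk : IsCompact (tsupport θ ×ˢ tsupport ζ) := IsCompact.prod hθ.2.1 hζ.2.1
  exact ⟨(hθ.1.comp contDiff_fst).mul (hζ.1.comp contDiff_snd),
    hk.of_isClosed_subset (isClosed_tsupport _) hsub, hsub.trans fun z hz => ⟨hθ.2.2 hz.1, (hζ.2.2 hz.2).1⟩⟩

lemma mixedDeriv_mul {θ ζ : ℝ → ℝ} (k : ℕ) (z : ℝ²) :
    mixedDeriv k 1 (fun z => θ z.1 * ζ z.2) z = iteratedDeriv k θ z.1 * deriv ζ z.2 := by
  unfold mixedDeriv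
  simp only [iteratedDeriv_one, deriv_const_mul_field']
  simp only [mul_comm _ (deriv ζ z.2)]
  rw [iteratedDeriv_const_mul_field]

/-- The time derivatives of the trace at `ξ = 0` of a function that vanishes for `ξ ≥ 1`. -/
lemma trace_weak {T : ℝ} {g V : ℝ² → ℝ} {k : ℕ} (hg : ContinuousOn g (closedStrip T))
    (hg1 : ∀ t ∈ Icc 0 T, ∀ ξ, 1 ≤ ξ → g (t, ξ) = 0) (hV : IsWeakDeriv T k 1 g V)
    (hV2 : MemLp V 2 vol(strip T)) :
    MemLp (fun t => -∫ ξ in Ioo (0 : ℝ) 1, V (t, ξ)) 2 vol(Ioo 0 T) ∧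
    ∀ θ, IsTimeTest T θ → ∫ t in Ioo 0 T, g (t, 0) * iteratedDeriv k θ t =
      (-1) ^ k * ∫ t in Ioo 0 T, (-∫ ξ in Ioo (0 : ℝ) 1, V (t, ξ)) * θ t := by
  set ν := vol(Ioo 0 T).prod vol(Ioo (0 : ℝ) 1) with hν
  have hνe : ν = vol(Ioo 0 T ×ˢ Ioo (0 : ℝ) 1) := by
    rw [hν, prod_restrict, volume_eq_prod]
  have hsub : Ioo 0 T ×ˢ Ioo (0 : ℝ) 1 ⊆ strip T := prod_mono_right Ioo_subset_Ioi_self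
  have hV2' : MemLp V 2 ν := by rw [hνe]; exact hV2.mono_measure (restrict_mono hsub le_rfl)
  have hVi : Integrable V ν := hV2'.integrable (by norm_num)
  have hV0 := hV.ae_eq_zero_of_one_lt fun z hz h => hg1 z.1 (Ioo_subset_Icc_self hz.1) z.2 h.le
  refine ⟨?_, fun θ hθ => ?_⟩
  · have hm : AEStronglyMeasurable (fun t => -∫ ξ in Ioo (0 : ℝ) 1, V (t, ξ)) vol(Ioo 0 T) :=
      hVi.1.integral_prod_right'.neg
    rw [memLp_two_iff_lintegral hm]
    have h2 := (memLp_two_iff_lintegral hV2'.1).1 hV2'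
    rw [lintegral_prod _ (aemeasurable_enorm_sq hV2'.1)] at h2
    refine lt_of_le_of_lt (lintegral_mono_ae ?_) h2
    have hsl := hV2'.1.prodMk_left
    filter_upwards [hsl] with t ht
    rw [enorm_neg]
    -- Cauchy-Schwarz on an interval of length one.
    have h3 := lintegral_mul_sq_le (μ := vol(Ioo (0 : ℝ) 1)) (f := fun _ => 1)
      (g := fun ξ => ‖V (t, ξ)‖ₑ) aemeasurable_const ht.enorm
    simp only [one_mul, one_pow, lintegral_const, Measure.restrict_apply_univ, volume_Ioo, sub_zero,
      ofReal_one] at h3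
    refine le_trans ?_ h3
    gcongr
    exact enorm_integral_le_lintegral_enorm _
  · -- the weak identity with the cutoff
    have hk : ∀ δ ∈ Ioo (0 : ℝ) 1, ∃ ζ : ℝ → ℝ, Continuous ζ ∧ (∀ ξ ∈ Icc (0 : ℝ) 1, |ζ ξ| ≤ 1) ∧
        (∀ ξ ∈ Icc δ 1, ζ ξ = 1) ∧
        ∫ t in Ioo 0 T, (∫ ξ in Ioo (0 : ℝ) 1, g (t, ξ) * bump δ ξ) * iteratedDeriv k θ t =
          (-1) ^ (k + 1) * ∫ z, V z * (θ z.1 * ζ z.2) ∂ν := by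
      intro δ hδ
      obtain ⟨ζ, hζ, h1, h2, h3⟩ := exists_cutoff hδ
      refine ⟨ζ, hζ.1.continuous, h2, h3, ?_⟩
      have key := hV.2.2 _ (isTest_mul hθ hζ)
      have e1 : ∫ z in strip T, V z * (θ z.1 * ζ z.2) = ∫ z, V z * (θ z.1 * ζ z.2) ∂ν := by
        rw [hνe]
        refine setIntegral_eq_of_subset_of_ae_sdiff_eq_zero (measurableSet_strip T).nullMeasurableSet hsub ?_
        rw [ae_restrict_iff' (measurableSet_strip T)] at hV0
        have hne : ∀ᵐ z : ℝ², z.2 ≠ 1 := by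
          rw [volume_eq_prod]
          exact Measure.quasiMeasurePreserving_snd.ae (p := fun x : ℝ => x ≠ 1)
            (by simp [ae_iff, measure_singleton])
        filter_upwards [hV0, hne] with z hz hne hzm
        have h1z : 1 < z.2 := by
          by_contra hcon
          exact hzm.2 ⟨hzm.1.1, hzm.1.2, lt_of_le_of_ne (not_lt.1 hcon) hne⟩
        rw [hz hzm.1 h1z, zero_mul]
      rw [← e1]
      rw [← key]
      have e2 : ∫ z in strip T, g z * mixedDeriv k 1 (fun z => θ z.1 * ζ z.2) z =
          ∫ z, g z * (iteratedDeriv k θ z.1 * bump δ z.2) ∂ν := by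
        rw [hνe]
        rw [setIntegral_eq_of_subset_of_forall_sdiff_eq_zero (measurableSet_strip T) hsub]
        · refine setIntegral_congr_fun (measurableSet_Ioo.prod measurableSet_Ioo) fun z hz => ?_
          simp only [mixedDeriv_mul, h1 z.2 hz.2.2.le]
        · intro z hz
          have h1z : 1 ≤ z.2 := by
            by_contra hcon
            exact hz.2 ⟨hz.1.1, hz.1.2, not_le.1 hcon⟩
          rw [hg1 z.1 (Ioo_subset_Icc_self hz.1.1) z.2 h1z, zero_mul]
      have hcl : Ioo 0 T ×ˢ Ioo (0 : ℝ) 1 ⊆ Icc 0 T ×ˢ Icc (0 : ℝ) 1 :=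
        prod_mono Ioo_subset_Icc_self Ioo_subset_Icc_self
      have hint : Integrable (fun z => g z * (iteratedDeriv k θ z.1 * bump δ z.2)) ν := by
        rw [hνe]
        refine IntegrableOn.mono_set (ContinuousOn.integrableOn_compact (isCompact_Icc.prod isCompact_Icc) ?_) hcl
        refine (hg.mono (prod_mono_right Icc_subset_Ici_self)).mul (Continuous.continuousOn ?_)
        exact ((hθ.iteratedDeriv k).1.continuous.comp continuous_fst).mul ((continuous_bump δ).comp continuous_snd)
      rw [e2, hν, integral_prod _ hint]
      congr 1; ext t
      rw [← integral_mul_const]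
      congr 1; ext ξ; ring
    have hmem : ∀ᶠ δ : ℝ in 𝓝[>] 0, δ ∈ Ioo (0 : ℝ) 1 := Ioo_mem_nhdsGT one_pos
    choose! ζ ζc ζ1 ζ2 hζ using hk
    obtain ⟨Cg, hCg⟩ := (isCompact_Icc.prod isCompact_Icc).exists_bound_of_continuousOn
      (hg.mono (prod_mono_right Icc_subset_Ici_self : Icc 0 T ×ˢ Icc (0 : ℝ) 1 ⊆ closedStrip T))
    obtain ⟨Cθ, hCθ⟩ := hθ.2.1.exists_bound_of_continuous hθ.1.continuous
    obtain ⟨Ck, hCk⟩ := (hθ.iteratedDeriv k).2.1.exists_bound_of_continuous (hθ.iteratedDeriv k).1.continuous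
    have hgs : ∀ t ∈ Icc 0 T, ContinuousOn (fun ξ => g (t, ξ)) (Icc 0 1) := fun t ht =>
      hg.comp (by fun_prop : Continuous fun ξ : ℝ => (t, ξ)).continuousOn fun ξ hξ => ⟨ht, hξ.1⟩
    -- As `δ → 0` the slope of the cutoff concentrates at `ξ = 0` and produces the trace, while in
    -- `lim2` the cutoff itself tends to one and leaves the integral of the `ξ`-derivative over
    -- `(0,1)`.
    have lim1 : Tendsto (fun δ => ∫ t in Ioo 0 T, (∫ ξ in Ioo (0 : ℝ) 1, g (t, ξ) * bump δ ξ) * iteratedDeriv k θ t)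
        (𝓝[>] 0) (𝓝 (∫ t in Ioo 0 T, g (t, 0) * iteratedDeriv k θ t)) := by
      refine tendsto_integral_filter_of_dominated_convergence (fun _ => Cg * Ck) ?_ ?_ ?_ ?_
      · filter_upwards [hmem] with δ hδ
        refine AEStronglyMeasurable.mul ?_ (hθ.iteratedDeriv k).1.continuous.aestronglyMeasurable
        have : AEStronglyMeasurable (fun z => g z * bump δ z.2) ν := by
          rw [hνe]
          refine ContinuousOn.aestronglyMeasurable ?_ (measurableSet_Ioo.prod measurableSet_Ioo)
          exact (hg.mono (prod_mono Ioo_subset_Icc_self fun x hx => hx.1.le)).mul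
            ((continuous_bump δ).comp continuous_snd).continuousOn
        exact this.integral_prod_right'
      · filter_upwards [hmem] with δ hδ
        refine ae_restrict_of_forall_mem measurableSet_Ioo (fun t ht => ?_)
        rw [norm_mul]
        have hCg0 : 0 ≤ Cg := (norm_nonneg _).trans (hCg (t, 0) ⟨Ioo_subset_Icc_self ht, by simp⟩)
        refine mul_le_mul ?_ (hCk t) (norm_nonneg _) hCg0
        have ib : IntegrableOn (bump δ) (Ioo 0 1) := (integrable_bump δ hδ.1).integrableOn
        have := norm_integral_le_of_norm_le (f := fun ξ => g (t, ξ) * bump δ ξ) (ib.const_mul Cg)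
          (ae_restrict_of_forall_mem measurableSet_Ioo (fun ξ hξ => by
            rw [norm_mul, norm_of_nonneg (bump_nonneg hδ.1 ξ)]
            exact mul_le_mul_of_nonneg_right (hCg (t, ξ) ⟨Ioo_subset_Icc_self ht, Ioo_subset_Icc_self hξ⟩)
              (bump_nonneg hδ.1 ξ)))
        rwa [integral_const_mul, setIntegral_bump hδ.1 (Ioo_subset_Ioo_right hδ.2.le), mul_one] at this
      · exact integrable_const _
      · refine ae_restrict_of_forall_mem measurableSet_Ioo (fun t ht => ?_)
        exact (tendsto_integral_bump (hgs t (Ioo_subset_Icc_self ht))).mul_const _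
    have lim2 : Tendsto (fun δ => (-1 : ℝ) ^ (k + 1) * ∫ z, V z * (θ z.1 * ζ δ z.2) ∂ν)
        (𝓝[>] 0) (𝓝 ((-1 : ℝ) ^ (k + 1) * ∫ z, V z * (θ z.1 * 1) ∂ν)) := by
      refine Tendsto.const_mul _ ?_
      have hmν : ∀ᵐ z ∂ν, z.2 ∈ Ioo (0 : ℝ) 1 := by
        rw [hνe, ae_restrict_iff' (measurableSet_Ioo.prod measurableSet_Ioo)]
        exact .of_forall fun z hz => hz.2
      refine tendsto_integral_filter_of_dominated_convergence (fun z => ‖V z‖ * Cθ) ?_ ?_ ?_ ?_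
      · filter_upwards [hmem] with δ hδ
        exact hVi.1.mul ((hθ.1.continuous.comp continuous_fst).mul
          ((ζc δ hδ).comp continuous_snd)).aestronglyMeasurable
      · filter_upwards [hmem] with δ hδ
        filter_upwards [hmν] with z hz
        rw [norm_mul, norm_mul]
        gcongr
        calc _ ≤ ‖θ z.1‖ * 1 := by
              gcongr
              exact ζ1 δ hδ _ (Ioo_subset_Icc_self hz)
          _ ≤ Cθ := by rw [mul_one]; exact hCθ _
      · exact hVi.norm.mul_const _
      · filter_upwards [hmν] with z hz
        refine tendsto_const_nhds.congr' ?_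
        filter_upwards [hmem, Ioo_mem_nhdsGT hz.1] with δ hδ hδz
        rw [ζ2 δ hδ _ ⟨hδz.2.le, hz.2.le⟩]
    have := tendsto_nhds_unique (lim1.congr' (by filter_upwards [hmem] with δ hδ using hζ δ hδ)) lim2
    have hint : Integrable (fun z => V z * θ z.1) ν :=
      hVi.mul_bdd (c := Cθ) (hθ.1.continuous.comp continuous_fst).aestronglyMeasurable
        (.of_forall fun z => hCθ z.1)
    rw [this]
    simp only [mul_one]
    rw [hν, integral_prod _ hint, pow_succ]
    simp only [integral_mul_const, neg_mul, integral_neg]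
    ring

/-! ### Mollification in the half-strip -/

/-- The convolution of `φ`, extended by zero outside the half-strip, with `k`. -/
noncomputable def conv (T : ℝ) (φ k : ℝ² → ℝ) (z : ℝ²) : ℝ :=
  ∫ y, (strip T).indicator φ y * k (z - y)

lemma conv_eq (T : ℝ) (φ k : ℝ² → ℝ) (z : ℝ²) : conv T φ k z = ∫ y in strip T, φ y * k (z - y) := by
  rw [conv, ← integral_indicator (measurableSet_strip T)]
  congr 1; ext y
  by_cases hy : y ∈ strip T <;> simp [hy]

section Smooth
variable {T : ℝ} {φ k : ℝ² → ℝ} (hφ : IntegrableOn φ (strip T)) (hk : ContDiff ℝ ∞ k)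
  (hkc : HasCompactSupport k)
include hφ hk hkc

lemma conv_fderiv (z e : ℝ²) : HasFDerivAt (conv T φ k) (fderiv ℝ (conv T φ k) z) z ∧
    fderiv ℝ (conv T φ k) z e = conv T φ (fun y => fderiv ℝ k y e) z := by
  have hl : LocallyIntegrable ((strip T).indicator φ) volume :=
    (hφ.integrable_indicator (measurableSet_strip T)).locallyIntegrable
  have h1 := hkc.hasFDerivAt_convolution_right (ContinuousLinearMap.lsmul ℝ ℝ) hl (hk.of_le (by simp)) z
  have h2 : HasFDerivAt (conv T φ k) _ z := h1
  refine ⟨by rw [h2.fderiv]; exact h2, ?_⟩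
  rw [h2.fderiv, convolution_precompR_apply _ hl (hkc.fderiv ℝ) (hk.continuous_fderiv (by simp))]
  rfl

lemma contDiff_conv : ContDiff ℝ ∞ (conv T φ k) := by
  have hl : LocallyIntegrable ((strip T).indicator φ) volume :=
    (hφ.integrable_indicator (measurableSet_strip T)).locallyIntegrable
  exact hkc.contDiff_convolution_right (n := ⊤) (ContinuousLinearMap.lsmul ℝ ℝ) hl hk

lemma dT_conv : dT (conv T φ k) = conv T φ (dT k) := funext fun z => (conv_fderiv hφ hk hkc z _).2

lemma dX_conv : dX (conv T φ k) = conv T φ (dX k) := funext fun z => (conv_fderiv hφ hk hkc z _).2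

lemma mixedDeriv_conv (i j : ℕ) : mixedDeriv i j (conv T φ k) = conv T φ (mixedDeriv i j k) := by
  induction i generalizing k with
  | zero =>
    induction j generalizing k with
    | zero => rw [mixedDeriv_zero, mixedDeriv_zero]
    | succ j ih =>
      rw [mixedDeriv_succ_right (contDiff_conv hφ hk hkc), dX_conv hφ hk hkc,
        ih (contDiff_dX hk) (hkc.fderiv_apply (𝕜 := ℝ) _), mixedDeriv_succ_right hk]
  | succ i ih =>
    rw [mixedDeriv_succ_left (contDiff_conv hφ hk hkc), dT_conv hφ hk hkc,
      ih (contDiff_dT hk) (hkc.fderiv_apply (𝕜 := ℝ) _), mixedDeriv_succ_left hk]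

end Smooth

lemma mixedDeriv_neg (i j : ℕ) (φ : ℝ² → ℝ) (z : ℝ²) :
    mixedDeriv i j (fun z => -φ z) z = -mixedDeriv i j φ z := by
  unfold mixedDeriv
  simp only [iteratedDeriv_fun_neg]

lemma mixedDeriv_sub_left {k : ℝ² → ℝ} (hk : ContDiff ℝ ∞ k) (z : ℝ²) (i j : ℕ) (y : ℝ²) :
    mixedDeriv i j (fun y => k (z - y)) y = (-1) ^ (i + j) * mixedDeriv i j k (z - y) := by
  have hr : ∀ k : ℝ² → ℝ, ContDiff ℝ ∞ k → ContDiff ℝ ∞ fun y => k (z - y) := fun k hk =>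
    hk.comp (contDiff_const.sub contDiff_id)
  have hd : ∀ k : ℝ² → ℝ, ContDiff ℝ ∞ k → ∀ e y,
      fderiv ℝ (fun y => k (z - y)) y e = -fderiv ℝ k (z - y) e := by
    intro k hk e y
    have h1 : HasFDerivAt (fun y => z - y) (-ContinuousLinearMap.id ℝ (ℝ²)) y :=
      (hasFDerivAt_id y).const_sub z
    have h2 := (((hk.differentiable (by simp)) (z - y)).hasFDerivAt.comp y h1).fderiv
    simp only [Function.comp_def] at h2
    rw [h2]; simp
  induction i generalizing k with
  | zero =>
    induction j generalizing k with
    | zero => simp [mixedDeriv_zero]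
    | succ j ih =>
      rw [mixedDeriv_succ_right (hr k hk), mixedDeriv_succ_right hk]
      have e : dX (fun y => k (z - y)) = fun y => -dX k (z - y) := funext fun y => hd k hk _ y
      rw [e, mixedDeriv_neg, ih (contDiff_dX hk)]
      ring
  | succ i ih =>
    rw [mixedDeriv_succ_left (hr k hk), mixedDeriv_succ_left hk]
    have e : dT (fun y => k (z - y)) = fun y => -dT k (z - y) := funext fun y => hd k hk _ y
    rw [e, mixedDeriv_neg, ih (contDiff_dT hk)]
    ring

/-- For fixed `z` the reflected kernel is itself a test function; the sign from the reflection
cancels the sign in the definition of the weak derivative. -/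
lemma conv_mixedDeriv_eq {T : ℝ} {φ w k : ℝ² → ℝ} {i j : ℕ} (h : IsWeakDeriv T i j φ w)
    (hk : ContDiff ℝ ∞ k) {z : ℝ²} (ht : IsTest T fun y => k (z - y)) :
    conv T φ (mixedDeriv i j k) z = conv T w k z := by
  rw [conv_eq, conv_eq]
  have h1 := h.2.2 _ ht
  simp only [mixedDeriv_sub_left hk] at h1
  have e : ((-1 : ℝ) ^ (i + j)) ≠ 0 := pow_ne_zero _ (by norm_num)
  refine mul_left_cancel₀ e (Eq.trans ?_ h1)
  rw [← integral_const_mul]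
  congr 1; ext y; ring

/-- The mollifying kernel; it averages over times after and points to the right of the given one. -/
noncomputable def bumpTwo (ε : ℝ) (x : ℝ²) : ℝ := bump ε (-x.1) * bump ε (-x.2)

lemma contDiff_bumpTwo (ε : ℝ) : ContDiff ℝ ∞ (bumpTwo ε) :=
  ((contDiff_bump ε).comp contDiff_fst.neg).mul ((contDiff_bump ε).comp contDiff_snd.neg)

lemma bumpTwo_nonneg {ε : ℝ} (hε : 0 < ε) (x : ℝ²) : 0 ≤ bumpTwo ε x :=
  mul_nonneg (bump_nonneg hε _) (bump_nonneg hε _)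

lemma bumpTwo_eq_zero {ε : ℝ} (hε : 0 < ε) {x : ℝ²}
    (hx : x ∉ Icc (-(3 * ε / 4)) (-(ε / 4)) ×ˢ Icc (-(3 * ε / 4)) (-(ε / 4))) : bumpTwo ε x = 0 := by
  by_contra h
  refine hx ⟨?_, ?_⟩
  · by_contra h'
    exact h (by rw [bumpTwo, bump_eq_zero hε fun h'' => h' ⟨by linarith [h''.2], by linarith [h''.1]⟩, zero_mul])
  · by_contra h'
    exact h (by rw [bumpTwo, bump_eq_zero (x := -x.2) hε fun h'' =>
      h' ⟨by linarith [h''.2], by linarith [h''.1]⟩, mul_zero])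

lemma hasCompactSupport_bumpTwo {ε : ℝ} (hε : 0 < ε) : HasCompactSupport (bumpTwo ε) :=
  HasCompactSupport.intro (isCompact_Icc.prod isCompact_Icc) fun _ hx => bumpTwo_eq_zero hε hx

lemma bumpTwo_ne_zero {ε : ℝ} (hε : 0 < ε) {z y : ℝ²} (h : bumpTwo ε (z - y) ≠ 0) :
    y ∈ Icc (z.1 + ε / 4) (z.1 + 3 * ε / 4) ×ˢ Icc (z.2 + ε / 4) (z.2 + 3 * ε / 4) := by
  by_contra hy
  refine h (bumpTwo_eq_zero hε fun h' => hy ?_)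
  simp only [mem_prod, mem_Icc, Prod.fst_sub, Prod.snd_sub] at h' ⊢
  refine ⟨⟨?_, ?_⟩, ?_, ?_⟩ <;> linarith [h'.1.1, h'.1.2, h'.2.1, h'.2.2]

/-- The kernel is displaced by at least `ε/4` to later times and to the right, so its support stays
in the open half-strip even for `t = 0` or `ξ = 0`. No extension of the function across these edges
is needed; the price is the restriction `t ≤ T - ε`. -/
lemma isTest_bumpTwo {T ε : ℝ} (hε : 0 < ε) {z : ℝ²} (hz : z ∈ Icc 0 (T - ε) ×ˢ Ici 0) :
    IsTest T fun y => bumpTwo ε (z - y) := by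
  have hsub : tsupport (fun y => bumpTwo ε (z - y)) ⊆
      Icc (z.1 + ε / 4) (z.1 + 3 * ε / 4) ×ˢ Icc (z.2 + ε / 4) (z.2 + 3 * ε / 4) :=
    closure_minimal (fun y hy => bumpTwo_ne_zero hε hy) (isClosed_Icc.prod isClosed_Icc)
  refine ⟨(contDiff_bumpTwo ε).comp (contDiff_const.sub contDiff_id),
    (isCompact_Icc.prod isCompact_Icc).of_isClosed_subset (isClosed_tsupport _) hsub, hsub.trans fun y hy => ?_⟩
  obtain ⟨⟨h1, h2⟩, h3⟩ := hz
  have h3 : 0 ≤ z.2 := h3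
  obtain ⟨⟨h4, h5⟩, h6, h7⟩ := hy
  exact ⟨⟨by linarith, by linarith⟩, show 0 < y.2 by linarith⟩

/-- The mollification of a function on the half-strip. -/
noncomputable def mol (T ε : ℝ) (φ : ℝ² → ℝ) : ℝ² → ℝ := conv T φ (bumpTwo ε)

lemma contDiff_mol {T ε : ℝ} (hε : 0 < ε) {φ : ℝ² → ℝ} (hφ : IntegrableOn φ (strip T)) :
    ContDiff ℝ ∞ (mol T ε φ) := contDiff_conv hφ (contDiff_bumpTwo ε) (hasCompactSupport_bumpTwo hε)

lemma mixedDeriv_mol {T ε : ℝ} (hε : 0 < ε) {φ w : ℝ² → ℝ} (hφ : IntegrableOn φ (strip T)) {i j : ℕ}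
    (h : IsWeakDeriv T i j φ w) {z : ℝ²} (hz : z ∈ Icc 0 (T - ε) ×ˢ Ici 0) :
    mixedDeriv i j (mol T ε φ) z = mol T ε w z := by
  rw [mol, mixedDeriv_conv hφ (contDiff_bumpTwo ε) (hasCompactSupport_bumpTwo hε)]
  exact conv_mixedDeriv_eq h (contDiff_bumpTwo ε) (isTest_bumpTwo hε hz)

/-- Averaging only to the right preserves vanishing beyond `ξ = 1`, so mollified lifts are again
lifts. -/
lemma mol_eq_zero {T ε : ℝ} (hε : 0 < ε) {φ : ℝ² → ℝ} (h : ∀ z ∈ strip T, 1 ≤ z.2 → φ z = 0) {z : ℝ²}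
    (hz : 1 ≤ z.2) : mol T ε φ z = 0 := by
  rw [mol, conv_eq]
  refine setIntegral_eq_zero_of_forall_eq_zero fun y hy => ?_
  by_cases hb : bumpTwo ε (z - y) = 0
  · rw [hb, mul_zero]
  · have := (bumpTwo_ne_zero hε hb).2.1
    rw [h y hy (by linarith), zero_mul]

lemma integrable_bumpTwo_sub {ε : ℝ} (hε : 0 < ε) (z : ℝ²) : Integrable fun y => bumpTwo ε (z - y) := by
  have hc : Continuous fun y => bumpTwo ε (z - y) := by
    have := (contDiff_bumpTwo ε).continuous; fun_prop
  exact hc.integrable_of_hasCompactSupport ((hasCompactSupport_bumpTwo hε).comp_homeomorph (Homeomorph.subLeft z))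

lemma integral_bumpTwo {ε : ℝ} (hε : 0 < ε) : ∫ x, bumpTwo ε x = 1 := by
  have := integral_prod_mul (μ := volume) (ν := volume) (fun x => bump ε (-x)) (fun x => bump ε (-x))
  rw [← volume_eq_prod, integral_neg_eq_self (bump ε), integral_bump hε, mul_one] at this
  exact this

lemma integral_bumpTwo_sub {ε : ℝ} (hε : 0 < ε) (z : ℝ²) : ∫ y, bumpTwo ε (z - y) = 1 := by
  rw [integral_sub_left_eq_self (bumpTwo ε), integral_bumpTwo hε]

lemma setIntegral_bumpTwo_sub {T ε : ℝ} (hε : 0 < ε) {z : ℝ²} (hz : z ∈ Icc 0 (T - ε) ×ˢ Ici 0) :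
    ∫ y in strip T, bumpTwo ε (z - y) = 1 := by
  rw [← integral_bumpTwo_sub hε z]
  refine setIntegral_eq_integral_of_forall_compl_eq_zero fun y hy => ?_
  have h := isTest_bumpTwo hε hz
  exact image_eq_zero_of_notMem_tsupport (f := fun y => bumpTwo ε (z - y)) fun h' => hy (h.2.2 h')

lemma lintegral_bumpTwo {ε : ℝ} (hε : 0 < ε) : ∫⁻ x, ‖bumpTwo ε x‖ₑ = 1 := by
  have hi : Integrable (bumpTwo ε) :=
    (contDiff_bumpTwo ε).continuous.integrable_of_hasCompactSupport (hasCompactSupport_bumpTwo hε)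
  have h2 := ofReal_integral_eq_lintegral_ofReal hi (.of_forall fun x => bumpTwo_nonneg hε x)
  rw [integral_bumpTwo hε, ofReal_one] at h2
  rw [h2]
  refine lintegral_congr fun x => ?_
  rw [Real.enorm_of_nonneg (bumpTwo_nonneg hε x)]

/-- Jensen's inequality, through Cauchy-Schwarz with the kernel split into two square roots. -/
lemma enorm_mol_sq_le {T ε : ℝ} (hε : 0 < ε) {φ : ℝ² → ℝ} (hφ : AEStronglyMeasurable φ vol(strip T))
    (z : ℝ²) : ‖mol T ε φ z‖ₑ ^ 2 ≤ ∫⁻ y in strip T, ‖φ y‖ₑ ^ 2 * ‖bumpTwo ε (z - y)‖ₑ := by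
  have hc : Continuous fun y => bumpTwo ε (z - y) := by
    have := (contDiff_bumpTwo ε).continuous; fun_prop
  have hm : AEMeasurable (fun y => ‖bumpTwo ε (z - y)‖ₑ ^ (1 / 2 : ℝ)) vol(strip T) :=
    hc.measurable.enorm.aemeasurable.pow_const _
  have hsq : ∀ y, ‖bumpTwo ε (z - y)‖ₑ ^ (1 / 2 : ℝ) * ‖bumpTwo ε (z - y)‖ₑ ^ (1 / 2 : ℝ) =
      ‖bumpTwo ε (z - y)‖ₑ := fun y => by
    rw [← ENNReal.rpow_add_of_nonneg _ _ (by norm_num) (by norm_num)]; norm_num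
  have hle : ∫⁻ y in strip T, ‖bumpTwo ε (z - y)‖ₑ ≤ 1 := by
    refine (setLIntegral_le_lintegral _ _).trans ?_
    have := lintegral_sub_left_eq_self (μ := (volume : Measure (ℝ²))) (fun y => ‖bumpTwo ε y‖ₑ) z
    rw [this, lintegral_bumpTwo hε]
  have h1 := lintegral_mul_sq_le (hφ.enorm.mul hm) hm
  rw [mol, conv_eq]
  calc _ ≤ (∫⁻ y in strip T, ‖φ y * bumpTwo ε (z - y)‖ₑ) ^ 2 := by
        gcongr; exact enorm_integral_le_lintegral_enorm _
    _ = (∫⁻ y in strip T, (‖φ y‖ₑ * ‖bumpTwo ε (z - y)‖ₑ ^ (1 / 2 : ℝ)) * ‖bumpTwo ε (z - y)‖ₑ ^ (1 / 2 : ℝ)) ^ 2 := by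
        simp only [mul_assoc, hsq, enorm_mul]
    _ ≤ (∫⁻ y in strip T, (‖φ y‖ₑ * ‖bumpTwo ε (z - y)‖ₑ ^ (1 / 2 : ℝ)) ^ 2) *
          ∫⁻ y in strip T, (‖bumpTwo ε (z - y)‖ₑ ^ (1 / 2 : ℝ)) ^ 2 := h1
    _ = (∫⁻ y in strip T, ‖φ y‖ₑ ^ 2 * ‖bumpTwo ε (z - y)‖ₑ) * ∫⁻ y in strip T, ‖bumpTwo ε (z - y)‖ₑ := by
        simp only [mul_pow, sq (‖bumpTwo ε _‖ₑ ^ (1 / 2 : ℝ)), hsq]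
    _ ≤ _ := mul_le_of_le_one_right' hle

lemma lintegral_mol_sq_le {T ε : ℝ} (hε : 0 < ε) {φ : ℝ² → ℝ}
    (hφ : AEStronglyMeasurable φ vol(strip T)) :
    ∫⁻ z, ‖mol T ε φ z‖ₑ ^ 2 ≤ ∫⁻ y in strip T, ‖φ y‖ₑ ^ 2 := by
  have hc : Continuous fun p : (ℝ²) × (ℝ²) => bumpTwo ε (p.1 - p.2) := by
    have := (contDiff_bumpTwo ε).continuous; fun_prop
  calc _ ≤ ∫⁻ z, ∫⁻ y in strip T, ‖φ y‖ₑ ^ 2 * ‖bumpTwo ε (z - y)‖ₑ := lintegral_mono fun z => enorm_mol_sq_le hε hφ z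
    _ = ∫⁻ y in strip T, ∫⁻ z, ‖φ y‖ₑ ^ 2 * ‖bumpTwo ε (z - y)‖ₑ := by
        refine lintegral_lintegral_swap ?_
        exact AEMeasurable.mul (AEMeasurable.comp_snd (f := fun y => ‖φ y‖ₑ ^ 2) (aemeasurable_enorm_sq hφ))
          hc.measurable.enorm.aemeasurable
    _ = _ := by
        refine lintegral_congr fun y => ?_
        rw [lintegral_const_mul' _ _ (by simp),
          lintegral_sub_right_eq_self (μ := (volume : Measure (ℝ²))) (fun z => ‖bumpTwo ε z‖ₑ) y,
          lintegral_bumpTwo hε, mul_one]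

/-- Lebesgue's differentiation theorem: the kernel is at most `K²/ε²` and supported in the ball of
radius `ε`, which in the maximum norm has area `4ε²`; hence the factor `4K²` in front of the mean
oscillation. -/
lemma ae_tendsto_mol {T : ℝ} {φ : ℝ² → ℝ} (hφ : IntegrableOn φ (strip T)) :
    ∀ᵐ z ∂vol(strip T), Tendsto (fun ε => mol T ε φ z) (𝓝[>] 0) (𝓝 (φ z)) := by
  obtain ⟨K, hK, hKb⟩ := exists_bump_le
  have hi : Integrable ((strip T).indicator φ) := hφ.integrable_indicator (measurableSet_strip T)
  have h := IsUnifLocDoublingMeasure.ae_tendsto_average_norm_sub (μ := (volume : Measure (ℝ²)))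
    hi.locallyIntegrable 1
  rw [ae_restrict_iff' (measurableSet_strip T)]
  filter_upwards [h] with z hz hzm
  have h1 := hz (l := 𝓝[>] (0 : ℝ)) (fun _ => z) (fun ε => ε) tendsto_id (by
    filter_upwards [self_mem_nhdsWithin] with ε hε
    exact Metric.mem_closedBall_self (by rw [one_mul]; exact le_of_lt hε))
  rw [tendsto_iff_norm_sub_tendsto_zero]
  have h2 := h1.const_mul (4 * K ^ 2)
  rw [mul_zero] at h2
  refine squeeze_zero' (.of_forall fun _ => norm_nonneg _) ?_ h2
  filter_upwards [self_mem_nhdsWithin] with ε hε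
  have hε : 0 < ε := hε
  have hb1 := integral_bumpTwo_sub hε z
  have hc : Continuous fun y => bumpTwo ε (z - y) := by
    have := (contDiff_bumpTwo ε).continuous; fun_prop
  have hbi := integrable_bumpTwo_sub hε z
  have hbd : ∀ x, ‖bumpTwo ε x‖ ≤ K ^ 2 / ε ^ 2 := fun x => by
    rw [norm_of_nonneg (bumpTwo_nonneg hε x), bumpTwo]
    calc _ ≤ (K / ε) * (K / ε) := mul_le_mul (hKb _ _ hε) (hKb _ _ hε) (bump_nonneg hε _) (by positivity)
      _ = _ := by ring
  have hφb : Integrable fun y => (strip T).indicator φ y * bumpTwo ε (z - y) :=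
    hi.mul_bdd (c := K ^ 2 / ε ^ 2) hc.aestronglyMeasurable (.of_forall fun y => hbd _)
  have e1 : mol T ε φ z - φ z = ∫ y, ((strip T).indicator φ y - (strip T).indicator φ z) * bumpTwo ε (z - y) := by
    simp only [sub_mul]
    rw [integral_sub hφb (hbi.const_mul _), integral_const_mul, hb1, mul_one, indicator_of_mem hzm]
    rfl
  have hvol : volume.real (Metric.closedBall z ε) = 4 * ε ^ 2 := by
    rw [← closedBall_prod_same, volume_eq_prod, measureReal_prod_prod]
    simp only [Real.volume_real_closedBall hε.le]
    ring
  have e2 : ∫ y, ((strip T).indicator φ y - (strip T).indicator φ z) * bumpTwo ε (z - y) =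
      ∫ y in Metric.closedBall z ε, ((strip T).indicator φ y - (strip T).indicator φ z) * bumpTwo ε (z - y) := by
    refine (setIntegral_eq_integral_of_forall_compl_eq_zero fun y hy => ?_).symm
    by_contra hne
    have := bumpTwo_ne_zero hε (right_ne_zero_of_mul hne)
    refine hy ?_
    rw [← closedBall_prod_same, Real.closedBall_eq_Icc, Real.closedBall_eq_Icc]
    exact ⟨⟨by linarith [this.1.1], by linarith [this.1.2]⟩, by linarith [this.2.1], by linarith [this.2.2]⟩
  have hni : Integrable (fun y => ‖(strip T).indicator φ y - (strip T).indicator φ z‖)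
      vol(Metric.closedBall z ε) := (hi.integrableOn.sub (integrableOn_const (by
      exact (isCompact_closedBall z ε).measure_lt_top.ne))).norm
  rw [e1, e2, setAverage_eq, hvol]
  calc _ ≤ ∫ y in Metric.closedBall z ε, K ^ 2 / ε ^ 2 * ‖(strip T).indicator φ y - (strip T).indicator φ z‖ := by
        refine norm_integral_le_of_norm_le (hni.const_mul _) (.of_forall fun y => ?_)
        rw [norm_mul, mul_comm]
        gcongr
        exact hbd _
    _ = _ := by
        rw [integral_const_mul, smul_eq_mul]
        field_simp

/-! ### Passage to the limit in the energy estimate -/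

lemma isLift_mul {ψ : ℝ² → ℝ} (hψ : ContDiff ℝ ∞ ψ) (hs : ∀ z : ℝ², 1 ≤ z.2 → ψ z = 0) {m m' : ℝ → ℝ}
    (hm : ∀ t, HasDerivAt m (m' t) t) (hm' : Continuous m') :
    IsLift (fun t ξ => m t * ψ (t, ξ)) (fun t ξ => m t * dX ψ (t, ξ)) (fun t ξ => m t * dX (dX ψ) (t, ξ))
      (fun t ξ => m' t * ψ (t, ξ) + m t * dT ψ (t, ξ))
      (fun t ξ => m' t * dX ψ (t, ξ) + m t * dX (dT ψ) (t, ξ)) := by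
  have hmc : Continuous m := continuous_iff_continuousAt.2 fun t => (hm t).continuousAt
  have c1 := (contDiff_dX hψ).continuous
  have c2 := (contDiff_dX (contDiff_dX hψ)).continuous
  have c3 := (contDiff_dT hψ).continuous
  have c4 := (contDiff_dX (contDiff_dT hψ)).continuous
  have c0 := hψ.continuous
  exact
  { dx := fun t ξ => (hasDerivAt_dX hψ t ξ).const_mul _
    dxx := fun t ξ => (hasDerivAt_dX (contDiff_dX hψ) t ξ).const_mul _
    dt := fun t ξ => (hm t).mul (hasDerivAt_dT hψ t ξ)
    dtx := fun t ξ => ((hasDerivAt_dX hψ t ξ).const_mul _).add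
      ((hasDerivAt_dX (contDiff_dT hψ) t ξ).const_mul _)
    dxt := fun t ξ => by
      rw [← dT_dX hψ]
      exact (hm t).mul (hasDerivAt_dT (contDiff_dX hψ) t ξ)
    cx := by unfold uncurry; fun_prop
    cxx := by unfold uncurry; fun_prop
    ct := by unfold uncurry; fun_prop
    ctx := by unfold uncurry; fun_prop
    supp := fun t ξ h => by rw [hs (t, ξ) h, mul_zero] }

lemma ofReal_integral_sq {δ : ℝ} {a : ℝ} (h : δ ≤ a) {G : ℝ → ℝ} (hG : ContinuousOn G (Icc δ a)) :
    ofReal (∫ ξ in δ..a, G ξ ^ 2) = ∫⁻ ξ in Ioo δ a, ‖G ξ‖ₑ ^ 2 := by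
  have hi : IntegrableOn (fun x => G x ^ 2) (Ioo δ a) := (hG.pow 2).integrableOn_Ioo
  rw [integral_of_le h, integral_Ioc_eq_integral_Ioo, ofReal_integral_eq_lintegral_ofReal
    hi (.of_forall fun x => sq_nonneg _)]
  refine lintegral_congr fun x => ?_
  rw [enorm_sq_eq_ofReal]

lemma ofReal_integral_integral_sq {t δ a : ℝ} (ht : 0 ≤ t) (h : δ ≤ a) {G : ℝ → ℝ → ℝ}
    (hG : ContinuousOn (uncurry G) (Icc 0 t ×ˢ Icc δ a)) :
    ofReal (∫ s in 0..t, ∫ ξ in δ..a, G s ξ ^ 2) = ∫⁻ z in Ioo 0 t ×ˢ Ioo δ a, ‖G z.1 z.2‖ₑ ^ 2 := by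
  have hi : IntegrableOn (fun z => G z.1 z.2 ^ 2) (Ioo 0 t ×ˢ Ioo δ a) :=
    ((hG.pow 2).integrableOn_compact (isCompact_Icc.prod isCompact_Icc)).mono_set
      (Set.prod_mono Ioo_subset_Icc_self Ioo_subset_Icc_self)
  have e : ∫ s in 0..t, ∫ ξ in δ..a, G s ξ ^ 2 = ∫ z in Ioo 0 t ×ˢ Ioo δ a, G z.1 z.2 ^ 2 := by
    simp only [integral_of_le ht, integral_of_le h, integral_Ioc_eq_integral_Ioo]
    have hi' := hi
    rw [IntegrableOn, volume_eq_prod, ← prod_restrict] at hi'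
    rw [volume_eq_prod, ← prod_restrict, integral_prod _ hi']
  rw [e, ofReal_integral_eq_lintegral_ofReal hi (.of_forall fun x => sq_nonneg _)]
  refine lintegral_congr fun x => ?_
  rw [enorm_sq_eq_ofReal]

lemma setLIntegral_iUnion_le {α : Type*} [MeasurableSpace α] {μ : Measure α} {S : ℕ → Set α}
    (hS : Monotone S) {f : α → ℝ≥0∞} {A : ℝ≥0∞} (h : ∀ k, ∫⁻ x in S k, f x ∂μ ≤ A) :
    ∫⁻ x in ⋃ k, S k, f x ∂μ ≤ A := by
  rw [setLIntegral_iUnion_of_directed _ (directed_of_isDirected_le hS)]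
  exact iSup_le h

/-- Fatou's lemma, in the form needed when the energy bound holds only eventually and up to an error
`η`. -/
lemma setLIntegral_le_of_forall_eventually {α : Type*} [MeasurableSpace α] {μ : Measure α}
    {F : ℕ → α → ℝ} {f : α → ℝ} {R : ℝ} (hF : ∀ n, AEStronglyMeasurable (F n) μ)
    (hlim : ∀ᵐ x ∂μ, Tendsto (fun n => F n x) atTop (𝓝 (f x)))
    (h : ∀ η > 0, ∀ᶠ n in atTop, ∫⁻ x, ‖F n x‖ₑ ^ 2 ∂μ ≤ ofReal (R + η)) :
    ∫⁻ x, ‖f x‖ₑ ^ 2 ∂μ ≤ ofReal R := by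
  refine ENNReal.le_of_forall_pos_le_add fun η hη _ => ?_
  calc _ = ∫⁻ x, liminf (fun n => ‖F n x‖ₑ ^ 2) atTop ∂μ := by
        refine lintegral_congr_ae ?_
        filter_upwards [hlim] with x hx
        exact (((ENNReal.continuous_pow 2).comp continuous_enorm).tendsto _ |>.comp hx).liminf_eq.symm
    _ ≤ liminf (fun n => ∫⁻ x, ‖F n x‖ₑ ^ 2 ∂μ) atTop :=
        lintegral_liminf_le' fun n => aemeasurable_enorm_sq (hF n)
    _ ≤ ofReal (R + η) := by
        refine liminf_le_of_le (by isBoundedDefault) fun b hb => ?_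
        obtain ⟨n, h1, h2⟩ := (hb.and (h η hη)).exists
        exact h1.trans h2
    _ ≤ _ := by
        refine ENNReal.ofReal_add_le.trans ?_
        rw [ofReal_coe_nnreal]

namespace IsCoeff
variable {c : ℝ → ℝ} {c₀ c₁ : ℝ} (hc : IsCoeff c c₀ c₁)
include hc

lemma tendsto_pot {T B : ℝ} {b : ℝ → ℝ} {bn : ℕ → ℝ → ℝ} (hbn : ∀ n, Continuous (bn n)) {t : ℝ} (ht : t ≤ T)
    (hB : ∀ᶠ n in atTop, ∀ r ∈ Ioo 0 t, |bn n r| ≤ B)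
    (hlim : ∀ r ∈ Ioo 0 t, Tendsto (fun n => bn n r) atTop (𝓝 (b r))) (j : ℕ) {ξ : ℝ} (hξ : 0 < ξ) :
    Tendsto (fun n => pot c T (bn n) j t ξ) atTop (𝓝 (pot c T b j t ξ)) := by
  obtain ⟨K, hK, H⟩ := exists_abs_ker_le_div j
  simp only [hc.pot_eq_Ioo _ ht]
  refine tendsto_integral_filter_of_dominated_convergence (fun _ => K / ξ ^ (j + 1) * (c₁ * B)) ?_ ?_ ?_ ?_
  · refine .of_forall fun n => ?_
    exact (hc.aestronglyMeasurable_ker_mul (T := t) (hbn n).aestronglyMeasurable j t ξ)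
  · filter_upwards [hB] with n hn
    refine ae_restrict_of_forall_mem measurableSet_Ioo (fun r hr => ?_)
    rw [norm_mul, norm_mul, norm_eq_abs, norm_eq_abs, norm_eq_abs, abs_of_pos (hc.c_pos r)]
    have := hc.c₁_pos
    exact mul_le_mul (H _ _ hξ) (mul_le_mul (hc.upper r) (hn r hr) (abs_nonneg _) hc.c₁_pos.le)
      (mul_nonneg (hc.c_pos r).le (abs_nonneg _)) (by positivity)
  · exact integrable_const _
  · refine ae_restrict_of_forall_mem measurableSet_Ioo (fun r hr => ?_)
    exact ((hlim r hr).const_mul _).const_mul _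

/-- Bounds near the boundary from a sequence of lifts. -/
lemma near_of_lifts {T K R : ℝ} (hT : 0 < T)
    (hE : EnergyBound c c₀ T K)
    {φ φx φxx φt φtx : ℕ → ℝ → ℝ → ℝ} (hl : ∀ n, IsLift (φ n) (φx n) (φxx n) (φt n) (φtx n))
    {b : ℝ → ℝ} {B : ℝ} {F₁ F₂ : ℝ² → ℝ}
    (hB : ∀ t ∈ Ioo 0 T, ∀ᶠ n in atTop, ∀ r ∈ Ioo 0 t, |φ n r 0 - φ n 0 0| ≤ B)
    (hlim : ∀ r ∈ Ioo 0 T, Tendsto (fun n => φ n r 0 - φ n 0 0) atTop (𝓝 (b r)))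
    (h₁ : ∀ᵐ z ∂vol(strip T), Tendsto (fun n => φx n z.1 z.2) atTop (𝓝 (F₁ z)))
    (h₂ : ∀ᵐ z ∂vol(strip T), Tendsto (fun n => φxx n z.1 z.2) atTop (𝓝 (F₂ z)))
    (hR : ∀ t ∈ Ioo 0 T, ∀ η > 0, ∀ᶠ n in atTop, (∫ ξ in 0..1, φx n 0 ξ ^ 2)
        + c₀⁻¹ * (∫ s in 0..t, ∫ ξ in 0..1, (c s * φxx n s ξ - φt n s ξ) ^ 2)
        + K * (∫ r in Ioo 0 t, |φ n r 0 - φ n 0 0|) ^ 2 ≤ R + η) : (∀ᵐ t ∂vol(Ioo 0 T),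
      ∫⁻ ξ in Ioo 0 1, ‖-pot c T b 2 t ξ - F₁ (t, ξ)‖ₑ ^ 2 ≤ ofReal R) ∧
    ∫⁻ z in Ioo 0 T ×ˢ Ioo 0 1, ‖-pot c T b 3 z.1 z.2 - F₂ z‖ₑ ^ 2 ≤ ofReal (c₀⁻¹ * R) := by
  have hc₀ := hc.pos
  have hpot : ∀ j, ∀ t ∈ Ioo 0 T, ∀ ξ, 0 < ξ → Tendsto (fun n => pot c T (fun t => φ n t 0 - φ n 0 0) j t ξ)
      atTop (𝓝 (pot c T b j t ξ)) := fun j t ht ξ hξ =>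
    hc.tendsto_pot (fun n => (hl n).continuous_data) ht.2.le (hB t ht)
      (fun r hr => hlim r ⟨hr.1, hr.2.trans ht.2⟩) j hξ
  have hbi : ∀ n, IntegrableOn (fun t => φ n t 0 - φ n 0 0) (Ioo 0 T) := fun n =>
    ((hl n).continuous_data.integrableOn_Icc).mono_set Ioo_subset_Icc_self
  have hcpot : ∀ n j, ContinuousOn (fun z => pot c T (fun t => φ n t 0 - φ n 0 0) j z.1 z.2) (univ ×ˢ Ioi 0) :=
    fun n j => hc.continuousOn_pot (hbi n) j
  have G1 : ∀ n, ContinuousOn (fun z => -pot c T (fun t => φ n t 0 - φ n 0 0) 2 z.1 z.2 - φx n z.1 z.2)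
      (univ ×ˢ Ioi 0) := fun n => (hcpot n 2).neg.sub (hl n).cx.continuousOn
  have G2 : ∀ n, ContinuousOn (fun z => -pot c T (fun t => φ n t 0 - φ n 0 0) 3 z.1 z.2 - φxx n z.1 z.2)
      (univ ×ˢ Ioi 0) := fun n => (hcpot n 3).neg.sub (hl n).cxx.continuousOn
  have sl : ∀ t : ℝ, Continuous fun ξ : ℝ => (t, ξ) := fun t => by fun_prop
  -- The energy bound does not depend on `δ`, so the interval `(0,1)` is exhausted by `(1/(k+2), 1)`
  -- and the bound passes to the union.
  have hδk : ∀ k : ℕ, ((k : ℝ) + 2)⁻¹ ∈ Ioo 0 1 := fun k =>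
    ⟨by positivity, inv_lt_one_of_one_lt₀ (by have : (0 : ℝ) ≤ k := k.cast_nonneg; linarith)⟩
  have hmono : ∀ k l : ℕ, k ≤ l → ((l : ℝ) + 2)⁻¹ ≤ ((k : ℝ) + 2)⁻¹ := fun k l h => by gcongr
  have hex : ∀ x : ℝ, 0 < x → ∃ k : ℕ, ((k : ℝ) + 2)⁻¹ < x := fun x hx => by
    obtain ⟨k, hk⟩ := exists_nat_gt x⁻¹
    refine ⟨k, inv_lt_of_inv_lt₀ hx (by linarith)⟩
  constructor
  · rw [volume_restrict_strip] at h₁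
    filter_upwards [ae_ae_of_ae_prod h₁, ae_restrict_mem measurableSet_Ioo] with t h₁ ht
    have hS : Ioo 0 1 = ⋃ k : ℕ, Ioo ((k : ℝ) + 2)⁻¹ 1 := by
      ext x
      simp only [mem_iUnion]
      exact ⟨fun hx => (hex x hx.1).imp fun k hk => ⟨hk, hx.2⟩, fun ⟨k, hk⟩ => ⟨(hδk k).1.trans hk.1, hk.2⟩⟩
    rw [hS]
    refine setLIntegral_iUnion_le (fun k l h => Ioo_subset_Ioo_left (hmono k l h)) fun k => ?_
    have hδ := hδk k
    set δ := ((k : ℝ) + 2)⁻¹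
    have hcn : ∀ n, ContinuousOn (fun ξ => -pot c T (fun t => φ n t 0 - φ n 0 0) 2 t ξ - φx n t ξ) (Icc δ 1) := by
      intro n
      have hm : MapsTo (fun ξ : ℝ => (t, ξ)) (Icc δ 1) (univ ×ˢ Ioi 0) :=
        fun ξ hξ => ⟨mem_univ _, hδ.1.trans_le hξ.1⟩
      have := ContinuousOn.comp (G1 n) (sl t).continuousOn hm
      simpa only [Function.comp_def] using this
    refine setLIntegral_le_of_forall_eventually
      (F := fun n ξ => -pot c T (fun t => φ n t 0 - φ n 0 0) 2 t ξ - φx n t ξ) (fun n => ?_) ?_ fun η hη => ?_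
    · exact ((hcn n).mono Ioo_subset_Icc_self).aestronglyMeasurable measurableSet_Ioo
    · have h₁' := ae_restrict_of_ae_restrict_of_subset (show Ioo δ 1 ⊆ ℝ₊ from fun x hx => hδ.1.trans hx.1) h₁
      filter_upwards [h₁', ae_restrict_mem measurableSet_Ioo] with ξ h1 hξ
      exact ((hpot 2 t ht ξ (hδ.1.trans hξ.1)).neg).sub h1
    · filter_upwards [hR t ht η hη] with n hn
      rw [← ofReal_integral_sq hδ.2.le (hcn n)]
      have h3 := (hE _ _ _ _ _ (hl n) δ hδ t (Ioo_subset_Icc_self ht)).trans hn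
      have : 0 ≤ c₀ * ∫ s in 0..t, ∫ ξ in δ..1,
          (-pot c T (fun t => φ n t 0 - φ n 0 0) 3 s ξ - φxx n s ξ) ^ 2 :=
        mul_nonneg hc₀.le (intervalIntegral.integral_nonneg ht.1.le fun s _ =>
          intervalIntegral.integral_nonneg hδ.2.le fun ξ _ => sq_nonneg _)
      exact ofReal_le_ofReal (le_of_add_le_of_nonneg_left h3 this)
  -- Time is exhausted as well, since `hR` speaks only of times strictly before `T`.
  · have hS : Ioo 0 T ×ˢ Ioo 0 1 = ⋃ k : ℕ, Ioo 0 (T - T * ((k : ℝ) + 2)⁻¹) ×ˢ Ioo ((k : ℝ) + 2)⁻¹ 1 := by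
      ext z
      simp only [mem_iUnion]
      constructor
      · intro hz
        obtain ⟨k, hk⟩ := hex (min z.2 ((T - z.1) / T)) (lt_min hz.2.1 (div_pos (by linarith [hz.1.2]) hT))
        refine ⟨k, ⟨hz.1.1, ?_⟩, hk.trans_le (min_le_left _ _), hz.2.2⟩
        have := hk.trans_le (min_le_right _ _)
        rw [lt_div_iff₀ hT] at this
        linarith
      · rintro ⟨k, hk1, hk2⟩
        have := mul_pos hT (hδk k).1
        exact ⟨⟨hk1.1, by linarith [hk1.2]⟩, (hδk k).1.trans hk2.1, hk2.2⟩
    rw [hS]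
    refine setLIntegral_iUnion_le (fun k l h => Set.prod_mono
      (Ioo_subset_Ioo_right (by have := hmono k l h; gcongr)) (Ioo_subset_Ioo_left (hmono k l h))) fun k => ?_
    have hδ := hδk k
    set δ := ((k : ℝ) + 2)⁻¹
    have ht : T - T * δ ∈ Ioo 0 T := ⟨by nlinarith [hδ.2], by nlinarith [hδ.1]⟩
    set t := T - T * δ
    have hcn : ∀ n, ContinuousOn (uncurry fun s ξ => -pot c T (fun t => φ n t 0 - φ n 0 0) 3 s ξ - φxx n s ξ)
        (Icc 0 t ×ˢ Icc δ 1) :=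
      fun n => (G2 n).mono (Set.prod_mono (subset_univ _) fun ξ hξ => hδ.1.trans_le hξ.1)
    have hms : MeasurableSet (Ioo 0 t ×ˢ Ioo δ 1) := measurableSet_Ioo.prod measurableSet_Ioo
    have hsub : Ioo 0 t ×ˢ Ioo δ 1 ⊆ strip T :=
      Set.prod_mono (Ioo_subset_Ioo_right ht.2.le) fun ξ hξ => hδ.1.trans hξ.1
    refine setLIntegral_le_of_forall_eventually
      (F := fun n z => -pot c T (fun t => φ n t 0 - φ n 0 0) 3 z.1 z.2 - φxx n z.1 z.2) (fun n => ?_) ?_ fun η hη => ?_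
    · exact ((hcn n).mono (Set.prod_mono Ioo_subset_Icc_self Ioo_subset_Icc_self)).aestronglyMeasurable hms
    · filter_upwards [ae_restrict_of_ae_restrict_of_subset hsub h₂, ae_restrict_mem hms] with z h1 hz
      exact ((hpot 3 z.1 (hsub hz).1 z.2 (hsub hz).2).neg).sub h1
    -- The error is taken as `c₀ η` because the inequality is divided by `c₀` at the end.
    · filter_upwards [hR t ht (c₀ * η) (by positivity)] with n hn
      rw [← ofReal_integral_integral_sq ht.1.le hδ.2.le (hcn n)]
      refine ofReal_le_ofReal ?_
      have h3 := (hE _ _ _ _ _ (hl n) δ hδ t (Ioo_subset_Icc_self ht)).trans hn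
      have : 0 ≤ ∫ ξ in δ..1, (-pot c T (fun t => φ n t 0 - φ n 0 0) 2 t ξ - φx n t ξ) ^ 2 :=
        intervalIntegral.integral_nonneg hδ.2.le fun ξ _ => sq_nonneg _
      have h4 : c₀ * (∫ s in 0..t, ∫ ξ in δ..1,
          (-pot c T (fun t => φ n t 0 - φ n 0 0) 3 s ξ - φxx n s ξ) ^ 2) ≤ R + c₀ * η :=
        le_of_add_le_of_nonneg_right h3 this
      rw [← mul_le_mul_iff_right₀ hc₀]
      refine h4.trans (le_of_eq ?_)
      field_simp

end IsCoeff

lemma abs_mol_le {T ε B : ℝ} (hε : 0 < ε) {ψ : ℝ² → ℝ} (hB : ∀ y ∈ strip T, |ψ y| ≤ B) (hB0 : 0 ≤ B)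
    (z : ℝ²) : |mol T ε ψ z| ≤ B := by
  rw [mol, conv_eq, ← norm_eq_abs]
  have hi := integrable_bumpTwo_sub hε z
  calc _ ≤ ∫ y in strip T, B * bumpTwo ε (z - y) := by
        refine norm_integral_le_of_norm_le (hi.integrableOn.const_mul B) ?_
        refine ae_restrict_of_forall_mem (measurableSet_strip T) (fun y hy => ?_)
        rw [norm_mul, norm_of_nonneg (bumpTwo_nonneg hε _)]
        exact mul_le_mul_of_nonneg_right (hB y hy) (bumpTwo_nonneg hε _)
    _ ≤ B * 1 := by
        rw [integral_const_mul]
        refine mul_le_mul_of_nonneg_left ?_ hB0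
        rw [← integral_bumpTwo_sub hε z]
        exact setIntegral_le_integral hi (.of_forall fun y => bumpTwo_nonneg hε _)
    _ = B := mul_one B

lemma tendsto_mol {T : ℝ} {ψ : ℝ² → ℝ} (hψ : ContinuousOn ψ (closedStrip T)) (hi : IntegrableOn ψ (strip T))
    {z : ℝ²} (hz : z ∈ Ico 0 T ×ˢ Ici 0) : Tendsto (fun ε => mol T ε ψ z) (𝓝[>] 0) (𝓝 (ψ z)) := by
  have hzc : z ∈ closedStrip T := ⟨Ico_subset_Icc_self hz.1, hz.2⟩
  rw [Metric.tendsto_nhds]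
  intro η hη
  obtain ⟨δ, hδ, H⟩ := Metric.continuousWithinAt_iff.1 (hψ z hzc) (η / 2) (by positivity)
  filter_upwards [Ioo_mem_nhdsGT (lt_min hδ (sub_pos.2 hz.1.2))] with ε hε
  have hε0 : 0 < ε := hε.1
  have hεδ : ε < δ := hε.2.trans_le (min_le_left _ _)
  have hzε : z ∈ Icc 0 (T - ε) ×ˢ Ici 0 := ⟨⟨hz.1.1, by linarith [hε.2.trans_le (min_le_right _ _)]⟩, hz.2⟩
  have e1 := setIntegral_bumpTwo_sub hε0 hzε
  have hb := (integrable_bumpTwo_sub hε0 z).integrableOn (s := strip T)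
  have hfb : IntegrableOn (fun y => ψ y * bumpTwo ε (z - y)) (strip T) :=
    (isTest_bumpTwo hε0 hzε).integrable hi.locallyIntegrableOn
  have e2 : mol T ε ψ z - ψ z = ∫ y in strip T, (ψ y - ψ z) * bumpTwo ε (z - y) := by
    simp only [sub_mul]
    rw [integral_sub hfb (hb.const_mul _), integral_const_mul, e1, mul_one, mol, conv_eq]
  rw [dist_eq, e2]
  calc _ ≤ ∫ y in strip T, η / 2 * bumpTwo ε (z - y) := by
        rw [← norm_eq_abs]
        refine norm_integral_le_of_norm_le (hb.const_mul _) ?_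
        refine ae_restrict_of_forall_mem (measurableSet_strip T) (fun y hy => ?_)
        rw [norm_mul, norm_of_nonneg (bumpTwo_nonneg hε0 _)]
        by_cases hne : bumpTwo ε (z - y) = 0
        · rw [hne, mul_zero, mul_zero]
        · have h1 := bumpTwo_ne_zero hε0 hne
          have hd : dist y z < δ := by
            rw [Prod.dist_eq, max_lt_iff, dist_eq, dist_eq, abs_lt, abs_lt]
            refine ⟨⟨?_, ?_⟩, ?_, ?_⟩ <;> linarith [h1.1.1, h1.1.2, h1.2.1, h1.2.2]
          exact mul_le_mul_of_nonneg_right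
            (le_of_lt (H ⟨Ioo_subset_Icc_self hy.1, (show (0:ℝ) ≤ y.2 from le_of_lt hy.2)⟩ hd)) (bumpTwo_nonneg hε0 _)
    _ = η / 2 := by rw [integral_const_mul, e1, mul_one]
    _ < η := by linarith

lemma lintegral_bump {ε : ℝ} (hε : 0 < ε) : ∫⁻ x, ‖bump ε x‖ₑ = 1 := by
  have h2 := ofReal_integral_eq_lintegral_ofReal (integrable_bump ε hε) (.of_forall fun x => bump_nonneg hε x)
  rw [integral_bump hε, ofReal_one] at h2
  rw [h2]
  refine lintegral_congr fun x => ?_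
  rw [Real.enorm_of_nonneg (bump_nonneg hε x)]

/-- The initial slice of a mollification. -/
lemma lintegral_mol_zero_sq_le {T ε : ℝ} (hε : 0 < ε) {ψ : ℝ² → ℝ} {A : ℝ≥0∞}
    (hψ : AEStronglyMeasurable ψ vol(strip T))
    (hA : ∀ᵐ t ∂vol(Ioo 0 T), t < ε → ∫⁻ ξ in ℝ₊, ‖ψ (t, ξ)‖ₑ ^ 2 ≤ A) :
    ∫⁻ ξ, ‖mol T ε ψ (0, ξ)‖ₑ ^ 2 ≤ A := by
  have hc : Continuous fun p : ℝ × (ℝ²) => bumpTwo ε ((0, p.1) - p.2) := by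
    have := (contDiff_bumpTwo ε).continuous; fun_prop
  have hbm : Continuous (bump ε) := continuous_bump ε
  calc _ ≤ ∫⁻ ξ, ∫⁻ y in strip T, ‖ψ y‖ₑ ^ 2 * ‖bumpTwo ε ((0, ξ) - y)‖ₑ :=
        lintegral_mono fun ξ => enorm_mol_sq_le hε hψ _
    _ = ∫⁻ y in strip T, ∫⁻ ξ, ‖ψ y‖ₑ ^ 2 * ‖bumpTwo ε ((0, ξ) - y)‖ₑ := by
        refine lintegral_lintegral_swap ?_
        exact AEMeasurable.mul (AEMeasurable.comp_snd (f := fun y => ‖ψ y‖ₑ ^ 2) (aemeasurable_enorm_sq hψ))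
          hc.measurable.enorm.aemeasurable
    _ = ∫⁻ y in strip T, ‖ψ y‖ₑ ^ 2 * ‖bump ε y.1‖ₑ := by
        refine lintegral_congr fun y => ?_
        rw [lintegral_const_mul' _ _ (by simp)]
        congr 1
        simp only [bumpTwo, Prod.fst_sub, Prod.snd_sub, zero_sub, neg_neg, enorm_mul, neg_sub]
        rw [lintegral_const_mul' _ _ (by simp), lintegral_sub_left_eq_self (fun x => ‖bump ε x‖ₑ) y.2,
          lintegral_bump hε, mul_one]
    _ = ∫⁻ t in Ioo 0 T, ∫⁻ ξ in ℝ₊, ‖ψ (t, ξ)‖ₑ ^ 2 * ‖bump ε t‖ₑ := by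
        rw [volume_restrict_strip] at hψ ⊢
        exact lintegral_prod _ ((aemeasurable_enorm_sq hψ).mul
          (hbm.comp continuous_fst).measurable.enorm.aemeasurable)
    _ ≤ ∫⁻ t in Ioo 0 T, A * ‖bump ε t‖ₑ := by
        refine lintegral_mono_ae ?_
        filter_upwards [hA] with t ht
        rw [lintegral_mul_const' _ _ (by simp)]
        rcases lt_or_ge t ε with h | h
        · gcongr; exact ht h
        · rw [bump_eq_zero_of_ge hε h]; simp
    _ ≤ ∫⁻ t, A * ‖bump ε t‖ₑ := setLIntegral_le_lintegral _ _
    _ = A := by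
        rw [lintegral_const_mul _ hbm.measurable.enorm, lintegral_bump hε, mul_one]

/-- Derivatives of mollifications under the integral sign. -/
lemma dX_mol {T ε : ℝ} (hε : 0 < ε) {φ w : ℝ² → ℝ} (hφ : IntegrableOn φ (strip T))
    (h : IsWeakDeriv T 0 1 φ w) {z : ℝ²} (hz : z ∈ Icc 0 (T - ε) ×ˢ Ici 0) :
    dX (mol T ε φ) z = mol T ε w z := by
  rw [← mixedDeriv_mol hε hφ h hz, mixedDeriv_zero_one (contDiff_mol hε hφ)]

lemma dX_dX_mol {T ε : ℝ} (hε : 0 < ε) {φ w : ℝ² → ℝ} (hφ : IntegrableOn φ (strip T))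
    (h : IsWeakDeriv T 0 2 φ w) {z : ℝ²} (hz : z ∈ Icc 0 (T - ε) ×ˢ Ici 0) :
    dX (dX (mol T ε φ)) z = mol T ε w z := by
  rw [← mixedDeriv_mol hε hφ h hz, mixedDeriv_succ_right (contDiff_mol hε hφ),
    mixedDeriv_zero_one (contDiff_dX (contDiff_mol hε hφ))]

lemma dT_mol {T ε : ℝ} (hε : 0 < ε) {φ w : ℝ² → ℝ} (hφ : IntegrableOn φ (strip T))
    (h : IsWeakDeriv T 1 0 φ w) {z : ℝ²} (hz : z ∈ Icc 0 (T - ε) ×ˢ Ici 0) :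
    dT (mol T ε φ) z = mol T ε w z := by
  rw [← mixedDeriv_mol hε hφ h hz, mixedDeriv_one_zero (contDiff_mol hε hφ)]

/-- `∫∫ |w|²` over the half-strip. -/
noncomputable def sqInt (T : ℝ) (w : ℝ² → ℝ) : ℝ := (∫⁻ z in strip T, ‖w z‖ₑ ^ 2).toReal

lemma sqInt_nonneg (T : ℝ) (w : ℝ² → ℝ) : 0 ≤ sqInt T w := ENNReal.toReal_nonneg

lemma IsSq.lintegral_lt_top {T : ℝ} {w : ℝ² → ℝ} (h : IsSq T w) : ∫⁻ z in strip T, ‖w z‖ₑ ^ 2 < ⊤ := by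
  have := h.2 0; rwa [weighted_zero] at this

lemma IsSq.ofReal_sqInt {T : ℝ} {w : ℝ² → ℝ} (h : IsSq T w) :
    ofReal (sqInt T w) = ∫⁻ z in strip T, ‖w z‖ₑ ^ 2 := ENNReal.ofReal_toReal h.lintegral_lt_top.ne

lemma integral_mol_sq_le {T ε t a : ℝ} (hε : 0 < ε) (ht : 0 ≤ t) (ha : 0 ≤ a) {w : ℝ² → ℝ} (hw : IsSq T w)
    (hi : IntegrableOn w (strip T)) :
    ∫ s in 0..t, ∫ ξ in 0..a, mol T ε w (s, ξ) ^ 2 ≤ sqInt T w := by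
  rw [← ofReal_le_ofReal_iff (sqInt_nonneg T w), hw.ofReal_sqInt,
    ofReal_integral_integral_sq (G := fun s ξ => mol T ε w (s, ξ)) ht ha]
  · exact (setLIntegral_le_lintegral _ _).trans (lintegral_mol_sq_le hε hw.1)
  · exact (contDiff_mol hε hi).continuous.continuousOn

/-- A function on the half-strip, vanishing for `ξ ≥ 1`, with its first weak derivatives
and its second weak space derivative. -/
structure IsProfile (T : ℝ) (ψ ψ₁ ψ₂ ψt : ℝ² → ℝ) : Prop where
  cont : ContinuousOn ψ (closedStrip T)
  supp : ∀ t ∈ Icc 0 T, ∀ ξ, 1 ≤ ξ → ψ (t, ξ) = 0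
  dx : IsWeakDeriv T 0 1 ψ ψ₁
  dxx : IsWeakDeriv T 0 2 ψ ψ₂
  dt : IsWeakDeriv T 1 0 ψ ψt
  int : IntegrableOn ψ (strip T)
  int₁ : IntegrableOn ψ₁ (strip T)
  int₂ : IntegrableOn ψ₂ (strip T)
  intt : IntegrableOn ψt (strip T)
  sq : IsSq T ψ
  sq₁ : IsSq T ψ₁
  sq₂ : IsSq T ψ₂
  sqt : IsSq T ψt

lemma exists_abs_le_of_supp {T : ℝ} {ψ : ℝ² → ℝ} (hc : ContinuousOn ψ (closedStrip T))
    (hs : ∀ t ∈ Icc 0 T, ∀ ξ, 1 ≤ ξ → ψ (t, ξ) = 0) :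
    ∃ B, 0 ≤ B ∧ ∀ z ∈ closedStrip T, |ψ z| ≤ B := by
  have hK : IsCompact (Icc (0 : ℝ) T ×ˢ Icc (0 : ℝ) 1) := isCompact_Icc.prod isCompact_Icc
  obtain ⟨B, hB⟩ := hK.exists_bound_of_continuousOn (hc.mono (Set.prod_mono Subset.rfl fun x hx => hx.1))
  refine ⟨max B 0, le_max_right _ _, fun z hz => ?_⟩
  rcases le_total z.2 1 with h | h
  · exact (hB z ⟨hz.1, hz.2, h⟩).trans (le_max_left _ _)
  · rw [show ψ z = 0 from hs z.1 hz.1 z.2 h, abs_zero]; exact le_max_right _ _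

lemma tendsto_inv_nat_nhdsGT : Tendsto (fun n : ℕ => ((n : ℝ) + 1)⁻¹) atTop (𝓝[>] 0) :=
  tendsto_nhdsWithin_iff.2 ⟨by simpa using tendsto_one_div_add_atTop_nhds_zero_nat (𝕜 := ℝ),
    .of_forall fun n => by simp only [mem_Ioi]; positivity⟩

namespace IsCoeff
variable {c : ℝ → ℝ} {c₀ c₁ : ℝ} (hc : IsCoeff c c₀ c₁)
include hc

set_option maxHeartbeats 400000 in
/-- Bounds near the boundary for boundary data `m(t) ψ(t, 0)`. -/
lemma near_of_profile {T K A L L' : ℝ} (hT : 0 < T) (hK : 0 ≤ K) (hA0 : 0 ≤ A) 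
    (hE : EnergyBound c c₀ T K)
    {ψ ψ₁ ψ₂ ψt : ℝ² → ℝ} (hψ : IsProfile T ψ ψ₁ ψ₂ ψt)
    {m m' : ℕ → ℝ → ℝ} {M : ℝ → ℝ} (hm : ∀ n t, HasDerivAt (m n) (m' n t) t)
    (hm' : ∀ n, Continuous (m' n)) (hL : ∀ n t, |m n t| ≤ L) (hL' : ∀ n t, |m' n t| ≤ L')
    (hM : ∀ t, Tendsto (fun n => m n t) atTop (𝓝 (M t))) (h00 : ψ (0, 0) = 0)
    (hA : ∀ η > 0, ∀ᶠ ε in 𝓝[>] (0 : ℝ), ∀ᵐ t ∂vol(Ioo 0 T), t < ε →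
      ∫⁻ ξ in ℝ₊, ‖ψ₁ (t, ξ)‖ₑ ^ 2 ≤ ofReal (A + η)) {R : ℝ}
    (hR : R = L ^ 2 * A + c₀⁻¹ * (2 * c₁ ^ 2 * L ^ 2 * sqInt T ψ₂ + 4 * L' ^ 2 * sqInt T ψ
      + 4 * L ^ 2 * sqInt T ψt) + K * (∫ r in Ioo 0 T, |M r * ψ (r, 0)|) ^ 2) :
    (∀ᵐ t ∂vol(Ioo 0 T), ∫⁻ ξ in Ioo 0 1,
      ‖-pot c T (fun r => M r * ψ (r, 0)) 2 t ξ - M t * ψ₁ (t, ξ)‖ₑ ^ 2 ≤ ofReal R) ∧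
    ∫⁻ z in Ioo 0 T ×ˢ Ioo 0 1,
      ‖-pot c T (fun r => M r * ψ (r, 0)) 3 z.1 z.2 - M z.1 * ψ₂ z‖ₑ ^ 2 ≤ ofReal (c₀⁻¹ * R) := by
  have hc₀ := hc.pos
  have hc₁ := hc.c₁_pos
  have hL0 : 0 ≤ L := (abs_nonneg _).trans (hL 0 0)
  set ε : ℕ → ℝ := fun n => ((n : ℝ) + 1)⁻¹ with hεdef
  have hε : ∀ n, 0 < ε n := fun n => by positivity
  have hεl : Tendsto ε atTop (𝓝[>] 0) := tendsto_inv_nat_nhdsGT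
  obtain ⟨B, hB0, hB⟩ := exists_abs_le_of_supp hψ.cont hψ.supp
  have hBs : ∀ y ∈ strip T, |ψ y| ≤ B := fun y hy =>
    hB y (strip_subset_closedStrip T hy)
  set u : ℕ → ℝ² → ℝ := fun n => mol T (ε n) ψ with hu
  have hus : ∀ n, ContDiff ℝ ∞ (u n) := fun n => contDiff_mol (hε n) hψ.int
  have hsmall : ∀ t, t < T → ∀ᶠ n in atTop, t ≤ T - ε n := fun t ht => by
    have := hεl (Ioo_mem_nhdsGT (sub_pos.2 ht))
    filter_upwards [this] with n hn
    have := hn.2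
    linarith
  -- The approximating lifts are smooth multipliers `m n` times mollifications of `ψ`; they vanish
  -- for `ξ ≥ 1` because the mollifier looks to the right.
  have hlift := fun n => isLift_mul (hus n) (fun z hz => mol_eq_zero (hε n)
    (fun z hz h => hψ.supp z.1 (Ioo_subset_Icc_self hz.1) z.2 h) hz) (hm n) (hm' n)
  have hpt : ∀ z ∈ Ico 0 T ×ˢ Ici (0 : ℝ), Tendsto (fun n => u n z) atTop (𝓝 (ψ z)) := fun z hz =>
    (tendsto_mol hψ.cont hψ.int hz).comp hεl
  have hbd : ∀ n r, |m n r * u n (r, 0) - m n 0 * u n (0, 0)| ≤ 2 * (L * B) := fun n r => by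
    have h1 : ∀ s, |m n s * u n (s, 0)| ≤ L * B := fun s => by
      rw [abs_mul]; exact mul_le_mul (hL n s) (abs_mol_le (hε n) hBs hB0 _) (abs_nonneg _) hL0
    calc _ ≤ |m n r * u n (r, 0)| + |m n 0 * u n (0, 0)| := abs_sub _ _
      _ ≤ _ := by linarith [h1 r, h1 0]
  have hlim : ∀ r ∈ Ioo 0 T, Tendsto (fun n => m n r * u n (r, 0) - m n 0 * u n (0, 0)) atTop
      (𝓝 (M r * ψ (r, 0))) := fun r hr => by
    have h1 := ((hM r).mul (hpt (r, 0) ⟨⟨hr.1.le, hr.2⟩, self_mem_Ici⟩)).sub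
      ((hM 0).mul (hpt (0, 0) ⟨⟨le_rfl, hT⟩, self_mem_Ici⟩))
    simpa [h00] using h1
  have hdx : ∀ n, ∀ z ∈ Icc 0 (T - ε n) ×ˢ Ici (0 : ℝ), dX (u n) z = mol T (ε n) ψ₁ z := fun n z hz =>
    dX_mol (hε n) hψ.int hψ.dx hz
  have hdxx : ∀ n, ∀ z ∈ Icc 0 (T - ε n) ×ˢ Ici (0 : ℝ), dX (dX (u n)) z = mol T (ε n) ψ₂ z :=
    fun n z hz => dX_dX_mol (hε n) hψ.int hψ.dxx hz
  have hdt : ∀ n, ∀ z ∈ Icc 0 (T - ε n) ×ˢ Ici (0 : ℝ), dT (u n) z = mol T (ε n) ψt z :=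
    fun n z hz => dT_mol (hε n) hψ.int hψ.dt hz
  have hmol : ∀ {w : ℝ² → ℝ}, IntegrableOn w (strip T) → ∀ n, Continuous (mol T (ε n) w) :=
    fun hw n => (contDiff_mol (hε n) hw).continuous
  have hconv : ∀ {w : ℝ² → ℝ} {W : ℕ → ℝ² → ℝ}, IntegrableOn w (strip T) →
      (∀ n, ∀ z ∈ Icc 0 (T - ε n) ×ˢ Ici (0 : ℝ), W n z = mol T (ε n) w z) →
      ∀ᵐ z ∂vol(strip T), Tendsto (fun n => m n z.1 * W n z) atTop (𝓝 (M z.1 * w z)) := fun hw hW => by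
    filter_upwards [ae_tendsto_mol hw, ae_restrict_mem (measurableSet_strip T)] with z hz hzs
    refine ((hM z.1).mul (hz.comp hεl)).congr' ?_
    filter_upwards [hsmall z.1 hzs.1.2] with n hn
    rw [Function.comp, ← hW n z ⟨⟨hzs.1.1.le, hn⟩, (strip_subset_closedStrip T hzs).2⟩]
  refine hc.near_of_lifts hT hE hlift (b := fun r => M r * ψ (r, 0)) (F₁ := fun z => M z.1 * ψ₁ z)
    (F₂ := fun z => M z.1 * ψ₂ z) (B := 2 * (L * B)) (R := R)
    (fun t _ => .of_forall fun n r _ => hbd n r) hlim (hconv hψ.int₁ hdx) (hconv hψ.int₂ hdxx) ?_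
  · intro t ht η hη
    have hL2 : 0 < L ^ 2 + 1 := by positivity
    have h3 : Tendsto (fun n => K * (∫ r in Ioo 0 t, |m n r * u n (r, 0) - m n 0 * u n (0, 0)|) ^ 2) atTop
        (𝓝 (K * (∫ r in Ioo 0 t, |M r * ψ (r, 0)|) ^ 2)) := by
      refine ((tendsto_integral_filter_of_dominated_convergence (fun _ => 2 * (L * B)) ?_ ?_ ?_ ?_).pow 2).const_mul K
      · exact .of_forall fun n => ((hlift n).continuous_data.abs).aestronglyMeasurable
      · exact .of_forall fun n => .of_forall fun r => by rw [norm_eq_abs, abs_abs]; exact hbd n r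
      · exact integrable_const _
      · refine ae_restrict_of_forall_mem measurableSet_Ioo (fun r hr => ?_)
        exact (hlim r ⟨hr.1, hr.2.trans ht.2⟩).abs
    have h3' : K * (∫ r in Ioo 0 t, |M r * ψ (r, 0)|) ^ 2 ≤ K * (∫ r in Ioo 0 T, |M r * ψ (r, 0)|) ^ 2 := by
      refine mul_le_mul_of_nonneg_left (pow_le_pow_left₀ (integral_nonneg fun _ => abs_nonneg _) ?_ 2) hK
      refine setIntegral_mono_set ?_ (ae_of_all _ fun _ => abs_nonneg _)
        (Ioo_subset_Ioo_right ht.2.le).eventuallyLE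
      refine Integrable.of_bound (C := L * B) ?_ ?_
      · have hMm : AEStronglyMeasurable M vol(Ioo 0 T) := by
          refine aestronglyMeasurable_of_tendsto_ae atTop (f := fun n => m n) (fun n => ?_) (ae_of_all _ hM)
          exact (continuous_iff_continuousAt.2 fun t => (hm n t).continuousAt).aestronglyMeasurable
        exact (hMm.mul <| (hψ.cont.comp (by fun_prop) fun r hr =>
          ⟨Ioo_subset_Icc_self hr, self_mem_Ici⟩).aestronglyMeasurable measurableSet_Ioo).norm
      · refine ae_restrict_of_forall_mem measurableSet_Ioo (fun r hr => ?_)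
        rw [norm_eq_abs, abs_abs, abs_mul]
        exact mul_le_mul (le_of_tendsto (hM r).abs (.of_forall fun n => hL n r))
          (hB _ ⟨Ioo_subset_Icc_self hr, self_mem_Ici⟩) (abs_nonneg _) hL0
    -- The error `η` is shared equally between the initial slice, where `L²` multiplies it, and the
    -- boundary term `(∫|b|)²`.
    filter_upwards [hsmall t ht.2, hεl (hA (η / (2 * (L ^ 2 + 1))) (by positivity)),
      h3.eventually_le_const (u := K * (∫ r in Ioo 0 t, |M r * ψ (r, 0)|) ^ 2 + η / 2) (by linarith)]
      with n hn hAn h3n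
    have e1 : ∫ ξ in 0..1, (m n 0 * dX (u n) (0, ξ)) ^ 2 ≤ L ^ 2 * (A + η / (2 * (L ^ 2 + 1))) := by
      have e : ∫ ξ in 0..1, (m n 0 * dX (u n) (0, ξ)) ^ 2 =
          m n 0 ^ 2 * ∫ ξ in 0..1, mol T (ε n) ψ₁ (0, ξ) ^ 2 := by
        rw [← intervalIntegral.integral_const_mul]
        refine integral_congr fun ξ hξ => ?_
        rw [uIcc_of_le zero_le_one] at hξ
        rw [hdx n (0, ξ) ⟨⟨le_rfl, ht.1.le.trans hn⟩, hξ.1⟩, mul_pow]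
      rw [e]
      refine mul_le_mul (sq_le_sq' (by linarith [abs_le.1 (hL n 0)]) (le_of_abs_le (hL n 0))) ?_
        (intervalIntegral.integral_nonneg zero_le_one fun _ _ => sq_nonneg _) (sq_nonneg L)
      have hp : 0 ≤ A + η / (2 * (L ^ 2 + 1)) := by positivity
      rw [← ofReal_le_ofReal_iff hp, ofReal_integral_sq (G := fun ξ => mol T (ε n) ψ₁ (0, ξ)) zero_le_one
        ((hmol hψ.int₁ n).comp (by fun_prop : Continuous fun ξ : ℝ => ((0 : ℝ), ξ))).continuousOn]
      exact (setLIntegral_le_lintegral _ _).trans (lintegral_mol_zero_sq_le (hε n) hψ.sq₁.1 hAn)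
    -- The forcing has three terms; `(x - (y + z))² ≤ 2x² + 4y² + 4z²` explains the factors 2, 4, 4.
    have e2 : ∫ s in 0..t, ∫ ξ in 0..1, (c s * (m n s * dX (dX (u n)) (s, ξ)) -
        (m' n s * u n (s, ξ) + m n s * dT (u n) (s, ξ))) ^ 2 ≤ 2 * c₁ ^ 2 * L ^ 2 * sqInt T ψ₂ +
          4 * L' ^ 2 * sqInt T ψ + 4 * L ^ 2 * sqInt T ψt := by
      have q1 := hmol hψ.int₁ n
      have q2 := hmol hψ.int₂ n
      have q0 : Continuous (u n) := hmol hψ.int n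
      have qt := hmol hψ.intt n
      have mc : Continuous (m n) := continuous_iff_continuousAt.2 fun t => (hm n t).continuousAt
      have cc := hc.cont
      have m'c := hm' n
      have v2 : Continuous (dX (dX (u n))) := (contDiff_dX (contDiff_dX (hus n))).continuous
      have vt : Continuous (dT (u n)) := (contDiff_dT (hus n)).continuous
      have i2 : ∀ {G : ℝ → ℝ → ℝ}, Continuous (uncurry G) → ∀ a b : ℝ,
          IntervalIntegrable (fun s => ∫ ξ in 0..1, G s ξ) volume a b := fun hG a b =>
        (continuous_parametric_intervalIntegral_of_continuous' hG 0 1).intervalIntegrable a b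
      calc _ ≤ ∫ s in 0..t, ∫ ξ in 0..1, (2 * c₁ ^ 2 * L ^ 2 * mol T (ε n) ψ₂ (s, ξ) ^ 2 +
            4 * L' ^ 2 * u n (s, ξ) ^ 2 + 4 * L ^ 2 * mol T (ε n) ψt (s, ξ) ^ 2) := by
            refine integral_mono_on ht.1.le (i2 (by fun_prop) _ _) (i2 (by fun_prop) _ _) fun s hs => ?_
            refine integral_mono_on zero_le_one (Continuous.intervalIntegrable (by fun_prop) _ _)
              (Continuous.intervalIntegrable (by fun_prop) _ _) fun ξ hξ => ?_
            have hz : (s, ξ) ∈ Icc 0 (T - ε n) ×ˢ Ici (0 : ℝ) := ⟨⟨hs.1, hs.2.trans hn⟩, hξ.1⟩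
            rw [hdxx n _ hz, hdt n _ hz]
            have hcs : c s ^ 2 ≤ c₁ ^ 2 := pow_le_pow_left₀ (hc.c_pos s).le (hc.upper s) 2
            have hms : m n s ^ 2 ≤ L ^ 2 := sq_le_sq' (by linarith [abs_le.1 (hL n s)]) (le_of_abs_le (hL n s))
            have hms' : m' n s ^ 2 ≤ L' ^ 2 := sq_le_sq' (by linarith [abs_le.1 (hL' n s)]) (le_of_abs_le (hL' n s))
            have z1 : (c s * m n s) ^ 2 ≤ c₁ ^ 2 * L ^ 2 := by
              rw [mul_pow]; exact mul_le_mul hcs hms (sq_nonneg _) (sq_nonneg _)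
            have w1 := mul_le_mul_of_nonneg_right z1 (sq_nonneg (mol T (ε n) ψ₂ (s, ξ)))
            have w2 := mul_le_mul_of_nonneg_right hms' (sq_nonneg (u n (s, ξ)))
            have w3 := mul_le_mul_of_nonneg_right hms (sq_nonneg (mol T (ε n) ψt (s, ξ)))
            nlinarith [sq_nonneg (c s * m n s * mol T (ε n) ψ₂ (s, ξ) +
              (m' n s * u n (s, ξ) + m n s * mol T (ε n) ψt (s, ξ))),
              sq_nonneg (m' n s * u n (s, ξ) - m n s * mol T (ε n) ψt (s, ξ))]
        _ = 2 * c₁ ^ 2 * L ^ 2 * (∫ s in 0..t, ∫ ξ in 0..1, mol T (ε n) ψ₂ (s, ξ) ^ 2) +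
            4 * L' ^ 2 * (∫ s in 0..t, ∫ ξ in 0..1, u n (s, ξ) ^ 2) +
            4 * L ^ 2 * (∫ s in 0..t, ∫ ξ in 0..1, mol T (ε n) ψt (s, ξ) ^ 2) := by
            have i1 : ∀ {G : ℝ → ℝ}, Continuous G → IntervalIntegrable G volume 0 1 := fun hG =>
              hG.intervalIntegrable _ _
            simp only [← intervalIntegral.integral_const_mul]
            rw [← intervalIntegral.integral_add (i2 (by fun_prop) _ _) (i2 (by fun_prop) _ _),
              ← intervalIntegral.integral_add (i2 (by fun_prop) _ _ |>.add (i2 (by fun_prop) _ _)) (i2 (by fun_prop) _ _)]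
            refine integral_congr fun s _ => ?_
            rw [← intervalIntegral.integral_add (i1 (by fun_prop)) (i1 (by fun_prop)),
              ← intervalIntegral.integral_add (i1 (by fun_prop)) (i1 (by fun_prop))]
        _ ≤ _ := by
            have a2 := integral_mol_sq_le (hε n) ht.1.le zero_le_one hψ.sq₂ hψ.int₂
            have a0 := integral_mol_sq_le (hε n) ht.1.le zero_le_one hψ.sq hψ.int
            have at' := integral_mol_sq_le (hε n) ht.1.le zero_le_one hψ.sqt hψ.intt
            gcongr
    have e3 : L ^ 2 * (A + η / (2 * (L ^ 2 + 1))) ≤ L ^ 2 * A + η / 2 := by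
      have : L ^ 2 * (η / (2 * (L ^ 2 + 1))) ≤ η / 2 := by
        rw [mul_div_assoc', div_le_div_iff₀ (by positivity) two_pos]
        nlinarith
      linarith
    have e4 := mul_le_mul_of_nonneg_left e2 (inv_nonneg.2 hc₀.le)
    rw [hR]
    calc _ ≤ (L ^ 2 * A + η / 2) + c₀⁻¹ * (2 * c₁ ^ 2 * L ^ 2 * sqInt T ψ₂ +
          4 * L' ^ 2 * sqInt T ψ + 4 * L ^ 2 * sqInt T ψt) + (K * (∫ r in Ioo 0 T, |M r * ψ (r, 0)|) ^ 2 + η / 2) :=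
          add_le_add (add_le_add (e1.trans e3) e4) (h3n.trans (by linarith))
      _ = _ := by ring

end IsCoeff

lemma IsSq.memLp {T : ℝ} {w : ℝ² → ℝ} (h : IsSq T w) : MemLp w 2 vol(strip T) :=
  (memLp_two_iff_lintegral h.1).2 h.lintegral_lt_top

/-- Cauchy-Schwarz against `⟨ξ⟩^{-1}`, which is square integrable; one power of the weight is spent.
-/
lemma IsSq.integrableOn {T : ℝ} {w : ℝ² → ℝ} (h : IsSq T w) : IntegrableOn w (strip T) := by
  have h1 : MemLp (weighted 1 w) 2 vol(strip T) :=
    (memLp_two_iff_lintegral (aestronglyMeasurable_weighted h.1 1)).2 (h.2 1)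
  have hm : AEStronglyMeasurable (fun z => (√(1 + z.2 ^ 2))⁻¹) vol(strip T) :=
    (Continuous.inv₀ (by fun_prop) fun z => (Real.sqrt_pos.2 (by positivity)).ne').aestronglyMeasurable
  have h2 : MemLp (fun z => (√(1 + z.2 ^ 2))⁻¹) 2 vol(strip T) := by
    rw [memLp_two_iff_integrable_sq hm, volume_restrict_strip]
    have := (integrable_inv_one_add_sq.integrableOn (s := ℝ₊)).comp_snd vol(Ioo 0 T)
    refine this.congr (.of_forall fun z => ?_)
    beta_reduce
    rw [inv_pow, Real.sq_sqrt (by positivity)]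
  refine (h2.integrable_mul h1).congr (.of_forall fun z => ?_)
  have : √(1 + z.2 ^ 2) ≠ 0 := (Real.sqrt_pos.2 (by positivity)).ne'
  simp only [Pi.mul_apply, weighted, pow_one]
  rw [inv_mul_cancel_left₀ this]

lemma enorm_weighted_sq_le {N : ℕ} {w : ℝ² → ℝ} {z : ℝ²} (h0 : 0 ≤ z.2) (h : 1 < z.2 → w z = 0) :
    ‖weighted N w z‖ₑ ^ 2 ≤ 2 ^ N * ‖w z‖ₑ ^ 2 := by
  rcases le_or_gt z.2 1 with h1 | h1
  · have e : ‖weighted N w z‖ₑ ^ 2 = ofReal ((1 + z.2 ^ 2) ^ N) * ‖w z‖ₑ ^ 2 := by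
      rw [weighted, enorm_mul, mul_pow]
      congr 1
      rw [Real.enorm_of_nonneg (by positivity), ← ofReal_pow (by positivity), ← pow_mul, mul_comm N,
        pow_mul, Real.sq_sqrt (by positivity)]
    rw [e]
    gcongr
    rw [show (2 : ℝ≥0∞) ^ N = ofReal (2 ^ N) by rw [ofReal_pow (by norm_num), ENNReal.ofReal_ofNat]]
    gcongr
    nlinarith
  · simp [weighted, h h1]

lemma isSup_of_vanish {T : ℝ} {w : ℝ² → ℝ} (hm : AEStronglyMeasurable w vol(strip T))
    {B : NNReal} (hB : ∀ᵐ t ∂vol(Ioo 0 T), ∫⁻ ξ in ℝ₊, ‖w (t, ξ)‖ₑ ^ 2 ≤ B)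
    (h : ∀ᵐ z ∂vol(strip T), 1 < z.2 → w z = 0) : IsSup T w := by
  refine ⟨hm, fun N => ⟨2 ^ N * B, ?_⟩⟩
  rw [volume_restrict_strip] at h
  filter_upwards [hB, ae_ae_of_ae_prod h] with t ht h
  calc _ ≤ ∫⁻ ξ in ℝ₊, 2 ^ N * ‖w (t, ξ)‖ₑ ^ 2 := by
        refine lintegral_mono_ae ?_
        filter_upwards [h, ae_restrict_mem measurableSet_Ioi] with ξ hξ h0
        exact enorm_weighted_sq_le (le_of_lt h0) hξ
    _ ≤ _ := by
        rw [lintegral_const_mul' _ _ (by simp)]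
        push_cast
        gcongr

lemma isSq_of_vanish {T : ℝ} {w : ℝ² → ℝ} (hm : MemLp w 2 vol(strip T))
    (h : ∀ᵐ z ∂vol(strip T), 1 < z.2 → w z = 0) : IsSq T w := by
  refine ⟨hm.1, fun N => ?_⟩
  calc _ ≤ ∫⁻ z in strip T, 2 ^ N * ‖w z‖ₑ ^ 2 := by
        refine lintegral_mono_ae ?_
        filter_upwards [h, ae_restrict_mem (measurableSet_strip T)] with z hz h0
        exact enorm_weighted_sq_le (le_of_lt h0.2) hz
    _ < ⊤ := by
        rw [lintegral_const_mul' _ _ (by simp)]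
        exact mul_lt_top (by simp) ((memLp_two_iff_lintegral hm.1).1 hm)

/-! ### Primitives in time -/

/-- `∫₀ᵗ g(r, ξ) dr`. -/
noncomputable def timePrim (T : ℝ) (g : ℝ² → ℝ) (z : ℝ²) : ℝ :=
  ∫ r in Ioo 0 T, (Iio z.1).indicator (fun r => g (r, z.2)) r

lemma timePrim_eq {T : ℝ} (g : ℝ² → ℝ) {t : ℝ} (ht : t ∈ Icc 0 T) (ξ : ℝ) :
    timePrim T g (t, ξ) = ∫ r in 0..t, g (r, ξ) := by
  rw [timePrim, setIntegral_indicator measurableSet_Iio, integral_of_le ht.1, integral_Ioc_eq_integral_Ioo]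
  congr 2
  ext r
  exact ⟨fun h => ⟨h.1.1, h.2⟩, fun h => ⟨⟨h.1, h.2.trans_le ht.2⟩, h.2⟩⟩

lemma integrableOn_timePrim {T : ℝ} {g : ℝ² → ℝ} (hg : IntegrableOn g (strip T)) :
    IntegrableOn (timePrim T g) (strip T) := by
  rw [IntegrableOn, volume_restrict_strip] at hg ⊢
  have h1 := hg.comp_snd vol(Ioo 0 T)
  set μ := vol(Ioo (0 : ℝ) T)
  set ν := vol(ℝ₊)
  have hp : MeasurePreserving (fun p : (ℝ²) × ℝ => (p.1.1, (p.2, p.1.2)))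
      ((μ.prod ν).prod μ) (μ.prod (μ.prod ν)) :=
    ((MeasurePreserving.id μ).prod (Measure.measurePreserving_swap (μ := ν) (ν := μ))).comp
      (measurePreserving_prodAssoc μ ν μ)
  have h2 := hp.integrable_comp_of_integrable h1
  have hS : MeasurableSet {p : (ℝ²) × ℝ | p.2 < p.1.1} := measurableSet_lt (by fun_prop) (by fun_prop)
  have h3 := (h2.indicator hS).integral_prod_left
  refine h3.congr (.of_forall fun z => ?_)
  beta_reduce
  rw [timePrim]
  refine integral_congr_ae (.of_forall fun r => ?_)
  simp only [indicator, mem_ofPred_eq, mem_Iio, Function.comp]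

/-- Cauchy-Schwarz over `(0,t)`. The factor `t` is kept because it makes the initial energy of the
lift vanish in `slice_small`. -/
lemma enorm_timePrim_sq_le {T : ℝ} {g : ℝ² → ℝ} {t ξ : ℝ} (ht : t ∈ Ioo 0 T)
    (hm : AEMeasurable (fun r => g (r, ξ)) vol(Ioo 0 T)) :
    ‖timePrim T g (t, ξ)‖ₑ ^ 2 ≤ ofReal t * ∫⁻ r in Ioo 0 T, ‖g (r, ξ)‖ₑ ^ 2 := by
  calc _ ≤ (∫⁻ r in Ioo 0 T, (Iio t).indicator (fun _ => 1) r * ‖g (r, ξ)‖ₑ) ^ 2 := by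
        gcongr
        refine (enorm_integral_le_lintegral_enorm _).trans (le_of_eq (lintegral_congr fun r => ?_))
        by_cases h : r < t <;> simp [indicator, h]
    _ ≤ (∫⁻ r in Ioo 0 T, (Iio t).indicator (fun _ => 1) r ^ 2) * ∫⁻ r in Ioo 0 T, ‖g (r, ξ)‖ₑ ^ 2 :=
        lintegral_mul_sq_le (aemeasurable_const.indicator measurableSet_Iio) hm.enorm
    _ = _ := by
        congr 1
        have e : ∀ r, (Iio t).indicator (fun _ => (1 : ℝ≥0∞)) r ^ 2 = (Iio t).indicator (fun _ => 1) r := fun r => by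
          by_cases h : r < t <;> simp [indicator, h]
        simp only [e]
        rw [lintegral_indicator measurableSet_Iio, Measure.restrict_restrict measurableSet_Iio, setLIntegral_one,
          show Iio t ∩ Ioo 0 T = Ioo 0 t from ?_, volume_Ioo, sub_zero]
        ext r
        exact ⟨fun h => ⟨h.2.1, h.1⟩, fun h => ⟨h.2, h.1, h.2.trans ht.2⟩⟩

lemma weighted_timePrim (N : ℕ) (T : ℝ) (g : ℝ² → ℝ) (z : ℝ²) :
    weighted N (timePrim T g) z = timePrim T (weighted N g) z := by
  rw [weighted, timePrim, timePrim, ← integral_const_mul]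
  refine integral_congr_ae (.of_forall fun r => ?_)
  by_cases h : r < z.1 <;> simp [indicator, h, weighted]

lemma lintegral_timePrim_sq_le {T : ℝ} {g : ℝ² → ℝ}
    (hg : AEStronglyMeasurable g vol(strip T)) {t : ℝ} (ht : t ∈ Ioo 0 T) :
    ∫⁻ ξ in ℝ₊, ‖timePrim T g (t, ξ)‖ₑ ^ 2 ≤ ofReal t * ∫⁻ z in strip T, ‖g z‖ₑ ^ 2 := by
  have h0 := aemeasurable_enorm_sq hg
  rw [volume_restrict_strip] at h0 hg
  have hs : ∀ᵐ ξ ∂vol(ℝ₊), AEStronglyMeasurable (fun r => g (r, ξ)) vol(Ioo 0 T) :=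
    hg.prod_swap.prodMk_left
  calc _ ≤ ∫⁻ ξ in ℝ₊, ofReal t * ∫⁻ r in Ioo 0 T, ‖g (r, ξ)‖ₑ ^ 2 := by
        refine lintegral_mono_ae ?_
        filter_upwards [hs] with ξ hξ
        exact enorm_timePrim_sq_le ht hξ.aemeasurable
    _ = _ := by
        rw [lintegral_const_mul' _ _ (by simp), volume_restrict_strip, lintegral_prod_symm _ h0]

lemma IsSq.timePrim {T : ℝ} {g : ℝ² → ℝ} (hg : IsSq T g) : IsSup T (timePrim T g) := by
  refine ⟨(integrableOn_timePrim hg.integrableOn).1, fun N => ⟨(ofReal T *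
    ∫⁻ z in strip T, ‖weighted N g z‖ₑ ^ 2).toNNReal, ?_⟩⟩
  rw [coe_toNNReal (mul_lt_top (by simp) (hg.2 N)).ne]
  refine ae_restrict_of_forall_mem measurableSet_Ioo (fun t ht => ?_)
  simp only [weighted_timePrim]
  refine (lintegral_timePrim_sq_le (aestronglyMeasurable_weighted hg.1 N) ht).trans ?_
  gcongr
  exact ht.2.le

/-- Fubini on the triangle `r < t`, with `s = t - r` as new variable: integrating the function in
time is the same as averaging over time shifts of the test function. -/
lemma integral_timePrim_mul {T : ℝ} {g ψ : ℝ² → ℝ} (hg : IntegrableOn g (strip T))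
    (hψ : Continuous ψ) (hc : HasCompactSupport ψ) (hs : ∀ z, T ≤ z.1 → ψ z = 0) :
    ∫ z in strip T, timePrim T g z * ψ z = ∫ s in Ioo 0 T, ∫ z in strip T, g z * ψ (z.1 + s, z.2) := by
  obtain ⟨C, hC⟩ := hc.exists_bound_of_continuous hψ
  have hP := integrableOn_timePrim hg
  have hPψ : Integrable (fun z => timePrim T g z * ψ z) vol(strip T) :=
    hP.mul_bdd (c := C) hψ.aestronglyMeasurable (.of_forall hC)
  have hgs : Integrable (fun p : ℝ × (ℝ²) => g p.2 * ψ (p.2.1 + p.1, p.2.2))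
      (vol(Ioo 0 T).prod vol(strip T)) := (hg.comp_snd vol(Ioo 0 T)).mul_bdd (c := C)
      (Continuous.aestronglyMeasurable (by fun_prop)) (.of_forall fun p => hC _)
  rw [integral_integral_swap (f := fun s z => g z * ψ (z.1 + s, z.2)) hgs]
  have hgs' := hgs.integral_prod_right
  rw [IntegrableOn] at hg
  rw [volume_restrict_strip] at hPψ hg hgs' ⊢
  rw [integral_prod_symm _ hPψ, integral_prod_symm _ hgs']
  refine integral_congr_ae ?_
  filter_upwards [hg.prod_left_ae] with ξ hξ
  have hψξ : IntegrableOn (fun t => ψ (t, ξ)) (Ioo 0 T) :=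
    ((Continuous.continuousOn (by fun_prop)).integrableOn_Icc (a := 0) (b := T)).mono_set Ioo_subset_Icc_self
  have hS : MeasurableSet {p : ℝ² | p.2 < p.1} := measurableSet_lt (by fun_prop) (by fun_prop)
  have hi := (hψξ.mul_prod hξ).indicator hS
  have hsw := integral_integral_swap (f := fun t r => {p : ℝ² | p.2 < p.1}.indicator
    (fun p : ℝ² => ψ (p.1, ξ) * g (p.2, ξ)) (t, r)) hi
  refine Eq.trans (integral_congr_ae (.of_forall fun t => ?_)) (hsw.trans
    (setIntegral_congr_fun measurableSet_Ioo fun r hr => ?_))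
  · beta_reduce
    rw [timePrim, ← integral_mul_const]
    refine integral_congr_ae (.of_forall fun r => ?_)
    by_cases h : r < t <;> simp [indicator, h, mul_comm]
  · rw [integral_const_mul]
    have e1 : ∀ t, {p : ℝ² | p.2 < p.1}.indicator (fun p : ℝ² => ψ (p.1, ξ) * g (p.2, ξ)) (t, r) =
        g (r, ξ) * (Ioi r).indicator (fun t => ψ (t, ξ)) t := fun t => by
      by_cases h : r < t <;> simp [indicator, h, mul_comm]
    simp only [e1]
    rw [integral_const_mul, setIntegral_indicator measurableSet_Ioi]
    congr 1
    have e2 : ∫ s in Ioo 0 T, ψ (r + s, ξ) = ∫ s in 0..T, ψ (r + s, ξ) := by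
      rw [integral_of_le (hr.1.trans hr.2).le, integral_Ioc_eq_integral_Ioo]
    rw [e2, intervalIntegral.integral_comp_add_left (fun t => ψ (t, ξ)),
      integral_of_le (by linarith [hr.1, hr.2]), integral_Ioc_eq_integral_Ioo]
    refine (setIntegral_eq_of_subset_of_forall_sdiff_eq_zero measurableSet_Ioo
      (fun t ht => ⟨by linarith [mem_Ioi.1 ht.2], by linarith [ht.1.2, hr.1]⟩) fun t ht => hs _ ?_).symm
    by_contra h
    exact ht.2 ⟨⟨by linarith [ht.1.1, hr.1], not_le.1 h⟩, mem_Ioi.2 (by linarith [ht.1.1])⟩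

/-- A test function shifted backwards in time may reach `t = 0`, so it is cut off below `t = δ`. The
cutoff depends on time only and commutes with the space derivatives. -/
lemma IsTest.shift {T : ℝ} {φ : ℝ² → ℝ} (h : IsTest T φ) {s δ : ℝ} (hs : 0 ≤ s) (hδ : 0 < δ) :
    IsTest T fun z => Real.smoothTransition (z.1 / δ - 1) * φ (z.1 + s, z.2) := by
  have hsub : tsupport (fun z : ℝ² => Real.smoothTransition (z.1 / δ - 1) * φ (z.1 + s, z.2)) ⊆
      {z | δ ≤ z.1} ∩ (fun z : ℝ² => (z.1 + s, z.2)) ⁻¹' tsupport φ := by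
    refine closure_minimal (fun z hz => ⟨?_, subset_tsupport _ (right_ne_zero_of_mul hz)⟩)
      ((isClosed_le continuous_const continuous_fst).inter ((isClosed_tsupport φ).preimage (by fun_prop)))
    by_contra hlt
    refine left_ne_zero_of_mul hz (Real.smoothTransition.zero_of_nonpos ?_)
    rw [sub_nonpos, div_le_one hδ]
    exact (not_le.1 hlt).le
  have hk : IsCompact ((fun z : ℝ² => (z.1 + s, z.2)) ⁻¹' tsupport φ) := by
    have := h.2.1.isCompact.image (f := fun z : ℝ² => (z.1 - s, z.2)) (by fun_prop)
    refine this.of_isClosed_subset ((isClosed_tsupport φ).preimage (by fun_prop)) fun z hz =>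
      ⟨_, hz, by simp⟩
  refine ⟨?_, hk.of_isClosed_subset (isClosed_tsupport _) (hsub.trans inter_subset_right), fun z hz => ?_⟩
  · refine ContDiff.mul ?_ (h.1.comp (by fun_prop))
    exact Real.smoothTransition.contDiff.comp (by fun_prop)
  · have h1 := h.2.2 (hsub hz).2
    exact ⟨⟨hδ.trans_le (hsub hz).1, by linarith [h1.1.2]⟩, h1.2⟩

/-- The cutoff of `IsTest.shift` is removed by dominated convergence. No boundary term at `t = 0`
can appear, since only space derivatives are involved. -/
lemma IsWeakDeriv.integral_shift {T : ℝ} {j : ℕ} {g w φ : ℝ² → ℝ} (h : IsWeakDeriv T 0 j g w)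
    (hg : IntegrableOn g (strip T)) (hw : IntegrableOn w (strip T)) (hφ : IsTest T φ) {s : ℝ} (hs : 0 ≤ s) :
    ∫ z in strip T, g z * mixedDeriv 0 j φ (z.1 + s, z.2) =
      (-1) ^ j * ∫ z in strip T, w z * φ (z.1 + s, z.2) := by
  have key : ∀ {u ψ : ℝ² → ℝ}, IntegrableOn u (strip T) → IsTest T ψ →
      Tendsto (fun n : ℕ => ∫ z in strip T, u z * (Real.smoothTransition (z.1 / ((n : ℝ) + 1)⁻¹ - 1) *
        ψ (z.1 + s, z.2))) atTop (𝓝 (∫ z in strip T, u z * ψ (z.1 + s, z.2))) := by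
    intro u ψ hu hψ
    obtain ⟨C, hC⟩ := hψ.2.1.exists_bound_of_continuous hψ.1.continuous
    have hψc := hψ.1.continuous
    have hSc := Real.smoothTransition.continuous
    refine tendsto_integral_of_dominated_convergence (fun z => ‖u z‖ * C) (fun n => ?_)
      (hu.norm.mul_const C) (fun n => .of_forall fun z => ?_) ?_
    · exact hu.1.mul (Continuous.aestronglyMeasurable (by fun_prop))
    · rw [norm_mul, norm_mul]
      refine mul_le_mul_of_nonneg_left ?_ (norm_nonneg _)
      calc _ ≤ 1 * C := mul_le_mul (by
            rw [norm_of_nonneg (Real.smoothTransition.nonneg _)]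
            exact Real.smoothTransition.le_one _) (hC _) (norm_nonneg _) zero_le_one
        _ = C := one_mul C
    · refine ae_restrict_of_forall_mem (measurableSet_strip T) (fun z hz => ?_)
      refine tendsto_const_nhds.congr' ?_
      have hz1 : 0 < z.1 := hz.1.1
      -- The transition equals one as soon as `t ≥ 2δ`.
      obtain ⟨k, hk⟩ := exists_nat_gt (2 / z.1)
      filter_upwards [eventually_ge_atTop k] with n hn
      rw [Real.smoothTransition.one_of_one_le, one_mul]
      rw [div_inv_eq_mul]
      have : (k : ℝ) ≤ n := by exact_mod_cast hn
      have h2 : 2 < z.1 * k := by rwa [div_lt_iff₀ hz1, mul_comm] at hk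
      nlinarith
  refine tendsto_nhds_unique (key hg (hφ.mixedDeriv 0 j)) (((key hw hφ).const_mul ((-1) ^ j)).congr fun n => ?_)
  have := h.2.2 _ (hφ.shift hs (δ := ((n : ℝ) + 1)⁻¹) (by positivity))
  rw [zero_add] at this
  rw [← this]
  refine integral_congr_ae (.of_forall fun z => ?_)
  simp only [mixedDeriv, iteratedDeriv_zero]
  rw [iteratedDeriv_const_mul_field]

/-- Space derivatives commute with integration in time. -/
lemma IsWeakDeriv.timePrim {T : ℝ} {j : ℕ} {g w : ℝ² → ℝ} (h : IsWeakDeriv T 0 j g w)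
    (hg : IntegrableOn g (strip T)) (hw : IntegrableOn w (strip T)) :
    IsWeakDeriv T 0 j (timePrim T g) (timePrim T w) := by
  refine ⟨(integrableOn_timePrim hg).locallyIntegrableOn, (integrableOn_timePrim hw).locallyIntegrableOn,
    fun φ hφ => ?_⟩
  have hv : ∀ {ψ}, IsTest T ψ → ∀ z : ℝ², T ≤ z.1 → ψ z = 0 := fun hψ z hz =>
    image_eq_zero_of_notMem_tsupport fun hm => absurd (hψ.2.2 hm).1.2 (not_lt.2 hz)
  have hφj := hφ.mixedDeriv 0 j
  rw [integral_timePrim_mul hg hφj.1.continuous hφj.2.1 (hv hφj),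
    integral_timePrim_mul hw hφ.1.continuous hφ.2.1 (hv hφ), zero_add, ← integral_const_mul]
  exact setIntegral_congr_fun measurableSet_Ioo fun s hs => h.integral_shift hg hw hφ hs.1.le

/-- The one-dimensional Sobolev inequality. -/
lemma enorm_sq_le_lintegral {T t : ℝ} (ht : t ∈ Icc 0 T) (hT : 0 < T) {h h' : ℝ → ℝ}
    (hd : ∀ s, HasDerivAt h (h' s) s) (hc : Continuous h') :
    ‖h t‖ₑ ^ 2 ≤ ofReal (1 + T⁻¹) * ((∫⁻ r in Ioo 0 T, ‖h r‖ₑ ^ 2) + ∫⁻ r in Ioo 0 T, ‖h' r‖ₑ ^ 2) := by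
  have hhc : Continuous h := continuous_iff_continuousAt.2 fun s => (hd s).continuousAt
  set A := ∫ r in 0..T, h r ^ 2
  set B := ∫ r in 0..T, h' r ^ 2
  have hA0 : 0 ≤ A := intervalIntegral.integral_nonneg hT.le fun _ _ => sq_nonneg _
  have hB0 : 0 ≤ B := intervalIntegral.integral_nonneg hT.le fun _ _ => sq_nonneg _
  have hi : ∀ a b, IntervalIntegrable (fun r => h r ^ 2 + h' r ^ 2) volume a b := fun a b =>
    Continuous.intervalIntegrable (by fun_prop) _ _
  have key : ∀ s ∈ Icc 0 T, h t ^ 2 - h s ^ 2 ≤ A + B := fun s hs => by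
    have e : h t ^ 2 - h s ^ 2 = ∫ r in s..t, 2 * h r * h' r :=
      (integral_eq_sub_of_hasDerivAt (f := fun r => h r ^ 2)
        (fun r _ => ((hd r).fun_pow 2).congr_deriv (by simp)) (Continuous.intervalIntegrable (by fun_prop) _ _)).symm
    calc h t ^ 2 - h s ^ 2 ≤ |∫ r in s..t, 2 * h r * h' r| := by rw [e]; exact le_abs_self _
      _ ≤ |∫ r in s..t, (h r ^ 2 + h' r ^ 2)| := by
          rw [← norm_eq_abs]
          refine intervalIntegral.norm_integral_le_abs_of_norm_le (.of_forall fun r => ?_) (hi _ _)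
          rw [norm_eq_abs, abs_le]
          constructor <;> nlinarith [sq_nonneg (h r + h' r), sq_nonneg (h r - h' r)]
      _ ≤ |∫ r in 0..T, (h r ^ 2 + h' r ^ 2)| := by
          refine intervalIntegral.abs_integral_mono_interval ?_ (.of_forall fun r => by
            simp only [Pi.zero_apply]; positivity) (hi _ _)
          rw [uIoc_of_le hT.le]
          exact Ioc_subset_Ioc (le_min hs.1 ht.1) (max_le hs.2 ht.2)
      _ = A + B := by
          rw [intervalIntegral.integral_add (Continuous.intervalIntegrable (by fun_prop) _ _)
            (Continuous.intervalIntegrable (by fun_prop) _ _), abs_of_nonneg (add_nonneg hA0 hB0)]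
  have h1 : T * h t ^ 2 ≤ A + T * (A + B) := by
    have := integral_mono_on (μ := volume) (f := fun _ => h t ^ 2)
      (g := fun s => h s ^ 2 + (A + B)) hT.le (by simp)
      (Continuous.intervalIntegrable (by fun_prop) _ _) fun s hs => by linarith [key s hs]
    rw [intervalIntegral.integral_const, intervalIntegral.integral_add
      (Continuous.intervalIntegrable (by fun_prop) _ _) (by simp), intervalIntegral.integral_const] at this
    simpa using this
  have h2 : h t ^ 2 ≤ (1 + T⁻¹) * (A + B) := by
    have : h t ^ 2 = T⁻¹ * (T * h t ^ 2) := by field_simp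
    rw [this]
    calc _ ≤ T⁻¹ * (A + T * (A + B)) := mul_le_mul_of_nonneg_left h1 (by positivity)
      _ = T⁻¹ * A + (A + B) := by field_simp
      _ ≤ _ := by nlinarith [mul_nonneg (inv_nonneg.2 hT.le) hB0]
  rw [← ofReal_integral_sq hT.le hhc.continuousOn, ← ofReal_integral_sq hT.le hc.continuousOn,
    ← ofReal_add hA0 hB0, ← ofReal_mul (by positivity), enorm_sq_eq_ofReal]
  exact ofReal_le_ofReal h2

/-- A function in `H¹` in time is bounded in time. -/
lemma ae_lintegral_le_of_isWeakDeriv {T : ℝ} (hT : 0 < T) {y y' : ℝ² → ℝ} (hy : IsSq T y) (hy' : IsSq T y')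
    (h : IsWeakDeriv T 1 0 y y') : ∃ B : NNReal, ∀ᵐ t ∂vol(Ioo 0 T), ∫⁻ ξ in ℝ₊, ‖y (t, ξ)‖ₑ ^ 2 ≤ B := by
  set ε : ℕ → ℝ := fun n => ((n : ℝ) + 1)⁻¹ with hεdef
  have hε : ∀ n, 0 < ε n := fun n => by positivity
  have hεl : Tendsto ε atTop (𝓝[>] 0) := tendsto_inv_nat_nhdsGT
  have hi := hy.integrableOn
  have hi' := hy'.integrableOn
  -- Mollification shortens the time interval to `T - ε`; for `ε < T/2` the Sobolev constant stays
  -- below the one for length `T/2`.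
  set R := (1 + (T / 2)⁻¹) * (sqInt T y + sqInt T y') with hR
  refine ⟨R.toNNReal, ?_⟩
  have h1 := ae_tendsto_mol hi
  rw [volume_restrict_strip] at h1
  filter_upwards [ae_ae_of_ae_prod h1, ae_restrict_mem measurableSet_Ioo] with t h1 ht
  refine setLIntegral_le_of_forall_eventually (F := fun n ξ => mol T (ε n) y (t, ξ)) (R := R) (fun n => ?_)
    (h1.mono fun ξ hξ => hξ.comp hεl) fun η hη => ?_
  · exact ((contDiff_mol (hε n) hi).continuous.comp (by fun_prop)).aestronglyMeasurable
  have hlt : 0 < min (T - t) (T / 2) := lt_min (sub_pos.2 ht.2) (by linarith)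
  filter_upwards [hεl (Ioo_mem_nhdsGT hlt)] with n hn
  have hn' : ε n < min (T - t) (T / 2) := hn.2
  have n1 := hn'.trans_le (min_le_left _ _)
  have n2 := hn'.trans_le (min_le_right _ _)
  set T' := T - ε n with hT'
  have hs := contDiff_mol (hε n) hi
  have hs' := contDiff_mol (hε n) hi'
  have c0 : Continuous (mol T (ε n) y) := hs.continuous
  have c1 : Continuous (mol T (ε n) y') := hs'.continuous
  have m0 : ∀ {w : ℝ² → ℝ}, Continuous w → Measurable fun z => ‖w z‖ₑ ^ 2 := fun hw =>
    hw.measurable.enorm.pow_const 2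
  have sub : ∀ {w : ℝ² → ℝ}, Continuous w →
      ∫⁻ ξ in ℝ₊, ∫⁻ r in Ioo 0 T', ‖w (r, ξ)‖ₑ ^ 2 ≤ ∫⁻ z, ‖w z‖ₑ ^ 2 := fun {w} hw => by
    rw [← lintegral_prod_symm (μ := vol(Ioo 0 T')) (ν := vol(ℝ₊))
      _ (m0 hw).aemeasurable, prod_restrict, ← volume_eq_prod]
    exact setLIntegral_le_lintegral _ _
  calc _ ≤ ∫⁻ ξ in ℝ₊, ofReal (1 + T'⁻¹) *
        ((∫⁻ r in Ioo 0 T', ‖mol T (ε n) y (r, ξ)‖ₑ ^ 2) + ∫⁻ r in Ioo 0 T', ‖mol T (ε n) y' (r, ξ)‖ₑ ^ 2) := by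
        refine setLIntegral_mono' measurableSet_Ioi fun ξ hξ => ?_
        refine (enorm_sq_le_lintegral (T := T') (h := fun s => mol T (ε n) y (s, ξ)) ⟨ht.1.le, by linarith⟩ (by linarith)
          (fun s => hasDerivAt_dT hs s ξ)
          ((contDiff_dT hs).continuous.comp (by fun_prop))).trans (le_of_eq ?_)
        congr 1
        congr 1
        refine setLIntegral_congr_fun measurableSet_Ioo fun r hr => ?_
        rw [dT_mol (hε n) hi h (z := (r, ξ)) ⟨Ioo_subset_Icc_self hr, (show (0 : ℝ) ≤ ξ from le_of_lt hξ)⟩]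
    _ = ofReal (1 + T'⁻¹) * ((∫⁻ ξ in ℝ₊, ∫⁻ r in Ioo 0 T', ‖mol T (ε n) y (r, ξ)‖ₑ ^ 2) +
        ∫⁻ ξ in ℝ₊, ∫⁻ r in Ioo 0 T', ‖mol T (ε n) y' (r, ξ)‖ₑ ^ 2) := by
        rw [lintegral_const_mul' _ _ (by simp), lintegral_add_left]
        exact (m0 c0).lintegral_prod_left'
    _ ≤ ofReal (1 + (T / 2)⁻¹) * (ofReal (sqInt T y) + ofReal (sqInt T y')) := by
        rw [hy.ofReal_sqInt, hy'.ofReal_sqInt]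
        gcongr
        · linarith
        · exact (sub c0).trans (lintegral_mol_sq_le (hε n) hy.1)
        · exact (sub c1).trans (lintegral_mol_sq_le (hε n) hy'.1)
    _ = ofReal R := by
        rw [← ofReal_add (sqInt_nonneg _ _) (sqInt_nonneg _ _), ← ofReal_mul (by positivity)]
    _ ≤ _ := ofReal_le_ofReal (by linarith)

/-! ### Extraction of weak derivatives from membership in Bochner-Sobolev spaces -/

lemma IsWeakDeriv.aestronglyMeasurable {T : ℝ} {i j : ℕ} {u w : ℝ² → ℝ} (h : IsWeakDeriv T i j u w) :
    AEStronglyMeasurable w vol(strip T) := h.2.1.aestronglyMeasurable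

lemma MemBochner.exists_top {T : ℝ} {k l : ℕ} {u : ℝ² → ℝ} (h : MemBochner T k ⊤ l u) :
    ∃ w : ℕ → ℕ → ℝ² → ℝ, (∀ i ≤ k, ∀ j ≤ l, IsWeakDeriv T i j u (w i j)) ∧
      ∀ i ≤ k, ∀ j ≤ l, ∃ B : NNReal, ∀ᵐ t ∂vol(Ioo 0 T), ∫⁻ ξ in ℝ₊, ‖w i j (t, ξ)‖ₑ ^ 2 ≤ B := by
  obtain ⟨w, hw⟩ := iInf_lt_iff.1 h
  obtain ⟨hd, hs⟩ := iInf_lt_iff.1 hw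
  refine ⟨w, hd, fun i hi j hj => ?_⟩
  have h1 := (ENNReal.sum_lt_top.1 hs) i (Finset.mem_range.2 (Nat.lt_succ_of_le hi))
  rw [eLpNorm_exponent_top] at h1
  set E := eLpNormEssSup (sliceNorm l (w i)) vol(Ioo 0 T)
  refine ⟨(E ^ 2).toNNReal, ?_⟩
  filter_upwards [ae_le_eLpNormEssSup (f := sliceNorm l (w i)) (μ := vol(Ioo 0 T))] with t ht
  rw [coe_toNNReal (ENNReal.pow_lt_top h1).ne]
  calc _ ≤ ∑ j ∈ Finset.range (l + 1), ∫⁻ ξ in ℝ₊, ‖w i j (t, ξ)‖ₑ ^ 2 :=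
        Finset.single_le_sum (f := fun j => ∫⁻ ξ in ℝ₊, ‖w i j (t, ξ)‖ₑ ^ 2) (fun _ _ => zero_le)
          (Finset.mem_range.2 (Nat.lt_succ_of_le hj))
    _ = ‖sliceNorm l (w i) t‖ₑ ^ (2 : ℝ) := (sliceNorm_rpow_two _ _ _).symm
    _ ≤ _ := by
        rw [ENNReal.rpow_ofNat]
        gcongr

lemma isSup_of_continuousOn {T : ℝ} {ψ : ℝ² → ℝ} (hc : ContinuousOn ψ (closedStrip T))
    (hs : ∀ t ∈ Icc 0 T, ∀ ξ, 1 ≤ ξ → ψ (t, ξ) = 0) : IsSup T ψ := by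
  obtain ⟨B, hB0, hB⟩ := exists_abs_le_of_supp hc hs
  have hsub := strip_subset_closedStrip T
  refine isSup_of_vanish (B := (B ^ 2).toNNReal) ((hc.mono hsub).aestronglyMeasurable (measurableSet_strip T)) ?_ ?_
  · refine ae_restrict_of_forall_mem measurableSet_Ioo (fun t ht => ?_)
    calc _ ≤ ∫⁻ ξ in ℝ₊, (Ioo 0 1).indicator (fun _ => ofReal (B ^ 2)) ξ := by
          refine setLIntegral_mono' measurableSet_Ioi fun ξ hξ => ?_
          by_cases h : ξ < 1
          · rw [indicator_of_mem (show ξ ∈ Ioo 0 1 from ⟨hξ, h⟩), Real.enorm_eq_ofReal_abs,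
              ← ofReal_pow (abs_nonneg _)]
            exact ofReal_le_ofReal (pow_le_pow_left₀ (abs_nonneg _)
              (hB (t, ξ) ⟨Ioo_subset_Icc_self ht, (show (0 : ℝ) ≤ ξ from le_of_lt hξ)⟩) 2)
          · rw [hs t (Ioo_subset_Icc_self ht) ξ (not_lt.1 h)]; simp
      _ ≤ _ := by
          rw [lintegral_indicator measurableSet_Ioo, Measure.restrict_restrict measurableSet_Ioo, setLIntegral_const,
            inter_eq_left.2 Ioo_subset_Ioi_self, volume_Ioo]
          simp [ofReal]
  · refine ae_restrict_of_forall_mem (measurableSet_strip T) (fun z hz h => ?_)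
    exact hs z.1 (Ioo_subset_Icc_self hz.1) z.2 h.le

/-- The lift `f`, its time derivative `-g`, and their weak derivatives. -/
structure IsLiftPair (T : ℝ) (f g f₁ f₂ g₁ g₂ gt : ℝ² → ℝ) : Prop where
  fprof : IsProfile T f f₁ f₂ (fun z => -g z)
  gprof : IsProfile T g g₁ g₂ gt
  supf : IsSup T f
  supf₁ : IsSup T f₁
  supg : IsSup T g
  supg₁ : IsSup T g₁
  f0 : ∀ ξ, 0 ≤ ξ → f (0, ξ) = 0
  prim : ∀ t ∈ Icc 0 T, ∀ ξ, 0 ≤ ξ → f (t, ξ) = -∫ r in 0..t, g (r, ξ)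
  g00 : g (0, 0) = 0

/-- The space derivatives of `g` come from those of `∂_t f`, so `g` inherits `L^∞` in time with
values in `H²`; the Sobolev hypothesis on `g` contributes `∂_t g`. Everything vanishes beyond `ξ =
1`, so all weighted bounds follow from the unweighted ones. -/
lemma exists_isLiftPair {T : ℝ} (hT : 0 < T) {f g : ℝ² → ℝ} (hf : ContinuousOn f (closedStrip T))
    (hf0 : ∀ ξ ∈ Ici (0 : ℝ), f (0, ξ) = 0) (hf1 : ∀ t ∈ Icc 0 T, ∀ ξ ∈ Ici (1 : ℝ), f (t, ξ) = 0)
    (hfB : MemBochner T 1 ⊤ 2 f) (hg : ContinuousOn g (closedStrip T))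
    (hd : ∀ t ∈ Icc 0 T, ∀ ξ ∈ Ici (0 : ℝ), HasDerivWithinAt (fun s => f (s, ξ)) (-g (t, ξ)) (Icc 0 T) t)
    (hgS : MemSobolev T 1 g) (hg0 : g (0, 0) = 0) :
    ∃ f₁ f₂ g₁ g₂ gt, IsLiftPair T f g f₁ f₂ g₁ g₂ gt := by
  have hsub := strip_subset_closedStrip T
  have lf : LocallyIntegrableOn f (strip T) := (hf.mono hsub).locallyIntegrableOn (measurableSet_strip T)
  have lg : LocallyIntegrableOn g (strip T) := (hg.mono hsub).locallyIntegrableOn (measurableSet_strip T)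
  have hg1 : ∀ t ∈ Icc 0 T, ∀ ξ, 1 ≤ ξ → g (t, ξ) = 0 := fun t ht ξ hξ => by
    have h1 := hd t ht ξ (zero_le_one.trans hξ)
    have h2 : HasDerivWithinAt (fun s => f (s, ξ)) 0 (Icc 0 T) t :=
      (hasDerivWithinAt_const t (Icc 0 T) (0 : ℝ)).congr (fun s hs => hf1 s hs ξ hξ) (hf1 t ht ξ hξ)
    have := (uniqueDiffOn_Icc hT t ht).eq_deriv _ h1 h2
    linarith
  have hgc : ∀ ξ, 0 ≤ ξ → ContinuousOn (fun r => g (r, ξ)) (Icc 0 T) := fun ξ hξ =>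
    hg.comp (by fun_prop) fun r hr => ⟨hr, hξ⟩
  have hprim : ∀ t ∈ Icc 0 T, ∀ ξ, 0 ≤ ξ → f (t, ξ) = -∫ r in 0..t, g (r, ξ) := fun t ht ξ hξ => by
    have hIt : Icc 0 t ⊆ Icc 0 T := Icc_subset_Icc_right ht.2
    have := intervalIntegral.integral_eq_sub_of_hasDerivAt_of_le ht.1 (f := fun s => f (s, ξ))
      (f' := fun s => -g (s, ξ)) (hf.comp (by fun_prop) fun r hr => ⟨hIt hr, hξ⟩)
      (fun s hs => (hd s ⟨hs.1.le, hs.2.le.trans ht.2⟩ ξ hξ).hasDerivAt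
        (Icc_mem_nhds hs.1 (hs.2.trans_le ht.2))) (((hgc ξ hξ).mono hIt).neg.intervalIntegrable_of_Icc ht.1)
    rw [intervalIntegral.integral_neg] at this
    rw [this, hf0 ξ hξ, sub_zero]
  have hw : IsWeakDeriv T 1 0 f fun z => -g z := by
    refine isWeakDeriv_time_of_slices lf lg.neg (ae_restrict_of_forall_mem measurableSet_Ioi (fun ξ hξ θ hθ => ?_))
    have h0 : (0 : ℝ) ≤ ξ := le_of_lt hξ
    have hp : IsPrimitive T (fun t => f (t, ξ)) fun t => -g (t, ξ) := by
      refine IsPrimitive.of_integral hT.le ((hgc ξ h0).neg.integrableOn_Ioo) fun t ht => ?_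
      rw [hf0 ξ h0, hprim t ht ξ h0, intervalIntegral.integral_neg, zero_add]
    exact hp.integral_mul_eq (hθ.isPrimitive hT.le) hT.le (hθ.vanish (by simp)) (hθ.vanish (by simp))
  obtain ⟨w, hwd, hwB⟩ := hfB.exists_top
  have hwg : ∀ j ≤ 2, IsWeakDeriv T 0 j g fun z => -w 1 j z := fun j hj => by
    have h1 : IsWeakDeriv T 0 j (fun z => -g z) (w 1 j) := by
      rw [hw.comp_iff]; simpa using hwd 1 le_rfl j hj
    simpa using h1.neg
  have vf : ∀ z ∈ strip T, 1 < z.2 → f z = 0 := fun z hz h => hf1 z.1 (hsub hz).1 z.2 h.le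
  have vg : ∀ z ∈ strip T, 1 < z.2 → g z = 0 := fun z hz h => hg1 z.1 (hsub hz).1 z.2 h.le
  have sf : ∀ j ≤ 2, IsSup T (w 0 j) := fun j hj => by
    obtain ⟨B, hB⟩ := hwB 0 (by norm_num) j hj
    have h := hwd 0 (by norm_num) j hj
    exact isSup_of_vanish h.aestronglyMeasurable hB (h.ae_eq_zero_of_one_lt vf)
  have sg : ∀ j ≤ 2, IsSup T fun z => -w 1 j z := fun j hj => by
    obtain ⟨B, hB⟩ := hwB 1 le_rfl j hj
    have h := hwg j hj
    exact isSup_of_vanish h.aestronglyMeasurable (by simpa using hB) (h.ae_eq_zero_of_one_lt vg)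
  obtain ⟨gt, hgt, hgt2⟩ := hgS 1 0 (by norm_num)
  have sgt : IsSq T gt := isSq_of_vanish hgt2 (hgt.ae_eq_zero_of_one_lt vg)
  have Sf := isSup_of_continuousOn hf (fun t ht ξ hξ => hf1 t ht ξ hξ)
  have Sg := isSup_of_continuousOn hg hg1
  refine ⟨w 0 1, w 0 2, fun z => -w 1 1 z, fun z => -w 1 2 z, gt, ?_, ?_, Sf, sf 1 (by norm_num), Sg,
    sg 1 (by norm_num), hf0, hprim, hg0⟩
  · exact ⟨hf, fun t ht ξ hξ => hf1 t ht ξ hξ, hwd 0 (by norm_num) 1 (by norm_num), hwd 0 (by norm_num) 2 le_rfl, hw,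
      Sf.isSq.integrableOn, (sf 1 (by norm_num)).isSq.integrableOn, (sf 2 le_rfl).isSq.integrableOn,
      Sg.isSq.integrableOn.neg, Sf.isSq, (sf 1 (by norm_num)).isSq, (sf 2 le_rfl).isSq, Sg.isSq.neg⟩
  · exact ⟨hg, hg1, hwg 1 (by norm_num), hwg 2 le_rfl, hgt,
      Sg.isSq.integrableOn, (sg 1 (by norm_num)).isSq.integrableOn, (sg 2 le_rfl).isSq.integrableOn,
      sgt.integrableOn, Sg.isSq, (sg 1 (by norm_num)).isSq, (sg 2 le_rfl).isSq, sgt⟩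

/-! ### The energy estimate applied to the lift and to the source -/

/-- Averages of a Lipschitz function. -/
lemma exists_approx_of_lipschitz {κ : ℝ → ℝ} {L κ₁ : ℝ} (hκ : Continuous κ) (h0 : ∀ t, |κ t| ≤ κ₁)
    (hL : ∀ s t, |κ s - κ t| ≤ L * |s - t|) :
    ∃ m m' : ℕ → ℝ → ℝ, (∀ n t, HasDerivAt (m n) (m' n t) t) ∧ (∀ n, Continuous (m' n)) ∧
      (∀ n t, |m n t| ≤ κ₁) ∧ (∀ n t, |m' n t| ≤ L) ∧ ∀ t, Tendsto (fun n => m n t) atTop (𝓝 (κ t)) := by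
  have hd : ∀ t, HasDerivAt (fun t => ∫ r in 0..t, κ r) (κ t) t := fun t =>
    integral_hasDerivAt_right (hκ.intervalIntegrable _ _) (hκ.stronglyMeasurableAtFilter _ _) hκ.continuousAt
  set P : ℝ → ℝ := fun t => ∫ r in 0..t, κ r
  set e : ℕ → ℝ := fun n => ((n : ℝ) + 1)⁻¹
  have he : ∀ n, 0 < e n := fun n => by positivity
  have hP : ∀ n t, P (t + e n) - P t = ∫ r in t..(t + e n), κ r := fun n t => by
    rw [intervalIntegral.integral_interval_sub_left (hκ.intervalIntegrable _ _) (hκ.intervalIntegrable _ _)]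
  refine ⟨fun n t => (e n)⁻¹ * (P (t + e n) - P t), fun n t => (e n)⁻¹ * (κ (t + e n) - κ t),
    fun n t => ?_, fun n => by fun_prop, fun n t => ?_, fun n t => ?_, fun t => ?_⟩
  · exact (((hd (t + e n)).comp_add_const t (e n)).sub (hd t)).const_mul _
  · rw [abs_mul, abs_of_pos (inv_pos.2 (he n)), hP, inv_mul_le_iff₀ (he n)]
    have := intervalIntegral.norm_integral_le_of_norm_le_const (f := κ) (a := t) (b := t + e n) (C := κ₁)
      fun x _ => h0 x
    rw [norm_eq_abs, add_sub_cancel_left, abs_of_pos (he n)] at this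
    linarith
  · rw [abs_mul, abs_of_pos (inv_pos.2 (he n)), inv_mul_le_iff₀ (he n)]
    have := hL (t + e n) t
    rw [add_sub_cancel_left, abs_of_pos (he n)] at this
    linarith
  · have h1 := (hasDerivAt_iff_tendsto_slope_zero.1 (hd t)).comp
      (tendsto_inv_nat_nhdsGT.mono_right (nhdsWithin_mono 0 fun x (hx : 0 < x) => hx.ne'))
    refine h1.congr fun n => ?_
    simp [P, e, Function.comp]

lemma ae_eq_of_integral_timeTest {T : ℝ} {b b' : ℝ → ℝ} (hb : IntegrableOn b (Ioo 0 T))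
    (hb' : IntegrableOn b' (Ioo 0 T))
    (h : ∀ θ, IsTimeTest T θ → ∫ t in Ioo 0 T, b t * θ t = ∫ t in Ioo 0 T, b' t * θ t) :
    b =ᵐ[vol(Ioo 0 T)] b' := by
  have h0 : ∀ θ : ℝ → ℝ, ContDiff ℝ ∞ θ → HasCompactSupport θ → tsupport θ ⊆ Ioo 0 T →
      ∫ t, θ t • (b - b') t = 0 := fun θ h1 h2 h3 => by
    have hθ : IsTimeTest T θ := ⟨h1, h2, h3⟩
    have e := sub_eq_zero.2 (h θ hθ)
    rw [← integral_sub (hθ.integrable_mul hb) (hθ.integrable_mul hb')] at e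
    rw [← setIntegral_eq_integral_of_forall_compl_eq_zero (s := Ioo 0 T) fun t ht => by simp [hθ.vanish ht]]
    refine Eq.trans (integral_congr_ae (.of_forall fun t => ?_)) e
    simp only [smul_eq_mul, Pi.sub_apply]; ring
  have h1 := isOpen_Ioo.ae_eq_zero_of_integral_contDiff_smul_eq_zero (μ := volume) (hb.sub hb').locallyIntegrableOn h0
  refine (ae_restrict_iff' measurableSet_Ioo).2 (h1.mono fun t ht hm => ?_)
  have := ht hm
  simp only [Pi.sub_apply] at this; linarith

lemma sqInt_neg (T : ℝ) (w : ℝ² → ℝ) : sqInt T (fun z => -w z) = sqInt T w := by simp [sqInt]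

namespace IsLiftPair
variable {T : ℝ} {f g f₁ f₂ g₁ g₂ gt : ℝ² → ℝ} (h : IsLiftPair T f g f₁ f₂ g₁ g₂ gt)
include h

lemma continuousOn_trace : ContinuousOn (fun t => f (t, 0)) (Icc 0 T) :=
  h.fprof.cont.comp (by fun_prop) fun _ hr => ⟨hr, self_mem_Ici⟩

lemma continuousOn_trace' : ContinuousOn (fun t => g (t, 0)) (Icc 0 T) :=
  h.gprof.cont.comp (by fun_prop) fun _ hr => ⟨hr, self_mem_Ici⟩

lemma integrableOn_trace : IntegrableOn (fun t => f (t, 0)) (Ioo 0 T) :=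
  h.continuousOn_trace.integrableOn_Ioo

/-- By `trace_weak` the trace is `-∫₀¹ f₁ dξ`; the rest is Cauchy-Schwarz on a rectangle of area
`T`. -/
lemma sq_integral_trace_le (hT : 0 ≤ T) : (∫ r in Ioo 0 T, |f (r, 0)|) ^ 2 ≤ T * sqInt T f₁ := by
  simp only [← norm_eq_abs]
  obtain ⟨h1, h2⟩ := trace_weak h.fprof.cont h.fprof.supp h.fprof.dx h.fprof.sq₁.memLp
  have ha := ae_eq_of_integral_timeTest h.integrableOn_trace (IsCoeff.integrableOn_of_memLp_two h1) fun θ hθ => by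
    simpa using h2 θ hθ
  have hm := h.fprof.sq₁.1.enorm
  rw [volume_restrict_strip] at hm
  have hle : ofReal (∫ r in Ioo 0 T, ‖f (r, 0)‖) ≤
      ∫⁻ z in strip T, (univ ×ˢ Ioo 0 1).indicator (fun _ => 1) z * ‖f₁ z‖ₑ := by
    rw [ofReal_integral_eq_lintegral_ofReal h.integrableOn_trace.norm (ae_of_all _ fun _ => norm_nonneg _),
      volume_restrict_strip, lintegral_prod _ (by
        exact (aemeasurable_const.indicator (MeasurableSet.univ.prod measurableSet_Ioo)).mul hm)]
    refine lintegral_mono_ae ?_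
    filter_upwards [ha] with t ht
    rw [ht, norm_eq_abs, abs_neg, ← Real.enorm_eq_ofReal_abs]
    refine (enorm_integral_le_lintegral_enorm _).trans (le_of_eq ?_)
    have e : ∀ ξ, (univ ×ˢ Ioo 0 1).indicator (fun _ : ℝ² => (1 : ℝ≥0∞)) (t, ξ) * ‖f₁ (t, ξ)‖ₑ =
        (Ioo 0 1).indicator (fun ξ => ‖f₁ (t, ξ)‖ₑ) ξ := fun ξ => by
      by_cases hξ : ξ ∈ Ioo 0 1 <;> simp [indicator, hξ] 
    simp only [e]
    rw [lintegral_indicator measurableSet_Ioo, Measure.restrict_restrict measurableSet_Ioo,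
      inter_eq_left.2 Ioo_subset_Ioi_self]
  have hcs := lintegral_mul_sq_le (μ := vol(strip T)) (f := (univ ×ˢ Ioo 0 1).indicator fun _ => 1)
    (g := fun z => ‖f₁ z‖ₑ) (aemeasurable_const.indicator (MeasurableSet.univ.prod measurableSet_Ioo)) h.fprof.sq₁.1.enorm
  have e1 : ∫⁻ z in strip T, (univ ×ˢ Ioo 0 1).indicator (fun _ => (1 : ℝ≥0∞)) z ^ 2 = ofReal T := by
    have e : ∀ z : ℝ², (univ ×ˢ Ioo 0 1).indicator (fun _ => (1 : ℝ≥0∞)) z ^ 2 =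
        (univ ×ˢ Ioo 0 1).indicator (fun _ => (1 : ℝ≥0∞)) z := fun z => by
      by_cases hz : z ∈ univ ×ˢ Ioo 0 1
      · rw [indicator_of_mem hz, one_pow]
      · rw [indicator_of_notMem hz]; simp
    simp only [e]
    have hS : MeasurableSet (univ ×ˢ Ioo 0 1 : Set (ℝ²)) := MeasurableSet.univ.prod measurableSet_Ioo
    rw [lintegral_indicator hS, Measure.restrict_restrict hS, setLIntegral_one, strip, Set.prod_inter_prod, univ_inter,
      inter_eq_left.2 Ioo_subset_Ioi_self, volume_eq_prod, Measure.prod_prod, volume_Ioo, volume_Ioo]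
    simp
  rw [e1, ← h.fprof.sq₁.ofReal_sqInt, ← ofReal_mul hT] at hcs
  rw [← ofReal_le_ofReal_iff (mul_nonneg hT (sqInt_nonneg _ _)),
    ofReal_pow (integral_nonneg fun _ => norm_nonneg _)]
  exact (pow_le_pow_left₀ (zero_le) hle 2).trans hcs

lemma ae_eq_neg_timePrim {j : ℕ} {fj gj : ℝ² → ℝ} (hf : IsWeakDeriv T 0 j f fj) (hg : IsWeakDeriv T 0 j g gj)
    (hi : IntegrableOn gj (strip T)) : fj =ᵐ[vol(strip T)] fun z => -timePrim T gj z := by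
  refine hf.ae_eq ((hg.timePrim h.gprof.int hi).neg.congr ?_ (EventuallyEq.refl _ _))
  refine ae_restrict_of_forall_mem (measurableSet_strip T) (fun z hz => ?_)
  have ht := Ioo_subset_Icc_self hz.1
  have := timePrim_eq g ht z.2
  rw [show z = (z.1, z.2) from rfl]
  beta_reduce
  rw [this, ← h.prim z.1 ht z.2 (le_of_lt hz.2)]

/-- Since `f` starts from zero, `f₁(t,·)` is minus the time integral of `g₁`, and its squared norm
is at most `t` times a constant. Thus the lift has no initial energy. -/
lemma slice_small {η : ℝ} (hη : 0 < η) : ∀ᶠ ε in 𝓝[>] (0 : ℝ), ∀ᵐ t ∂vol(Ioo 0 T), t < ε →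
    ∫⁻ ξ in ℝ₊, ‖f₁ (t, ξ)‖ₑ ^ 2 ≤ ofReal (0 + η) := by
  have h1 := h.ae_eq_neg_timePrim h.fprof.dx h.gprof.dx h.gprof.int₁
  rw [volume_restrict_strip] at h1
  have hS := sqInt_nonneg T g₁
  filter_upwards [Ioo_mem_nhdsGT (show 0 < η / (sqInt T g₁ + 1) by positivity)] with ε hε
  filter_upwards [ae_ae_of_ae_prod h1, ae_restrict_mem measurableSet_Ioo] with t ht htT htε
  calc _ = ∫⁻ ξ in ℝ₊, ‖timePrim T g₁ (t, ξ)‖ₑ ^ 2 := lintegral_congr_ae (by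
        filter_upwards [ht] with ξ hξ
        rw [hξ, enorm_neg])
    _ ≤ ofReal t * ofReal (sqInt T g₁) := by
        rw [h.gprof.sq₁.ofReal_sqInt]; exact lintegral_timePrim_sq_le h.gprof.sq₁.1 htT
    _ ≤ _ := by
        rw [← ofReal_mul htT.1.le]
        refine ofReal_le_ofReal ?_
        have h2 := (lt_div_iff₀ (by positivity)).1 hε.2
        nlinarith [mul_le_mul_of_nonneg_right htε.le hS, hε.1]

end IsLiftPair

namespace IsCoeff
variable {c : ℝ → ℝ} {c₀ c₁ : ℝ} (hc : IsCoeff c c₀ c₁) {T K : ℝ} (hT : 0 < T) (hK : 0 ≤ K)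
  (hE : EnergyBound c c₀ T K) {f g f₁ f₂ g₁ g₂ gt : ℝ² → ℝ} (h : IsLiftPair T f g f₁ f₂ g₁ g₂ gt)
include hc hT hK hE h

/-- `near_of_profile` with multiplier one and initial energy zero. The resulting bound contains
exactly the norms of `f₁`, `f₂`, `g`, which is the right side of the weighted estimate. -/
lemma near_lift {R : ℝ} (hR : R = c₀⁻¹ * (2 * c₁ ^ 2 * sqInt T f₂ + 4 * sqInt T g) + K * (T * sqInt T f₁)) :
    (∀ᵐ t ∂vol(Ioo 0 T), ∫⁻ ξ in Ioo 0 1,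
      ‖-pot c T tr(f) 2 t ξ - f₁ (t, ξ)‖ₑ ^ 2 ≤ ofReal R) ∧ ∫⁻ z in Ioo 0 T ×ˢ Ioo 0 1,
      ‖-pot c T tr(f) 3 z.1 z.2 - f₂ z‖ₑ ^ 2 ≤ ofReal (c₀⁻¹ * R) := by
  have hi := inv_pos.2 hc.pos
  have := hc.near_of_profile (A := 0) (L := 1) (L' := 0) hT hK le_rfl hE h.fprof (m := fun _ _ => 1) (m' := fun _ _ => 0)
    (M := fun _ => 1) (fun _ _ => hasDerivAt_const _ _) (fun _ => continuous_const) (by simp) (by simp)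
    (fun _ => tendsto_const_nhds) (h.f0 0 le_rfl) (fun η hη => h.slice_small hη) rfl
  simp only [one_mul, sqInt_neg] at this
  have hle := ofReal_le_ofReal (show 1 ^ 2 * 0 + c₀⁻¹ * (2 * c₁ ^ 2 * 1 ^ 2 * sqInt T f₂ +
      4 * 0 ^ 2 * sqInt T f + 4 * 1 ^ 2 * sqInt T g) + K * (∫ r in Ioo 0 T, |f (r, 0)|) ^ 2 ≤ R from by
    have h1 := mul_le_mul_of_nonneg_left (h.sq_integral_trace_le hT.le) hK
    rw [hR]
    simp only [one_pow, mul_zero, zero_add, mul_one, ne_eq, OfNat.ofNat_ne_zero, not_false_eq_true, zero_pow,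
      zero_mul, add_zero]
    exact add_le_add_right h1 _)
  refine ⟨this.1.mono fun t ht => ht.trans hle, this.2.trans ?_⟩
  rw [ofReal_mul hi.le, ofReal_mul hi.le]
  gcongr

/-- The regularity of the potential of the trace of the lift. -/
lemma isSup_pot_trace {L : ℝ} (hL : ∀ s t, |(c s)⁻¹ - (c t)⁻¹| ≤ L * |s - t|) :
    (∀ j ≤ 4, IsSup T fun z => pot c T tr(f) j z.1 z.2) ∧
    ∀ j ≤ 5, IsSq T fun z => pot c T tr(f) j z.1 z.2 := by
  have hcc := hc.cont
  have hκc : Continuous fun t => -(c t)⁻¹ := (hcc.inv₀ fun t => (hc.c_pos t).ne').neg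
  have hκ0 : ∀ t, |-(c t)⁻¹| ≤ c₀⁻¹ := fun t => by
    rw [abs_neg, abs_of_pos (inv_pos.2 (hc.c_pos t))]
    exact inv_anti₀ hc.pos (hc.lower t)
  -- The factor `-1/c` is only Lipschitz, whereas lifts must be differentiable in time; it is
  -- replaced by its short averages.
  obtain ⟨m, m', hm, hm', hb, hb', hlim⟩ := exists_approx_of_lipschitz hκc hκ0 (L := L) fun s t => by
    rw [neg_sub_neg, abs_sub_comm]; exact hL s t
  obtain ⟨A, hA⟩ := h.supg₁.2 0
  rw [weighted_zero] at hA
  -- These are the data of which `f(·,0)` is the primitive against `c`. By `pot_add_two` the orders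
  -- 4 and 5 for the trace of `f` are the orders 2 and 3 for `b₁`, which the energy estimate for the
  -- profile `g` controls; `g(0,0) = 0` is used here.
  set b₁ : ℝ → ℝ := fun r => -(c r)⁻¹ * g (r, 0)
  obtain ⟨R, n1, n2⟩ : ∃ R : ℝ, (∀ᵐ t ∂vol(Ioo 0 T),
      ∫⁻ ξ in Ioo (0 : ℝ) 1, ‖-pot c T b₁ 2 t ξ - -(c t)⁻¹ * g₁ (t, ξ)‖ₑ ^ 2 ≤ ofReal R) ∧
      ∫⁻ z in Ioo 0 T ×ˢ Ioo (0 : ℝ) 1, ‖-pot c T b₁ 3 z.1 z.2 - -(c z.1)⁻¹ * g₂ z‖ₑ ^ 2 ≤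
        ofReal (c₀⁻¹ * R) := ⟨_, hc.near_of_profile (A := A) hT hK A.2 hE h.gprof hm hm' hb hb' hlim h.g00
    (fun η hη => .of_forall fun ε => hA.mono fun t ht _ => ht.trans (by
      rw [← ofReal_coe_nnreal]; exact ofReal_le_ofReal (by linarith))) rfl⟩
  have hb₁c : ContinuousOn b₁ (Icc 0 T) := hκc.continuousOn.mul h.continuousOn_trace'
  have hb₁i : IntegrableOn b₁ (Ioo 0 T) := hb₁c.integrableOn_Ioo
  obtain ⟨B, hB⟩ := isCompact_Icc.exists_bound_of_continuousOn hb₁c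
  have hb₁2 : MemLp b₁ 2 vol(Ioo 0 T) :=
    MemLp.of_bound hb₁i.1 B (ae_restrict_of_forall_mem measurableSet_Ioo (fun r hr => hB r (Ioo_subset_Icc_self hr)))
  have hbb : ∀ t ∈ Icc 0 T, f (t, 0) = ∫ r in (0 : ℝ)..t, c r * b₁ r := fun t ht => by
    rw [h.prim t ht 0 le_rfl, ← intervalIntegral.integral_neg]
    refine integral_congr fun r _ => ?_
    have := (hc.c_pos r).ne'
    simp only [b₁]; field_simp
  have hadd : ∀ j, EqOn (fun z => pot c T b₁ j z.1 z.2) (fun z => pot c T tr(f) (j + 2) z.1 z.2)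
      (strip T) := fun j z hz => (hc.pot_add_two hb₁i hbb j (Ioo_subset_Icc_self hz.1) hz.2).symm
  have haddq : ∀ j, (fun z => pot c T b₁ j z.1 z.2) =ᵐ[vol(strip T)]
      fun z => pot c T tr(f) (j + 2) z.1 z.2 := fun j =>
    ae_restrict_of_forall_mem (measurableSet_strip T) (fun z hz => hadd j hz)
  have hch : DataChain c T 1 tr(f) := ⟨b₁, hb₁2, hbb⟩
  have hI : Ioo (0 : ℝ) 1 ⊆ Ioi 0 := Ioo_subset_Ioi_self
  have p2 : IsSup T fun z => pot c T b₁ 2 z.1 z.2 := by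
    have h1 := (h.supg₁.mul_time (P := fun t => -(c t)⁻¹) (memLp_top_of_bound hκc.aestronglyMeasurable c₀⁻¹
      (.of_forall hκ0))).2 0
    simp only [weighted_zero] at h1
    obtain ⟨A', hA'⟩ := h1
    refine isSup_of_near_far (hc.aestronglyMeasurable_pot hb₁i 2) (B := 2 * Real.toNNReal R + 2 * A')
      ?_ (hc.exists_abs_pot_le_div hb₁i 2)
    filter_upwards [n1, hA', ae_slice_aestronglyMeasurable (hc.aestronglyMeasurable_pot hb₁i 2),
      ae_slice_aestronglyMeasurable h.supg₁.1] with t h1 h2 h3 h4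
    have h3' := h3.mono_measure (restrict_mono hI le_rfl)
    have h4' := h4.mono_measure (restrict_mono hI le_rfl)
    calc _ = ∫⁻ ξ in Ioo (0 : ℝ) 1, ‖(-pot c T b₁ 2 t ξ - -(c t)⁻¹ * g₁ (t, ξ)) + -(c t)⁻¹ * g₁ (t, ξ)‖ₑ ^ 2 := by
          simp
      _ ≤ _ := lintegral_enorm_add_sq_le (h3'.neg.sub (h4'.const_mul _))
      _ ≤ _ := by
          push_cast
          refine add_le_add (mul_le_mul_right h1 _) (mul_le_mul_right ?_ _)
          exact (lintegral_mono_set Ioo_subset_Ioi_self).trans h2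
  have p3 : IsSq T fun z => pot c T b₁ 3 z.1 z.2 := by
    have hq := (h.gprof.sq₂.mul_time (P := fun t => -(c t)⁻¹) (memLp_top_of_bound hκc.aestronglyMeasurable c₀⁻¹
      (.of_forall hκ0)))
    have hm3 := hc.aestronglyMeasurable_pot hb₁i 3
    have hsub : Ioo 0 T ×ˢ Ioo (0 : ℝ) 1 ⊆ strip T := Set.prod_mono Subset.rfl Ioo_subset_Ioi_self
    refine hc.isSq_pot_of_near hb₁i ?_
    have e : ∫⁻ t in Ioo 0 T, ∫⁻ ξ in Ioo (0 : ℝ) 1, ‖pot c T b₁ 3 t ξ‖ₑ ^ 2 =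
        ∫⁻ z in Ioo 0 T ×ˢ Ioo (0 : ℝ) 1, ‖pot c T b₁ 3 z.1 z.2‖ₑ ^ 2 := by
      have := aemeasurable_enorm_sq (hm3.mono_measure (restrict_mono hsub le_rfl))
      rw [volume_eq_prod, ← prod_restrict] at this ⊢
      rw [lintegral_prod _ this]
    rw [e]
    calc _ = ∫⁻ z in Ioo 0 T ×ˢ Ioo (0 : ℝ) 1, ‖(-pot c T b₁ 3 z.1 z.2 - -(c z.1)⁻¹ * g₂ z) + -(c z.1)⁻¹ * g₂ z‖ₑ ^ 2 := by
          simp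
      _ ≤ _ := lintegral_enorm_add_sq_le ((hm3.neg.sub hq.1).mono_measure (restrict_mono hsub le_rfl))
      _ < ⊤ := by
          refine ENNReal.add_lt_top.2 ⟨mul_lt_top (by simp) (n2.trans_lt ofReal_lt_top),
            mul_lt_top (by simp) ((lintegral_mono_set hsub).trans_lt hq.lintegral_lt_top)⟩
  have s3 := (hc.isSup_pot_one hb₁i.1 (B := B) fun r hr => hB r (Ioo_subset_Icc_self hr)).congr (hadd 1)
  have s4 := p2.congr (hadd 2)
  have s5 := p3.congr (haddq 3)
  refine ⟨fun j hj => ?_, fun j hj => ?_⟩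
  · rcases Nat.lt_or_ge j 3 with hj' | hj'
    · exact hc.isSup_pot_of_dataChain hT.le hch (by omega)
    · interval_cases j
      exacts [s3, s4]
  · rcases Nat.lt_or_ge j 4 with hj' | hj'
    · exact hc.isSq_pot_of_dataChain hT.le hch (by omega)
    · interval_cases j
      exacts [s4.isSq, s5]

end IsCoeff

/-! ### Uniqueness by the maximum principle -/

/-- A positive second derivative would make the point a local minimum as well, hence the function
locally constant, and the second derivative zero. -/
lemma deriv_deriv_nonpos_of_isLocalMax {w : ℝ → ℝ} {x : ℝ} (hc : ContinuousAt w x) (h : IsLocalMax w x) :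
    deriv (deriv w) x ≤ 0 := by
  by_contra! hpos
  have hmin := isLocalMin_of_deriv_deriv_pos hpos h.deriv_eq_zero hc
  have he : w =ᶠ[𝓝 x] fun _ => w x := by
    filter_upwards [h, hmin] with y h1 h2 using le_antisymm h1 h2
  have h2 : deriv w =ᶠ[𝓝 x] fun _ => 0 := by
    filter_upwards [he.deriv] with y hy
    rw [hy, deriv_const]
  rw [h2.deriv_eq, deriv_const] at hpos
  exact lt_irrefl _ hpos

lemma HasDerivAt.nonneg_of_le_left {w : ℝ → ℝ} {w' x a : ℝ} (hd : HasDerivAt w w' x) (ha : a < x)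
    (h : ∀ s ∈ Icc a x, w s ≤ w x) : 0 ≤ w' := by
  have h1 : Tendsto (slope w x) (𝓝[<] x) (𝓝 w') :=
    (hasDerivAt_iff_tendsto_slope.1 hd).mono_left (nhdsWithin_mono _ fun y hy => ne_of_lt hy)
  refine ge_of_tendsto h1 ?_
  filter_upwards [Ioo_mem_nhdsLT ha] with y hy
  rw [slope_def_field]
  exact div_nonneg_of_nonpos (by linarith [h y ⟨hy.1.le, hy.2.le⟩]) (by linarith [hy.2])

/-- A maximum principle on the half-strip. -/
lemma le_of_subsolution {T c₁ C δ : ℝ} {c : ℝ → ℝ} {U U₁ U₂ : ℝ → ℝ → ℝ} (hc0 : ∀ t, 0 ≤ c t) (hc : ∀ t, c t ≤ c₁)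
    (hU : Continuous (uncurry U)) (hx : ∀ t ξ, HasDerivAt (U t) (U₁ t ξ) ξ)
    (hxx : ∀ t ξ, HasDerivAt (U₁ t) (U₂ t ξ) ξ)
    (ht : ∀ t ∈ Ioo 0 T, ∀ ξ, 0 ≤ ξ → HasDerivAt (fun t => U t ξ) (c t * U₂ t ξ) t) (hδ : 0 ≤ δ)
    (h0 : ∀ ξ, 0 ≤ ξ → U 0 ξ = 0) (hb : ∀ t ∈ Icc 0 T, U t 0 ≤ δ)
    (hC : ∀ t ∈ Ioo 0 T, ∀ ξ, 0 ≤ ξ → U t ξ ≤ C) {t ξ : ℝ} (htT : t ∈ Ioo 0 T) (hξ : 0 ≤ ξ) : U t ξ ≤ δ := by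
  have hc₁ : 0 ≤ c₁ := (hc0 0).trans (hc 0)
  -- The barrier `η(1 + ξ² + (2c₁+1)t)` is a strict supersolution, since `2c₁ + 1 > 2c`, and its
  -- quadratic growth beats the bound `C` at infinity.
  have key : ∀ η > 0, U t ξ ≤ δ + η * (1 + ξ ^ 2 + (2 * c₁ + 1) * t) := by
    intro η hη
    by_contra! hlt
    -- Chosen so that `C ≤ η L²`, which rules out a positive maximum at `ξ = L`, and so that the
    -- given point lies in the box.
    obtain ⟨L, hL⟩ : ∃ L : ℝ, L = 1 + ξ + max C 0 / η := ⟨_, rfl⟩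
    have hM : 0 ≤ max C 0 / η := by positivity
    have hL1 : 1 ≤ L := by linarith
    have hCL : C ≤ η * L ^ 2 := by
      have : max C 0 ≤ η * L := by
        rw [hL]; have : η * (max C 0 / η) = max C 0 := by field_simp
        nlinarith
      nlinarith [le_max_left C 0, mul_le_mul_of_nonneg_left hL1 (by positivity : 0 ≤ η * L)]
    set W : ℝ² → ℝ := fun z => U z.1 z.2 - δ - η * (1 + z.2 ^ 2 + (2 * c₁ + 1) * z.1) with hW
    have hUc : Continuous fun z : ℝ² => U z.1 z.2 := hU
    obtain ⟨z, hz, hmax⟩ := (isCompact_Icc.prod isCompact_Icc : IsCompact (Icc 0 t ×ˢ Icc 0 L)).exists_isMaxOn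
      ⟨(t, ξ), ⟨htT.1.le, le_rfl⟩, hξ, by linarith⟩ (show ContinuousOn W _ from (by fun_prop : Continuous W).continuousOn)
    have hpos : 0 < W z := by
      have : W (t, ξ) ≤ W z := hmax ⟨⟨htT.1.le, le_rfl⟩, hξ, by linarith⟩
      simp only [hW] at this ⊢; linarith
    have hz1 : z.1 ∈ Icc 0 T := ⟨hz.1.1, hz.1.2.trans htT.2.le⟩
    have e1 : 0 < z.1 := by
      refine lt_of_le_of_ne hz.1.1 fun h => ?_
      simp only [hW, ← h, h0 _ hz.2.1] at hpos
      nlinarith [sq_nonneg z.2]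
    have hzT : z.1 ∈ Ioo 0 T := ⟨e1, hz.1.2.trans_lt htT.2⟩
    have e2 : 0 < z.2 := by
      refine lt_of_le_of_ne hz.2.1 fun h => ?_
      simp only [hW, ← h] at hpos
      have := hb z.1 hz1
      nlinarith [mul_nonneg (by linarith : 0 ≤ 2 * c₁ + 1) hz.1.1]
    have e3 : z.2 < L := by
      refine lt_of_le_of_ne hz.2.2 fun h => ?_
      simp only [hW, h] at hpos
      have := hC z.1 hzT L (by linarith)
      nlinarith [mul_nonneg (by linarith : 0 ≤ 2 * c₁ + 1) hz.1.1]
    have d1 : ∀ x, HasDerivAt (fun x => W (z.1, x)) (U₁ z.1 x - 2 * η * x) x := fun x =>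
      (((hx z.1 x).sub_const δ).sub ((((hasDerivAt_id x).fun_pow 2).const_add 1).add_const
        ((2 * c₁ + 1) * z.1) |>.const_mul η)).congr_deriv (by simp; ring)
    have d2 : HasDerivAt (fun x => U₁ z.1 x - 2 * η * x) (U₂ z.1 z.2 - 2 * η) z.2 :=
      ((hxx z.1 z.2).sub ((hasDerivAt_id z.2).const_mul (2 * η))).congr_deriv (by simp)
    have d3 : HasDerivAt (fun s => W (s, z.2)) (c z.1 * U₂ z.1 z.2 - η * (2 * c₁ + 1)) z.1 :=
      (((ht z.1 hzT z.2 e2.le).sub_const δ).sub ((((hasDerivAt_id z.1).const_mul (2 * c₁ + 1)).const_add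
        (1 + z.2 ^ 2)).const_mul η)).congr_deriv (by simp)
    have f1 : U₂ z.1 z.2 - 2 * η ≤ 0 := by
      have := deriv_deriv_nonpos_of_isLocalMax (d1 z.2).continuousAt (by
        filter_upwards [Ioo_mem_nhds e2 e3] with x hx
        exact hmax ⟨hz.1, Ioo_subset_Icc_self hx⟩)
      rwa [show deriv (fun x => W (z.1, x)) = fun x => U₁ z.1 x - 2 * η * x from funext fun x => (d1 x).deriv,
        d2.deriv] at this
    have f2 := HasDerivAt.nonneg_of_le_left d3 e1 fun s hs => hmax ⟨⟨hs.1, hs.2.trans hz.1.2⟩, hz.2⟩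
    nlinarith [mul_le_mul_of_nonneg_left f1 (hc0 z.1), mul_le_mul_of_nonneg_right (hc z.1) hη.le]
  have hl : Tendsto (fun η : ℝ => δ + η * (1 + ξ ^ 2 + (2 * c₁ + 1) * t)) (𝓝[>] 0) (𝓝 δ) := by
    have : Continuous fun η : ℝ => δ + η * (1 + ξ ^ 2 + (2 * c₁ + 1) * t) := by fun_prop
    simpa using (this.tendsto 0).mono_left nhdsWithin_le_nhds
  exact ge_of_tendsto hl (eventually_mem_nhdsWithin.mono key)

/-- Forward averages in space. -/
noncomputable def avg (e : ℝ² → ℝ) (k : ℝ → ℝ) (t ξ : ℝ) : ℝ := ∫ x in 0..1, e (t, ξ + x) * k x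

lemma continuous_avg {e : ℝ² → ℝ} {k : ℝ → ℝ} (he : Continuous e) (hk : Continuous k) :
    Continuous (uncurry (avg e k)) :=
  continuous_parametric_intervalIntegral_of_continuous'
    (f := fun (z : ℝ²) x => e (z.1, z.2 + x) * k x) (by fun_prop) 0 1

lemma avg_eq {e : ℝ² → ℝ} {k : ℝ → ℝ} (hk : IsTimeTest 1 k) (t ξ : ℝ) :
    avg e k t ξ = ∫ y, e (t, y) * k (y - ξ) := by
  rw [avg, integral_of_le zero_le_one, integral_Ioc_eq_integral_Ioo,
    setIntegral_eq_integral_of_forall_compl_eq_zero fun x hx => by rw [hk.vanish hx, mul_zero],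
    ← integral_sub_right_eq_self _ ξ]
  simp

lemma avg_eq_setIntegral {e : ℝ² → ℝ} {k : ℝ → ℝ} (hk : IsTimeTest 1 k) (t : ℝ) {ξ : ℝ} (hξ : 0 ≤ ξ) :
    avg e k t ξ = ∫ y in ℝ₊, e (t, y) * k (y - ξ) := by
  rw [avg_eq hk, setIntegral_eq_integral_of_forall_compl_eq_zero fun y hy => ?_]
  rw [hk.vanish fun h => hy (mem_Ioi.2 (by linarith [h.1])), mul_zero]

lemma hasDerivAt_avg {e : ℝ² → ℝ} {k : ℝ → ℝ} (he : Continuous e) (hk : IsTimeTest 1 k) (t ξ : ℝ) :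
    HasDerivAt (avg e k t) (-avg e (deriv k) t ξ) ξ := by
  have hk' : HasCompactSupport fun x => k (-x) := hk.2.1.comp_homeomorph (Homeomorph.neg ℝ)
  have h := hk'.hasDerivAt_convolution_right (ContinuousLinearMap.mul ℝ ℝ) (μ := volume) (f₀ := fun y => e (t, y))
    (Continuous.locallyIntegrable (by fun_prop)) ((hk.1.comp contDiff_neg).of_le (by norm_num)) ξ
  refine (h.congr_of_eventuallyEq (.of_forall fun x => ?_)).congr_deriv ?_
  · rw [avg_eq hk]
    simp [convolution, neg_sub]
  · rw [avg_eq hk.deriv, ← integral_neg]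
    simp [convolution, neg_sub, deriv_comp_neg]

lemma integral_strip_mul {T R : ℝ} {u : ℝ² → ℝ} {θ ζ : ℝ → ℝ} (hu : LocallyIntegrableOn u (strip T))
    (hθ : IsTimeTest T θ) (hζ : IsTimeTest R ζ) :
    IntegrableOn (fun t => θ t * ∫ y in ℝ₊, u (t, y) * ζ y) (Ioo 0 T) ∧
    ∀ c : ℝ → ℝ, Continuous c → ∫ z in strip T, c z.1 * u z * (θ z.1 * ζ z.2) =
      ∫ t in Ioo 0 T, c t * (θ t * ∫ y in ℝ₊, u (t, y) * ζ y) := by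
  have h1 := (isTest_mul hθ hζ).integrableOn_mul hu
  refine ⟨h1.integral_prod_left.congr (.of_forall fun t => ?_), fun c hc => ?_⟩
  · beta_reduce
    rw [← integral_const_mul]
    refine integral_congr_ae (.of_forall fun y => ?_)
    beta_reduce; ring
  · have h2 := (isTest_mul hθ hζ).integrableOn_mul (w := fun z => c z.1 * u z)
      (hu.continuousOn_mul (by fun_prop) (isOpen_strip T).isLocallyClosed)
    rw [volume_restrict_strip, integral_prod _ h2]
    refine integral_congr_ae (.of_forall fun t => ?_)
    beta_reduce
    rw [← integral_const_mul, ← integral_const_mul]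
    refine integral_congr_ae (.of_forall fun y => ?_)
    beta_reduce; ring

lemma IsTimeTest.shift {k : ℝ → ℝ} (hk : IsTimeTest 1 k) {ξ : ℝ} (hξ : 0 ≤ ξ) :
    IsTimeTest (ξ + 1) fun y => k (y - ξ) := by
  have hs : tsupport (fun y => k (y - ξ)) ⊆ (fun y => y - ξ) ⁻¹' tsupport k :=
    closure_minimal (fun y hy => subset_tsupport _ hy) ((isClosed_tsupport k).preimage (by fun_prop))
  refine ⟨hk.1.comp (by fun_prop), hk.2.1.comp_homeomorph (Homeomorph.subRight ξ), fun y hy => ?_⟩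
  have := hk.2.2 (hs hy)
  exact ⟨by linarith [this.1], by linarith [this.2]⟩

/-- The space averages of a weak solution are classical in time. -/
lemma hasDerivAt_avg_time {T : ℝ} (hT : 0 < T) {c : ℝ → ℝ} (hc : Continuous c) {d e p q : ℝ² → ℝ}
    (he : Continuous e) (hde : EqOn d e (strip T)) (hp : IsWeakDeriv T 1 0 d p) (hq : IsWeakDeriv T 0 2 d q)
    (hpq : ∀ᵐ z ∂vol(strip T), p z = c z.1 * q z) {k : ℝ → ℝ} (hk : IsTimeTest 1 k) {ξ : ℝ}
    (hξ : 0 ≤ ξ) {t : ℝ} (ht : t ∈ Ioo 0 T) :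
    HasDerivAt (fun t => avg e k t ξ) (c t * avg e (deriv (deriv k)) t ξ) t := by
  have hk2 := hk.deriv.deriv
  have havg : ∀ {k}, IsTimeTest 1 k → ∀ t ∈ Ioo 0 T, ∫ y in ℝ₊, d (t, y) * k (y - ξ) = avg e k t ξ :=
    fun hk t ht => by
      rw [avg_eq_setIntegral hk t hξ]
      exact setIntegral_congr_fun measurableSet_Ioi fun y hy => by
        rw [hde (show (t, y) ∈ strip T from ⟨ht, hy⟩)]
  have hca : ∀ {k}, IsTimeTest 1 k → Continuous fun t => avg e k t ξ := fun hk =>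
    (continuous_avg he hk.1.continuous).comp (by fun_prop : Continuous fun t : ℝ => (t, ξ))
  have m2 : ∀ (θ : ℝ → ℝ) (z : ℝ²), mixedDeriv 0 2 (fun z => θ z.1 * k (z.2 - ξ)) z =
      θ z.1 * deriv (deriv k) (z.2 - ξ) := fun θ z => by
    simp only [mixedDeriv, iteratedDeriv_zero]
    rw [iteratedDeriv_const_mul_field, iteratedDeriv_comp_sub_const, iteratedDeriv_succ, iteratedDeriv_one]
  have m1 : ∀ (θ : ℝ → ℝ) (z : ℝ²), mixedDeriv 1 0 (fun z => θ z.1 * k (z.2 - ξ)) z =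
      deriv θ z.1 * k (z.2 - ξ) := fun θ z => by
    simp only [mixedDeriv, iteratedDeriv_zero, iteratedDeriv_one]
    rw [deriv_mul_const_field]
  have i1 : ∀ {θ : ℝ → ℝ} {G : ℝ → ℝ}, IsTimeTest T θ → Continuous G → IntegrableOn (fun t => θ t * G t) (Ioo 0 T) :=
    fun hθ hG => (hθ.1.continuous.mul hG).continuousOn.integrableOn_Ioo
  -- The average of `q` against `k` is the average of `d` against `k''` for almost every time. The
  -- factor `θ` stays because `q` is only locally integrable in the open half-strip.
  have hQ : ∀ θ, IsTimeTest T θ → (fun t => θ t * ∫ y in ℝ₊, q (t, y) * k (y - ξ))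
      =ᵐ[vol(Ioo 0 T)] fun t => θ t * avg e (deriv (deriv k)) t ξ := fun θ hθ => by
    refine ae_eq_of_integral_timeTest (integral_strip_mul hq.2.1 hθ (hk.shift hξ)).1 (i1 hθ (hca hk2)) fun χ hχ => ?_
    have hm : IsTimeTest T fun t => χ t * θ t :=
      ⟨hχ.1.mul hθ.1, hθ.2.1.mul_left, tsupport_mul_subset_right.trans hθ.2.2⟩
    have h1 := hq.2.2 _ (isTest_mul hm (hk.shift hξ))
    simp only [m2 fun t => χ t * θ t] at h1
    have h2 := (integral_strip_mul hq.1 hm (hk2.shift hξ)).2 (fun _ => 1) continuous_const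
    have h3 := (integral_strip_mul hq.2.1 hm (hk.shift hξ)).2 (fun _ => 1) continuous_const
    simp only [one_mul] at h2 h3
    rw [h2, h3] at h1
    norm_num at h1
    calc _ = ∫ t in Ioo 0 T, χ t * θ t * ∫ y in ℝ₊, q (t, y) * k (y - ξ) :=
          integral_congr_ae (.of_forall fun t => by beta_reduce; ring)
      _ = _ := by
          rw [← h1]
          refine setIntegral_congr_fun measurableSet_Ioo fun t ht => ?_
          rw [havg hk2 t ht]; ring
  have hprim : IsPrimitive T (fun t => avg e k t ξ) fun t => c t * avg e (deriv (deriv k)) t ξ := by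
    refine isPrimitive_of_weak hT (hca hk).continuousOn
      ((hc.mul (hca hk2)).continuousOn.integrableOn_Ioo) fun θ hθ => ?_
    have h1 := hp.2.2 _ (isTest_mul hθ (hk.shift hξ))
    simp only [m1 θ] at h1
    have h2 := (integral_strip_mul hp.1 hθ.deriv (hk.shift hξ)).2 (fun _ => 1) continuous_const
    have h3 := (integral_strip_mul hq.2.1 hθ (hk.shift hξ)).2 c hc
    have h4 : ∫ z in strip T, p z * (θ z.1 * k (z.2 - ξ)) = ∫ z in strip T, c z.1 * q z * (θ z.1 * k (z.2 - ξ)) :=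
      integral_congr_ae (hpq.mono fun z hz => by beta_reduce; rw [hz])
    simp only [one_mul] at h2
    rw [h2, h4, h3] at h1
    calc _ = ∫ t in Ioo 0 T, deriv θ t * ∫ y in ℝ₊, d (t, y) * k (y - ξ) :=
          setIntegral_congr_fun measurableSet_Ioo fun t ht => by rw [havg hk t ht, mul_comm]
      _ = -∫ t in Ioo 0 T, c t * (θ t * ∫ y in ℝ₊, q (t, y) * k (y - ξ)) := by rw [h1]; norm_num
      _ = _ := by
          congr 1
          refine integral_congr_ae ((hQ θ hθ).mono fun t ht => ?_)
          beta_reduce at ht ⊢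
          rw [ht]; ring
  have hcont : Continuous fun t => c t * avg e (deriv (deriv k)) t ξ := hc.mul (hca hk2)
  have hd := (integral_hasDerivAt_right (hcont.intervalIntegrable 0 t)
    (hcont.stronglyMeasurableAtFilter _ _) hcont.continuousAt).const_add (avg e k 0 ξ)
  refine hd.congr_of_eventuallyEq ?_
  filter_upwards [Ioo_mem_nhds ht.1 ht.2] with s hs
  have := hprim.sub_eq_integral (s := 0) (t := s) ⟨le_rfl, hT.le⟩ (Ioo_subset_Icc_self hs)
  beta_reduce at this
  linarith

lemma IsTimeTest.bump {ε : ℝ} (hε : ε ∈ Ioo 0 1) : IsTimeTest 1 (bump ε) :=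
  ⟨contDiff_bump ε, isCompact_Icc.of_isClosed_subset (isClosed_tsupport _) (tsupport_bump_subset hε.1),
    (tsupport_bump_subset hε.1).trans fun x hx => ⟨by linarith [hx.1, hε.1], by linarith [hx.2, hε.2, hε.1]⟩⟩

/-- Uniform approximation by averages on compact sets. -/
lemma abs_avg_bump_sub_le {e : ℝ² → ℝ} (he : Continuous e) {ε η t ξ : ℝ} (hε : ε ∈ Ioo 0 1)
    (h : ∀ x ∈ Ioo 0 ε, |e (t, ξ + x) - e (t, ξ)| ≤ η) : |avg e (bump ε) t ξ - e (t, ξ)| ≤ η := by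
  have hb := continuous_bump ε
  have h1 : ∫ x in 0..1, bump ε x = 1 := by
    rw [integral_of_le zero_le_one]
    exact setIntegral_bump hε.1 fun x hx => ⟨hx.1, hx.2.le.trans hε.2.le⟩
  have h2 : avg e (bump ε) t ξ - e (t, ξ) = ∫ x in 0..1, (e (t, ξ + x) - e (t, ξ)) * bump ε x := by
    simp only [sub_mul]
    rw [intervalIntegral.integral_sub (Continuous.intervalIntegrable (by fun_prop) _ _)
      (Continuous.intervalIntegrable (by fun_prop) _ _), intervalIntegral.integral_const_mul, h1, mul_one, avg]
  rw [h2, ← norm_eq_abs]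
  calc _ ≤ ∫ x in 0..1, η * bump ε x := by
        refine intervalIntegral.norm_integral_le_of_norm_le zero_le_one (.of_forall fun x hx => ?_)
          (Continuous.intervalIntegrable (by fun_prop) _ _)
        rw [norm_mul, norm_of_nonneg (bump_nonneg hε.1 x)]
        rcases lt_or_ge x ε with hx' | hx'
        · exact mul_le_mul_of_nonneg_right (h x ⟨hx.1, hx'⟩) (bump_nonneg hε.1 x)
        · rw [bump_eq_zero_of_ge hε.1 hx', mul_zero, mul_zero]
    _ = η := by rw [intervalIntegral.integral_const_mul, h1, mul_one]

/-- Weak solutions with zero data are nonpositive. -/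
lemma nonpos_of_isWeakDeriv {T : ℝ} (hT : 0 < T) {c : ℝ → ℝ} {c₀ c₁ : ℝ} (hc : IsCoeff c c₀ c₁) {d p q : ℝ² → ℝ}
    (hd : ContinuousOn d (closedStrip T)) (hp : IsWeakDeriv T 1 0 d p) (hq : IsWeakDeriv T 0 2 d q)
    (hpq : ∀ᵐ z ∂vol(strip T), p z = c z.1 * q z) (h0 : ∀ ξ, 0 ≤ ξ → d (0, ξ) = 0)
    (hb : ∀ t ∈ Icc 0 T, d (t, 0) = 0) {B : NNReal}
    (hB : ∀ᵐ t ∂vol(Ioo 0 T), ∫⁻ ξ in ℝ₊, ‖d (t, ξ)‖ₑ ^ 2 ≤ B) :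
    ∀ t ∈ Icc 0 T, ∀ ξ, 0 ≤ ξ → d (t, ξ) ≤ 0 := by
  -- A continuous extension of `d` to the plane, constant in time outside `[0,T]` and in space for
  -- `ξ < 0`, so that averages may be differentiated freely.
  set e : ℝ² → ℝ := fun z => d (projIcc 0 T hT.le z.1, max z.2 0) with hedef
  have he : Continuous e := hd.comp_continuous (by fun_prop) fun z =>
    ⟨(projIcc 0 T hT.le z.1).2, (show (0 : ℝ) ≤ max z.2 0 from le_max_right _ _)⟩
  have hde : EqOn d e (closedStrip T) := fun z hz => by
    simp only [hedef, projIcc_of_mem hT.le hz.1, max_eq_left (show (0 : ℝ) ≤ z.2 from hz.2)]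
  have hsub := strip_subset_closedStrip T
  have hes : ∀ t ∈ Icc 0 T, ∀ ξ, 0 ≤ ξ → e (t, ξ) = d (t, ξ) := fun t ht ξ hξ => (hde (show (t, ξ) ∈ closedStrip T from ⟨ht, hξ⟩)).symm
  -- The `L²` bound in space controls the averages through `xy ≤ x² + y²`, for almost every time and
  -- then, by continuity, for every time. This is the growth condition of the maximum principle.
  have hbd : ∀ ε ∈ Ioo 0 1, ∃ C, ∀ t ∈ Ioo 0 T, ∀ ξ, 0 ≤ ξ → avg e (bump ε) t ξ ≤ C := by
    intro ε hε
    obtain ⟨K, hK, hKb⟩ := exists_bump_le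
    have hk := IsTimeTest.bump hε
    refine ⟨B + (K / ε) ^ 2, fun t ht ξ hξ => ?_⟩
    have hcl : IsClosed {s : ℝ | avg e (bump ε) s ξ ≤ B + (K / ε) ^ 2} :=
      isClosed_le ((continuous_avg he (continuous_bump ε)).comp (by fun_prop : Continuous fun s : ℝ => (s, ξ)))
        continuous_const
    have hae : ∀ᵐ s ∂vol(Ioo 0 T), avg e (bump ε) s ξ ≤ B + (K / ε) ^ 2 := by
      filter_upwards [hB, ae_restrict_mem measurableSet_Ioo] with s hs hsT
      have hsc : Continuous fun x : ℝ => e (s, ξ + x) := by fun_prop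
      have h1 : ∫ x in 0..1, e (s, ξ + x) ^ 2 ≤ B := by
        rw [← ofReal_le_ofReal_iff B.coe_nonneg, ofReal_integral_sq (G := fun x => e (s, ξ + x)) zero_le_one hsc.continuousOn,
          ofReal_coe_nnreal]
        refine le_trans ?_ hs
        calc _ ≤ ∫⁻ x in ℝ₊, ‖e (s, ξ + x)‖ₑ ^ 2 := lintegral_mono_set Ioo_subset_Ioi_self
          _ = ∫⁻ x, (Ioi ξ).indicator (fun y => ‖e (s, y)‖ₑ ^ 2) (ξ + x) := by
              rw [← lintegral_indicator measurableSet_Ioi]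
              refine lintegral_congr fun x => ?_
              by_cases hx : 0 < x <;> simp [indicator, hx]
          _ = ∫⁻ y in Ioi ξ, ‖e (s, y)‖ₑ ^ 2 := by
              rw [lintegral_add_left_eq_self _ ξ, lintegral_indicator measurableSet_Ioi]
          _ ≤ ∫⁻ y in ℝ₊, ‖e (s, y)‖ₑ ^ 2 := lintegral_mono_set (Ioi_subset_Ioi hξ)
          _ = _ := setLIntegral_congr_fun measurableSet_Ioi fun y hy => by
              rw [hes s (Ioo_subset_Icc_self hsT) y (le_of_lt hy)]
      have hbc := continuous_bump ε
      calc avg e (bump ε) s ξ ≤ ∫ x in 0..1, (e (s, ξ + x) ^ 2 + (K / ε) ^ 2) := by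
            refine integral_mono_on zero_le_one (Continuous.intervalIntegrable (by fun_prop) _ _)
              (Continuous.intervalIntegrable (by fun_prop) _ _) fun x _ => ?_
            have h2 := hKb ε x hε.1
            have h3 := bump_nonneg hε.1 x
            nlinarith [sq_nonneg (e (s, ξ + x) - bump ε x), sq_nonneg (e (s, ξ + x) + bump ε x)]
        _ ≤ _ := by
            rw [intervalIntegral.integral_add (Continuous.intervalIntegrable (by fun_prop) _ _) (by simp),
              intervalIntegral.integral_const]
            simpa using h1
    have hdense : Ioo 0 T ⊆ closure ({s : ℝ | avg e (bump ε) s ξ ≤ B + (K / ε) ^ 2}) := by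
      have h1 : {s | avg e (bump ε) s ξ ≤ B + (K / ε) ^ 2} ∪ (Ioo 0 T)ᶜ ∈ ae volume := by
        filter_upwards [(ae_restrict_iff' measurableSet_Ioo).1 hae] with s hs
        by_cases h : s ∈ Ioo 0 T
        · exact Or.inl (hs h)
        · exact Or.inr h
      have h2 := Measure.dense_of_ae h1
      intro s hs
      have h3 := h2.open_subset_closure_inter isOpen_Ioo hs
      exact closure_mono (fun x hx => hx.2.resolve_right fun h => h hx.1) h3
    exact hcl.closure_subset (hdense ht)
  -- One `δ` is the boundary value of the averages, the other their distance to `d`; one averaging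
  -- length serves both by uniform continuity.
  have hmain : ∀ δ > 0, ∀ t ∈ Ioo 0 T, ∀ ξ, 0 ≤ ξ → d (t, ξ) ≤ 2 * δ := by
    intro δ hδ t ht ξ hξ
    have huc : UniformContinuousOn e (Icc 0 T ×ˢ Icc 0 (ξ + 1)) :=
      (isCompact_Icc.prod isCompact_Icc).uniformContinuousOn_of_continuous he.continuousOn
    obtain ⟨r, hr, H⟩ := Metric.uniformContinuousOn_iff_le.1 huc δ hδ
    obtain ⟨ε, hε, hεr⟩ : ∃ ε ∈ Ioo 0 1, ε ≤ r :=
      ⟨min r (1 / 2), ⟨by positivity, (min_le_right _ _).trans_lt (by norm_num)⟩, min_le_left _ _⟩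
    have happ : ∀ s ∈ Icc 0 T, ∀ y ∈ Icc 0 ξ, |avg e (bump ε) s y - e (s, y)| ≤ δ := fun s hs y hy =>
      abs_avg_bump_sub_le he hε fun x hx => by
        rw [← dist_eq]
        refine H _ ⟨hs, by linarith [hx.1, hy.1], by linarith [hx.2, hy.2, hε.2]⟩ _ ⟨hs, hy.1, by linarith [hy.2]⟩ ?_
        rw [Prod.dist_eq, dist_self, dist_eq, add_sub_cancel_left, abs_of_pos hx.1]
        exact max_le hr.le (hx.2.le.trans hεr)
    obtain ⟨C, hC⟩ := hbd ε hε
    have hk := IsTimeTest.bump hε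
    have h2 : ∀ t ξ, HasDerivAt (fun ξ => -avg e (deriv (bump ε)) t ξ) (avg e (deriv (deriv (bump ε))) t ξ) ξ :=
      fun t ξ => (hasDerivAt_avg he hk.deriv t ξ).neg.congr_deriv (neg_neg _)
    have := le_of_subsolution (T := T) (c₁ := c₁) (C := C) (δ := δ) (fun t => (hc.c_pos t).le) hc.upper
      (continuous_avg he (continuous_bump ε)) (hasDerivAt_avg he hk) h2
      (fun t ht ξ hξ => hasDerivAt_avg_time hT hc.cont he (hde.mono hsub) hp hq hpq hk hξ ht) hδ.le
      (fun ξ hξ => by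
        rw [avg, integral_congr (g := fun _ => 0), intervalIntegral.integral_zero]
        intro x hx
        rw [uIcc_of_le zero_le_one] at hx
        beta_reduce
        rw [hes 0 ⟨le_rfl, hT.le⟩ _ (by linarith [hx.1]), h0 _ (by linarith [hx.1]), zero_mul])
      (fun t ht => by
        have := (abs_le.1 (happ t ht 0 ⟨le_rfl, hξ⟩)).2
        rw [hes t ht 0 le_rfl, hb t ht] at this; linarith)
      hC ht hξ
    have h3 := (abs_le.1 (happ t (Ioo_subset_Icc_self ht) ξ ⟨hξ, le_rfl⟩)).1
    rw [hes t (Ioo_subset_Icc_self ht) ξ hξ] at h3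
    linarith
  intro t ht ξ hξ
  have hcl : IsClosed {s : ℝ | e (s, ξ) ≤ 0} := isClosed_le (by fun_prop) continuous_const
  have hsub' : Ioo 0 T ⊆ {s : ℝ | e (s, ξ) ≤ 0} := fun s hs => by
    rw [mem_ofPred_eq, hes s (Ioo_subset_Icc_self hs) ξ hξ]
    exact le_of_forall_pos_le_add fun δ hδ => by linarith [hmain (δ / 2) (by linarith) s hs ξ hξ]
  have := closure_minimal hsub' hcl
  rw [closure_Ioo hT.ne] at this
  rw [← hes t ht ξ hξ]
  exact this ht

/-! ### Smooth weights and weighted Bochner norms -/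

/-- The derivatives of the weight `⟨ξ⟩ⁿ`. -/
noncomputable def weightD (n q : ℕ) : ℝ → ℝ := iteratedDeriv q fun x => √(1 + x ^ 2) ^ n

lemma weightD_growth (n : ℕ) : (fun x : ℝ => √(1 + x ^ 2) ^ n).HasTemperateGrowth := by
  have h := Function.hasTemperateGrowth_one_add_norm_sq_rpow ℝ (n / 2 : ℝ)
  have e : (fun x : ℝ => √(1 + x ^ 2) ^ n) = fun x => (1 + ‖x‖ ^ 2) ^ (n / 2 : ℝ) := by
    ext x
    rw [Real.sqrt_eq_rpow, ← Real.rpow_natCast, ← Real.rpow_mul (by positivity), norm_eq_abs, sq_abs]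
    congr 1; ring
  rw [e]; exact h

lemma contDiff_weightD (n q : ℕ) : ContDiff ℝ ∞ (weightD n q) := by
  have h : ContDiff ℝ ∞ fun x : ℝ => √(1 + x ^ 2) ^ n := by
    have := weightD_growth n
    rw [Function.HasTemperateGrowth] at this
    exact this.1
  rw [weightD, iteratedDeriv_eq_iterate]
  exact h.iterate_deriv q

lemma hasDerivAt_weightD (n q : ℕ) (x : ℝ) : HasDerivAt (weightD n q) (weightD n (q + 1) x) x := by
  have h := ((contDiff_weightD n q).differentiable (by norm_num) x).hasDerivAt
  rwa [weightD, ← iteratedDeriv_succ] at h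

lemma exists_abs_weightD_le (n q : ℕ) : ∃ K r, 0 ≤ K ∧ ∀ x, |weightD n q x| ≤ K * √(1 + x ^ 2) ^ r := by
  obtain ⟨k, C, h⟩ := (weightD_growth n).2 q
  have hC : 0 ≤ C := by simpa using (norm_nonneg _).trans (h 0)
  refine ⟨C * 2 ^ k, k, by positivity, fun x => ?_⟩
  have h1 := h x
  rw [norm_iteratedFDeriv_eq_norm_iteratedDeriv] at h1
  refine h1.trans ?_
  rw [mul_assoc, ← mul_pow]
  refine mul_le_mul_of_nonneg_left (pow_le_pow_left₀ (by positivity) ?_ k) hC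
  have h2 := one_le_sqrt_weight x
  have h3 : |x| ≤ √(1 + x ^ 2) := Real.le_sqrt_of_sq_le (by rw [sq_abs]; linarith)
  rw [norm_eq_abs]; linarith

/-- The recursion of `leib` differentiates the weight in one branch, so the statement must allow
weights that have already been differentiated `q` times. -/
lemma leib_induction {T : ℝ} {P : (ℝ² → ℝ) → Prop} (hadd : ∀ u w, P u → P w → P fun z => u z + w z)
    (hmul : ∀ w, P w → ∀ m : ℝ → ℝ, Continuous m → ∀ K r, (∀ z ∈ strip T, |m z.2| ≤ K * √(1 + z.2 ^ 2) ^ r) →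
      P fun z => m z.2 * w z) (n j q : ℕ) {W : ℕ → ℝ² → ℝ} (hW : ∀ p ≤ j, P (W p)) :
    P (leib j (fun i => weightD n (i + q)) W) := by
  induction j generalizing q W with
  | zero =>
    obtain ⟨K, r, -, h⟩ := exists_abs_weightD_le n (0 + q)
    exact hmul _ (hW 0 le_rfl) _ (contDiff_weightD n (0 + q)).continuous K r fun z _ => h _
  | succ j ih =>
    refine hadd _ _ ?_ (ih q fun p hp => hW (p + 1) (by omega))
    simpa only [add_assoc, add_comm 1] using ih (1 + q) fun p hp => hW p (by omega)

lemma IsSup.leib {T : ℝ} (n j : ℕ) {W : ℕ → ℝ² → ℝ} (hW : ∀ p ≤ j, IsSup T (W p)) : IsSup T (leib j (weightD n) W) :=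
  leib_induction (fun _ _ => IsSup.add) (fun _ hw _ hm _ _ h =>
    hw.mul (hm.comp continuous_snd).aestronglyMeasurable h) n j 0 hW

lemma IsSq.leib {T : ℝ} (n j : ℕ) {W : ℕ → ℝ² → ℝ} (hW : ∀ p ≤ j, IsSq T (W p)) : IsSq T (leib j (weightD n) W) :=
  leib_induction (fun _ _ => IsSq.add) (fun _ hw _ hm _ _ h =>
    hw.mul (hm.comp continuous_snd).aestronglyMeasurable h) n j 0 hW

lemma isWeakDeriv_weighted {T : ℝ} {i l : ℕ} {v : ℝ² → ℝ} {V : ℕ → ℝ² → ℝ}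
    (hV : ∀ j ≤ l, IsWeakDeriv T i j v (V j)) (n : ℕ) : IsWeakDeriv T i l (weighted n v) (leib l (weightD n) V) :=
  IsWeakDeriv.leib (contDiff_weightD n) (hasDerivAt_weightD n) l (hV 0 (by omega)) fun p hp => by
    have := hV (p + 1) hp
    rw [(hV p hp.le).comp_iff, zero_add, add_comm 1]
    exact this

lemma memBochner_weighted_top {T : ℝ} {k l : ℕ} {v : ℝ² → ℝ} {V : ℕ → ℕ → ℝ² → ℝ}
    (hV : ∀ i ≤ k, ∀ j ≤ l, IsWeakDeriv T i j v (V i j)) (h : ∀ i ≤ k, ∀ j ≤ l, IsSup T (V i j)) (n : ℕ) :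
    MemBochner T k ⊤ l (weighted n v) :=
  memBochner_top (fun i j => leib j (weightD n) (V i))
    (fun i hi _ hj => isWeakDeriv_weighted (fun p hp => hV i hi p (hp.trans hj)) n)
    fun i hi j hj => IsSup.leib n j fun p hp => h i hi p (hp.trans hj)

lemma memBochner_weighted_two {T : ℝ} {k l : ℕ} {v : ℝ² → ℝ} {V : ℕ → ℕ → ℝ² → ℝ}
    (hV : ∀ i ≤ k, ∀ j ≤ l, IsWeakDeriv T i j v (V i j)) (h : ∀ i ≤ k, ∀ j ≤ l, IsSq T (V i j)) (n : ℕ) :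
    MemBochner T k 2 l (weighted n v) :=
  memBochner_two (fun i j => leib j (weightD n) (V i))
    (fun i hi _ hj => isWeakDeriv_weighted (fun p hp => hV i hi p (hp.trans hj)) n)
    fun i hi j hj => IsSq.leib n j fun p hp => h i hi p (hp.trans hj)

/-! ### The solution and its higher regularity -/

/-- The solution: the potential of the boundary values, minus the lift. -/
noncomputable def sol (c : ℝ → ℝ) (T : ℝ) (f : ℝ² → ℝ) (z : ℝ²) : ℝ :=
  (if 0 < z.2 then -pot c T tr(f) 1 z.1 z.2 else f (z.1, 0)) - f z

namespace IsCoeff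
variable {c : ℝ → ℝ} {c₀ c₁ : ℝ} (hc : IsCoeff c c₀ c₁) {T : ℝ} (hT : 0 < T)
  {f g f₁ f₂ g₁ g₂ gt : ℝ² → ℝ} (h : IsLiftPair T f g f₁ f₂ g₁ g₂ gt)
include hc hT h

/-- The potential enters with order one, each space derivative adds one and each time derivative
two; this is the count `1 + l + 2i`. -/
lemma exists_isWeakDeriv_sol {i l : ℕ} (hci : Chain False ⊤ T i c) {F : ℝ² → ℝ} (hF : IsWeakDeriv T i l f F) :
    ∃ V, IsWeakDeriv T i l (sol c T f) V ∧
      ((∀ q ≤ 1 + l + 2 * i, IsSup T fun z => pot c T tr(f) q z.1 z.2) → IsSup T F → IsSup T V) ∧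
      ((∀ q ≤ 1 + l + 2 * i, IsSq T fun z => pot c T tr(f) q z.1 z.2) → IsSq T F → IsSq T V) := by
  obtain ⟨w, hw⟩ := hc.exists_isWeakDeriv_pot hT.le h.integrableOn_trace i hci (Chain.const T (-1) i) 1
  obtain ⟨h1, h2, h3⟩ := hw l
  refine ⟨fun z => w l z + -F z, (h1.add hF.neg).congr ?_ (EventuallyEq.refl _ _), fun a b => (h2 a).add b.neg,
    fun a b => (h3 a).add b.neg⟩
  refine ae_restrict_of_forall_mem (measurableSet_strip T) fun z hz => ?_
  simp [sol, if_pos (show 0 < z.2 from hz.2), sub_eq_add_neg]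

/-- Higher regularity. -/
lemma higher_regularity {m : ℕ} (hcm : Chain False ⊤ T m c) (hκ : Chain False ⊤ T m fun t => (c t)⁻¹)
    (hg : ∀ j : ℕ, ∃ gj : ℝ² → ℝ, IsWeakDeriv T 0 j g gj ∧ MemSobolev T m gj)
    (h0 : ∀ k < m, ∀ ξ ∈ Ici (0 : ℝ), iteratedDerivWithin k (fun t => g (t, ξ)) (Icc 0 T) 0 = 0)
    (n : ℕ) {k l : ℕ} (hkl : k + l / 2 ≤ m) :
    MemBochner T k ⊤ l (weighted n (sol c T f)) ∧ MemBochner T k 2 (l + 1) (weighted n (sol c T f)) := by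
  have hsub := strip_subset_closedStrip T
  have vg : ∀ z ∈ strip T, 1 < z.2 → g z = 0 := fun z hz hz1 => h.gprof.supp z.1 (hsub hz).1 z.2 hz1.le
  have hG : ∀ i j, ∃ G, i ≤ m → IsWeakDeriv T i j g G ∧ IsSq T G := fun i j => by
    by_cases hi : i ≤ m
    · obtain ⟨gj, h1, h2⟩ := hg j
      obtain ⟨G, h3, h4⟩ := h2 i 0 (by omega)
      have h5 := h1.comp h3
      rw [add_zero, zero_add] at h5
      exact ⟨G, fun _ => ⟨h5, isSq_of_vanish h4 (h5.ae_eq_zero_of_one_lt vg)⟩⟩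
    · exact ⟨0, fun h => absurd h hi⟩
  choose G hG using hG
  -- The trace of `∂_t^k g` is square integrable because `∂_ξ ∂_t^k g` is, and the compatibility
  -- conditions at `ξ = 0` give the zeros at `t = 0`.
  have hγ : Chain True 2 T m fun t => g (t, 0) := by
    have tr := fun k (hk : k ≤ m) => trace_weak h.gprof.cont h.gprof.supp (hG k 1 hk).1 (hG k 1 hk).2.memLp
    exact chain_of_weak (by norm_num) hT h.continuousOn_trace' (fun k t => -∫ ξ in Ioo 0 1, G k 1 (t, ξ))
      (fun k hk => (tr k hk).1) (fun k hk => (tr k hk).2) fun _ k hk => h0 k hk 0 self_mem_Ici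
  -- The trace of `f` is a time integral of that of `g`, so the chain has one link more than the
  -- source: orders up to `2m + 2` are bounded in time and order `2m + 3` is square integrable.
  have hb : DataChain c T (m + 1) tr(f) := by
    refine ⟨fun t => (c t)⁻¹ * -g (t, 0), DataChain.of_chain (fun t => (hc.c_pos t).ne') hT.le
      (hκ.mono hT.le (by omega)) (hκ.mul hT.le (hγ.neg hT.le)), fun t ht => ?_⟩
    beta_reduce
    rw [h.prim t ht 0 le_rfl, ← intervalIntegral.integral_neg]
    refine integral_congr fun r _ => ?_
    have := (hc.c_pos r).ne'
    field_simp
  -- Without a time derivative, those of `f` are time integrals of those of `g`. With `i + 1` of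
  -- them they are minus `∂_t^i ∂_ξ^j g`, bounded in time because one more time derivative is still
  -- square integrable.
  have hF : ∀ i j, ∃ F, i ≤ m → IsWeakDeriv T i j f F ∧ IsSup T F := fun i j => by
    rcases i with _ | i
    · obtain ⟨h1, h2⟩ := hG 0 j (by omega)
      have hw : IsWeakDeriv T 0 j f fun z => -timePrim T (G 0 j) z := by
        refine (h1.timePrim h.gprof.int h2.integrableOn).neg.congr ?_ (EventuallyEq.refl _ _)
        refine ae_restrict_of_forall_mem (measurableSet_strip T) fun z hz => ?_
        have e := timePrim_eq g (hsub hz).1 z.2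
        have e' := h.prim z.1 (hsub hz).1 z.2 (le_of_lt hz.2)
        rw [← e] at e'
        exact e'.symm
      exact ⟨_, fun _ => ⟨hw, h2.timePrim.neg⟩⟩
    · refine ⟨fun z => -G i j z, fun hi => ?_⟩
      obtain ⟨h1, h2⟩ := hG i j (by omega)
      obtain ⟨h3, h4⟩ := hG (i + 1) j hi
      have h5 : IsWeakDeriv T 1 0 (G i j) (G (i + 1) j) := by
        rw [h1.comp_iff, zero_add, add_comm 1]; exact h3
      obtain ⟨B, hB⟩ := ae_lintegral_le_of_isWeakDeriv hT h2 h4 h5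
      exact ⟨h.fprof.dt.comp h1.neg, (isSup_of_vanish h2.1 hB (h1.ae_eq_zero_of_one_lt vg)).neg⟩
  choose F hF using hF
  -- From `l ≤ 2[l/2] + 1` and `k + [l/2] ≤ m` one gets `1 + l + 2k ≤ 2(m+1)`; the `H^{l+1}` norm
  -- may use one order more.
  have hV : ∀ i j, ∃ V, i ≤ m → IsWeakDeriv T i j (sol c T f) V ∧ (1 + j + 2 * i ≤ 2 * (m + 1) → IsSup T V) ∧
      (1 + j + 2 * i ≤ 2 * (m + 1) + 1 → IsSq T V) := fun i j => by
    by_cases hi : i ≤ m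
    · obtain ⟨V, h1, h2, h3⟩ := hc.exists_isWeakDeriv_sol hT h (hcm.mono hT.le hi) (hF i j hi).1
      exact ⟨V, fun _ => ⟨h1, fun hq => h2 (fun q hq' => hc.isSup_pot_of_dataChain hT.le hb (hq'.trans hq)) (hF i j hi).2,
        fun hq => h3 (fun q hq' => hc.isSq_pot_of_dataChain hT.le hb (hq'.trans hq)) (hF i j hi).2.isSq⟩⟩
    · exact ⟨0, fun h => absurd h hi⟩
  choose V hV using hV
  exact ⟨memBochner_weighted_top (fun i hi j hj => (hV i j (by omega)).1)
      (fun i hi j hj => (hV i j (by omega)).2.1 (by omega)) n,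
    memBochner_weighted_two (fun i hi j hj => (hV i j (by omega)).1)
      (fun i hi j hj => (hV i j (by omega)).2.2 (by omega)) n⟩

end IsCoeff

/-! ### The weighted estimate -/

lemma lintegral_weighted_sq_le_of_ae (N : ℕ) {w u : ℝ → ℝ} {K : ℝ} (h : ∀ ξ, 1 ≤ ξ → |u ξ| ≤ K / ξ ^ (N + 1))
    (hw : ∀ᵐ ξ ∂vol(ℝ₊), 1 < ξ → w ξ = u ξ) :
    ∫⁻ ξ in ℝ₊, ‖√(1 + ξ ^ 2) ^ N * w ξ‖ₑ ^ 2 ≤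
      2 ^ N * (∫⁻ ξ in Ioo 0 1, ‖w ξ‖ₑ ^ 2) + 2 ^ N * ofReal (K ^ 2) := by
  have h1 := lintegral_weighted_sq_le N (fun ξ => if ξ < 1 then w ξ else u ξ) (K := K) fun ξ hξ => by
    simpa [not_lt.2 hξ] using h ξ hξ
  have e : ∫⁻ ξ in Ioo 0 1, ‖if ξ < 1 then w ξ else u ξ‖ₑ ^ 2 = ∫⁻ ξ in Ioo 0 1, ‖w ξ‖ₑ ^ 2 :=
    setLIntegral_congr_fun measurableSet_Ioo fun ξ hξ => by simp [hξ.2]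
  rw [e] at h1
  refine (lintegral_congr_ae ?_).trans_le h1
  filter_upwards [hw, Measure.ae_ne vol(ℝ₊) 1] with ξ hξ hne
  rcases lt_or_gt_of_ne hne with h2 | h2
  · simp [h2]
  · simp [not_lt.2 h2.le, hξ h2]

/-- A function with two derivatives. -/
def jet (u u₁ u₂ : ℝ² → ℝ) : ℕ → ℝ² → ℝ
  | 0 => u
  | 1 => u₁
  | _ + 2 => u₂

lemma exists_enorm_leib_le (n j q : ℕ) : ∃ (C : NNReal) (r : ℕ), ∀ (V : ℕ → ℝ² → ℝ) (z : ℝ²),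
    ‖leib j (fun i => weightD n (i + q)) V z‖ₑ ^ 2 ≤ C * ∑ p ∈ Finset.range (j + 1), ‖weighted r (V p) z‖ₑ ^ 2 := by
  induction j generalizing q with
  | zero =>
    obtain ⟨K, r, -, h⟩ := exists_abs_weightD_le n (0 + q)
    refine ⟨(K ^ 2).toNNReal, r, fun V z => ?_⟩
    have := enorm_weighted_mul_le (m := fun z => weightD n (0 + q) z.2) (w := V 0) (h z.2) 0
    rw [weighted_zero, zero_add] at this
    simpa [leib, ofReal] using this
  | succ j ih =>
    obtain ⟨C₁, r₁, h₁⟩ := ih (1 + q)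
    obtain ⟨C₂, r₂, h₂⟩ := ih q
    have mono : ∀ {s}, s ≤ max r₁ r₂ → ∀ (w : ℝ² → ℝ) z, ‖weighted s w z‖ₑ ^ 2 ≤ ‖weighted (max r₁ r₂) w z‖ₑ ^ 2 :=
      fun hs w z => by
        simp only [weighted, enorm_mul, Real.enorm_of_nonneg (pow_nonneg (Real.sqrt_nonneg (1 + z.2 ^ 2)) _)]
        gcongr
        exact one_le_sqrt_weight z.2
    refine ⟨2 * C₁ + 2 * C₂, max r₁ r₂, fun V z => ?_⟩
    set S := ∑ p ∈ Finset.range (j + 1 + 1), ‖weighted (max r₁ r₂) (V p) z‖ₑ ^ 2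
    have e1 : leib (j + 1) (fun i => weightD n (i + q)) V z = leib j (fun i => weightD n (i + (1 + q))) V z +
        leib j (fun i => weightD n (i + q)) (fun p => V (p + 1)) z := by
      simp only [leib, add_assoc]
    have s1 : ∑ p ∈ Finset.range (j + 1), ‖weighted r₁ (V p) z‖ₑ ^ 2 ≤ S :=
      (Finset.sum_le_sum fun p _ => mono (le_max_left _ _) (V p) z).trans
        (Finset.sum_le_sum_of_subset (Finset.range_mono (by omega)))
    have s2 : ∑ p ∈ Finset.range (j + 1), ‖weighted r₂ (V (p + 1)) z‖ₑ ^ 2 ≤ S := by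
      refine (Finset.sum_le_sum fun p _ => mono (le_max_right _ _) (V (p + 1)) z).trans ?_
      simp only [S]
      rw [Finset.sum_range_succ' _ (j + 1)]
      exact le_self_add
    rw [e1]
    refine (enorm_add_sq_le _ _).trans ?_
    push_cast
    rw [add_mul, mul_assoc, mul_assoc]
    gcongr
    · exact (h₁ V z).trans (by gcongr)
    · exact (h₂ _ z).trans (by gcongr)

lemma IsLiftPair.ae_eq_zero {T : ℝ} {f g f₁ f₂ g₁ g₂ gt : ℝ² → ℝ} (h : IsLiftPair T f g f₁ f₂ g₁ g₂ gt) :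
    ∀ᵐ z ∂vol(strip T), 1 < z.2 → f z = 0 ∧ g z = 0 ∧ f₁ z = 0 ∧ f₂ z = 0 := by
  have vf : ∀ z ∈ strip T, 1 < z.2 → f z = 0 := fun z hz hl =>
    h.fprof.supp z.1 (Ioo_subset_Icc_self hz.1) z.2 hl.le
  filter_upwards [h.fprof.dx.ae_eq_zero_of_one_lt vf, h.fprof.dxx.ae_eq_zero_of_one_lt vf,
    ae_restrict_mem (measurableSet_strip T)] with z h1 h2 hz hl
  exact ⟨vf z hz hl, h.gprof.supp z.1 (Ioo_subset_Icc_self hz.1) z.2 hl.le, h1 hl, h2 hl⟩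

namespace IsCoeff

/-- The solution is recovered by integrating `∂_t v = -c · pot 3 + g` from zero. The bound for `v`
itself then follows from the one for its second space derivative. -/
lemma sol_eq_timePrim {c : ℝ → ℝ} {c₀ c₁ : ℝ} (hc : IsCoeff c c₀ c₁) {T : ℝ} (hT : 0 < T)
    {f g f₁ f₂ g₁ g₂ gt : ℝ² → ℝ} (h : IsLiftPair T f g f₁ f₂ g₁ g₂ gt) {z : ℝ²} (hz : z ∈ strip T) :
    sol c T f z = timePrim T (fun z => -(c z.1 * pot c T tr(f) 3 z.1 z.2) + g z) z := by
  obtain ⟨t, ξ⟩ := z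
  have ht := Ioo_subset_Icc_self hz.1
  have hξ : 0 < ξ := hz.2
  have hi := h.integrableOn_trace
  have hp : Continuous fun s => pot c T tr(f) 3 s ξ :=
    ((hc.continuousOn_pot hi 3).comp_continuous (f := fun s => (s, ξ)) (by fun_prop) fun s => ⟨mem_univ _, hξ⟩)
  have h1 := integral_eq_sub_of_hasDerivAt (a := 0) (b := t)
    (fun s _ => hc.hasDerivAt_pot_time hi 1 s hξ) ((hc.cont.mul hp).intervalIntegrable _ _)
  rw [hc.pot_zero_time hT.le, sub_zero] at h1
  have hg : IntervalIntegrable (fun r => g (r, ξ)) volume 0 t :=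
    ContinuousOn.intervalIntegrable_of_Icc ht.1 (h.gprof.cont.comp (by fun_prop) fun r hr =>
      ⟨⟨hr.1, hr.2.trans ht.2⟩, hξ.le⟩)
  have e := intervalIntegral.integral_add (f := fun s => -(c s * pot c T tr(f) 3 s ξ))
    (g := fun r => g (r, ξ)) ((hc.cont.mul hp).neg.intervalIntegrable 0 t) hg
  rw [intervalIntegral.integral_neg] at e
  rw [timePrim_eq _ ht]
  refine Eq.trans ?_ e.symm
  simp only [sol, hξ, if_true]
  rw [h1, h.prim t ht ξ hξ.le]; ring

/-- Near the boundary the energy estimate `near_lift` is used. For `ξ > 1` the lift vanishes and the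
potential decays, with an amplitude `∫|f(s,0)|` whose square is at most `T` times that of `‖f₁‖`.
The quantifiers put the constant before the coefficient and the data. -/
lemma exists_weighted_sol_le (c₀ c₁ T K : ℝ) (hc₀ : 0 < c₀) (hc₁ : 0 < c₁) (hT : 0 < T) (hK : 0 ≤ K) (r : ℕ) :
    ∃ C : ℝ, ∀ c, IsCoeff c c₀ c₁ → EnergyBound c c₀ T K → ∀ f g f₁ f₂ g₁ g₂ gt,
      IsLiftPair T f g f₁ f₂ g₁ g₂ gt → ∀ S, S = sqInt T f₁ + sqInt T f₂ + sqInt T g →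
      (∀ᵐ t ∂vol(Ioo 0 T), ∫⁻ ξ in ℝ₊, ‖weighted r (sol c T f) (t, ξ)‖ₑ ^ 2 ≤ ofReal (C * S)) ∧
      (∀ᵐ t ∂vol(Ioo 0 T), ∫⁻ ξ in ℝ₊,
        ‖weighted r (fun z => -pot c T tr(f) 2 z.1 z.2 - f₁ z) (t, ξ)‖ₑ ^ 2 ≤ ofReal (C * S)) ∧
      ∫⁻ z in strip T, ‖weighted r (fun z => -pot c T tr(f) 3 z.1 z.2 - f₂ z) z‖ₑ ^ 2 ≤
        ofReal (C * S) := by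
  obtain ⟨K₂, -, p2⟩ := exists_abs_pot_le c₀ c₁ T hT hc₁ 2 (r + 1)
  obtain ⟨K₃, -, p3⟩ := exists_abs_pot_le c₀ c₁ T hT hc₁ 3 (r + 1)
  set A := c₀⁻¹ * (2 * c₁ ^ 2 + 4) + K * T
  have hA : 0 ≤ A := by positivity
  -- In `D₂` and `D₃` the first summand is the near part and the second the far part. `D₁` comes
  -- from `∂_t v = c(v_ξξ + f₂) + g`, with a factor 2 for each splitting of a square and a factor
  -- `T` from the time integral.
  set D₂ := 2 ^ r * A + 2 ^ r * (K₂ ^ 2 * T)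
  set D₃ := 2 ^ r * (c₀⁻¹ * A) + T * (2 ^ r * (K₃ ^ 2 * T))
  set D₁ := T * (2 * (c₁ ^ 2 * (2 * D₃ + 2 * 2 ^ r)) + 2 * 2 ^ r)
  have hD₂ : 0 ≤ D₂ := by positivity
  have hD₃ : 0 ≤ D₃ := by positivity
  have hD₁ : 0 ≤ D₁ := by positivity
  refine ⟨D₁ + D₂ + D₃, fun c hc hE f g f₁ f₂ g₁ g₂ gt h S hS => ?_⟩
  have s1 := sqInt_nonneg T f₁
  have s2 := sqInt_nonneg T f₂
  have s3 := sqInt_nonneg T g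
  have hS0 : 0 ≤ S := by rw [hS]; positivity
  have hi := h.integrableOn_trace
  obtain ⟨N2, N3⟩ := hc.near_lift hT hK hE h rfl
  have hR : c₀⁻¹ * (2 * c₁ ^ 2 * sqInt T f₂ + 4 * sqInt T g) + K * (T * sqInt T f₁) ≤ A * S := by
    have : 0 < c₀⁻¹ := inv_pos.2 hc₀
    calc _ ≤ c₀⁻¹ * (2 * c₁ ^ 2 * S + 4 * S) + K * (T * S) := by gcongr <;> linarith
      _ = _ := by ring
  have hfar : ∀ {j : ℕ} {κ : ℝ}, (∀ t ∈ Icc 0 T, ∀ ξ : ℝ, 1 ≤ ξ → |pot c T tr(f) j t ξ| ≤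
      κ / ξ ^ (r + 1) * ∫ s in Ioo 0 t, |f (s, 0)|) → ∀ t ∈ Ioo 0 T, ∀ ξ : ℝ, 1 ≤ ξ →
      |-pot c T tr(f) j t ξ| ≤ |κ| * (∫ s in Ioo 0 T, |f (s, 0)|) / ξ ^ (r + 1) :=
    fun {j κ} hp t ht ξ hξ => by
      have h0 : ∫ s in Ioo 0 t, |f (s, 0)| ≤ ∫ s in Ioo 0 T, |f (s, 0)| :=
        setIntegral_mono_set hi.abs (ae_of_all _ fun _ => abs_nonneg _) (Ioo_subset_Ioo_right ht.2.le).eventuallyLE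
      have h1 : 0 ≤ ∫ s in Ioo 0 t, |f (s, 0)| := integral_nonneg fun _ => abs_nonneg _
      have h2 : 0 < ξ ^ (r + 1) := by positivity
      rw [abs_neg, mul_div_right_comm]
      refine (hp t (Ioo_subset_Icc_self ht) ξ hξ).trans ?_
      gcongr
      exact le_abs_self κ
  have hsq : ∀ κ : ℝ, ofReal ((|κ| * ∫ s in Ioo 0 T, |f (s, 0)|) ^ 2) ≤ ofReal (κ ^ 2 * T * S) :=
    fun κ => ofReal_le_ofReal (by
      rw [mul_pow, sq_abs, mul_assoc]
      refine mul_le_mul_of_nonneg_left ((h.sq_integral_trace_le hT.le).trans ?_) (sq_nonneg _)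
      gcongr; linarith)
  have two : ∀ x : ℝ, (2 : ℝ≥0∞) ^ r * ofReal x = ofReal (2 ^ r * x) := fun x => by
    rw [ofReal_mul (by positivity), ofReal_pow (by norm_num)]; norm_num
  have hz := h.ae_eq_zero
  rw [volume_restrict_strip] at hz
  have hz := ae_ae_of_ae_prod hz
  have b3 : ∫⁻ z in strip T, ‖weighted r (fun z => -pot c T tr(f) 3 z.1 z.2 - f₂ z) z‖ₑ ^ 2 ≤
      ofReal (D₃ * S) := by
    have hm : AEStronglyMeasurable (fun z => -pot c T tr(f) 3 z.1 z.2 - f₂ z) vol(strip T) :=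
      (hc.aestronglyMeasurable_pot hi 3).neg.sub h.fprof.sq₂.1
    rw [lintegral_strip T (aestronglyMeasurable_weighted hm r)]
    have hm' := (aemeasurable_enorm_sq hm).mono_measure (restrict_mono
      (s := Ioo 0 T ×ˢ Ioo 0 1) (Set.prod_mono_right Ioo_subset_Ioi_self) le_rfl)
    have e : (vol(Ioo 0 T ×ˢ Ioo 0 1) : Measure (ℝ²)) = vol(Ioo 0 T).prod vol(Ioo 0 1) := by
      rw [prod_restrict, ← volume_eq_prod]
    rw [e] at hm' N3
    rw [lintegral_prod _ (by exact hm')] at N3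
    calc _ ≤ ∫⁻ t in Ioo 0 T, (2 ^ r * (∫⁻ ξ in Ioo 0 1,
          ‖-pot c T tr(f) 3 t ξ - f₂ (t, ξ)‖ₑ ^ 2) + 2 ^ r * ofReal (K₃ ^ 2 * T * S)) := by
          refine lintegral_mono_ae ?_
          filter_upwards [hz, ae_restrict_mem measurableSet_Ioo] with t ht htT
          refine (lintegral_weighted_sq_le_of_ae r (hfar (p3 c hc _ hi) t htT) ?_).trans
            (add_le_add le_rfl (mul_le_mul' le_rfl (hsq K₃)))
          filter_upwards [ht] with ξ hξ hl
          simp [(hξ hl).2.2.2]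
      _ ≤ 2 ^ r * ofReal (c₀⁻¹ * (A * S)) + 2 ^ r * ofReal (K₃ ^ 2 * T * S) * ofReal T := by
          rw [lintegral_add_right _ measurable_const, lintegral_const_mul' _ _ (by simp), setLIntegral_const,
            volume_Ioo, sub_zero]
          gcongr
          refine N3.trans (ofReal_le_ofReal ?_)
          have : 0 < c₀⁻¹ := inv_pos.2 hc₀
          gcongr
      _ = _ := by
          rw [two, two, ← ofReal_mul (by positivity), ← ofReal_add (by positivity) (by positivity)]
          congr 1; simp only [D₃]; ring
  refine ⟨?_, ?_, b3.trans (ofReal_le_ofReal (by gcongr; linarith))⟩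
  · have hm3 := hc.aestronglyMeasurable_pot hi 3
    have hcm : AEStronglyMeasurable (fun z => c z.1) vol(strip T) :=
      (hc.cont.comp continuous_fst).aestronglyMeasurable
    have hmG : AEStronglyMeasurable (fun z => -(c z.1 * pot c T tr(f) 3 z.1 z.2) + g z)
      vol(strip T) := (hcm.mul hm3).neg.add h.supg.1
    have sup : ∀ {w : ℝ² → ℝ}, IsSq T w → (∀ᵐ z ∂vol(strip T), 1 < z.2 → w z = 0) → sqInt T w ≤ S →
        ∫⁻ z in strip T, ‖weighted r w z‖ₑ ^ 2 ≤ ofReal (2 ^ r * S) := fun {w} hw h0 hle => by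
      calc _ ≤ ∫⁻ z in strip T, 2 ^ r * ‖w z‖ₑ ^ 2 := by
            refine lintegral_mono_ae ?_
            filter_upwards [h0, ae_restrict_mem (measurableSet_strip T)] with z h0 hz
            exact enorm_weighted_sq_le (le_of_lt hz.2) h0
        _ ≤ _ := by
            rw [lintegral_const_mul' _ _ (by simp), ← hw.ofReal_sqInt, two]
            exact ofReal_le_ofReal (by gcongr)
    have bG : ∫⁻ z in strip T, ‖weighted r (fun z => -(c z.1 * pot c T tr(f) 3 z.1 z.2) + g z) z‖ₑ ^ 2 ≤
        ofReal ((2 * (c₁ ^ 2 * (2 * D₃ + 2 * 2 ^ r)) + 2 * 2 ^ r) * S) := by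
      set V : ℝ² → ℝ := fun z => -pot c T tr(f) 3 z.1 z.2 - f₂ z
      have hmV : AEStronglyMeasurable V vol(strip T) := hm3.neg.sub h.fprof.sq₂.1
      have e : (fun z => -(c z.1 * pot c T tr(f) 3 z.1 z.2) + g z) =
          fun z => c z.1 * (V z + f₂ z) + g z := by ext z; simp only [V]; ring
      rw [e]
      simp only [weighted_add r (fun z => c z.1 * (V z + f₂ z)) g]
      refine (lintegral_enorm_add_sq_le (u := weighted r fun z => c z.1 * (V z + f₂ z)) (w := weighted r g)
        (aestronglyMeasurable_weighted (hcm.mul (hmV.add h.fprof.sq₂.1)) r)).trans ?_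
      have h1 : ∫⁻ z in strip T, ‖weighted r (fun z => c z.1 * (V z + f₂ z)) z‖ₑ ^ 2 ≤
          ofReal (c₁ ^ 2) * (2 * ofReal (D₃ * S) + 2 * ofReal (2 ^ r * S)) := by
        refine (lintegral_mono fun z => enorm_weighted_mul_le (m := fun z => c z.1) (K := c₁) (r := 0) (by
          simpa [abs_of_pos (hc.c_pos z.1)] using hc.upper z.1) r).trans ?_
        rw [lintegral_const_mul' _ _ (by simp)]
        simp only [add_zero, weighted_add]
        refine mul_le_mul_right ((lintegral_enorm_add_sq_le (aestronglyMeasurable_weighted hmV r)).trans ?_) _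
        have := sup h.fprof.sq₂ (h.ae_eq_zero.mono fun z hz hl => (hz hl).2.2.2) (by linarith)
        gcongr
      have h2 := sup h.gprof.sq (h.ae_eq_zero.mono fun z hz hl => (hz hl).2.1) (by linarith)
      calc _ ≤ 2 * (ofReal (c₁ ^ 2) * (2 * ofReal (D₃ * S) + 2 * ofReal (2 ^ r * S))) +
            2 * ofReal (2 ^ r * S) := by gcongr
        _ = _ := by
          have t : (2 : ℝ≥0∞) = ofReal 2 := by simp
          rw [t, ← ofReal_mul (by norm_num), ← ofReal_mul (by norm_num),
            ← ofReal_add (by positivity) (by positivity), ← ofReal_mul (by positivity),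
            ← ofReal_mul (by norm_num), ← ofReal_add (by positivity) (by positivity)]
          congr 1; ring
    refine ae_restrict_of_forall_mem measurableSet_Ioo fun t ht => ?_
    calc _ = ∫⁻ ξ in ℝ₊, ‖timePrim T (weighted r fun z =>
          -(c z.1 * pot c T tr(f) 3 z.1 z.2) + g z) (t, ξ)‖ₑ ^ 2 :=
          setLIntegral_congr_fun measurableSet_Ioi fun ξ hξ => by
            rw [← weighted_timePrim, weighted, weighted, hc.sol_eq_timePrim hT h ⟨ht, hξ⟩]
      _ ≤ ofReal t * _ := lintegral_timePrim_sq_le (aestronglyMeasurable_weighted hmG r) ht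
      _ ≤ ofReal T * _ := mul_le_mul' (ofReal_le_ofReal ht.2.le) bG
      _ ≤ _ := by
          rw [← ofReal_mul hT.le, ← mul_assoc]
          exact ofReal_le_ofReal (by gcongr; simp only [D₁] at *; linarith)
  · filter_upwards [hz, N2, ae_restrict_mem measurableSet_Ioo] with t ht hn htT
    refine (lintegral_weighted_sq_le_of_ae r (w := fun ξ => -pot c T tr(f) 2 t ξ - f₁ (t, ξ))
      (hfar (p2 c hc _ hi) t htT) (by filter_upwards [ht] with ξ hξ hl; simp [(hξ hl).2.2.1])).trans ?_
    calc _ ≤ 2 ^ r * ofReal (A * S) + 2 ^ r * ofReal (K₂ ^ 2 * T * S) := by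
          exact add_le_add (mul_le_mul' le_rfl (hn.trans (ofReal_le_ofReal hR))) (mul_le_mul' le_rfl (hsq K₂))
      _ = ofReal (D₂ * S) := by
          rw [two, two, ← ofReal_add (by positivity) (by positivity)]
          congr 1; simp only [D₂]; ring
      _ ≤ _ := ofReal_le_ofReal (by gcongr; linarith)

end IsCoeff

lemma lintegral_strip_le {T : ℝ} {w : ℝ² → ℝ} (hm : AEStronglyMeasurable w vol(strip T)) {B : ℝ≥0∞}
    (h : ∀ᵐ t ∂vol(Ioo 0 T), ∫⁻ ξ in ℝ₊, ‖w (t, ξ)‖ₑ ^ 2 ≤ B) :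
    ∫⁻ z in strip T, ‖w z‖ₑ ^ 2 ≤ B * ofReal T := by
  rw [lintegral_strip T hm]
  refine (lintegral_mono_ae h).trans ?_
  rw [setLIntegral_const, volume_Ioo, sub_zero]

/-- The norms of the data, without weight, are controlled by the weighted norms. -/
lemma exists_sqInt_le (n : ℕ) : ∃ A : ℝ, 0 ≤ A ∧ ∀ (T : ℝ) (f g f₁ f₂ g₁ g₂ gt : ℝ² → ℝ),
    IsLiftPair T f g f₁ f₂ g₁ g₂ gt → ∀ w w' : ℕ → ℝ² → ℝ,
      (∀ j ≤ 2, IsWeakDeriv T 0 j (weighted n f) (w j)) → (∀ j ≤ 0, IsWeakDeriv T 0 j (weighted n g) (w' j)) →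
      ofReal (sqInt T f₁ + sqInt T f₂ + sqInt T g) ≤ ofReal A *
        ((∑ j ∈ Finset.range 3, ∫⁻ z in strip T, ‖w j z‖ₑ ^ 2) + ∑ j ∈ Finset.range 1, ∫⁻ z in strip T, ‖w' j z‖ₑ ^ 2) := by
  obtain ⟨K₁, r₁, k1, h1⟩ := exists_abs_weightD_le n 1
  obtain ⟨K₂, r₂, k2, h2⟩ := exists_abs_weightD_le n 2
  set B := K₁ * 2 ^ r₁ + K₂ * 2 ^ r₂
  have hB : 0 ≤ B := by positivity
  have hs : ∀ {x : ℝ}, 0 ≤ x → x ≤ 1 → √(1 + x ^ 2) ≤ 2 := fun {x} h0 h1 =>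
    Real.sqrt_le_iff.2 ⟨by norm_num, by nlinarith⟩
  have hb1 : ∀ x : ℝ, 0 ≤ x → x ≤ 1 → weightD n 1 x ^ 2 ≤ B ^ 2 := fun x h0 hx => by
    refine sq_le_sq.2 ((h1 x).trans ?_)
    rw [abs_of_nonneg hB]
    have : K₁ * √(1 + x ^ 2) ^ r₁ ≤ K₁ * 2 ^ r₁ := by gcongr; exact hs h0 hx
    have : 0 ≤ K₂ * 2 ^ r₂ := by positivity
    simp only [B]; linarith
  have hb2 : ∀ x : ℝ, 0 ≤ x → x ≤ 1 → weightD n 2 x ^ 2 ≤ B ^ 2 := fun x h0 hx => by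
    refine sq_le_sq.2 ((h2 x).trans ?_)
    rw [abs_of_nonneg hB]
    have : K₂ * √(1 + x ^ 2) ^ r₂ ≤ K₂ * 2 ^ r₂ := by gcongr; exact hs h0 hx
    have : 0 ≤ K₁ * 2 ^ r₁ := by positivity
    simp only [B]; linarith
  -- The Leibniz relations `w₀ = ωf`, `w₁ = ω'f + ωf₁`, `w₂ = ω''f + 2ω'f₁ + ωf₂` are solved for
  -- `f₁` and `f₂`, using `ω ≥ 1` and that `ω'`, `ω''` are at most `B` in size on `[0,1]`; beyond `ξ
  -- = 1` there is nothing to show.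
  set A := 3 + (1 + 12 * B ^ 2) * (2 + 2 * B ^ 2) + 3 * B ^ 2
  have hA : 1 ≤ A := by simp only [A]; nlinarith [sq_nonneg B, sq_nonneg (B ^ 2)]
  refine ⟨A, by linarith, fun T f g f₁ f₂ g₁ g₂ gt h w w' hw hw' => ?_⟩
  have hF : ∀ j ≤ 2, IsWeakDeriv T 0 j f (jet f f₁ f₂ j) := fun j hj => by
    interval_cases j
    exacts [.refl h.fprof.dx.1, h.fprof.dx, h.fprof.dxx]
  have e : ∀ j ≤ 2, w j =ᵐ[vol(strip T)] leib j (weightD n) (jet f f₁ f₂) := fun j hj =>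
    (hw j hj).ae_eq (isWeakDeriv_weighted (fun p hp => hF p (hp.trans hj)) n)
  have e' : w' 0 =ᵐ[vol(strip T)] weighted n g := (hw' 0 le_rfl).ae_eq (.refl (hw' 0 le_rfl).1)
  have W1 : ∀ x, 1 ≤ weightD n 0 x := fun x => by
    simpa [weightD] using one_le_pow₀ (one_le_sqrt_weight x)
  have hf : ∀ᵐ z ∂vol(strip T), ‖f₁ z‖ₑ ^ 2 + ‖f₂ z‖ₑ ^ 2 ≤
      ofReal A * ∑ j ∈ Finset.range 3, ‖w j z‖ₑ ^ 2 := by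
    filter_upwards [e 0 (by norm_num), e 1 (by norm_num), e 2 le_rfl, h.ae_eq_zero,
      ae_restrict_mem (measurableSet_strip T)] with z e0 e1 e2 hz hzs
    simp only [Finset.sum_range_succ, Finset.sum_range_zero, zero_add, enorm_sq_eq_ofReal]
    rw [← ofReal_add (by positivity) (by positivity), ← ofReal_add (by positivity) (by positivity),
      ← ofReal_add (by positivity) (by positivity), ← ofReal_mul (by linarith)]
    refine ofReal_le_ofReal ?_
    rcases lt_or_ge 1 z.2 with hl | hl
    · obtain ⟨-, -, z1, z2⟩ := hz hl
      rw [z1, z2]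
      have : 0 ≤ A := by linarith
      simp only [ne_eq, OfNat.ofNat_ne_zero, not_false_eq_true, zero_pow, add_zero]
      positivity
    · have c1 := hb1 z.2 (le_of_lt hzs.2) hl
      have c2 := hb2 z.2 (le_of_lt hzs.2) hl
      have c0 := W1 z.2
      simp only [leib, jet, zero_add] at e0 e1 e2
      norm_num at e1 e2
      have up : ∀ y : ℝ, y ^ 2 ≤ (weightD n 0 z.2 * y) ^ 2 := fun y => by
        rw [mul_pow]
        nlinarith [sq_nonneg y, mul_le_mul_of_nonneg_right (one_le_pow₀ c0 (n := 2)) (sq_nonneg y)]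
      have q0 : f z ^ 2 ≤ w 0 z ^ 2 := by rw [e0]; exact up _
      have m1 : ∀ y : ℝ, (weightD n 1 z.2 * y) ^ 2 ≤ B ^ 2 * y ^ 2 := fun y => by
        rw [mul_pow]; gcongr
      have m2 : ∀ y : ℝ, (weightD n 2 z.2 * y) ^ 2 ≤ B ^ 2 * y ^ 2 := fun y => by
        rw [mul_pow]; gcongr
      have q1 : f₁ z ^ 2 ≤ 2 * w 1 z ^ 2 + 2 * (B ^ 2 * f z ^ 2) := by
        refine (up _).trans ?_
        rw [show weightD n 0 z.2 * f₁ z = w 1 z - weightD n 1 z.2 * f z by rw [e1]; ring]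
        nlinarith [m1 (f z), sq_nonneg (w 1 z + weightD n 1 z.2 * f z)]
      have q2 : f₂ z ^ 2 ≤ 3 * w 2 z ^ 2 + 12 * (B ^ 2 * f₁ z ^ 2) + 3 * (B ^ 2 * f z ^ 2) := by
        refine (up _).trans ?_
        rw [show weightD n 0 z.2 * f₂ z = w 2 z - 2 * (weightD n 1 z.2 * f₁ z) - weightD n 2 z.2 * f z by rw [e2]; ring]
        nlinarith [m1 (f₁ z), m2 (f z), sq_nonneg (w 2 z + 2 * (weightD n 1 z.2 * f₁ z)),
          sq_nonneg (w 2 z + weightD n 2 z.2 * f z), sq_nonneg (2 * (weightD n 1 z.2 * f₁ z) - weightD n 2 z.2 * f z)]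
      have B2 := sq_nonneg B
      have q3 : B ^ 2 * f z ^ 2 ≤ B ^ 2 * w 0 z ^ 2 := by gcongr
      calc f₁ z ^ 2 + f₂ z ^ 2 ≤ 3 * w 2 z ^ 2 + (1 + 12 * B ^ 2) * f₁ z ^ 2 + 3 * (B ^ 2 * f z ^ 2) := by linarith
        _ ≤ 3 * w 2 z ^ 2 + (1 + 12 * B ^ 2) * (2 * w 1 z ^ 2 + 2 * (B ^ 2 * w 0 z ^ 2)) + 3 * (B ^ 2 * w 0 z ^ 2) := by
            gcongr; linarith
        _ ≤ (3 + (1 + 12 * B ^ 2) * (2 + 2 * B ^ 2) + 3 * B ^ 2) * (w 0 z ^ 2 + w 1 z ^ 2 + w 2 z ^ 2) := by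
            have x0 := sq_nonneg (w 0 z)
            have x1 := sq_nonneg (w 1 z)
            have x2 := sq_nonneg (w 2 z)
            have y : 0 ≤ (1 + 12 * B ^ 2) * (2 * (B ^ 2 * (w 1 z ^ 2 + w 2 z ^ 2)) + 2 * (w 0 z ^ 2 + w 2 z ^ 2)) +
              3 * B ^ 2 * (w 1 z ^ 2 + w 2 z ^ 2) + 3 * (w 0 z ^ 2 + w 1 z ^ 2) := by positivity
            nlinarith
  have hg : ∀ᵐ z ∂vol(strip T), ‖g z‖ₑ ^ 2 ≤ ofReal A * ‖w' 0 z‖ₑ ^ 2 := by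
    filter_upwards [e'] with z hz
    simp only [enorm_sq_eq_ofReal]
    rw [hz, ← ofReal_mul (by linarith), weighted, mul_pow]
    refine ofReal_le_ofReal ?_
    have := one_le_pow₀ (one_le_pow₀ (one_le_sqrt_weight z.2) (n := n)) (n := 2)
    rw [← mul_assoc]
    exact le_mul_of_one_le_left (sq_nonneg _) (one_le_mul_of_one_le_of_one_le hA this)
  have mw : ∀ j ≤ 2, AEMeasurable (fun z => ‖w j z‖ₑ ^ 2) vol(strip T) := fun j hj =>
    aemeasurable_enorm_sq (hw j hj).aestronglyMeasurable
  rw [ofReal_add (add_nonneg (sqInt_nonneg _ _) (sqInt_nonneg _ _)) (sqInt_nonneg _ _),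
    ofReal_add (sqInt_nonneg _ _) (sqInt_nonneg _ _), h.fprof.sq₁.ofReal_sqInt, h.fprof.sq₂.ofReal_sqInt,
    h.gprof.sq.ofReal_sqInt, mul_add, ← lintegral_add_left' (aemeasurable_enorm_sq h.fprof.sq₁.1)]
  refine add_le_add ((lintegral_mono_ae hf).trans (le_of_eq ?_)) ((lintegral_mono_ae hg).trans (le_of_eq ?_))
  · rw [lintegral_const_mul' _ _ (by simp), lintegral_finsetSum' _ fun j hj => mw j (by have := Finset.mem_range.1 hj; omega)]
  · rw [lintegral_const_mul' _ _ (by simp), Finset.sum_range_one]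

/-- A bound by the norms is checked for every admissible family of weak derivatives. The factor must
be neither zero nor infinite so that it commutes with the infimum, also over an empty family. -/
lemma le_mul_add_bochnerNorm {T : ℝ} {k k' l l' : ℕ} {p p' : ℝ≥0∞} {u u' : ℝ² → ℝ} {L M : ℝ≥0∞} (hM : M ≠ 0) (hM' : M ≠ ⊤)
    (h : ∀ w w' : ℕ → ℕ → ℝ² → ℝ, (∀ i ≤ k, ∀ j ≤ l, IsWeakDeriv T i j u (w i j)) →
      (∀ i ≤ k', ∀ j ≤ l', IsWeakDeriv T i j u' (w' i j)) →
      L ≤ M * ((∑ i ∈ Finset.range (k + 1), eLpNorm (sliceNorm l (w i)) p vol(Ioo 0 T)) +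
        ∑ i ∈ Finset.range (k' + 1), eLpNorm (sliceNorm l' (w' i)) p' vol(Ioo 0 T))) :
    L ≤ M * (bochnerNorm T k p l u + bochnerNorm T k' p' l' u') := by
  rw [bochnerNorm, bochnerNorm]
  simp only [ENNReal.iInf_add, ENNReal.add_iInf, ENNReal.mul_iInf_of_ne hM hM']
  exact le_iInf₂ fun w hw => le_iInf₂ fun w' hw' => by first | exact h w w' hw hw' | exact h w' w hw' hw

namespace IsCoeff

lemma isWeakDeriv_sol_space {c : ℝ → ℝ} {c₀ c₁ : ℝ} (hc : IsCoeff c c₀ c₁) {T : ℝ}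
    {f g f₁ f₂ g₁ g₂ gt : ℝ² → ℝ} (h : IsLiftPair T f g f₁ f₂ g₁ g₂ gt) (j : ℕ) (hj : j ≤ 2) :
    IsWeakDeriv T 0 j (sol c T f) (jet (sol c T f) (fun z => -pot c T tr(f) 2 z.1 z.2 - f₁ z)
      (fun z => -pot c T tr(f) 3 z.1 z.2 - f₂ z) j) := by
  have key : ∀ l F, IsWeakDeriv T 0 l f F → IsWeakDeriv T 0 l (sol c T f) fun z =>
      -pot c T tr(f) (1 + l) z.1 z.2 - F z := fun l F hF => by
    have h1 := hc.isWeakDeriv_mul_pot_space h.integrableOn_trace (P := fun _ => -1) (by simp) 1 l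
    refine (h1.add hF.neg).congr (ae_restrict_of_forall_mem (measurableSet_strip T) fun z hz => ?_)
      (ae_of_all _ fun z => ?_)
    · simp [sol, if_pos (show 0 < z.2 from hz.2), sub_eq_add_neg]
    · simp [sub_eq_add_neg]
  interval_cases j
  · exact .refl (key 0 f (.refl h.fprof.dx.1)).1
  · exact key 1 f₁ h.fprof.dx
  · exact key 2 f₂ h.fprof.dxx

/-- The weighted estimate. -/
lemma exists_weighted_estimate (c₀ c₁ T K : ℝ) (hc₀ : 0 < c₀) (hc₁ : 0 < c₁) (hT : 0 < T) (hK : 0 ≤ K) (n : ℕ) :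
    ∃ M : ℝ, 0 < M ∧ ∀ c, IsCoeff c c₀ c₁ → EnergyBound c c₀ T K → ∀ f g f₁ f₂ g₁ g₂ gt,
      IsLiftPair T f g f₁ f₂ g₁ g₂ gt →
      bochnerNorm T 0 ⊤ 1 (weighted n (sol c T f)) + bochnerNorm T 0 2 2 (weighted n (sol c T f)) ≤
        ofReal M * (bochnerNorm T 0 2 2 (weighted n f) + bochnerNorm T 0 2 0 (weighted n g)) := by
  obtain ⟨A, hA, hS⟩ := exists_sqInt_le n
  choose C r hC using fun j => exists_enorm_leib_le n j 0
  choose D hD using fun j => exists_weighted_sol_le c₀ c₁ T K hc₀ hc₁ hT hK (r j)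
  set Q : ℕ → ℝ := fun j => C j * (3 * (|D j| * (1 + T)))
  have hQ : ∀ j, 0 ≤ Q j := fun j => by positivity
  set P := (Q 0 + Q 1 + Q 2) * A
  have hP : 0 ≤ P := mul_nonneg (by linarith [hQ 0, hQ 1, hQ 2]) hA
  -- Each of the two norms on the left is at most `P^{1/2}` times the right side; the added one only
  -- guarantees a positive constant.
  refine ⟨2 * P ^ (1 / 2 : ℝ) + 1, by positivity, fun c hc hE f g f₁ f₂ g₁ g₂ gt h => ?_⟩
  set V := jet (sol c T f) (fun z => -pot c T tr(f) 2 z.1 z.2 - f₁ z)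
      (fun z => -pot c T tr(f) 3 z.1 z.2 - f₂ z)
  have hV : ∀ j ≤ 2, IsWeakDeriv T 0 j (sol c T f) (V j) := hc.isWeakDeriv_sol_space h
  set S := sqInt T f₁ + sqInt T f₂ + sqInt T g
  have hS0 : 0 ≤ S := add_nonneg (add_nonneg (sqInt_nonneg _ _) (sqInt_nonneg _ _)) (sqInt_nonneg _ _)
  have hm : ∀ s, ∀ j ≤ 2, AEStronglyMeasurable (weighted s (V j)) vol(strip T) := fun s j hj =>
    aestronglyMeasurable_weighted (hV j hj).aestronglyMeasurable s
  set E : ℕ → ℝ≥0∞ := fun j => ofReal (|D j| * (1 + T) * S)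
  have hDE : ∀ j, ofReal (D j * S) ≤ E j := fun j => ofReal_le_ofReal (by
    gcongr; nlinarith [le_abs_self (D j), abs_nonneg (D j)])
  have sup : ∀ j, ∀ p ≤ 1, ∀ᵐ t ∂vol(Ioo 0 T), ∫⁻ ξ in ℝ₊, ‖weighted (r j) (V p) (t, ξ)‖ₑ ^ 2 ≤
      ofReal (D j * S) := fun j p hp => by
    obtain ⟨h0, h1, -⟩ := hD j c hc hE f g f₁ f₂ g₁ g₂ gt h S rfl
    interval_cases p
    exacts [h0, h1]
  have sq : ∀ j, ∀ p ≤ 2, ∫⁻ z in strip T, ‖weighted (r j) (V p) z‖ₑ ^ 2 ≤ E j := fun j p hp => by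
    have h01 : ∀ p ≤ 1, ∫⁻ z in strip T, ‖weighted (r j) (V p) z‖ₑ ^ 2 ≤ E j := fun p hp =>
      (lintegral_strip_le (hm _ p (by omega)) (sup j p hp)).trans (by
        rw [← ENNReal.ofReal_mul' hT.le]
        refine ofReal_le_ofReal ?_
        have h1 := mul_le_mul_of_nonneg_right (le_abs_self (D j)) (mul_nonneg hS0 hT.le)
        have h2 := mul_nonneg (abs_nonneg (D j)) hS0
        linarith)
    interval_cases p
    exacts [h01 0 (by norm_num), h01 1 le_rfl, (hD j c hc hE f g f₁ f₂ g₁ g₂ gt h S rfl).2.2.trans (hDE j)]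
  have tot : ∀ j ≤ 2, (C j : ℝ≥0∞) * ∑ p ∈ Finset.range (j + 1), E j ≤ ofReal (Q j * S) := fun j hj => by
    rw [Finset.sum_const, Finset.card_range, nsmul_eq_mul, ← ofReal_coe_nnreal, ← ENNReal.ofReal_natCast,
      ← ofReal_mul (by positivity), ← ofReal_mul (by positivity)]
    refine ofReal_le_ofReal ?_
    have : ((j + 1 : ℕ) : ℝ) ≤ 3 := by exact_mod_cast Nat.succ_le_succ hj
    calc _ ≤ (C j : ℝ) * (3 * (|D j| * (1 + T) * S)) := by gcongr
      _ = _ := by simp only [Q]; ring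
  have lsup : ∀ j ≤ 1, ∀ᵐ t ∂vol(Ioo 0 T), ∫⁻ ξ in ℝ₊, ‖leib j (weightD n) V (t, ξ)‖ₑ ^ 2 ≤
      ofReal (Q j * S) := fun j hj => by
    have a1 : ∀ᵐ t ∂vol(Ioo 0 T), ∀ p ∈ Finset.range (j + 1), AEMeasurable
        (fun ξ => ‖weighted (r j) (V p) (t, ξ)‖ₑ ^ 2) vol(Ioi 0) ∧
        ∫⁻ ξ in ℝ₊, ‖weighted (r j) (V p) (t, ξ)‖ₑ ^ 2 ≤ E j := by
      rw [eventually_all_finset]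
      intro p hp
      have hp := Finset.mem_range.1 hp
      filter_upwards [sup j p (by omega), ae_slice_aestronglyMeasurable (hm (r j) p (by omega))] with t h1 h2
      exact ⟨aemeasurable_enorm_sq h2, h1.trans (hDE j)⟩
    filter_upwards [a1] with t ht
    refine (lintegral_mono fun ξ => hC j V (t, ξ)).trans (le_trans ?_ (tot j (by omega)))
    rw [lintegral_const_mul' _ _ (by simp), lintegral_finsetSum' _ fun p hp => (ht p hp).1]
    exact mul_le_mul_right (Finset.sum_le_sum fun p hp => (ht p hp).2) _
  have lsq : ∀ j ≤ 2, ∫⁻ z in strip T, ‖leib j (weightD n) V z‖ₑ ^ 2 ≤ ofReal (Q j * S) := fun j hj => by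
    have hp' : ∀ p ∈ Finset.range (j + 1), p ≤ 2 := fun p hp => by have := Finset.mem_range.1 hp; omega
    refine (lintegral_mono fun z => hC j V z).trans (le_trans ?_ (tot j hj))
    rw [lintegral_const_mul' _ _ (by simp),
      lintegral_finsetSum' _ fun p hp => aemeasurable_enorm_sq (hm (r j) p (hp' p hp))]
    exact mul_le_mul_right (Finset.sum_le_sum fun p hp => sq j p (hp' p hp)) _
  have hw : ∀ l ≤ 2, ∀ i ≤ 0, ∀ j ≤ l, IsWeakDeriv T i j (weighted n (sol c T f)) (leib j (weightD n) V) :=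
    fun l hl i hi j hj => by
      obtain rfl : i = 0 := by omega
      exact isWeakDeriv_weighted (fun p hp => hV p (by omega)) n
  have hsum : ∀ l ≤ 2, ∑ j ∈ Finset.range (l + 1), ofReal (Q j * S) ≤ ofReal ((Q 0 + Q 1 + Q 2) * S) :=
    fun l hl => by
      refine (Finset.sum_le_sum_of_subset (Finset.range_mono (show l + 1 ≤ 3 by omega))).trans (le_of_eq ?_)
      rw [← ENNReal.ofReal_sum_of_nonneg fun j _ => mul_nonneg (hQ j) hS0]
      simp [Finset.sum_range_succ, add_mul]
  refine le_mul_add_bochnerNorm (by positivity) ofReal_ne_top fun w w' h1 h2 => ?_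
  have L1 : bochnerNorm T 0 ⊤ 1 (weighted n (sol c T f)) ≤ ofReal ((Q 0 + Q 1 + Q 2) * S) ^ (1 / 2 : ℝ) := by
    refine (iInf₂_le (fun _ j => leib j (weightD n) V) (hw 1 (by norm_num))).trans ?_
    rw [zero_add, Finset.sum_range_one]
    exact (eLpNorm_sliceNorm_top_le T 1 _ _ lsup).trans (ENNReal.rpow_le_rpow (hsum 1 (by norm_num)) (by norm_num))
  have L2 : bochnerNorm T 0 2 2 (weighted n (sol c T f)) ≤ ofReal ((Q 0 + Q 1 + Q 2) * S) ^ (1 / 2 : ℝ) := by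
    refine (iInf₂_le (fun _ j => leib j (weightD n) V) (hw 2 le_rfl)).trans ?_
    rw [zero_add, Finset.sum_range_one,
      eLpNorm_sliceNorm_two T 2 _ fun j hj => (hw 2 le_rfl 0 le_rfl j hj).aestronglyMeasurable]
    exact ENNReal.rpow_le_rpow ((Finset.sum_le_sum fun j hj => lsq j (by
      have := Finset.mem_range.1 hj; omega)).trans (hsum 2 le_rfl)) (by norm_num)
  have hX := hS T f g f₁ f₂ g₁ g₂ gt h (w 0) (w' 0) (h1 0 le_rfl) (h2 0 le_rfl)
  rw [zero_add, Finset.sum_range_one, Finset.sum_range_one,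
    eLpNorm_sliceNorm_two T 2 _ fun j hj => (h1 0 le_rfl j hj).aestronglyMeasurable,
    eLpNorm_sliceNorm_two T 0 _ fun j hj => (h2 0 le_rfl j hj).aestronglyMeasurable]
  set X := ∑ j ∈ Finset.range (2 + 1), ∫⁻ z in strip T, ‖w 0 j z‖ₑ ^ 2
  set Y := ∑ j ∈ Finset.range (0 + 1), ∫⁻ z in strip T, ‖w' 0 j z‖ₑ ^ 2
  have hPS : ofReal ((Q 0 + Q 1 + Q 2) * S) ^ (1 / 2 : ℝ) ≤
      ofReal (P ^ (1 / 2 : ℝ)) * (X ^ (1 / 2 : ℝ) + Y ^ (1 / 2 : ℝ)) := by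
    calc _ ≤ (ofReal P * (X + Y)) ^ (1 / 2 : ℝ) := by
          refine ENNReal.rpow_le_rpow ?_ (by norm_num)
          rw [ofReal_mul (by linarith [hQ 0, hQ 1, hQ 2]), ofReal_mul (by linarith [hQ 0, hQ 1, hQ 2]),
            mul_assoc]
          exact mul_le_mul_right hX _
      _ ≤ _ := by
          rw [ENNReal.mul_rpow_of_nonneg _ _ (by norm_num), ENNReal.ofReal_rpow_of_nonneg hP (by norm_num)]
          exact mul_le_mul_right (ENNReal.rpow_add_le_add_rpow _ _ (by norm_num) (by norm_num)) _
  calc _ ≤ _ := add_le_add (L1.trans hPS) (L2.trans hPS)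
    _ = ofReal (2 * P ^ (1 / 2 : ℝ)) * (X ^ (1 / 2 : ℝ) + Y ^ (1 / 2 : ℝ)) := by
        rw [← two_mul, ofReal_mul (by norm_num), ← mul_assoc]; simp
    _ ≤ _ := by gcongr; linarith

end IsCoeff

/-- The constant is made available, and positive, for all real parameters, so that it can be chosen
as a function of them; for meaningless parameters its value is irrelevant. -/
lemma exists_estimate_const (c₀ c₁ T : ℝ) (n : ℕ) :
    ∃ M : ℝ, 0 < M ∧ (0 < c₀ → 0 < c₁ → 0 < T → ∀ c, IsCoeff c c₀ c₁ → ∀ f g f₁ f₂ g₁ g₂ gt,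
      IsLiftPair T f g f₁ f₂ g₁ g₂ gt →
      bochnerNorm T 0 ⊤ 1 (weighted n (sol c T f)) + bochnerNorm T 0 2 2 (weighted n (sol c T f)) ≤
        ofReal M * (bochnerNorm T 0 2 2 (weighted n f) + bochnerNorm T 0 2 0 (weighted n g))) := by
  by_cases h : 0 < c₀ ∧ 0 < c₁ ∧ 0 < T
  · obtain ⟨h0, h1, hT⟩ := h
    obtain ⟨K, hK, hE⟩ := exists_energy_le c₀ c₁ T hT h1
    obtain ⟨M, hM, H⟩ := IsCoeff.exists_weighted_estimate c₀ c₁ T K h0 h1 hT hK.le n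
    exact ⟨M, hM, fun _ _ _ c hc => H c hc (hE c hc)⟩
  · exact ⟨1, one_pos, fun h0 h1 hT => absurd ⟨h0, h1, hT⟩ h⟩

/-! ### The coefficient on the whole line, and the conclusion -/

/-- The extension of a function on `[0,T]` that is constant outside of the interval. -/
noncomputable def extend (T : ℝ) (τ : ℝ → ℝ) (t : ℝ) : ℝ := τ (max 0 (min T t))

section extend
variable {T : ℝ} {τ : ℝ → ℝ}

lemma clamp_mem (hT : 0 ≤ T) (t : ℝ) : max 0 (min T t) ∈ Icc 0 T := ⟨le_max_left _ _, max_le hT (min_le_left _ _)⟩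

lemma extend_eq {t : ℝ} (ht : t ∈ Icc 0 T) : extend T τ t = τ t := by
  rw [extend, min_eq_right ht.2, max_eq_right ht.1]

lemma continuous_extend (hT : 0 ≤ T) (hτ : ContinuousOn τ (Icc 0 T)) : Continuous (extend T τ) :=
  hτ.comp_continuous (by fun_prop) (clamp_mem hT)

lemma chain_of_memTimeWInfty (hT : 0 < T) (hτ : ContinuousOn τ (Icc 0 T)) {m : ℕ} (h : MemTimeWInfty T m τ) :
    Chain False ⊤ T m (extend T τ) := by
  have h' : ∀ k, ∃ d : ℝ → ℝ, k ≤ m → MemLp d ⊤ vol(Ioo 0 T) ∧ ∀ θ, IsTimeTest T θ →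
      ∫ t in Ioo 0 T, τ t * iteratedDeriv k θ t = (-1) ^ k * ∫ t in Ioo 0 T, d t * θ t := fun k => by
    by_cases hk : k ≤ m
    · obtain ⟨d, h1, h2⟩ := h k hk
      exact ⟨d, fun _ => ⟨h1, fun θ hθ => h2 θ hθ.1 hθ.2.1 hθ.2.2⟩⟩
    · exact ⟨0, fun h => absurd h hk⟩
  choose d hd using h'
  refine chain_of_weak le_top hT (continuous_extend hT.le hτ).continuousOn d (fun k hk => (hd k hk).1)
    (fun k hk θ hθ => ?_) False.elim
  rw [← (hd k hk).2 θ hθ]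
  exact setIntegral_congr_fun measurableSet_Ioo fun t ht => by rw [extend_eq (Ioo_subset_Icc_self ht)]

lemma exists_lipschitz_extend (hT : 0 < T) (hτ : ContinuousOn τ (Icc 0 T)) (h : MemTimeWInfty T 1 τ) :
    ∃ L, ∀ s t, |extend T τ s - extend T τ t| ≤ L * |s - t| := by
  obtain ⟨-, γ', h1, h2⟩ := chain_of_memTimeWInfty hT hτ h
  obtain ⟨K, hK⟩ := h2.lipschitz h1
  refine ⟨K, fun s t => ?_⟩
  have := hK.dist_le_mul _ (clamp_mem hT.le s) _ (clamp_mem hT.le t)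
  rw [extend_eq (clamp_mem hT.le s), extend_eq (clamp_mem hT.le t), dist_eq, dist_eq] at this
  refine this.trans (mul_le_mul_of_nonneg_left ?_ K.coe_nonneg)
  exact (abs_max_sub_max_le_max _ _ _ _).trans (max_le (by simp) ((abs_min_sub_min_le_max _ _ _ _).trans (max_le (by simp) le_rfl)))

end extend

namespace IsCoeff
variable {c : ℝ → ℝ} {c₀ c₁ : ℝ} (hc : IsCoeff c c₀ c₁) {T : ℝ} (hT : 0 < T)
  {f g f₁ f₂ g₁ g₂ gt : ℝ² → ℝ} (h : IsLiftPair T f g f₁ f₂ g₁ g₂ gt)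
include hc hT h

lemma isSolution_sol {a μ : ℝ} {τ : ℝ → ℝ} (hcτ : ∀ t ∈ Icc 0 T, c t = a ^ 2 * μ * (1 / τ t)) :
    IsSolution a μ τ f g T (sol c T f) := by
  have hi := h.integrableOn_trace
  have hs : (fun z => (-1 : ℝ) * pot c T tr(f) 1 z.1 z.2 - f z)
      =ᵐ[vol(strip T)] sol c T f := ae_restrict_of_forall_mem (measurableSet_strip T) fun z hz => by
    simp [sol, if_pos (show 0 < z.2 from hz.2)]
  refine ⟨(hc.continuousOn_pot_one hT h.continuousOn_trace (h.f0 0 le_rfl)).sub h.fprof.cont,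
    ⟨_, _, ((hc.isWeakDeriv_pot_time hT.le hi (.const T (-1)) 1).sub h.fprof.dt).congr hs (EventuallyEq.refl _ _),
      (hc.isWeakDeriv_mul_pot_space hi (P := fun _ => -1) (by simp) 1 2).congr (hs.mono fun z hz => ?_)
        (EventuallyEq.refl _ _), ?_⟩, fun t _ => by simp [sol], fun ξ hξ => ?_⟩
  · beta_reduce at hz ⊢
    rw [← hz]; ring
  · refine ae_restrict_of_forall_mem (measurableSet_strip T) fun z hz => ?_
    rw [← hcτ z.1 (Ioo_subset_Icc_self hz.1)]; ring
  · have e : f (0, ξ) = 0 := h.f0 ξ hξ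
    rcases lt_or_eq_of_le (show (0 : ℝ) ≤ ξ from hξ) with h0 | h0
    · simp [sol, h0, hc.pot_zero_time hT.le, e]
    · subst h0; simp [sol]

/-- With one time derivative the count `1 + l + 2i` gives order 4 in `H¹` and order 5 in `H²`, which
are the top orders supplied by `isSup_pot_trace`. -/
lemma inSolutionClass_sol {K L : ℝ} (hK : 0 ≤ K) (hE : EnergyBound c c₀ T K)
    (hL : ∀ s t, |(c s)⁻¹ - (c t)⁻¹| ≤ L * |s - t|) (hc1 : Chain False ⊤ T 1 c) :
    InSolutionClass T (sol c T f) := by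
  obtain ⟨pS, pQ⟩ := hc.isSup_pot_trace hT hK hE h hL
  have hF : ∀ i ≤ 1, ∀ j ≤ 2, ∃ F, IsWeakDeriv T i j f F ∧ (j ≤ 1 → IsSup T F) ∧ IsSq T F := fun i hi j hj => by
    have hF0 : ∀ j ≤ 2, ∃ F, IsWeakDeriv T 0 j f F ∧ (j ≤ 1 → IsSup T F) ∧ IsSq T F := fun j hj => by
      interval_cases j
      exacts [⟨f, .refl h.fprof.dx.1, fun _ => h.supf, h.fprof.sq⟩, ⟨f₁, h.fprof.dx, fun _ => h.supf₁, h.fprof.sq₁⟩,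
        ⟨f₂, h.fprof.dxx, fun h => by omega, h.fprof.sq₂⟩]
    have hG : ∀ j ≤ 2, ∃ G, IsWeakDeriv T 0 j g G ∧ (j ≤ 1 → IsSup T G) ∧ IsSq T G := fun j hj => by
      interval_cases j
      exacts [⟨g, .refl h.gprof.dx.1, fun _ => h.supg, h.gprof.sq⟩, ⟨g₁, h.gprof.dx, fun _ => h.supg₁, h.gprof.sq₁⟩,
        ⟨g₂, h.gprof.dxx, fun h => by omega, h.gprof.sq₂⟩]
    interval_cases i
    · exact hF0 j hj
    · obtain ⟨G, g1, g2, g3⟩ := hG j hj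
      exact ⟨_, h.fprof.dt.comp g1.neg, fun hj => (g2 hj).neg, g3.neg⟩
  have hV : ∀ i j, ∃ V, i ≤ 1 → j ≤ 2 → IsWeakDeriv T i j (sol c T f) V ∧ (j ≤ 1 → IsSup T V) ∧ IsSq T V := fun i j => by
    by_cases hij : i ≤ 1 ∧ j ≤ 2
    · obtain ⟨F, f1, f2, f3⟩ := hF i hij.1 j hij.2
      obtain ⟨V, v1, v2, v3⟩ := hc.exists_isWeakDeriv_sol hT h (hc1.mono hT.le hij.1) f1
      exact ⟨V, fun _ _ => ⟨v1, fun hj => v2 (fun q hq => pS q (by omega)) (f2 hj), v3 (fun q hq => pQ q (by omega)) f3⟩⟩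
    · exact ⟨0, fun h1 h2 => absurd ⟨h1, h2⟩ hij⟩
  choose V hV using hV
  have h1 := memBochner_weighted_top (T := T) (k := 1) (l := 1) (fun i hi j hj => (hV i j hi (by omega)).1)
    (fun i hi j hj => (hV i j hi (by omega)).2.1 hj) 0
  have h2 := memBochner_weighted_two (T := T) (k := 1) (l := 2) (fun i hi j hj => (hV i j hi hj).1)
    (fun i hi j hj => (hV i j hi hj).2.2) 0
  rw [weighted_zero] at h1 h2
  exact ⟨h1, h2⟩

end IsCoeff

lemma MemBochner.ae_slice_le {T : ℝ} {k l : ℕ} {v : ℝ² → ℝ} (h : MemBochner T k ⊤ l v) :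
    ∃ B : NNReal, ∀ᵐ t ∂vol(Ioo 0 T), ∫⁻ ξ in ℝ₊, ‖v (t, ξ)‖ₑ ^ 2 ≤ B := by
  obtain ⟨w, h1, h2⟩ := h.exists_top
  obtain ⟨B, hB⟩ := h2 0 (Nat.zero_le _) 0 (Nat.zero_le _)
  have h0 := h1 0 (Nat.zero_le _) 0 (Nat.zero_le _)
  have e := h0.ae_eq (.refl h0.1)
  rw [volume_restrict_strip] at e
  refine ⟨B, ?_⟩
  filter_upwards [hB, ae_ae_of_ae_prod e] with t ht het
  exact (lintegral_congr_ae (het.mono fun ξ hξ => by rw [hξ])).trans_le ht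

/-- In the difference of two solutions the source and the lift cancel, and the solution class
provides the `L^∞L²` bound of the maximum principle. Exchanging the two solutions gives equality. -/
lemma IsSolution.le {a μ T : ℝ} (hT : 0 < T) {c τ : ℝ → ℝ} {c₀ c₁ : ℝ} (hc : IsCoeff c c₀ c₁)
    (hcτ : ∀ t ∈ Icc 0 T, c t = a ^ 2 * μ * (1 / τ t)) {f g v v' : ℝ² → ℝ} (h : IsSolution a μ τ f g T v)
    (h' : IsSolution a μ τ f g T v') (hv : InSolutionClass T v) (hv' : InSolutionClass T v') :
    ∀ z ∈ closedStrip T, v z ≤ v' z := by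
  obtain ⟨c1, ⟨p, q, hp, hq, e⟩, b1, i1⟩ := h
  obtain ⟨c2, ⟨p', q', hp', hq', e'⟩, b2, i2⟩ := h'
  obtain ⟨B, hB⟩ := hv.1.ae_slice_le
  obtain ⟨B', hB'⟩ := hv'.1.ae_slice_le
  have hsub := strip_subset_closedStrip T
  have hm := (c1.mono hsub).aestronglyMeasurable (measurableSet_strip T) (μ := volume)
  intro z hz
  refine sub_nonpos.1 (nonpos_of_isWeakDeriv hT hc (d := fun z => v z - v' z) (c1.sub c2) (hp.sub hp')
    ((hq.sub hq').congr (ae_of_all _ fun z => by ring) (EventuallyEq.refl _ _)) ?_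
    (fun ξ hξ => by simp [i1 ξ hξ, i2 ξ hξ]) (fun t ht => by simp [b1 t ht, b2 t ht]) (B := 2 * B + 2 * B') ?_
    z.1 hz.1 z.2 hz.2)
  · filter_upwards [e, e', ae_restrict_mem (measurableSet_strip T)] with z h1 h2 hz
    rw [hcτ z.1 (Ioo_subset_Icc_self hz.1)]; linarith
  · filter_upwards [hB, hB', ae_slice_aestronglyMeasurable hm] with t h1 h2 h3
    have := lintegral_enorm_add_sq_le (w := fun ξ => -v' (t, ξ)) h3
    simp only [enorm_neg, ← sub_eq_add_neg] at this
    refine this.trans ?_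
    push_cast
    gcongr

end BoundaryLayer


theorem proposition4p2 (μ : ℝ) (hμ : 0 < μ) :
    ∃ M : ℝ → ℕ → ℝ → ℝ, (∀ T n K, 0 < M T n K) ∧
    -- inner radius, final time, bound on the coefficient, boundary specific volume, lift, source
    ∀ (a T₀ M₁ : ℝ) (τ : ℝ → ℝ) (f g : ℝ × ℝ → ℝ),
    0 < a → 0 < T₀ → 0 < M₁ →
    ContinuousOn τ (Set.Icc 0 T₀) →
    BoundaryLayer.MemTimeWInfty T₀ 1 τ →
    (∀ t ∈ Set.Icc 0 T₀, M₁⁻¹ ≤ a ^ 2 / τ t ∧ a ^ 2 / τ t ≤ M₁) →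
    (∀ᵐ t ∂(MeasureTheory.volume.restrict (Set.Ioo 0 T₀)),
      deriv (fun s => a ^ 2 / τ s) t ≤ M₁) →
    -- the lift: `f(0,ξ) = 0`, `f(t,ξ) = 0` for `ξ ≥ 1`, and its regularity
    ContinuousOn f (BoundaryLayer.closedStrip T₀) →
    (∀ ξ ∈ Set.Ici (0 : ℝ), f (0, ξ) = 0) →
    (∀ t ∈ Set.Icc 0 T₀, ∀ ξ ∈ Set.Ici (1 : ℝ), f (t, ξ) = 0) →
    BoundaryLayer.MemBochner T₀ 1 ⊤ 2 f →
    -- the source `g = -∂_t f`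
    ContinuousOn g (BoundaryLayer.closedStrip T₀) →
    (∀ t ∈ Set.Icc 0 T₀, ∀ ξ ∈ Set.Ici (0 : ℝ),
      HasDerivWithinAt (fun s => f (s, ξ)) (-g (t, ξ)) (Set.Icc 0 T₀) t) →
    BoundaryLayer.MemSobolev T₀ 1 g →
    -- first order compatibility at the corner
    g (0, 0) = 0 →
    ∃ T₁ : ℝ, 0 < T₁ ∧ T₁ ≤ T₀ ∧ ∃ v : ℝ × ℝ → ℝ,
      (BoundaryLayer.IsSolution a μ τ f g T₁ v ∧ BoundaryLayer.InSolutionClass T₁ v) ∧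
      (∀ v' : ℝ × ℝ → ℝ,
        BoundaryLayer.IsSolution a μ τ f g T₁ v' → BoundaryLayer.InSolutionClass T₁ v' →
        Set.EqOn v' v (BoundaryLayer.closedStrip T₁)) ∧
      -- weighted estimate
      (∀ n : ℕ,
        BoundaryLayer.bochnerNorm T₁ 0 ⊤ 1 (BoundaryLayer.weighted n v) +
          BoundaryLayer.bochnerNorm T₁ 0 2 2 (BoundaryLayer.weighted n v) ≤
        ENNReal.ofReal (M T₁ n M₁) *
          (BoundaryLayer.bochnerNorm T₁ 0 2 2 (BoundaryLayer.weighted n f) +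
            BoundaryLayer.bochnerNorm T₁ 0 2 0 (BoundaryLayer.weighted n g)) ∧
        BoundaryLayer.bochnerNorm T₁ 0 2 2 (BoundaryLayer.weighted n f) +
            BoundaryLayer.bochnerNorm T₁ 0 2 0 (BoundaryLayer.weighted n g) < ⊤) ∧
      -- higher regularity
      (∀ m : ℕ,
        BoundaryLayer.MemTimeWInfty T₁ m τ →
        (∀ j : ℕ, ∃ gj : ℝ × ℝ → ℝ,
          BoundaryLayer.IsWeakDeriv T₁ 0 j g gj ∧ BoundaryLayer.MemSobolev T₁ m gj) →
        (∀ k < m, ∀ ξ ∈ Set.Ici (0 : ℝ),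
          iteratedDerivWithin k (fun t => g (t, ξ)) (Set.Icc 0 T₁) 0 = 0) →
        ∀ n k l : ℕ, k + l / 2 ≤ m →
          BoundaryLayer.MemBochner T₁ k ⊤ l (BoundaryLayer.weighted n v) ∧
          BoundaryLayer.MemBochner T₁ k 2 (l + 1) (BoundaryLayer.weighted n v)) := by
  -- The bounds on `a²/τ` give `μ/M₁ ≤ c ≤ μM₁`, so these two numbers are the only trace of the
  -- coefficient in the constant.
  choose N hN hNe using fun (T : ℝ) (n : ℕ) (K : ℝ) => BoundaryLayer.exists_estimate_const (μ / K) (μ * K) T n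
  refine ⟨N, hN, fun a T M₁ τ f g ha hT hM hτ hτ1 hτb _ hf hf0 hf1 hfB hg hd hgS hg0 => ?_⟩
  obtain ⟨f₁, f₂, g₁, g₂, gt, h⟩ := BoundaryLayer.exists_isLiftPair hT hf hf0 hf1 hfB hg hd hgS hg0
  have ha2 : 0 < a ^ 2 := by positivity
  have hτ0 : ∀ t ∈ Icc 0 T, 0 < τ t := fun t ht =>
    (div_pos_iff_of_pos_left ha2).1 ((inv_pos.2 hM).trans_le (hτb t ht).1)
  -- The coefficient is frozen outside `[0,T]`, since `IsCoeff` asks for continuity and bounds on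
  -- the whole line.
  set c : ℝ → ℝ := fun t => a ^ 2 * μ * (1 / BoundaryLayer.extend T τ t)
  have hx0 : ∀ t, 0 < BoundaryLayer.extend T τ t := fun t => hτ0 _ (BoundaryLayer.clamp_mem hT.le t)
  have hxc := BoundaryLayer.continuous_extend hT.le hτ
  have hcx : ∀ t, c t = μ * (a ^ 2 / BoundaryLayer.extend T τ t) := fun t => by simp only [c]; ring
  have hc : BoundaryLayer.IsCoeff c (μ / M₁) (μ * M₁) :=
    { cont := continuous_const.mul (continuous_const.div hxc fun t => (hx0 t).ne')
      pos := by positivity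
      lower := fun t => by
        rw [hcx, div_eq_mul_inv]
        exact mul_le_mul_of_nonneg_left (hτb _ (BoundaryLayer.clamp_mem hT.le t)).1 hμ.le
      upper := fun t => by
        rw [hcx]
        exact mul_le_mul_of_nonneg_left (hτb _ (BoundaryLayer.clamp_mem hT.le t)).2 hμ.le }
  have hcτ : ∀ t ∈ Icc 0 T, c t = a ^ 2 * μ * (1 / τ t) := fun t ht => by
    simp only [c, BoundaryLayer.extend_eq ht]
  -- The reciprocal of the coefficient is a constant multiple of `τ` and inherits its regularity
  -- directly; `c` itself gets it by inversion.
  have hci : ∀ t, (c t)⁻¹ = (a ^ 2 * μ)⁻¹ * BoundaryLayer.extend T τ t := fun t => by simp [c, mul_comm]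
  have hκ : ∀ m, BoundaryLayer.MemTimeWInfty T m τ → BoundaryLayer.Chain False ⊤ T m fun t => (c t)⁻¹ := fun m hm => by
    simp only [hci]
    exact (BoundaryLayer.Chain.const T _ m).mul hT.le (BoundaryLayer.chain_of_memTimeWInfty hT hτ hm)
  have hcc : ∀ m, BoundaryLayer.MemTimeWInfty T m τ → BoundaryLayer.Chain False ⊤ T m c := fun m hm => by
    simpa using (hκ m hm).inv hT.le (inv_pos.2 hc.c₁_pos) (fun t _ => inv_anti₀ (hc.c_pos t) (hc.upper t))
      (hc.cont.inv₀ fun t => (hc.c_pos t).ne').continuousOn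
  obtain ⟨L, hL⟩ := BoundaryLayer.exists_lipschitz_extend hT hτ hτ1
  have hκL : ∀ s t, |(c s)⁻¹ - (c t)⁻¹| ≤ (a ^ 2 * μ)⁻¹ * L * |s - t| := fun s t => by
    have : 0 < (a ^ 2 * μ)⁻¹ := by positivity
    rw [hci, hci, ← mul_sub, abs_mul, abs_of_pos this, mul_assoc]
    exact mul_le_mul_of_nonneg_left (hL s t) this.le
  obtain ⟨K, hK, hE⟩ := BoundaryLayer.exists_energy_le _ _ T hT hc.c₁_pos
  have hs := hc.isSolution_sol hT h hcτ
  have hcl := hc.inSolutionClass_sol hT h hK.le (hE c hc) hκL (hcc 1 hτ1)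
  -- The explicit formula works on the whole interval, so `T₁ = T₀`; uniqueness is the comparison
  -- used in both directions.
  refine ⟨T, hT, le_rfl, BoundaryLayer.sol c T f, ⟨hs, hcl⟩, fun v' hv' hcl' z hz =>
    le_antisymm (hv'.le hT hc hcτ hs hcl' hcl z hz) (hs.le hT hc hcτ hv' hcl hcl' z hz), fun n => ⟨?_, ?_⟩,
    fun m hm hgm h0 n k l hkl => hc.higher_regularity hT h (hcc m hm) (hκ m hm) hgm h0 n hkl⟩
  · exact hNe T n M₁ hc.pos hc.c₁_pos hT c hc f g f₁ f₂ g₁ g₂ gt h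
  · refine ENNReal.add_lt_top.2 ⟨BoundaryLayer.memBochner_weighted_two
      (V := fun _ => BoundaryLayer.jet f f₁ f₂) (fun i hi j hj => ?_) (fun i _ j hj => ?_) n,
      BoundaryLayer.memBochner_weighted_two (V := fun _ _ => g) (fun i hi j hj => ?_) (fun _ _ _ _ => h.gprof.sq) n⟩
    · obtain rfl : i = 0 := by omega
      interval_cases j
      exacts [.refl h.fprof.dx.1, h.fprof.dx, h.fprof.dxx]
    · interval_cases j
      exacts [h.fprof.sq, h.fprof.sq₁, h.fprof.sq₂]
    · obtain ⟨rfl, rfl⟩ : i = 0 ∧ j = 0 := by omega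
      exact .refl h.gprof.dx.1
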